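/- Let $\Sigma=\{0,1,\#\}$. **Machine model.** An online probabilistic Turing machine (OPTM) $M$ is a probabilistic Turing machine (one flip of a fair coin per step) with a finite control, a one-way read-only input tape over $\Sigma$ (whose end is detectable), a read-write work tape over $\Sigma$, and a one-way write-only output tape over $\Sigma$. Its space is the number of work-tape cells used. **Circuits.** Let $G_0=H$ (Hadamard), $G_1=T$ (the $\pi/8$ gate) and $G_2=\mathrm{CNOT}$. For qubits labeled $0,\dots,m-1$ and $a\ne b$, let $G_i^{[a,b]}$ be $G_i$ applied to qubit $a$ (if $i\in\{0,1\}$) or to qubits $a,b$ with control $a$ and target $b$ (if $i=2$); if $a=b$, then $G_i^{[a,b]}$ is the identity. **The class.** For $s:\mathbb N\to\mathbb N$, a language $L\subseteq\Sigma^*$ is in $OQBPSPACE(s)$ if there is an OPTM $M$ such that for every $w\in\Sigma^*$, writing $m=s(|w|)$: 1. whatever the coin flips are, $M$ halts on $w$ after at most $2^{m}$ steps and uses at most $m$ space; 2. whatever the coin flips are, the content of the output tape when $M$ halts is of the form $a_1\#b_1\#c_1\#\cdots\#a_r\#b_r\#c_r$ with $r\ge 1$, $a_i,b_i\in\{0,\dots,m-1\}$,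 $c_i\in\{0,1,2\}$ (integers written in binary); 3. if $w\in L$, then with probability at least $\sqrt{2/3}$ over the coin flips, the output is such that measuring the first qubit of $G_{c_r}^{[a_r,b_r]}\cdots G_{c_1}^{[a_1,b_1]}|0\rangle^{\otimes m}$ in the computational basis gives $1$ with probability at least $\sqrt{2/3}$; 4. if $w\notin L$, then with probability at least $\sqrt{2/3}$ over the coin flips, the output is such that measuring the first qubit of $G_{c_r}^{[a_r,b_r]}\cdots G_{c_1}^{[a_1,b_1]}|0\rangle^{\otimes m}$ in the computational basis gives $0$ with probability at least $\sqrt{2/3}$. Let $OQBPL=\bigcup_{c>0}OQBPSPACE(c\log n)$, where $c\log n$ stands for the integer $\lceil c\log_2\max(n,2)\rceil$. **The language.** For $\mathbf x,\mathbf y\in\{0,1\}^N$ let $DISJ_N(\mathbf x,\mathbf y)=\bigwedge_{i=0}^{N-1}(\neg x_i\vee\neg y_i)$, and let $$L_{DISJ}=\Bigl\{\,1^k\#(\mathbf x\#\mathbf y\#\mathbf x\#)^{2^k}\;\Big|\;k\ge 1,\ \mathbf x,\mathbf y\in\{0,1\}^{2^{2k}},\ DISJ_{2^{2k}}(\mathbf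 x,\mathbf y)=1\,\Bigr\}.$$ **Corollary.** $L_{DISJ}\in OQBPL$. That is, $L_{DISJ}$ is recognized with bounded error by a quantum online machine using $O(\log n)$ classical and quantum space. -/

import Mathlib

/-- The ternary alphabet `{0, 1, #}`. -/
inductive Ternary : Type
  | zero
  | one
  | hash

/-! ### Online probabilistic Turing machines with an output tape -/

/-- What a machine does in one step: new control state, symbol written in the scanned work cell,
move of the work head, whether the input head moves one cell to the right (it never moves left),
and the symbol appended to the output tape, if any. -/
structure OPTMAction (Q : Type) where
  next : Q
  write : Ternary
  /-- `some true`: right, `some false`: left, `none`: stay. -/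
  workMove : Option Bool
  inputAdvance : Bool
  emit : Option Ternary

/-- An online (one-way) probabilistic Turing machine (OPTM) that computes a function: a finite
control, a one-way read-only input tape, a two-way read-write work tape, and a one-way write-only
output tape. Each step depends on one flip of a fair coin. The scanned input symbol is `none` when
the input has been read entirely. -/
structure OPTM where
  Q : Type
  finite : Finite Q
  start : Q
  isHalt : Q → Bool
  δ : Q → Option Ternary → Ternary → Bool → OPTMAction Q

/-- Configurations: control state, position of the input head, content of the work tape (cells
indexed by `ℕ`), position of the work head, and content of the output tape. -/
structure OPTMCfg (Q : Type) where
  state : Q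
  inputPos : ℕ
  work : ℕ → Ternary
  workPos : ℕ
  output : List Ternary

namespace OPTM

/-- Initially the work tape holds `#` everywhere and the output tape is empty. -/
def init (M : OPTM) : OPTMCfg M.Q where
  state := M.start
  inputPos := 0
  work := fun _ => Ternary.hash
  workPos := 0
  output := []

/-- One step on input `w` with coin flip `b`; a halting configuration does not change. A left move
from the leftmost work cell leaves the head there. -/
def step (M : OPTM) (w : List Ternary) (c : OPTMCfg M.Q) (b : Bool) : OPTMCfg M.Q :=
  if M.isHalt c.state = true then c
  else
    let a := M.δ c.state w[c.inputPos]? (c.work c.workPos) b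
    { state := a.next
      inputPos := if a.inputAdvance = true then c.inputPos + 1 else c.inputPos
      work := Function.update c.work c.workPos a.write
      workPos :=
        match a.workMove with
        | none => c.workPos
        | some true => c.workPos + 1
        | some false => c.workPos - 1
      output := c.output ++ a.emit.toList }

/-- The configuration on input `w` after the coin flips listed in `coins`. -/
def run (M : OPTM) (w : List Ternary) (coins : List Bool) : OPTMCfg M.Q :=
  coins.foldl (M.step w) M.init

/-- Whatever the coin flips are, `M` halts on `w` after at most `T` steps. -/
def HaltsWithin (M : OPTM) (w : List Ternary) (T : ℕ) : Prop :=
  ∀ coins : List Bool, coins.length = T → M.isHalt (M.run w coins).state = true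

/-- Whatever the coin flips are, `M` visits at most `S` work cells on `w`: the head starts on
cell `0` and moves by at most one cell per step, so the visited cells are those up to the largest
head position. -/
def UsesSpaceAtMost (M : OPTM) (w : List Ternary) (S : ℕ) : Prop :=
  ∀ coins : List Bool, (M.run w coins).workPos < S

/-- The content of the output tape on input `w` after `T` steps with coin flips `r`. -/
def outputAfter (M : OPTM) (w : List Ternary) (T : ℕ) (r : Fin T → Bool) : List Ternary :=
  (M.run w (List.ofFn r)).output

open scoped Classical in
/-- The probability, over `T` independent flips of a fair coin, that the content of the output
tape after `T` steps on input `w` satisfies `P`. If `M` always halts on `w` within `T` steps, this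
is the probability that the final output satisfies `P`. -/
noncomputable def outputProb (M : OPTM) (w : List Ternary) (T : ℕ) (P : List Ternary → Prop) : ℝ :=
  ((Finset.univ.filter fun r : Fin T → Bool => P (M.outputAfter w T r)).card : ℝ) / 2 ^ T

end OPTM

/-! ### Quantum circuits over Hadamard, `T` and CNOT -/

/-- State vectors (amplitudes in the computational basis) of `m` qubits, numbered `0, …, m - 1`. -/
abbrev QState (m : ℕ) : Type := (Fin m → Fin 2) → ℂ

/-- The state `|0⟩^{⊗ m}`. -/
def QState.zero (m : ℕ) : QState m := Pi.single (fun _ => 0) 1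

/-- The Hadamard matrix. -/
noncomputable def hadamardMatrix : Matrix (Fin 2) (Fin 2) ℂ :=
  ((1 / Real.sqrt 2 : ℝ) : ℂ) • !![1, 1; 1, -1]

/-- The matrix of the `π/8` gate `T`. -/
noncomputable def piEighthMatrix : Matrix (Fin 2) (Fin 2) ℂ :=
  !![1, 0; 0, Complex.exp (Complex.I * (Real.pi / 4))]

/-- The one-qubit gate with matrix `U` applied to qubit `a`. -/
noncomputable def applyOneQubit {m : ℕ} (U : Matrix (Fin 2) (Fin 2) ℂ) (a : Fin m)
    (ψ : QState m) : QState m :=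
  fun x => ∑ v : Fin 2, U (x a) v * ψ (Function.update x a v)

/-- CNOT with control `a` and target `b ≠ a`. The addition is modulo `2`; the basis permutation
is an involution. -/
def applyCNOT {m : ℕ} (a b : Fin m) (ψ : QState m) : QState m :=
  fun x => ψ (Function.update x b (x b + x a))

/-- A gate instruction `G_c^{[a,b]}` on `m` qubits. -/
structure GateInstr (m : ℕ) where
  a : Fin m
  b : Fin m
  c : Fin 3

/-- The action of `G_c^{[a,b]}`: the identity if `a = b`; otherwise Hadamard on qubit `a` if
`c = 0`, the `π/8` gate on qubit `a` if `c = 1`, CNOT with control `a` and target `b` if `c = 2`. -/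
noncomputable def GateInstr.apply {m : ℕ} (g : GateInstr m) (ψ : QState m) : QState m :=
  if g.a = g.b then ψ
  else if g.c = 0 then applyOneQubit hadamardMatrix g.a ψ
  else if g.c = 1 then applyOneQubit piEighthMatrix g.a ψ
  else applyCNOT g.a g.b ψ

/-- The state `G_r ⋯ G_1 |0⟩^{⊗ m}` for the list of instructions `G_1, …, G_r`. -/
noncomputable def circuitState {m : ℕ} (gates : List (GateInstr m)) : QState m :=
  gates.foldl (fun ψ g => g.apply ψ) (QState.zero m)

/-- The probability that measuring the first qubit (qubit number `0`) of `ψ` in the computational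
basis gives `v`. -/
noncomputable def measureFirstProb {m : ℕ} (v : Fin 2) (ψ : QState m) : ℝ :=
  ∑ x ∈ Finset.univ.filter (fun x : Fin m → Fin 2 => ∃ i : Fin m, (i : ℕ) = 0 ∧ x i = v),
    ‖ψ x‖ ^ 2

/-! ### Circuit descriptions on the output tape -/

/-- The symbol of a bit. -/
def Ternary.ofBool (b : Bool) : Ternary := if b = true then Ternary.one else Ternary.zero

/-- The binary notation of a natural number, most significant digit first, without leading zeros;
the number `0` is written `0`. -/
def binaryWord (a : ℕ) : List Ternary :=
  if a = 0 then [Ternary.zero]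
  else (Nat.digits 2 a).reverse.map fun d => Ternary.ofBool (decide (d = 1))

/-- The word `a#b#c` of a gate instruction. -/
def GateInstr.word {m : ℕ} (g : GateInstr m) : List Ternary :=
  binaryWord g.a ++ [Ternary.hash] ++ binaryWord g.b ++ [Ternary.hash] ++ binaryWord g.c

/-- The word `a₁#b₁#c₁#⋯#a_r#b_r#c_r` of a list of gate instructions. -/
def circuitWord {m : ℕ} (gates : List (GateInstr m)) : List Ternary :=
  List.intercalate [Ternary.hash] (gates.map GateInstr.word)

/-- `u` describes a circuit with at least one gate on `m` qubits. -/
def IsCircuitWord (m : ℕ) (u : List Ternary) : Prop :=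
  ∃ gates : List (GateInstr m), gates ≠ [] ∧ u = circuitWord gates

/-- `u` describes a circuit with at least one gate on `m` qubits, and measuring the first qubit
after applying it to `|0⟩^{⊗ m}` gives the outcome `v` with probability at least `p`. -/
def CircuitOutcome (m : ℕ) (v : Fin 2) (p : ℝ) (u : List Ternary) : Prop :=
  ∃ gates : List (GateInstr m), gates ≠ [] ∧ u = circuitWord gates ∧
    p ≤ measureFirstProb v (circuitState gates)

/-! ### Bounded-error quantum online space -/

/-- The class `OQBPSPACE(s)` of languages recognized with bounded error by a quantum online
machine with `s(n)` classical and quantum space. -/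
def OQBPSPACE (s : ℕ → ℕ) : Set (Language Ternary) :=
  {L | ∃ M : OPTM, ∀ w : List Ternary,
    (M.HaltsWithin w (2 ^ s w.length) ∧ M.UsesSpaceAtMost w (s w.length)) ∧
    (∀ r : Fin (2 ^ s w.length) → Bool,
      IsCircuitWord (s w.length) (M.outputAfter w (2 ^ s w.length) r)) ∧
    (w ∈ L → Real.sqrt (2 / 3) ≤
      M.outputProb w (2 ^ s w.length) (CircuitOutcome (s w.length) 1 (Real.sqrt (2 / 3)))) ∧
    (w ∉ L → Real.sqrt (2 / 3) ≤
      M.outputProb w (2 ^ s w.length) (CircuitOutcome (s w.length) 0 (Real.sqrt (2 / 3))))}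

/-- The space bound `c log n` as a number of cells and qubits: rounded up, and with `n` replaced
by `2` for inputs of length `0` and `1`. -/
noncomputable def logSpace (c : ℝ) (n : ℕ) : ℕ :=
  ⌈c * Real.logb 2 (max (n : ℝ) 2)⌉₊

/-- `OQBPL`, the union over `c > 0` of the classes `OQBPSPACE(c log n)`. -/
def OQBPL : Set (Language Ternary) :=
  ⋃ c : {c : ℝ // 0 < c}, OQBPSPACE (logSpace c)

/-! ### The disjointness language -/

/-- The disjointness function: the conjunction over `i` of `(¬ x i) ∨ (¬ y i)`. -/
def disj {n : ℕ} (x y : Fin n → Bool) : Bool :=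
  decide (∀ i, (!x i || !y i) = true)

/-- The word of a bit string. -/
def bitWord {n : ℕ} (x : Fin n → Bool) : List Ternary :=
  List.ofFn fun i => Ternary.ofBool (x i)

/-- The word `1^k#(x#y#x#)^{2^k}`. -/
def disjWord (k : ℕ) (x y : Fin (2 ^ (2 * k)) → Bool) : List Ternary :=
  List.replicate k Ternary.one ++ [Ternary.hash] ++
    (List.replicate (2 ^ k)
      (bitWord x ++ [Ternary.hash] ++ bitWord y ++ [Ternary.hash] ++ bitWord x ++ [Ternary.hash])).flatten

/-- The language `L_DISJ`. -/
def LDISJ : Language Ternary :=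
  {w | ∃ k : ℕ, 1 ≤ k ∧ ∃ x y : Fin (2 ^ (2 * k)) → Bool, disj x y = true ∧ w = disjWord k x y}

/-!
The verification of the form of the input is classical and randomized, and the disjointness of the two
words is decided by a circuit for amplitude amplification that is written while the input is read.

*The algorithm.* `disjAlg` keeps fifteen numbers of size polynomial in the input length `n`. It counts the
leading ones, measures the words that follow, and compares fingerprints: the word number `3b + 1` must agree
with the second word and all others with the first one. The fingerprint of a word is the value modulo a prime
of a polynomial with coefficients given by its bits, at a random point. The length of a word is not known in
advance, so the word is cut at the positions `4, 16, 256, …` into parts with a modulus each, and the seed is extended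
by at most one random digit in base 16 per symbol. Distinct words of the same length are confused with
probability at most `1/64` (`coinCount_collision`), hence so is a malformed input accepted
(`coinCount_accepted`). The parameter `k` of a malformed input may be far larger than `log n`; therefore
nothing that needs `2k` qubits is written before the first word has turned out to have length `2 ^ (2k)`.
This is why block `0` of the input is only checked and the search uses the blocks `1, …, 2 ^ k - 1`.

*The circuit.* There are eight copies of an index register of `2k` qubits, in uniform superposition at first.
For every bit `1` of the words `x` and `y` of a block, a test of the index against the position of the bit is
written, so that after the block the common positions have been found. In block `b`, they obtain the phase
`-1`, and then the diffusion operator is applied, so that the state of each copy rotates by `2θ`, where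
`sin² θ` is the fraction of the common positions; but if `b = 2 ^ l`, then the result goes to a fresh flag
instead, which amounts to a measurement. Checking at the powers of two makes it unnecessary to know `θ`. The
amplitude of the event that no flag is set is a product of the cosines of `2 ^ i θ`, `i < k`
(`hasCoords_amplitude`). It is `1` for disjoint words. Otherwise `2 ^ k θ ≥ 1`, some factor is at most
`cos (1/2)`, and the event has probability at most `7/9` (`sum_sq_amplitude_cases`). At the end, the
conjunction of the verdicts of all copies is written to qubit `0` (`BlockState.measure_verdict`), and
`(7/9)⁸ ≤ 1 - √(2/3)`. If the input is not accepted, then qubit `0` is never touched and gives `0`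
(`measure_circuit_rejected`), so that only malformed inputs are subject to errors of the fingerprints.

*The machine.* Stream algorithms are executed by structured programs for registers that can only be
incremented, cleared and compared; arithmetic is built from bounded sums (`RComp`, `RPred`). Programs become
flowcharts, and a flowchart becomes a machine that keeps the binary digits of the registers on interleaved
tracks of the work tape and performs every step by a sweep over the tape. Registers of polynomial size need
logarithmic space. The running time is not counted: a run that halts never repeats a configuration with the
same number of remaining coin flips (`GRunT.time_le`), and logarithmic space leaves only polynomially many
configurations. Since the number of coin flips consumed depends on `n` alone, probabilities over the coin
flips of the machine are those over the coin flips of the algorithm (`StreamAlg.exists_machine`).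
-/

open Finset (range mem_range mem_filter sum_congr prod_congr)
open Function (update update_self update_of_ne update_eq_self update_idem update_apply)

/-! ### Register programs -/

/-- Elementary actions of a register machine with an input tape and an output tape. -/
inductive RAct : Type
  | inc (r : ℕ)
  | zero (r : ℕ)
  | emit (t : Ternary)
  | emitBin (r : ℕ)
  | advance

/-- Elementary tests: comparison of two registers, a coin flip, inspection of the scanned input
symbol. -/
inductive RTest : Type
  | le (r s : ℕ)
  | coin
  | sym (o : Option Ternary)

/-- Structured programs. `untl t P` repeats `P` until the test `t` succeeds. -/
inductive RProg : Type
  | act (a : RAct)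
  | seq (P Q : RProg)
  | ite (t : RTest) (P Q : RProg)
  | untl (t : RTest) (P : RProg)

/-- The data a register program works on: registers, position of the input head, output. -/
@[ext] structure RState : Type where
  regs : ℕ → ℕ
  pos : ℕ
  out : List Ternary

namespace RState

/-- The state with register `r` set to `v`. -/
def set (st : RState) (r v : ℕ) : RState := { st with regs := update st.regs r v }

/-- The state with `u` appended to the output. -/
def put (st : RState) (u : List Ternary) : RState := { st with out := st.out ++ u }

end RState

/-- `RAct.Rel w B a st st'`: on input `w`, the action `a` leads from `st` to `st'`, and no register
is incremented beyond `B`. -/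
inductive RAct.Rel (w : List Ternary) (B : ℕ) : RAct → RState → RState → Prop
  | inc (r : ℕ) (st : RState) (h : st.regs r + 1 ≤ B) : Rel w B (.inc r) st (st.set r (st.regs r + 1))
  | zero (r : ℕ) (st : RState) : Rel w B (.zero r) st (st.set r 0)
  | emit (t : Ternary) (st : RState) : Rel w B (.emit t) st (st.put [t])
  | emitBin (r : ℕ) (st : RState) : Rel w B (.emitBin r) st (st.put (binaryWord (st.regs r)))
  | advance (st : RState) (h : st.pos < w.length) :
      Rel w B .advance st { st with pos := st.pos + 1 }

/-- `RTest.Val w t st l b`: on input `w`, the test `t` in state `st` gives `b` and consumes the coin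
flips `l`. Comparisons are available for registers in increasing order only. -/
inductive RTest.Val (w : List Ternary) : RTest → RState → List Bool → Bool → Prop
  | le (r s : ℕ) (st : RState) (h : r < s) : Val w (.le r s) st [] (decide (st.regs r ≤ st.regs s))
  | coin (st : RState) (b : Bool) : Val w .coin st [b] b
  | symT (o : Option Ternary) (st : RState) (h : w[st.pos]? = o) : Val w (.sym o) st [] true
  | symF (o : Option Ternary) (st : RState) (h : w[st.pos]? ≠ o) : Val w (.sym o) st [] false

/-- Big-step semantics: `Exec w B P st l st'` says that on input `w` the program `P` leads from `st`
to `st'`, consuming the coin flips `l`, and that no register is incremented beyond `B`. -/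
inductive Exec (w : List Ternary) (B : ℕ) : RProg → RState → List Bool → RState → Prop
  | act {a : RAct} {st st' : RState} (h : a.Rel w B st st') : Exec w B (.act a) st [] st'
  | seq {P Q : RProg} {st st' st'' : RState} {l l' : List Bool} (h : Exec w B P st l st')
      (h' : Exec w B Q st' l' st'') : Exec w B (.seq P Q) st (l ++ l') st''
  | iteT {t : RTest} {P Q : RProg} {st st' : RState} {l l' : List Bool} (h : t.Val w st l true)
      (h' : Exec w B P st l' st') : Exec w B (.ite t P Q) st (l ++ l') st'
  | iteF {t : RTest} {P Q : RProg} {st st' : RState} {l l' : List Bool} (h : t.Val w st l false)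
      (h' : Exec w B Q st l' st') : Exec w B (.ite t P Q) st (l ++ l') st'
  | untlT {t : RTest} {P : RProg} {st : RState} {l : List Bool} (h : t.Val w st l true) :
      Exec w B (.untl t P) st l st
  | untlF {t : RTest} {P : RProg} {st st' st'' : RState} {l l' l'' : List Bool}
      (h : t.Val w st l false) (h' : Exec w B P st l' st') (h'' : Exec w B (.untl t P) st' l'' st'') :
      Exec w B (.untl t P) st (l ++ (l' ++ l'')) st''

/-! ### Flowcharts -/

/-- A flowchart instruction with successors in `κ`. -/
inductive RInstr (κ : Type) : Type
  | act (a : RAct) (next : κ)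
  | test (t : RTest) (yes no : κ)

/-- Renaming of successors. -/
def RInstr.map {κ κ' : Type} (g : κ → κ') : RInstr κ → RInstr κ'
  | .act a n => .act a (g n)
  | .test t y n => .test t (g y) (g n)

/-- Runs of the flowchart `code`; the node `none` is the exit. -/
inductive FRun (w : List Ternary) (B : ℕ) {ν : Type} (code : ν → RInstr (Option ν)) :
    Option ν → RState → List Bool → Option ν → RState → Prop
  | refl (m : Option ν) (st : RState) : FRun w B code m st [] m st
  | act {n : ν} {a : RAct} {nx m : Option ν} {st st' st'' : RState} {l : List Bool}
      (hc : code n = .act a nx) (h : a.Rel w B st st') (h' : FRun w B code nx st' l m st'') :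
      FRun w B code (some n) st l m st''
  | test {n : ν} {t : RTest} {y no m : Option ν} {st st' : RState} {b : Bool} {l l' : List Bool}
      (hc : code n = .test t y no) (h : t.Val w st l b)
      (h' : FRun w B code (if b = true then y else no) st l' m st') :
      FRun w B code (some n) st (l ++ l') m st'

lemma FRun.trans {w : List Ternary} {B : ℕ} {ν : Type} {code : ν → RInstr (Option ν)}
    {n m q : Option ν} {st st' st'' : RState} {l l' : List Bool} (h : FRun w B code n st l m st')
    (h' : FRun w B code m st' l' q st'') : FRun w B code n st (l ++ l') q st'' := by
  induction h with
  | refl => simpa using h'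
  | act hc ha _ ih => exact .act hc ha (ih h')
  | test hc ht _ ih => rw [List.append_assoc]; exact .test hc ht (ih h')

/-- A flowchart embedded into a larger one runs there in the same way. -/
lemma FRun.map {w : List Ternary} {B : ℕ} {ν ν' : Type} {code : ν → RInstr (Option ν)}
    {code' : ν' → RInstr (Option ν')} (g : Option ν → Option ν')
    (hg : ∀ n, ∃ n', g (some n) = some n' ∧ code' n' = (code n).map g)
    {n m : Option ν} {st st' : RState} {l : List Bool} (h : FRun w B code n st l m st') :
    FRun w B code' (g n) st l (g m) st' := by
  induction h with
  | refl => exact .refl _ _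
  | @act n a nx m st st' st'' l hc ha _ ih =>
    obtain ⟨n', h1, h2⟩ := hg n
    rw [h1]
    refine .act (by rw [h2, hc]; rfl) ha ih
  | @test n t y no m st st' b l l' hc ht _ ih =>
    obtain ⟨n', h1, h2⟩ := hg n
    rw [h1]
    refine .test (by rw [h2, hc]; rfl) ht ?_
    cases b <;> simpa using ih

namespace RProg

/-- The nodes of the flowchart of a program. -/
def Node : RProg → Type
  | act _ => Unit
  | seq P Q => Node P ⊕ Node Q
  | ite _ P Q => Option (Node P ⊕ Node Q)
  | untl _ P => Option (Node P)

/-- The node where the flowchart of a program starts. -/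
def entry : (P : RProg) → P.Node
  | act _ => ()
  | seq P _ => Sum.inl P.entry
  | ite _ _ _ => none
  | untl _ _ => none

/-- The flowchart of a program. -/
def code : (P : RProg) → P.Node → RInstr (Option P.Node)
  | act a, _ => .act a none
  | seq P Q, .inl n => (code P n).map fun o => some (o.elim (Sum.inr Q.entry) Sum.inl)
  | seq _ Q, .inr n => (code Q n).map fun o => o.map Sum.inr
  | ite t P Q, none => .test t (some (some (.inl P.entry))) (some (some (.inr Q.entry)))
  | ite _ P _, some (.inl n) => (code P n).map fun o => o.map fun x => some (Sum.inl x)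
  | ite _ _ Q, some (.inr n) => (code Q n).map fun o => o.map fun x => some (Sum.inr x)
  | untl t P, none => .test t none (some (some P.entry))
  | untl _ P, some n => (code P n).map fun o => some (o.elim none some)

instance finite_node : (P : RProg) → Finite P.Node
  | act _ => inferInstanceAs (Finite Unit)
  | seq P Q =>
    have := finite_node P
    have := finite_node Q
    inferInstanceAs (Finite (P.Node ⊕ Q.Node))
  | ite _ P Q =>
    have := finite_node P
    have := finite_node Q
    inferInstanceAs (Finite (Option (P.Node ⊕ Q.Node)))
  | untl _ P =>
    have := finite_node P
    inferInstanceAs (Finite (Option P.Node))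

end RProg

lemma Exec.fRun {w : List Ternary} {B : ℕ} {P : RProg} {st st' : RState} {l : List Bool}
    (h : Exec w B P st l st') : FRun w B P.code (some P.entry) st l none st' := by
  induction h with
  | act h => exact .act (nx := none) rfl h (.refl _ _)
  | @seq P Q st st' st'' l l' _ _ ih ih' =>
    have h1 := ih.map (code' := (RProg.seq P Q).code)
      (fun o => some (o.elim (Sum.inr Q.entry) Sum.inl)) (fun n => ⟨Sum.inl n, rfl, rfl⟩)
    have h2 := ih'.map (code' := (RProg.seq P Q).code)
      (fun o => o.map Sum.inr) (fun n => ⟨Sum.inr n, rfl, rfl⟩)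
    exact h1.trans h2
  | @iteT t P Q st st' l l' ht _ ih =>
    refine .test (n := (none : (RProg.ite t P Q).Node)) rfl ht ?_
    exact ih.map (code' := (RProg.ite t P Q).code) (fun o => o.map fun x => some (Sum.inl x))
      (fun n => ⟨some (Sum.inl n), rfl, rfl⟩)
  | @iteF t P Q st st' l l' ht _ ih =>
    refine .test (n := (none : (RProg.ite t P Q).Node)) rfl ht ?_
    exact ih.map (code' := (RProg.ite t P Q).code) (fun o => o.map fun x => some (Sum.inr x))
      (fun n => ⟨some (Sum.inr n), rfl, rfl⟩)
  | @untlT t P st l ht =>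
    have := FRun.test (B := B) (n := (none : (RProg.untl t P).Node))
      (code := (RProg.untl t P).code) rfl ht (FRun.refl none st)
    rw [List.append_nil] at this
    exact this
  | @untlF t P st st' st'' l l' l'' ht _ _ ih ih' =>
    refine .test (n := (none : (RProg.untl t P).Node)) rfl ht ?_
    exact (ih.map (code' := (RProg.untl t P).code) (fun o => some (o.elim none some))
      (fun n => ⟨some n, rfl, rfl⟩)).trans ih'

namespace RProg

/-- The largest register number mentioned by an action. -/
def _root_.RAct.top : RAct → ℕ
  | .inc r => r
  | .zero r => r
  | .emitBin r => r
  | _ => 0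

/-- The largest register number mentioned by a test. -/
def _root_.RTest.top : RTest → ℕ
  | .le r s => max r s
  | _ => 0

/-- The largest register number mentioned by an instruction. -/
def _root_.RInstr.top {κ : Type} : RInstr κ → ℕ
  | .act a _ => a.top
  | .test t _ _ => t.top

lemma _root_.RInstr.top_map {κ κ' : Type} (g : κ → κ') (i : RInstr κ) : (i.map g).top = i.top := by
  cases i <;> rfl

/-- The largest register number mentioned by a program. -/
def top : RProg → ℕ
  | act a => a.top
  | seq P Q => max P.top Q.top
  | ite t P Q => max t.top (max P.top Q.top)
  | untl t P => max t.top P.top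

lemma top_code : (P : RProg) → (n : P.Node) → (P.code n).top ≤ P.top
  | act _, _ => le_rfl
  | seq P Q, .inl n => by
    rw [code, RInstr.top_map]; exact (top_code P n).trans (le_max_left _ _)
  | seq P Q, .inr n => by
    rw [code, RInstr.top_map]; exact (top_code Q n).trans (le_max_right _ _)
  | ite t P Q, none => le_max_left _ _
  | ite t P Q, some (.inl n) => by
    rw [code, RInstr.top_map]
    exact (top_code P n).trans ((le_max_left _ _).trans (le_max_right _ _))
  | ite t P Q, some (.inr n) => by
    rw [code, RInstr.top_map]
    exact (top_code Q n).trans ((le_max_right _ _).trans (le_max_right _ _))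
  | untl t P, none => le_max_left _ _
  | untl t P, some n => by
    rw [code, RInstr.top_map]; exact (top_code P n).trans (le_max_right _ _)

end RProg

/-! ### Guided runs of an online machine -/

instance : DecidableEq Ternary := fun a b => by
  cases a <;> cases b <;> first | exact isTrue rfl | exact isFalse (fun h => nomatch h)

/-- `GRun M flip S w c l c'`: the machine `M` leads from `c` to `c'` on input `w`, where the coin
flips `l` are used up, in order, by the steps taken in states marked by `flip`. Before `c'`, no
configuration is halting; all configurations have the work head among the first `S` cells and the
input head on the input or just behind it. -/
inductive GRun (M : OPTM) (flip : M.Q → Bool) (S : ℕ) (w : List Ternary) :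
    OPTMCfg M.Q → List Bool → OPTMCfg M.Q → Prop
  | refl (c : OPTMCfg M.Q) (hS : c.workPos < S) (hi : c.inputPos ≤ w.length) : GRun M flip S w c [] c
  | det {c c' : OPTMCfg M.Q} {l : List Bool} (hh : M.isHalt c.state = false)
      (hf : flip c.state = false) (hS : c.workPos < S) (hi : c.inputPos ≤ w.length)
      (h : GRun M flip S w (M.step w c false) l c') : GRun M flip S w c l c'
  | coin {c c' : OPTMCfg M.Q} {b : Bool} {l : List Bool} (hh : M.isHalt c.state = false)
      (hf : flip c.state = true) (hS : c.workPos < S) (hi : c.inputPos ≤ w.length)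
      (h : GRun M flip S w (M.step w c b) l c') : GRun M flip S w c (b :: l) c'

lemma GRun.trans {M : OPTM} {flip : M.Q → Bool} {S : ℕ} {w : List Ternary}
    {c c' c'' : OPTMCfg M.Q} {l l' : List Bool} (h : GRun M flip S w c l c')
    (h' : GRun M flip S w c' l' c'') : GRun M flip S w c (l ++ l') c'' := by
  induction h with
  | refl => simpa using h'
  | det hh hf hS hi _ ih => exact .det hh hf hS hi (ih h')
  | coin hh hf hS hi _ ih => exact .coin hh hf hS hi (ih h')

/-! ### The machine of a flowchart -/

/-- Is the symbol a `1`? -/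
def Ternary.isOne : Ternary → Bool
  | .one => true
  | _ => false

@[simp] lemma Ternary.isOne_iff (x : Ternary) : x.isOne = true ↔ x = .one := by
  cases x <;> simp [Ternary.isOne]

@[simp] lemma Ternary.ofBool_eq_one (b : Bool) : Ternary.ofBool b = .one ↔ b = true := by
  cases b <;> simp [Ternary.ofBool]

namespace Sweep

/-- Is the instruction executed by a sweep over the work tape? -/
def Needs {κ : Type} : RInstr κ → Bool
  | .act (.inc _) _ => true
  | .act (.zero _) _ => true
  | .act (.emitBin _) _ => true
  | .test (.le _ _) _ _ => true
  | _ => false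

/-- The local state at the start of the forward sweep: the carry of an increment, or the result of
the comparison of the empty lists of digits. -/
def start {κ : Type} : RInstr κ → Bool × Bool
  | .act (.inc _) _ => (true, false)
  | .test (.le _ _) _ _ => (true, false)
  | _ => (false, false)

/-- The forward sweep on track `τ`: the symbol written and the new local state. Register `r` is
stored on track `r + 1`. A comparison `r ≤ s` stores the digit of `r` and decides with the digit of
`s`, which comes later in the same group of cells. -/
def fwd {κ : Type} (I : RInstr κ) (τ : ℕ) (x : Ternary) (s : Bool × Bool) :
    Ternary × (Bool × Bool) :=
  match I with
  | .act (.inc r) _ =>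
    if τ = r + 1 then (Ternary.ofBool (x.isOne != s.1), (s.1 && x.isOne, false)) else (x, s)
  | .act (.zero r) _ => if τ = r + 1 then (.zero, s) else (x, s)
  | .test (.le r t) _ _ =>
    if τ = r + 1 then (x, (s.1, x.isOne))
    else if τ = t + 1 then (x, (if x.isOne = s.2 then s.1 else x.isOne, s.2)) else (x, s)
  | _ => (x, s)

/-- Does the forward sweep claim one more group of cells? -/
def ext {κ : Type} (I : RInstr κ) (s : Bool × Bool) : Bool :=
  match I with
  | .act (.inc _) _ => s.1
  | _ => false

/-- The backward sweep on track `τ`: the symbol emitted and the new local state, which for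
`emitBin` records whether a digit `1` has been seen. -/
def bwd {κ : Type} (I : RInstr κ) (τ : ℕ) (x : Ternary) (s : Bool × Bool) :
    Option Ternary × (Bool × Bool) :=
  match I with
  | .act (.emitBin r) _ =>
    if τ = r + 1 then
      (if s.1 || x.isOne then some (Ternary.ofBool x.isOne) else none, (s.1 || x.isOne, false))
    else (none, s)
  | _ => (none, s)

/-- The successor after a sweep. -/
def next {κ : Type} (I : RInstr κ) (s : Bool × Bool) : κ :=
  match I with
  | .act _ n => n
  | .test _ y n => if s.1 then y else n

/-- The symbol emitted at the end of a sweep: the number `0` is written `0`. -/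
def last {κ : Type} (I : RInstr κ) (s : Bool × Bool) : Option Ternary :=
  match I with
  | .act (.emitBin _) _ => if s.1 then none else some .zero
  | _ => none

end Sweep

/-- States of the machine of a flowchart with nodes `ν` and registers below `p`: the state `none`
marks the leftmost cell; `some (n, none)` is ready to execute node `n`; otherwise the machine is in
a sweep, with direction (`true` for forward), current track, and local state. -/
abbrev TMState (ν : Type) (p : ℕ) : Type := Option (Option ν × Option (Bool × Fin (p + 1) × (Bool × Bool)))

/-- The transition function of the machine of a flowchart. -/
def tmStep {ν : Type} (code : ν → RInstr (Option ν)) (entry : ν) (p : ℕ) :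
    TMState ν p → Option Ternary → Ternary → Bool → OPTMAction (TMState ν p)
  | none, _, _, _ => ⟨some (some entry, none), .one, none, false, none⟩
  | some (none, q), _, x, _ => ⟨some (none, q), x, none, false, none⟩
  | some (some n, none), i, x, b =>
    match code n with
    | .act (.emit t) nx => ⟨some (nx, none), x, none, false, some t⟩
    | .act .advance nx => ⟨some (nx, none), x, none, true, none⟩
    | .test .coin y no => ⟨some (if b = true then y else no, none), x, none, false, none⟩
    | .test (.sym o) y no => ⟨some (if i = o then y else no, none), x, none, false, none⟩
    | I => ⟨some (some n, some (true, 0, Sweep.start I)), x, none, false, none⟩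
  | some (some n, some (true, τ, s)), _, x, _ =>
    if τ = 0 then
      if x = .hash then
        if Sweep.ext (code n) s = true then
          ⟨some (some n, some (true, τ + 1, s)), .zero, some true, false, none⟩
        else ⟨some (some n, some (false, τ - 1, s)), x, some false, false, none⟩
      else ⟨some (some n, some (true, τ + 1, s)), x, some true, false, none⟩
    else
      ⟨some (some n, some (true, τ + 1, (Sweep.fwd (code n) τ x s).2)),
        (Sweep.fwd (code n) τ x s).1, some true, false, none⟩
  | some (some n, some (false, τ, s)), _, x, _ =>
    if τ = 0 then
      if x = .one then ⟨some (Sweep.next (code n) s, none), x, none, false, Sweep.last (code n) s⟩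
      else ⟨some (some n, some (false, τ - 1, s)), x, some false, false, none⟩
    else
      ⟨some (some n, some (false, τ - 1, (Sweep.bwd (code n) τ x s).2)), x, some false, false,
        (Sweep.bwd (code n) τ x s).1⟩

/-- The machine of a flowchart. -/
def flowTM {ν : Type} [Finite ν] (code : ν → RInstr (Option ν)) (entry : ν) (p : ℕ) : OPTM where
  Q := TMState ν p
  finite := inferInstance
  start := none
  isHalt := fun q => match q with
    | some (none, _) => true
    | _ => false
  δ := tmStep code entry p

/-- The states of the machine of a flowchart that use their coin flip. -/
def flowFlip {ν : Type} (code : ν → RInstr (Option ν)) (p : ℕ) : TMState ν p → Bool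
  | some (some n, none) => match code n with
    | .test .coin _ _ => true
    | _ => false
  | _ => false

lemma tmStep_eq_of_flip {ν : Type} (code : ν → RInstr (Option ν)) (entry : ν) (p : ℕ)
    (q : TMState ν p) (h : flowFlip code p q = false) (i : Option Ternary) (x : Ternary) (b : Bool) :
    tmStep code entry p q i x b = tmStep code entry p q i x false := by
  match q, h with
  | none, _ => rfl
  | some (none, _), _ => rfl
  | some (some n, none), h =>
    simp only [flowFlip] at h
    simp only [tmStep]
    rcases hc : code n with ⟨a, nx⟩ | ⟨t, y, no⟩
    · cases a <;> rfl
    · cases t <;> simp_all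
  | some (some n, some (true, τ, s)), _ => rfl
  | some (some n, some (false, τ, s)), _ => rfl

section Run

variable {ν : Type} [Finite ν] {code : ν → RInstr (Option ν)} {entry : ν} {p S : ℕ}
  {w : List Ternary}

/-- One step of the machine, given the action prescribed by the transition function. -/
lemma flow_step {q : TMState ν p} {a : OPTMAction (TMState ν p)} {pos k : ℕ} {tape : ℕ → Ternary}
    {out : List Ternary} {b : Bool} (hh : (flowTM code entry p).isHalt q = false)
    (ha : tmStep code entry p q w[pos]? (tape k) b = a) :
    (flowTM code entry p).step w ⟨q, pos, tape, k, out⟩ b =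
      ⟨a.next, if a.inputAdvance = true then pos + 1 else pos, update tape k a.write,
        match a.workMove with
        | none => k
        | some true => k + 1
        | some false => k - 1, out ++ a.emit.toList⟩ := by
  subst ha
  simp only [OPTM.step, hh, Bool.false_eq_true, if_false]
  rfl

lemma flow_fwd {n : ν} {f : ℕ → Bool × Bool} {tape : ℕ → Ternary} {ft : ℕ → Ternary} {e : ℕ}
    (hft : ∀ k < e, ft k = if k % (p + 1) = 0 then (if tape k = .hash then .zero else tape k)
      else (Sweep.fwd (code n) (k % (p + 1)) (tape k) (f k)).1)
    (hft' : ∀ k, e ≤ k → ft k = tape k)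
    (hf : ∀ k < e, f (k + 1) = if k % (p + 1) = 0 then f k
      else (Sweep.fwd (code n) (k % (p + 1)) (tape k) (f k)).2)
    (hx : ∀ k < e, k % (p + 1) = 0 → tape k = .hash → Sweep.ext (code n) (f k) = true)
    (hS : e < S) {pos : ℕ} (hpos : pos ≤ w.length) (out : List Ternary) :
    GRun (flowTM code entry p) (flowFlip code p) S w
      ⟨some (some n, some (true, 0, f 0)), pos, tape, 0, out⟩ []
      ⟨some (some n, some (true, Fin.ofNat (p + 1) e, f e)), pos, ft, e, out⟩ := by
  have key : ∀ k ≤ e, GRun (flowTM code entry p) (flowFlip code p) S w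
      ⟨some (some n, some (true, 0, f 0)), pos, tape, 0, out⟩ []
      ⟨some (some n, some (true, Fin.ofNat (p + 1) k, f k)), pos,
        fun i => if i < k then ft i else tape i, k, out⟩ := by
    intro k hk
    induction k with
    | zero =>
      have : (fun i => if i < 0 then ft i else tape i) = tape := by simp
      rw [this]
      exact .refl _ (by simp; omega) hpos
    | succ k ih =>
      rw [show ([] : List Bool) = [] ++ [] from rfl]
      refine (ih (by omega)).trans (.det rfl rfl (by simp; omega) hpos ?_)
      have hcell : (if k < k then ft k else tape k) = tape k := by simp
      have htape : ∀ x, ft k = x → update (fun i => if i < k then ft i else tape i) k x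
          = fun i => if i < k + 1 then ft i else tape i := by
        intro x hx
        funext i
        rcases lt_trichotomy i k with h | h | h
        · rw [update_of_ne (by omega)]; simp [h, show i < k + 1 by omega]
        · subst h; simp [hx]
        · rw [update_of_ne (by omega)]; simp [show ¬ i < k by omega, show ¬ i < k + 1 by omega]
      have hsucc : (Fin.ofNat (p + 1) k + 1 : Fin (p + 1)) = Fin.ofNat (p + 1) (k + 1) := by
        apply Fin.ext; simp [Fin.val_add]
      have h0 : (Fin.ofNat (p + 1) k = 0) ↔ k % (p + 1) = 0 := by
        rw [Fin.ext_iff]; simp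
      have hfk := hft k (by omega)
      have hfs := hf k (by omega)
      by_cases hk0 : k % (p + 1) = 0
      · rw [if_pos hk0] at hfk hfs
        by_cases hh : tape k = .hash
        · have hxk := hx k (by omega) hk0 hh
          rw [if_pos hh] at hfk
          rw [flow_step (a := ⟨some (some n, some (true, Fin.ofNat (p + 1) k + 1, f k)), .zero,
            some true, false, none⟩) rfl
            (by rw [hcell, tmStep, if_pos (h0.2 hk0), if_pos hh, if_pos hxk]), htape _ hfk, hsucc,
            ← hfs]
          simpa using GRun.refl _ (show k + 1 < S by omega) hpos
        · rw [if_neg hh] at hfk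
          rw [flow_step (a := ⟨some (some n, some (true, Fin.ofNat (p + 1) k + 1, f k)), tape k,
            some true, false, none⟩) rfl
            (by rw [hcell, tmStep, if_pos (h0.2 hk0), if_neg hh]), htape _ hfk, hsucc, ← hfs]
          simpa using GRun.refl _ (show k + 1 < S by omega) hpos
      · rw [if_neg hk0] at hfk hfs
        rw [flow_step (a := ⟨some (some n, some (true, Fin.ofNat (p + 1) k + 1, f (k + 1))), ft k,
            some true, false, none⟩) rfl
            (by rw [hcell, tmStep, if_neg (fun h => hk0 (h0.1 h)), hfk, hfs]; rfl), htape _ rfl, hsucc]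
        simpa using GRun.refl _ (show k + 1 < S by omega) hpos
  have := key e le_rfl
  have h2 : (fun i => if i < e then ft i else tape i) = ft := by
    funext i
    split_ifs with h
    · rfl
    · exact (hft' i (by omega)).symm
  rwa [h2] at this

lemma flow_bwd {n : ν} {g : ℕ → (Bool × Bool) × List Ternary} {tape : ℕ → Ternary} {e : ℕ}
    (hg : ∀ k < e, g k = if k % (p + 1) = 0 then g (k + 1)
      else ((Sweep.bwd (code n) (k % (p + 1)) (tape k) (g (k + 1)).1).2,
        (g (k + 1)).2 ++ (Sweep.bwd (code n) (k % (p + 1)) (tape k) (g (k + 1)).1).1.toList))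
    (hx : ∀ k < e, k % (p + 1) = 0 → (tape k = .one ↔ k = 0))
    (he : 0 < e) (hS : e ≤ S) {pos : ℕ} (hpos : pos ≤ w.length) :
    GRun (flowTM code entry p) (flowFlip code p) S w
      ⟨some (some n, some (false, Fin.ofNat (p + 1) (e - 1), (g e).1)), pos, tape, e - 1, (g e).2⟩ []
      ⟨some (some n, some (false, 0, (g 1).1)), pos, tape, 0, (g 1).2⟩ := by
  have key : ∀ k < e, GRun (flowTM code entry p) (flowFlip code p) S w
      ⟨some (some n, some (false, Fin.ofNat (p + 1) k, (g (k + 1)).1)), pos, tape, k, (g (k + 1)).2⟩ []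
      ⟨some (some n, some (false, 0, (g 1).1)), pos, tape, 0, (g 1).2⟩ := by
    intro k hk
    induction k with
    | zero =>
      have : Fin.ofNat (p + 1) 0 = 0 := rfl
      rw [this]
      exact .refl _ (by simp; omega) hpos
    | succ k ih =>
      refine .det rfl rfl (by simp; omega) hpos ?_
      have hpred : (Fin.ofNat (p + 1) (k + 1) - 1 : Fin (p + 1)) = Fin.ofNat (p + 1) k := by
        rw [sub_eq_iff_eq_add]
        apply Fin.ext; simp [Fin.val_add]
      have h0 : (Fin.ofNat (p + 1) (k + 1) = 0) ↔ (k + 1) % (p + 1) = 0 := by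
        rw [Fin.ext_iff]; simp
      have hgk := hg (k + 1) hk
      have hup : update tape (k + 1) (tape (k + 1)) = tape := update_eq_self _ _
      by_cases hk0 : (k + 1) % (p + 1) = 0
      · rw [if_pos hk0] at hgk
        have h1 : tape (k + 1) ≠ .one := fun h => by
          have := (hx (k + 1) hk hk0).1 h
          omega
        rw [flow_step (a := ⟨some (some n, some (false, Fin.ofNat (p + 1) (k + 1) - 1,
            (g (k + 1 + 1)).1)), tape (k + 1), some false, false, none⟩) rfl
            (by rw [tmStep, if_pos (h0.2 hk0), if_neg h1]), hup, hpred, ← hgk]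
        simpa using ih (by omega)
      · rw [if_neg hk0] at hgk
        rw [flow_step (a := ⟨some (some n, some (false, Fin.ofNat (p + 1) (k + 1) - 1,
            (g (k + 1)).1)), tape (k + 1), some false, false,
            (Sweep.bwd (code n) ((k + 1) % (p + 1)) (tape (k + 1)) (g (k + 1 + 1)).1).1⟩) rfl
            (by rw [tmStep, if_neg (fun h => hk0 (h0.1 h)), hgk]; rfl), hup, hpred]
        have : (g (k + 1)).2 = (g (k + 1 + 1)).2 ++ (Sweep.bwd (code n) ((k + 1) % (p + 1))
          (tape (k + 1)) (g (k + 1 + 1)).1).1.toList := by rw [hgk]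
        rw [← this]
        simpa using ih (by omega)
  obtain ⟨e, rfl⟩ : ∃ e', e = e' + 1 := ⟨e - 1, by omega⟩
  exact key e (by omega)

/-- A complete sweep, described by the local states `f` before each cell of the forward sweep and
the local states and outputs `g` behind each cell of the backward sweep. -/
lemma flow_sweep {n : ν} (hn : Sweep.Needs (code n) = true) {f : ℕ → Bool × Bool}
    {g : ℕ → (Bool × Bool) × List Ternary} {tape ft : ℕ → Ternary} {e : ℕ}
    (hf0 : f 0 = Sweep.start (code n))
    (hft : ∀ k < e, ft k = if k % (p + 1) = 0 then (if tape k = .hash then .zero else tape k)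
      else (Sweep.fwd (code n) (k % (p + 1)) (tape k) (f k)).1)
    (hft' : ∀ k, e ≤ k → ft k = tape k)
    (hf : ∀ k < e, f (k + 1) = if k % (p + 1) = 0 then f k
      else (Sweep.fwd (code n) (k % (p + 1)) (tape k) (f k)).2)
    (hx : ∀ k < e, k % (p + 1) = 0 → tape k = .hash → Sweep.ext (code n) (f k) = true)
    (hend : e % (p + 1) = 0) (htend : tape e = .hash) (hxe : Sweep.ext (code n) (f e) = false)
    {pos : ℕ} {out : List Ternary} (hge : g e = (f e, out))
    (hg : ∀ k < e, g k = if k % (p + 1) = 0 then g (k + 1)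
      else ((Sweep.bwd (code n) (k % (p + 1)) (ft k) (g (k + 1)).1).2,
        (g (k + 1)).2 ++ (Sweep.bwd (code n) (k % (p + 1)) (ft k) (g (k + 1)).1).1.toList))
    (hgx : ∀ k < e, k % (p + 1) = 0 → (ft k = .one ↔ k = 0))
    (he : 0 < e) (hS : e < S) (hpos : pos ≤ w.length) :
    GRun (flowTM code entry p) (flowFlip code p) S w
      ⟨some (some n, none), pos, tape, 0, out⟩ []
      ⟨some (Sweep.next (code n) (g 1).1, none), pos, ft, 0,
        (g 1).2 ++ (Sweep.last (code n) (g 1).1).toList⟩ := by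
  have hflip : flowFlip code p (some (some n, none)) = false := by
    unfold flowFlip
    rcases hc : code n with ⟨a, nx⟩ | ⟨t, y, no⟩
    · simp [hc]
    · cases t <;> simp_all [Sweep.Needs]
  have hstart : (flowTM code entry p).step w ⟨some (some n, none), pos, tape, 0, out⟩ false
      = ⟨some (some n, some (true, 0, f 0)), pos, tape, 0, out⟩ := by
    rw [flow_step (a := ⟨some (some n, some (true, 0, f 0)), tape 0, none, false, none⟩) rfl]
    · simp
    · rw [hf0, tmStep]
      rcases hc : code n with ⟨a, nx⟩ | ⟨t, y, no⟩
      · cases a <;> simp_all [Sweep.Needs]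
      · cases t <;> simp_all [Sweep.Needs]
  refine .det rfl hflip (by simp; omega) hpos ?_
  rw [hstart]
  have hturn : (flowTM code entry p).step w
      ⟨some (some n, some (true, Fin.ofNat (p + 1) e, f e)), pos, ft, e, out⟩ false
      = ⟨some (some n, some (false, Fin.ofNat (p + 1) (e - 1), (g e).1)), pos, ft, e - 1, (g e).2⟩ := by
    have h0 : Fin.ofNat (p + 1) e = 0 := by rw [Fin.ext_iff]; simp [hend]
    have hpred : (Fin.ofNat (p + 1) e - 1 : Fin (p + 1)) = Fin.ofNat (p + 1) (e - 1) := by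
      rw [sub_eq_iff_eq_add]
      apply Fin.ext; simp [Fin.val_add, Nat.sub_add_cancel he]
    have hte : ft e = .hash := by rw [hft' e le_rfl, htend]
    rw [flow_step (a := ⟨some (some n, some (false, Fin.ofNat (p + 1) e - 1, f e)), ft e,
      some false, false, none⟩) rfl
      (by rw [tmStep, if_pos h0, if_pos hte, if_neg (by simp [hxe])]), hpred, hge]
    simp
  have hback := flow_bwd (entry := entry) hg hgx he hS.le hpos
  have hfin : (flowTM code entry p).step w
      ⟨some (some n, some (false, 0, (g 1).1)), pos, ft, 0, (g 1).2⟩ false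
      = ⟨some (Sweep.next (code n) (g 1).1, none), pos, ft, 0,
        (g 1).2 ++ (Sweep.last (code n) (g 1).1).toList⟩ := by
    have hone := (hgx 0 he (by simp)).2 rfl
    rw [flow_step (a := ⟨some (Sweep.next (code n) (g 1).1, none), ft 0, none, false,
      Sweep.last (code n) (g 1).1⟩) rfl (by rw [tmStep, if_pos rfl, if_pos hone])]
    simp
  have h1 := flow_fwd (entry := entry) hft hft' hf hx hS hpos out
  refine h1.trans (l' := []) (.det rfl rfl (by simpa using hS) hpos ?_)
  rw [hturn]
  refine hback.trans (l' := []) (.det rfl rfl (by simp; omega) hpos ?_)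
  rw [hfin]
  exact .refl _ (by simp; omega) hpos

end Run

/-! ### Registers on the work tape -/

lemma Nat.testBit_add_one_eq (x j : ℕ) :
    (x + 1).testBit j = (x.testBit j != decide (∀ i < j, x.testBit i = true)) := by
  induction j generalizing x with
  | zero =>
    simp only [Nat.testBit_zero, not_lt_zero, IsEmpty.forall_iff, implies_true, decide_true]
    rcases Nat.mod_two_eq_zero_or_one x with h | h <;> simp [h, Nat.add_mod]
  | succ j ih =>
    have h3 : (∀ i < j + 1, x.testBit i = true) ↔
        (x % 2 = 1 ∧ ∀ i < j, (x / 2).testBit i = true) := by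
      constructor
      · intro h
        refine ⟨by simpa [Nat.testBit_zero] using h 0 (by omega), fun i hi => ?_⟩
        have := h (i + 1) (by omega)
        rwa [Nat.testBit_succ] at this
      · rintro ⟨h0, h1⟩ i hi
        rcases i with _ | i
        · simpa [Nat.testBit_zero] using h0
        · rw [Nat.testBit_succ]; exact h1 i (by omega)
    have h4 : decide (∀ i < j + 1, x.testBit i = true) =
        (decide (x % 2 = 1) && decide (∀ i < j, (x / 2).testBit i = true)) := by
      rw [← Bool.decide_and]
      exact decide_eq_decide.2 h3
    rw [Nat.testBit_succ, Nat.testBit_succ, h4]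
    rcases Nat.mod_two_eq_zero_or_one x with h | h
    · rw [show (x + 1) / 2 = x / 2 by omega]; simp [h]
    · rw [show (x + 1) / 2 = x / 2 + 1 by omega, ih]; simp [h]

lemma Nat.eq_two_pow_sub_one_of_testBit {x G : ℕ} (hx : x < 2 ^ G)
    (h : ∀ i < G, x.testBit i = true) : x = 2 ^ G - 1 := by
  apply Nat.eq_of_testBit_eq
  intro i
  rw [Nat.testBit_two_pow_sub_one]
  by_cases hi : i < G
  · simp [hi, h i hi]
  · simp only [hi, decide_false]
    exact Nat.testBit_lt_two_pow (hx.trans_le (Nat.pow_le_pow_right (by omega) (by omega)))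

lemma Nat.mod_two_pow_succ_le_iff (x y j : ℕ) :
    (x % 2 ^ (j + 1) ≤ y % 2 ^ (j + 1)) ↔
      (if y.testBit j = x.testBit j then x % 2 ^ j ≤ y % 2 ^ j else y.testBit j = true) := by
  have hx : x % 2 ^ j < 2 ^ j := Nat.mod_lt _ (by positivity)
  have hy : y % 2 ^ j < 2 ^ j := Nat.mod_lt _ (by positivity)
  have key : ∀ z : ℕ, z % 2 ^ (j + 1) = z % 2 ^ j + 2 ^ j * (z.testBit j).toNat := by
    intro z
    rw [Nat.toNat_testBit, Nat.mod_pow_succ]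
  rw [key, key]
  cases x.testBit j <;> cases y.testBit j <;> simp <;> omega

/-- The number of digits of register `r` stored in the cells before cell `k`. -/
def digitCount (p r k : ℕ) : ℕ := (k + p - (r + 1)) / (p + 1)

lemma digitCount_eq {p r k q t : ℕ} (hr : r < p) (hk : k = (p + 1) * q + t) (ht : t < p + 1) :
    digitCount p r k = if t ≤ r + 1 then q else q + 1 := by
  unfold digitCount
  split_ifs with h
  · rw [show k + p - (r + 1) = (t + p - (r + 1)) + (p + 1) * q by omega,
      Nat.add_mul_div_left _ _ (by omega), Nat.div_eq_of_lt (by omega)]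
    omega
  · rw [show k + p - (r + 1) = (t - (r + 2)) + (p + 1) * (q + 1) by rw [Nat.mul_add]; omega,
      Nat.add_mul_div_left _ _ (by omega), Nat.div_eq_of_lt (by omega)]
    omega

lemma digitCount_zero {p r : ℕ} (hr : r < p) : digitCount p r 0 = 0 := by
  rw [digitCount_eq (q := 0) (t := 0) hr (by simp) (by omega)]; simp

lemma digitCount_mul {p r : ℕ} (hr : r < p) (G : ℕ) : digitCount p r ((p + 1) * G) = G := by
  rw [digitCount_eq (q := G) (t := 0) hr (by simp) (by omega)]; simp

lemma digitCount_at {p r : ℕ} (hr : r < p) (k : ℕ) (h : k % (p + 1) = r + 1) :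
    digitCount p r k = k / (p + 1) := by
  rw [digitCount_eq hr (Nat.div_add_mod k (p + 1)).symm (Nat.mod_lt _ (by omega)), if_pos (by omega)]

lemma digitCount_lt {p r : ℕ} (hr : r < p) (k : ℕ) (h : r + 1 < k % (p + 1)) :
    digitCount p r k = k / (p + 1) + 1 := by
  rw [digitCount_eq hr (Nat.div_add_mod k (p + 1)).symm (Nat.mod_lt _ (by omega)), if_neg (by omega)]

lemma digitCount_succ {p r : ℕ} (hr : r < p) (k : ℕ) :
    digitCount p r (k + 1) = if k % (p + 1) = r + 1 then k / (p + 1) + 1 else digitCount p r k := by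
  have hk := (Nat.div_add_mod k (p + 1)).symm
  have hm := Nat.mod_lt k (show p + 1 > 0 by omega)
  set q := k / (p + 1)
  set t := k % (p + 1)
  rw [digitCount_eq hr hk hm]
  by_cases ht : t = p
  · rw [digitCount_eq (q := q + 1) (t := 0) hr (by rw [hk, ht]; ring) (by omega)]
    split_ifs <;> omega
  · rw [digitCount_eq (q := q) (t := t + 1) hr (by omega) (by omega)]
    split_ifs <;> omega

/-- The work tape `tape` holds, in `G` groups of `p + 1` cells, the binary digits of the registers
below `p`, least significant digits first. The first cell of each group is a marker: `1` in the
first group, `0` in the other groups, and blank behind the last group. -/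
structure TapeEnc (p : ℕ) (regs : ℕ → ℕ) (G : ℕ) (tape : ℕ → Ternary) : Prop where
  home : tape 0 = .one
  mark : ∀ j, 0 < j → j < G → tape ((p + 1) * j) = .zero
  free : ∀ j, G ≤ j → tape ((p + 1) * j) = .hash
  pos : 1 ≤ G
  bit : ∀ r < p, ∀ j, tape ((p + 1) * j + (r + 1)) = .one ↔ (regs r).testBit j = true
  lt : ∀ r < p, regs r < 2 ^ G

lemma TapeEnc.bit' {p : ℕ} {regs : ℕ → ℕ} {G : ℕ} {tape : ℕ → Ternary} (h : TapeEnc p regs G tape)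
    {r k : ℕ} (hr : r < p) (hk : k % (p + 1) = r + 1) :
    (tape k).isOne = (regs r).testBit (k / (p + 1)) := by
  have := h.bit r hr (k / (p + 1))
  rw [← hk, Nat.div_add_mod] at this
  rw [Bool.eq_iff_iff, Ternary.isOne_iff, this]

/-- The tape after a forward sweep over `e` cells with local states `f`. -/
def sweepTape {κ : Type} (I : RInstr κ) (p : ℕ) (f : ℕ → Bool × Bool) (e : ℕ) (tape : ℕ → Ternary)
    (k : ℕ) : Ternary :=
  if k < e then
    (if k % (p + 1) = 0 then (if tape k = .hash then .zero else tape k)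
      else (Sweep.fwd I (k % (p + 1)) (tape k) (f k)).1)
  else tape k

lemma TapeEnc.sweep {κ : Type} {I : RInstr κ} {p : ℕ} {regs regs' : ℕ → ℕ} {G G' : ℕ}
    {tape : ℕ → Ternary} {f : ℕ → Bool × Bool} (h : TapeEnc p regs G tape) (hG : G ≤ G')
    (hbit : ∀ r < p, ∀ j < G',
      (Sweep.fwd I (r + 1) (tape ((p + 1) * j + (r + 1))) (f ((p + 1) * j + (r + 1)))).1 = .one ↔
        (regs' r).testBit j = true)
    (hlt : ∀ r < p, regs' r < 2 ^ G') :
    TapeEnc p regs' G' (sweepTape I p f ((p + 1) * G') tape) where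
  home := by
    have := h.pos
    simp [sweepTape, h.home, show 0 < G' by omega]
  mark j h0 hj := by
    have h1 : (p + 1) * j < (p + 1) * G' := Nat.mul_lt_mul_of_pos_left hj (by omega)
    simp only [sweepTape, h1, if_true, Nat.mul_mod_right]
    by_cases hjG : j < G
    · simp [h.mark j h0 hjG]
    · simp [h.free j (by omega)]
  free j hj := by
    have h1 : ¬ (p + 1) * j < (p + 1) * G' := by
      have := Nat.mul_le_mul_left (p + 1) hj
      omega
    simp only [sweepTape, h1, if_false]
    exact h.free j (by omega)
  pos := h.pos.trans hG
  bit r hr j := by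
    have hm : ((p + 1) * j + (r + 1)) % (p + 1) = r + 1 := by
      rw [Nat.mul_add_mod, Nat.mod_eq_of_lt (by omega)]
    by_cases hj : j < G'
    · have h1 : (p + 1) * j + (r + 1) < (p + 1) * G' := by
        have := Nat.mul_le_mul_left (p + 1) (Nat.succ_le_of_lt hj)
        rw [Nat.mul_succ] at this
        omega
      simp only [sweepTape, h1, if_true, hm, Nat.succ_ne_zero, if_false]
      exact hbit r hr j hj
    · have h1 : ¬ (p + 1) * j + (r + 1) < (p + 1) * G' := by
        have := Nat.mul_le_mul_left (p + 1) (not_lt.1 hj)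
        omega
      simp only [sweepTape, h1, if_false]
      rw [h.bit r hr j]
      have hp : 2 ^ G' ≤ 2 ^ j := Nat.pow_le_pow_right (by omega) (not_lt.1 hj)
      have h2 := Nat.testBit_lt_two_pow ((hlt r hr).trans_le hp)
      have h3 := Nat.testBit_lt_two_pow
        ((h.lt r hr).trans_le ((Nat.pow_le_pow_right (by omega) hG).trans hp))
      simp [h2, h3]
  lt := hlt

section Run

variable {ν : Type} [Finite ν] {code : ν → RInstr (Option ν)} {entry : ν} {p S : ℕ}
  {w : List Ternary}

/-- A sweep on an encoded tape; only the digits matter. -/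
lemma flow_sweep_enc {n : ν} (hn : Sweep.Needs (code n) = true) {regs regs' : ℕ → ℕ} {G G' : ℕ}
    {tape : ℕ → Ternary} {f : ℕ → Bool × Bool} {g : ℕ → (Bool × Bool) × List Ternary}
    (h : TapeEnc p regs G tape) (hG : G ≤ G')
    (hbit : ∀ r < p, ∀ j < G',
      (Sweep.fwd (code n) (r + 1) (tape ((p + 1) * j + (r + 1))) (f ((p + 1) * j + (r + 1)))).1
        = .one ↔ (regs' r).testBit j = true)
    (hlt : ∀ r < p, regs' r < 2 ^ G')
    (hf0 : f 0 = Sweep.start (code n))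
    (hf : ∀ k, f (k + 1) = if k % (p + 1) = 0 then f k
      else (Sweep.fwd (code n) (k % (p + 1)) (tape k) (f k)).2)
    (hx : ∀ j < G', G ≤ j → Sweep.ext (code n) (f ((p + 1) * j)) = true)
    (hxe : Sweep.ext (code n) (f ((p + 1) * G')) = false)
    {pos : ℕ} {out : List Ternary} (hge : g ((p + 1) * G') = (f ((p + 1) * G'), out))
    (hg : ∀ k < (p + 1) * G', g k = if k % (p + 1) = 0 then g (k + 1)
      else ((Sweep.bwd (code n) (k % (p + 1)) (sweepTape (code n) p f ((p + 1) * G') tape k)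
          (g (k + 1)).1).2,
        (g (k + 1)).2 ++ (Sweep.bwd (code n) (k % (p + 1))
          (sweepTape (code n) p f ((p + 1) * G') tape k) (g (k + 1)).1).1.toList))
    (hS : (p + 1) * G' < S) (hpos : pos ≤ w.length) :
    ∃ tape', TapeEnc p regs' G' tape' ∧ GRun (flowTM code entry p) (flowFlip code p) S w
      ⟨some (some n, none), pos, tape, 0, out⟩ []
      ⟨some (Sweep.next (code n) (g 1).1, none), pos, tape', 0,
        (g 1).2 ++ (Sweep.last (code n) (g 1).1).toList⟩ := by
  have henc := h.sweep hG hbit hlt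
  refine ⟨_, henc, flow_sweep hn hf0 ?_ ?_ (fun k _ => hf k) ?_ (Nat.mul_mod_right _ _)
    (h.free G' hG) hxe hge hg ?_ ?_ hS hpos⟩
  · intro k hk; simp [sweepTape, hk]
  · intro k hk; simp [sweepTape, show ¬ k < (p + 1) * G' by omega]
  · intro k hk hk0 hh
    obtain ⟨j, rfl⟩ := Nat.dvd_of_mod_eq_zero hk0
    have hj : j < G' := lt_of_mul_lt_mul_left hk (by omega)
    refine hx j hj ?_
    by_contra hlt'
    rcases Nat.eq_zero_or_pos j with rfl | h0
    · rw [Nat.mul_zero, h.home] at hh; cases hh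
    · rw [h.mark j h0 (by omega)] at hh; cases hh
  · intro k hk hk0
    obtain ⟨j, rfl⟩ := Nat.dvd_of_mod_eq_zero hk0
    have hj : j < G' := lt_of_mul_lt_mul_left hk (by omega)
    rcases Nat.eq_zero_or_pos j with rfl | h0
    · simp [henc.home]
    · rw [henc.mark j h0 hj]
      simp [h0.ne']
  · have := h.pos
    exact Nat.mul_pos (by omega) (by omega)

lemma flow_inc {n : ν} {r : ℕ} {nx : Option ν} (hc : code n = .act (.inc r) nx) (hr : r < p)
    {regs : ℕ → ℕ} {G B : ℕ} {tape : ℕ → Ternary} (h : TapeEnc p regs G tape) (hB : regs r + 1 ≤ B)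
    (hG : 2 ^ (G - 1) ≤ B) (hS : (p + 1) * (Nat.log 2 B + 1) < S) {pos : ℕ} {out : List Ternary}
    (hpos : pos ≤ w.length) :
    ∃ tape' G', TapeEnc p (update regs r (regs r + 1)) G' tape' ∧ 2 ^ (G' - 1) ≤ B ∧
      GRun (flowTM code entry p) (flowFlip code p) S w
        ⟨some (some n, none), pos, tape, 0, out⟩ [] ⟨some (nx, none), pos, tape', 0, out⟩ := by
  have hpos' := h.pos
  have hlt := h.lt r hr
  obtain ⟨G', hGG', hG1, hcar, hG'B, hlt'⟩ : ∃ G', G ≤ G' ∧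
      (∀ j < G', G ≤ j → ∀ i < j, (regs r).testBit i = true) ∧
      (¬ ∀ i < G', (regs r).testBit i = true) ∧ 2 ^ (G' - 1) ≤ B ∧ regs r + 1 < 2 ^ G' := by
    by_cases hov : regs r + 1 = 2 ^ G
    · have hx : regs r = 2 ^ G - 1 := by omega
      refine ⟨G + 1, by omega, ?_, ?_, ?_, ?_⟩
      · intro j hj hj' i hi
        rw [hx, Nat.testBit_two_pow_sub_one]
        simp; omega
      · intro hall
        have := hall G (by omega)
        rw [hx, Nat.testBit_two_pow_sub_one] at this
        simp at this
      · simp only [Nat.add_sub_cancel]; omega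
      · rw [pow_succ]; omega
    · refine ⟨G, le_rfl, fun j hj hj' => absurd hj (by omega), ?_, hG, by omega⟩
      intro hall
      have := Nat.eq_two_pow_sub_one_of_testBit hlt hall
      omega
  have hGlog : G' ≤ Nat.log 2 B + 1 := by
    have := Nat.le_log_of_pow_le (by omega) hG'B
    omega
  have hSG : (p + 1) * G' < S := (Nat.mul_le_mul_left _ hGlog).trans_lt hS
  let f : ℕ → Bool × Bool := fun k => (decide (∀ i < digitCount p r k, (regs r).testBit i = true), false)
  have := flow_sweep_enc (code := code) (S := S) (entry := entry) (w := w) (pos := pos) (out := out) (n := n)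
    (by rw [hc]; rfl) (f := f) (g := fun _ => (f ((p + 1) * G'), out))
    (regs' := update regs r (regs r + 1)) h hGG' ?_ ?_ ?_ ?_ ?_ ?_ rfl ?_ hSG hpos
  · obtain ⟨tape', h1, h2⟩ := this
    refine ⟨tape', G', h1, hG'B, ?_⟩
    rw [hc] at h2
    simpa [Sweep.next, Sweep.last] using h2
  · intro r' hr' j hj
    by_cases hrr : r' = r
    · subst hrr
      have hm : ((p + 1) * j + (r' + 1)) % (p + 1) = r' + 1 := by
        rw [Nat.mul_add_mod, Nat.mod_eq_of_lt (by omega)]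
      have hd : ((p + 1) * j + (r' + 1)) / (p + 1) = j := by
        rw [Nat.mul_add_div (by omega), Nat.div_eq_of_lt (by omega), add_zero]
      have hb := h.bit' hr hm
      rw [hd] at hb
      simp only [hc, Sweep.fwd, if_true, Ternary.ofBool_eq_one, f, hb, digitCount_at hr _ hm, hd,
        update_self, Nat.testBit_add_one_eq]
    · have : r' + 1 ≠ r + 1 := by omega
      simp only [hc, Sweep.fwd, this, if_false, update_of_ne hrr]
      exact h.bit r' hr' j
  · intro r' hr'
    by_cases hrr : r' = r
    · subst hrr; simpa using hlt'
    · rw [update_of_ne hrr]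
      exact (h.lt r' hr').trans_le (Nat.pow_le_pow_right (by omega) hGG')
  · simp [f, digitCount_zero hr, hc, Sweep.start]
  · intro k
    by_cases hk0 : k % (p + 1) = 0
    · rw [if_pos hk0]
      simp only [f, digitCount_succ hr, hk0, (Nat.succ_ne_zero r).symm, if_false]
    · rw [if_neg hk0]
      by_cases hkr : k % (p + 1) = r + 1
      · simp only [hc, Sweep.fwd, hkr, if_true, f, digitCount_succ hr, h.bit' hr hkr,
          digitCount_at hr _ hkr, Prod.mk.injEq, and_true]
        rw [Bool.eq_iff_iff]
        simp only [decide_eq_true_eq, Bool.and_eq_true]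
        constructor
        · intro hall
          exact ⟨fun i hi => hall i (by omega), hall _ (by omega)⟩
        · rintro ⟨h1, h2⟩ i hi
          rcases Nat.lt_succ_iff_lt_or_eq.1 hi with h' | h'
          · exact h1 i h'
          · rw [h']; exact h2
      · simp only [hc, Sweep.fwd, hkr, if_false, f, digitCount_succ hr]
  · intro j hj hj'
    simp only [hc, Sweep.ext, f, digitCount_mul hr, decide_eq_true_eq]
    exact hG1 j hj hj'
  · simp only [hc, Sweep.ext, f, digitCount_mul hr, decide_eq_false_iff_not]
    exact hcar
  · intro k _
    simp [hc, Sweep.bwd]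

lemma flow_zero {n : ν} {r : ℕ} {nx : Option ν} (hc : code n = .act (.zero r) nx) (hr : r < p)
    {regs : ℕ → ℕ} {G : ℕ} {tape : ℕ → Ternary} (h : TapeEnc p regs G tape)
    (hS : (p + 1) * G < S) {pos : ℕ} {out : List Ternary} (hpos : pos ≤ w.length) :
    ∃ tape', TapeEnc p (update regs r 0) G tape' ∧ GRun (flowTM code entry p) (flowFlip code p) S w
        ⟨some (some n, none), pos, tape, 0, out⟩ [] ⟨some (nx, none), pos, tape', 0, out⟩ := by
  have := flow_sweep_enc (code := code) (S := S) (entry := entry) (w := w) (pos := pos) (out := out) (n := n)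
    (by rw [hc]; rfl) (f := fun _ => (false, false)) (g := fun _ => ((false, false), out))
    (regs' := update regs r 0) h le_rfl ?_ ?_ ?_ ?_ ?_ ?_ rfl ?_ hS hpos
  · obtain ⟨tape', h1, h2⟩ := this
    refine ⟨tape', h1, ?_⟩
    rw [hc] at h2
    simpa [Sweep.next, Sweep.last] using h2
  · intro r' hr' j hj
    by_cases hrr : r' = r
    · subst hrr
      simp [hc, Sweep.fwd]
    · have : r' + 1 ≠ r + 1 := by omega
      simp only [hc, Sweep.fwd, this, if_false, update_of_ne hrr]
      exact h.bit r' hr' j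
  · intro r' hr'
    by_cases hrr : r' = r
    · subst hrr; simp
    · rw [update_of_ne hrr]
      exact h.lt r' hr'
  · simp [hc, Sweep.start]
  · intro k
    simp only [hc, Sweep.fwd]
    split_ifs <;> rfl
  · intro j hj hj'; omega
  · simp [hc, Sweep.ext]
  · intro k _
    simp [hc, Sweep.bwd]

lemma flow_le {n : ν} {r s : ℕ} {y no : Option ν} (hc : code n = .test (.le r s) y no)
    (hrs : r < s) (hs : s < p) {regs : ℕ → ℕ} {G : ℕ} {tape : ℕ → Ternary}
    (h : TapeEnc p regs G tape) (hS : (p + 1) * G < S) {pos : ℕ} {out : List Ternary}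
    (hpos : pos ≤ w.length) :
    ∃ tape', TapeEnc p regs G tape' ∧ GRun (flowTM code entry p) (flowFlip code p) S w
        ⟨some (some n, none), pos, tape, 0, out⟩ []
        ⟨some (if decide (regs r ≤ regs s) = true then y else no, none), pos, tape', 0, out⟩ := by
  have hr : r < p := hrs.trans hs
  let f : ℕ → Bool × Bool := fun k =>
    (decide (regs r % 2 ^ digitCount p s k ≤ regs s % 2 ^ digitCount p s k),
      if digitCount p r k = 0 then false else (regs r).testBit (digitCount p r k - 1))
  have := flow_sweep_enc (code := code) (S := S) (entry := entry) (w := w) (pos := pos) (out := out) (n := n)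
    (by rw [hc]; rfl) (f := f) (g := fun _ => (f ((p + 1) * G), out))
    (regs' := regs) h le_rfl ?_ h.lt ?_ ?_ ?_ ?_ rfl ?_ hS hpos
  · obtain ⟨tape', h1, h2⟩ := this
    refine ⟨tape', h1, ?_⟩
    rw [hc] at h2
    simpa [Sweep.next, Sweep.last, f, digitCount_mul hs, Nat.mod_eq_of_lt (h.lt r hr),
      Nat.mod_eq_of_lt (h.lt s hs)] using h2
  · intro r' hr' j hj
    have : (Sweep.fwd (code n) (r' + 1) (tape ((p + 1) * j + (r' + 1)))
        (f ((p + 1) * j + (r' + 1)))).1 = tape ((p + 1) * j + (r' + 1)) := by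
      simp only [hc, Sweep.fwd]
      split_ifs <;> rfl
    rw [this]
    exact h.bit r' hr' j
  · simp [f, digitCount_zero hr, digitCount_zero hs, hc, Sweep.start, Nat.mod_one]
  · intro k
    by_cases hk0 : k % (p + 1) = 0
    · rw [if_pos hk0]
      simp only [f, digitCount_succ hr, digitCount_succ hs, hk0, (Nat.succ_ne_zero _).symm, if_false]
    · rw [if_neg hk0]
      by_cases hkr : k % (p + 1) = r + 1
      · have hks : k % (p + 1) ≠ s + 1 := by omega
        simp only [hc, Sweep.fwd, hkr, if_true, f, digitCount_succ hr, h.bit' hr hkr,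
          digitCount_succ hs, Nat.succ_ne_zero, if_false, Nat.add_sub_cancel]
        rw [if_neg (by omega)]
      · by_cases hks : k % (p + 1) = s + 1
        · have hdr : digitCount p r k = k / (p + 1) + 1 := digitCount_lt hr k (by omega)
          have hne : ¬ s + 1 = r + 1 := by omega
          simp only [hc, Sweep.fwd, hks, hne, if_false, if_true, f, digitCount_succ hr,
            digitCount_succ hs, h.bit' hs hks, hdr, Nat.succ_ne_zero, Nat.add_sub_cancel,
            digitCount_at hs k hks, Prod.mk.injEq, and_true]
          rw [Bool.eq_iff_iff, decide_eq_true_eq, Nat.mod_two_pow_succ_le_iff]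
          split_ifs <;> simp
        · simp only [hc, Sweep.fwd, hkr, hks, if_false, f, digitCount_succ hr, digitCount_succ hs]
  · intro j hj hj'; omega
  · simp [hc, Sweep.ext]
  · intro k _
    simp [hc, Sweep.bwd]

lemma binaryWord_two_mul_add {x : ℕ} (hx : x ≠ 0) (b : Bool) :
    binaryWord (2 * x + b.toNat) = binaryWord x ++ [Ternary.ofBool b] := by
  have h0 : 2 * x + b.toNat ≠ 0 := by omega
  unfold binaryWord
  rw [if_neg h0, if_neg hx, Nat.digits_def' (by omega) (by omega)]
  have h1 : (2 * x + b.toNat) % 2 = b.toNat := by cases b <;> simp [Nat.add_mod]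
  have h2 : (2 * x + b.toNat) / 2 = x := by cases b <;> simp; omega
  rw [h1, h2]
  cases b <;> simp

lemma flow_emitBin {n : ν} {r : ℕ} {nx : Option ν} (hc : code n = .act (.emitBin r) nx)
    (hr : r < p) {regs : ℕ → ℕ} {G : ℕ} {tape : ℕ → Ternary} (h : TapeEnc p regs G tape)
    (hS : (p + 1) * G < S) {pos : ℕ} {out : List Ternary} (hpos : pos ≤ w.length) :
    ∃ tape', TapeEnc p regs G tape' ∧ GRun (flowTM code entry p) (flowFlip code p) S w
        ⟨some (some n, none), pos, tape, 0, out⟩ []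
        ⟨some (nx, none), pos, tape', 0, out ++ binaryWord (regs r)⟩ := by
  let f : ℕ → Bool × Bool := fun _ => (false, false)
  -- Behind cell `k`, the number without its `digitCount p r k` last digits has been written.
  let g : ℕ → (Bool × Bool) × List Ternary := fun k =>
    ((decide (regs r / 2 ^ digitCount p r k ≠ 0), false),
      out ++ if regs r / 2 ^ digitCount p r k = 0 then [] else binaryWord (regs r / 2 ^ digitCount p r k))
  have := flow_sweep_enc (code := code) (S := S) (entry := entry) (w := w) (pos := pos) (out := out) (n := n)
    (by rw [hc]; rfl) (f := f) (g := g) (regs' := regs) h le_rfl ?_ h.lt ?_ ?_ ?_ ?_ ?_ ?_ hS hpos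
  · obtain ⟨tape', h1, h2⟩ := this
    refine ⟨tape', h1, ?_⟩
    rw [hc] at h2
    have h0 : digitCount p r 1 = 0 := by
      rw [digitCount_succ hr, digitCount_zero hr]; simp
    by_cases hx : regs r = 0
    · simpa [Sweep.next, Sweep.last, g, h0, hx, binaryWord] using h2
    · simpa [Sweep.next, Sweep.last, g, h0, hx] using h2
  · intro r' hr' j hj
    simp only [hc, Sweep.fwd]
    exact h.bit r' hr' j
  · simp [f, hc, Sweep.start]
  · intro k
    simp [f, hc, Sweep.fwd]
  · intro j hj hj'; omega
  · simp [hc, Sweep.ext]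
  · have := h.lt r hr
    simp [g, f, digitCount_mul hr, this]
  · intro k hk
    by_cases hk0 : k % (p + 1) = 0
    · rw [if_pos hk0]
      simp only [g, digitCount_succ hr, hk0, (Nat.succ_ne_zero _).symm, if_false]
    · rw [if_neg hk0]
      have ht : sweepTape (code n) p f ((p + 1) * G) tape k = tape k := by
        simp [sweepTape, hk, hk0, hc, Sweep.fwd]
      rw [ht]
      by_cases hkr : k % (p + 1) = r + 1
      · have hb := h.bit' hr hkr
        set q := k / (p + 1) with hq
        have hx : regs r / 2 ^ q = 2 * (regs r / 2 ^ (q + 1)) + ((regs r).testBit q).toNat := by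
          rw [pow_succ, ← Nat.div_div_eq_div_mul, Nat.toNat_testBit]
          omega
        simp only [g, hc, Sweep.bwd, hkr, if_true, digitCount_succ hr, digitCount_at hr k hkr, hb, ← hq]
        generalize regs r / 2 ^ (q + 1) = y at hx ⊢
        rw [hx]
        by_cases hy : y = 0
        · subst hy
          cases (regs r).testBit q <;> simp [binaryWord, Ternary.ofBool]
        · rw [binaryWord_two_mul_add hy]
          simp [hy]
      · simp [g, hc, Sweep.bwd, hkr, digitCount_succ hr]

end Run

/-! ### From programs to machines -/

lemma FRun.gRun {ν : Type} [Finite ν] {code : ν → RInstr (Option ν)} {entry : ν} {p S B : ℕ}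
    {w : List Ternary} (hcode : ∀ n, (code n).top < p) (hS : (p + 1) * (Nat.log 2 B + 1) < S)
    {m m' : Option ν} {st st' : RState} {l : List Bool} (h : FRun w B code m st l m' st') :
    ∀ (tape : ℕ → Ternary) (G : ℕ), TapeEnc p st.regs G tape → 2 ^ (G - 1) ≤ B →
      st.pos ≤ w.length → ∃ tape', GRun (flowTM code entry p) (flowFlip code p) S w
          ⟨some (m, none), st.pos, tape, 0, st.out⟩ l ⟨some (m', none), st'.pos, tape', 0, st'.out⟩ := by
  induction h with
  | refl m st =>
    intro tape G _ _ hpos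
    exact ⟨tape, .refl _ (by simp; omega) hpos⟩
  | @act n a nx m st st' st'' l hc ha _ ih =>
    intro tape G henc hGB hpos
    have hG : (p + 1) * G < S := by
      have := Nat.le_log_of_pow_le (by omega) hGB
      exact (Nat.mul_le_mul_left _ (by omega)).trans_lt hS
    have htop := hcode n
    rw [hc] at htop
    cases ha with
    | inc r st hB =>
      obtain ⟨tape1, G1, h1, h2, h3⟩ := flow_inc (entry := entry) hc htop henc hB hGB hS
        (out := st.out) hpos
      obtain ⟨tape', h4⟩ := ih tape1 G1 h1 h2 hpos
      exact ⟨tape', h3.trans h4⟩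
    | zero r st =>
      obtain ⟨tape1, h1, h3⟩ := flow_zero (entry := entry) hc htop henc hG (out := st.out) hpos
      obtain ⟨tape', h4⟩ := ih tape1 G h1 hGB hpos
      exact ⟨tape', h3.trans h4⟩
    | emit t st =>
      obtain ⟨tape', h4⟩ := ih tape G henc hGB hpos
      refine ⟨tape', .det rfl (by simp [flowFlip, hc]) (by simp; omega) hpos ?_⟩
      rw [flow_step (a := ⟨some (nx, none), tape 0, none, false, some t⟩) rfl (by rw [tmStep, hc])]
      simpa [RState.put] using h4
    | emitBin r st =>
      obtain ⟨tape1, h1, h3⟩ := flow_emitBin (entry := entry) hc htop henc hG (out := st.out) hpos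
      obtain ⟨tape', h4⟩ := ih tape1 G h1 hGB hpos
      exact ⟨tape', h3.trans h4⟩
    | advance st hlt =>
      obtain ⟨tape', h4⟩ := ih tape G henc hGB hlt
      refine ⟨tape', .det rfl (by simp [flowFlip, hc]) (by simp; omega) hpos ?_⟩
      rw [flow_step (a := ⟨some (nx, none), tape 0, none, true, none⟩) rfl (by rw [tmStep, hc])]
      simpa using h4
  | @test n t y no m st st' b l l' hc ht _ ih =>
    intro tape G henc hGB hpos
    have hG : (p + 1) * G < S := by
      have := Nat.le_log_of_pow_le (by omega) hGB
      exact (Nat.mul_le_mul_left _ (by omega)).trans_lt hS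
    have htop := hcode n
    rw [hc] at htop
    cases ht with
    | le r s st hrs =>
      obtain ⟨tape1, h1, h3⟩ := flow_le (entry := entry) hc hrs ((le_max_right _ _).trans_lt htop)
        henc hG (out := st.out) hpos
      obtain ⟨tape', h4⟩ := ih tape1 G h1 hGB hpos
      exact ⟨tape', h3.trans h4⟩
    | coin st b =>
      obtain ⟨tape', h4⟩ := ih tape G henc hGB hpos
      refine ⟨tape', .coin rfl (by simp [flowFlip, hc]) (by simp; omega) hpos ?_⟩
      rw [flow_step (a := ⟨some (if b = true then y else no, none), tape 0, none, false, none⟩) rfl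
        (by rw [tmStep, hc])]
      simpa using h4
    | symT o st ho =>
      obtain ⟨tape', h4⟩ := ih tape G henc hGB hpos
      refine ⟨tape', .det rfl (by simp [flowFlip, hc]) (by simp; omega) hpos ?_⟩
      rw [flow_step (a := ⟨some (y, none), tape 0, none, false, none⟩) rfl
        (by rw [tmStep, hc]; simp [ho])]
      simpa using h4
    | symF o st ho =>
      obtain ⟨tape', h4⟩ := ih tape G henc hGB hpos
      refine ⟨tape', .det rfl (by simp [flowFlip, hc]) (by simp; omega) hpos ?_⟩
      rw [flow_step (a := ⟨some (no, none), tape 0, none, false, none⟩) rfl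
        (by rw [tmStep, hc]; simp [ho])]
      simpa using h4

/-- The initial state of a register program. -/
def RState.init : RState := ⟨fun _ => 0, 0, []⟩

/-- The machine of a program. -/
def RProg.machine (P : RProg) : OPTM := flowTM P.code P.entry (P.top + 1)

/-- The states of the machine of a program that use their coin flip. -/
def RProg.flip (P : RProg) : P.machine.Q → Bool := flowFlip P.code (P.top + 1)

lemma Exec.gRun {P : RProg} {w : List Ternary} {B S : ℕ} {l : List Bool} {st' : RState}
    (hB : 1 ≤ B) (hS : (P.top + 2) * (Nat.log 2 B + 1) < S)
    (h : Exec w B P .init l st') : ∃ c', GRun P.machine P.flip S w P.machine.init l c' ∧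
      P.machine.isHalt c'.state = true ∧ c'.output = st'.out := by
  have henc : TapeEnc (P.top + 1) RState.init.regs 1
      (update (fun _ => Ternary.hash) 0 .one) := by
    refine ⟨by simp, fun j h1 h2 => by omega, fun j hj => ?_, le_rfl, fun r hr j => ?_,
      fun r hr => by simp [RState.init]⟩
    · rw [update_of_ne]
      have : 0 < (P.top + 1 + 1) * j := Nat.mul_pos (by omega) (by omega)
      omega
    · rw [update_of_ne (by omega)]
      simp [RState.init]
  obtain ⟨tape', h1⟩ := h.fRun.gRun (entry := P.entry) (p := P.top + 1)
    (fun n => Nat.lt_succ_of_le (P.top_code n)) hS _ 1 henc (by simpa using hB) (by simp [RState.init])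
  refine ⟨⟨some (none, none), st'.pos, tape', 0, st'.out⟩,
    .det rfl rfl (by simp [OPTM.init]; omega) (by simp [OPTM.init]) ?_, rfl, rfl⟩
  have := flow_step (code := P.code) (entry := P.entry) (p := P.top + 1) (w := w) (q := none)
    (a := ⟨some (some P.entry, none), .one, none, false, none⟩) (pos := 0) (k := 0)
    (tape := fun _ => Ternary.hash) (out := []) (b := false) rfl rfl
  rw [show P.machine.init = ⟨none, 0, fun _ => Ternary.hash, 0, []⟩ from rfl]
  unfold RProg.machine
  rw [this]
  exact h1

/-! ### Time from space -/

instance : Fintype Ternary := ⟨{.zero, .one, .hash}, fun x => by cases x <;> simp⟩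

/-- Guided runs with their number of steps. -/
inductive GRunT (M : OPTM) (flip : M.Q → Bool) (S : ℕ) (w : List Ternary) :
    ℕ → OPTMCfg M.Q → List Bool → OPTMCfg M.Q → Prop
  | refl (c : OPTMCfg M.Q) (hS : c.workPos < S) (hi : c.inputPos ≤ w.length) :
      GRunT M flip S w 0 c [] c
  | det {t : ℕ} {c c' : OPTMCfg M.Q} {l : List Bool} (hh : M.isHalt c.state = false)
      (hf : flip c.state = false) (hS : c.workPos < S) (hi : c.inputPos ≤ w.length)
      (h : GRunT M flip S w t (M.step w c false) l c') : GRunT M flip S w (t + 1) c l c'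
  | coin {t : ℕ} {c c' : OPTMCfg M.Q} {b : Bool} {l : List Bool} (hh : M.isHalt c.state = false)
      (hf : flip c.state = true) (hS : c.workPos < S) (hi : c.inputPos ≤ w.length)
      (h : GRunT M flip S w t (M.step w c b) l c') : GRunT M flip S w (t + 1) c (b :: l) c'

section Time

variable {M : OPTM} {flip : M.Q → Bool} {S : ℕ} {w : List Ternary}

lemma GRun.timed {c c' : OPTMCfg M.Q} {l : List Bool} (h : GRun M flip S w c l c') :
    ∃ t, GRunT M flip S w t c l c' := by
  induction h with
  | refl c hS hi => exact ⟨0, .refl c hS hi⟩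
  | det hh hf hS hi _ ih => exact ⟨_, .det hh hf hS hi ih.choose_spec⟩
  | coin hh hf hS hi _ ih => exact ⟨_, .coin hh hf hS hi ih.choose_spec⟩

lemma GRunT.inv {t : ℕ} {c c' : OPTMCfg M.Q} {l : List Bool} (h : GRunT M flip S w t c l c') :
    c.workPos < S ∧ c.inputPos ≤ w.length := by
  cases h <;> exact ⟨by assumption, by assumption⟩

lemma GRunT.split {t : ℕ} {c c' : OPTMCfg M.Q} {l : List Bool} (h : GRunT M flip S w t c l c')
    {s : ℕ} (hs : s ≤ t) : ∃ c1 l1 l2, l = l1 ++ l2 ∧ GRunT M flip S w (t - s) c1 l2 c' := by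
  induction h generalizing s with
  | refl c hS hi => exact ⟨c, [], [], rfl, by rw [Nat.zero_sub]; exact .refl c hS hi⟩
  | @det t c c' l hh hf hS hi h ih =>
    rcases s with _ | s
    · exact ⟨c, [], l, rfl, .det hh hf hS hi h⟩
    · obtain ⟨c1, l1, l2, h1, h2⟩ := ih (s := s) (by omega)
      exact ⟨c1, l1, l2, h1, by rwa [Nat.add_sub_add_right]⟩
  | @coin t c c' b l hh hf hS hi h ih =>
    rcases s with _ | s
    · exact ⟨c, [], b :: l, rfl, .coin hh hf hS hi h⟩
    · obtain ⟨c1, l1, l2, h1, h2⟩ := ih (s := s) (by omega)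
      exact ⟨c1, b :: l1, l2, by rw [h1]; rfl, by rwa [Nat.add_sub_add_right]⟩

/-- Equality of configurations as far as the first `S` work cells are concerned, and up to the
output. -/
def OPTMCfg.Same {Q : Type} (S : ℕ) (c d : OPTMCfg Q) : Prop :=
  c.state = d.state ∧ c.inputPos = d.inputPos ∧ c.workPos = d.workPos ∧ ∀ i < S, c.work i = d.work i

lemma OPTMCfg.Same.step {c d : OPTMCfg M.Q} (h : c.Same S d) (hc : c.workPos < S) (b : Bool) :
    (M.step w c b).Same S (M.step w d b) := by
  obtain ⟨h1, h2, h3, h4⟩ := h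
  have hw : c.work c.workPos = d.work d.workPos := by rw [← h3]; exact h4 _ hc
  unfold OPTM.step
  rw [h1, h2, hw]
  split_ifs with hh
  · exact ⟨h1, h2, h3, h4⟩
  · refine ⟨rfl, rfl, by simp only [h3], fun i hi => ?_⟩
    simp only [update_apply, h3, h4 i hi]

lemma GRunT.time_unique {t u : ℕ} {c c' d d' : OPTMCfg M.Q} {l : List Bool}
    (h : GRunT M flip S w t c l c') (h' : GRunT M flip S w u d l d') (hs : c.Same S d)
    (hc : M.isHalt c'.state = true) (hd : M.isHalt d'.state = true) : t = u := by
  induction h generalizing d u with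
  | refl c hS hi =>
    cases h' with
    | refl => rfl
    | det hh hf hS hi h => rw [← hs.1, hc] at hh; cases hh
  | det hh hf hS hi h ih =>
    cases h' with
    | refl => rw [hs.1, hd] at hh; cases hh
    | det hh' hf' hS' hi' h' => rw [ih h' (hs.step hS false) hc]
    | coin hh' hf' hS' hi' h' => rw [hs.1, hf'] at hf; cases hf
  | coin hh hf hS hi h ih =>
    cases h' with
    | det hh' hf' hS' hi' h' => rw [hs.1, hf'] at hf; cases hf
    | coin hh' hf' hS' hi' h' => rw [ih h' (hs.step hS _) hc]

/-- A run that ends in a halting configuration never repeats a configuration with the same number of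
remaining coin flips, which bounds its length. -/
lemma GRunT.time_le {t : ℕ} {c c' : OPTMCfg M.Q} {l : List Bool} (h : GRunT M flip S w t c l c')
    (hc : M.isHalt c'.state = true) :
    t ≤ Nat.card M.Q * ((w.length + 1) * (S * (3 ^ S * (l.length + 1)))) := by
  have := M.finite
  have := Fintype.ofFinite M.Q
  have hsplit : ∀ s : Fin (t + 1), ∃ (c1 : OPTMCfg M.Q) (l1 l2 : List Bool), l = l1 ++ l2 ∧
      GRunT M flip S w (t - s) c1 l2 c' := fun s => h.split (by omega)
  choose c1 l1 l2 hl hr using hsplit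
  have hlen : ∀ s, (l2 s).length < l.length + 1 := fun s => by
    have := congrArg List.length (hl s)
    rw [List.length_append] at this
    omega
  let key : Fin (t + 1) → M.Q × Fin (w.length + 1) × Fin S × (Fin S → Ternary) × Fin (l.length + 1) :=
    fun s => ((c1 s).state, ⟨(c1 s).inputPos, Nat.lt_succ_of_le (hr s).inv.2⟩,
      ⟨(c1 s).workPos, (hr s).inv.1⟩, fun i => (c1 s).work i, ⟨(l2 s).length, hlen s⟩)
  have hinj : Function.Injective key := by
    intro a b hab
    simp only [key, Prod.mk.injEq, Fin.mk.injEq] at hab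
    obtain ⟨e1, e2, e3, e4, e5⟩ := hab
    have hll : l2 a = l2 b := by
      have := (hl a).symm.trans (hl b)
      exact (List.append_inj' this e5).2
    have hb := hr b
    rw [← hll] at hb
    have := (hr a).time_unique hb ⟨e1, e2, e3, fun i hi => congrFun e4 ⟨i, hi⟩⟩ hc hc
    apply Fin.ext
    omega
  have hcard := Fintype.card_le_of_injective key hinj
  simp only [Fintype.card_prod, Fintype.card_fin, Fintype.card_fun, show Fintype.card Ternary = 3 from rfl] at hcard
  rw [Nat.card_eq_fintype_card]
  omega

/-! ### Probabilities of guided runs -/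

/-- The configuration reached from `c` with the coin flips `coins`. -/
def OPTM.runFrom (M : OPTM) (w : List Ternary) (c : OPTMCfg M.Q) (coins : List Bool) :
    OPTMCfg M.Q :=
  coins.foldl (M.step w) c

lemma OPTM.runFrom_halt {c : OPTMCfg M.Q} (h : M.isHalt c.state = true) (coins : List Bool) :
    M.runFrom w c coins = c := by
  induction coins with
  | nil => rfl
  | cons b coins ih =>
    have : M.step w c b = c := by simp [OPTM.step, h]
    rw [runFrom, List.foldl_cons, this]
    exact ih

/-- All guided runs from `c` with `K` coin flips end within `T` steps in halting configurations,
with output `f l` for the coin flips `l`. -/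
def Guided (M : OPTM) (flip : M.Q → Bool) (S : ℕ) (w : List Ternary) (T K : ℕ) (c : OPTMCfg M.Q)
    (f : List Bool → List Ternary) : Prop :=
  ∀ l : List Bool, l.length = K → ∃ t c', t ≤ T ∧ GRunT M flip S w t c l c' ∧
    M.isHalt c'.state = true ∧ c'.output = f l

/-- A guided computation halts at once, or ignores the next coin flip, or uses it. -/
lemma Guided.cases {T K : ℕ} {c : OPTMCfg M.Q} {f : List Bool → List Ternary}
    (hM : ∀ q, flip q = false → ∀ i x b, M.δ q i x b = M.δ q i x false)
    (h : Guided M flip S w T K c f) :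
    (M.isHalt c.state = true ∧ K = 0 ∧ c.output = f []) ∨
    (∃ T', T = T' + 1 ∧ ∀ b, Guided M flip S w T' K (M.step w c b) f) ∨
    (∃ T' K', T = T' + 1 ∧ K = K' + 1 ∧ ∀ b, Guided M flip S w T' K' (M.step w c b) fun l => f (b :: l)) := by
  obtain ⟨t, c', ht, hr, hc', hout⟩ := h (List.replicate K false) (by simp)
  by_cases hh : M.isHalt c.state = true
  · left
    refine ⟨hh, ?_⟩
    generalize hl : List.replicate K false = l at hr hout
    cases hr with
    | refl =>
      have : K = 0 := by simpa using congrArg List.length hl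
      exact ⟨this, hout⟩
    | det hh' => rw [hh] at hh'; cases hh'
    | coin hh' => rw [hh] at hh'; cases hh'
  · right
    obtain ⟨l, hl⟩ : ∃ l, List.replicate K false = l := ⟨_, rfl⟩
    rw [hl] at hr
    have hT : ∃ T', T = T' + 1 := by
      cases hr with
      | refl => exact absurd hc' hh
      | det => exact ⟨T - 1, by omega⟩
      | coin => exact ⟨T - 1, by omega⟩
    obtain ⟨T, rfl⟩ := hT
    by_cases hf : flip c.state = true
    · right
      have hK : ∃ K', K = K' + 1 := by
        cases hr with
        | refl => exact absurd hc' hh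
        | det _ hf' => rw [hf] at hf'; cases hf'
        | coin => exact ⟨K - 1, by have := congrArg List.length hl; simp at this; omega⟩
      obtain ⟨K, rfl⟩ := hK
      refine ⟨T, K, rfl, rfl, fun b l hl => ?_⟩
      obtain ⟨t, c', ht, hr, hc', hout⟩ := h (b :: l) (by simp [hl])
      cases hr with
      | det _ hf' => rw [hf] at hf'; cases hf'
      | coin _ _ _ _ hr => exact ⟨_, c', Nat.le_of_succ_le_succ ht, hr, hc', hout⟩
    · left
      refine ⟨T, rfl, fun b l hl => ?_⟩
      obtain ⟨t, c', ht, hr, hc', hout⟩ := h l hl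
      cases hr with
      | refl => exact absurd hc' hh
      | det _ hf' _ _ hr =>
        refine ⟨_, c', Nat.le_of_succ_le_succ ht, ?_, hc', hout⟩
        have : M.step w c b = M.step w c false := by
          unfold OPTM.step
          rw [hM _ hf' _ _ b]
        rwa [this]
      | coin _ hf' => exact absurd hf' hf

lemma Guided.output {T K : ℕ} {c : OPTMCfg M.Q} {f : List Bool → List Ternary}
    (hM : ∀ q, flip q = false → ∀ i x b, M.δ q i x b = M.δ q i x false)
    (h : Guided M flip S w T K c f) (coins : List Bool) (hT : coins.length = T) :
    M.isHalt (M.runFrom w c coins).state = true ∧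
      ∃ l : List Bool, l.length = K ∧ (M.runFrom w c coins).output = f l := by
  induction coins generalizing T K c f with
  | nil =>
    rcases h.cases hM with ⟨h1, h2, h3⟩ | ⟨T', h1, _⟩ | ⟨T', _, h1, _⟩
    · exact ⟨h1, [], h2.symm, h3⟩
    · simp at hT; omega
    · simp at hT; omega
  | cons b coins ih =>
    rcases h.cases hM with ⟨h1, h2, h3⟩ | ⟨T', h1, h2⟩ | ⟨T', K', h1, h2, h3⟩
    · rw [OPTM.runFrom_halt h1]
      exact ⟨h1, [], h2.symm, h3⟩
    · exact ih (h2 b) (by simpa [h1] using hT)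
    · obtain ⟨h4, l, h5, h6⟩ := ih (h3 b) (by simpa [h1] using hT)
      exact ⟨h4, b :: l, by simp [h5, h2], h6⟩

lemma Guided.space {T K : ℕ} {c : OPTMCfg M.Q} {f : List Bool → List Ternary}
    (hM : ∀ q, flip q = false → ∀ i x b, M.δ q i x b = M.δ q i x false)
    (h : Guided M flip S w T K c f) (coins : List Bool) : (M.runFrom w c coins).workPos < S := by
  have hc : c.workPos < S := by
    obtain ⟨t, c', _, hr, _⟩ := h (List.replicate K false) (by simp)
    exact hr.inv.1
  induction coins generalizing T K c f with
  | nil => exact hc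
  | cons b coins ih =>
    have hstep : ∀ {T K f}, Guided M flip S w T K (M.step w c b) f → (M.step w c b).workPos < S := by
      intro T K f h
      obtain ⟨t, c', _, hr, _⟩ := h (List.replicate K false) (by simp)
      exact hr.inv.1
    rcases h.cases hM with ⟨h1, h2, h3⟩ | ⟨T', h1, h2⟩ | ⟨T', K', h1, h2, h3⟩
    · rw [OPTM.runFrom_halt h1]; exact hc
    · exact ih (h2 b) (hstep (h2 b))
    · exact ih (h3 b) (hstep (h3 b))

open scoped Classical in
/-- The number of lists of `T` coin flips with property `A`. -/
noncomputable def coinCount (T : ℕ) (A : List Bool → Prop) : ℕ :=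
  (Finset.univ.filter fun r : Fin T → Bool => A (List.ofFn r)).card

lemma coinCount_zero (A : List Bool → Prop) [Decidable (A [])] :
    coinCount 0 A = if A [] then 1 else 0 := by
  classical
  unfold coinCount
  by_cases h : A []
  · simp [h]
  · simp [h]

lemma coinCount_succ (T : ℕ) (A : List Bool → Prop) :
    coinCount (T + 1) A = coinCount T (fun l => A (true :: l)) + coinCount T (fun l => A (false :: l)) := by
  classical
  unfold coinCount
  simp only [Finset.card_filter]
  rw [← (Fin.consEquiv fun _ : Fin (T + 1) => Bool).sum_comp, Fintype.sum_prod_type]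
  have h : ∀ (b : Bool) (y : Fin T → Bool),
      List.ofFn ((Fin.consEquiv fun _ : Fin (T + 1) => Bool) (b, y)) = b :: List.ofFn y :=
    fun b y => List.ofFn_cons b y
  simp only [Fintype.sum_bool, h]

lemma coinCount_const (T : ℕ) (A : Prop) [Decidable A] :
    coinCount T (fun _ => A) = if A then 2 ^ T else 0 := by
  induction T with
  | zero => rw [coinCount_zero]; simp
  | succ T ih => rw [coinCount_succ, ih]; split_ifs <;> ring

lemma Guided.count {T K : ℕ} {c : OPTMCfg M.Q} {f : List Bool → List Ternary}
    (hM : ∀ q, flip q = false → ∀ i x b, M.δ q i x b = M.δ q i x false)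
    (h : Guided M flip S w T K c f) (A : List Ternary → Prop) :
    coinCount T (fun l => A (M.runFrom w c l).output) * 2 ^ K = coinCount K (fun l => A (f l)) * 2 ^ T := by
  classical
  induction T generalizing K c f with
  | zero =>
    rcases h.cases hM with ⟨h1, rfl, h3⟩ | ⟨T', h1, _⟩ | ⟨T', _, h1, _⟩
    · rw [coinCount_zero, coinCount_zero]
      simp [OPTM.runFrom, h3]
    · omega
    · omega
  | succ T ih =>
    rcases h.cases hM with ⟨h1, rfl, h3⟩ | ⟨T', h1, h2⟩ | ⟨T', K', h1, rfl, h3⟩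
    · simp only [OPTM.runFrom_halt h1, coinCount_const, coinCount_zero, h3]
      split_ifs <;> simp
    · obtain rfl : T = T' := by omega
      rw [coinCount_succ, add_mul, pow_succ 2 T, ← mul_assoc]
      have e1 := ih (h2 true)
      have e2 := ih (h2 false)
      simp only [OPTM.runFrom, List.foldl_cons] at e1 e2 ⊢
      rw [e1, e2]; ring
    · obtain rfl : T = T' := by omega
      rw [coinCount_succ, coinCount_succ, add_mul, add_mul, pow_succ 2 T, pow_succ 2 K']
      have e1 := ih (h3 true)
      have e2 := ih (h3 false)
      simp only [OPTM.runFrom, List.foldl_cons] at e1 e2 ⊢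
      rw [← mul_assoc, ← mul_assoc, e1, e2]; ring

end Time

/-- A program whose runs, for all lists `l` of `K` coin flips, end with output `f l` without
exceeding `B` in a register, is simulated by a machine. -/
lemma RProg.machine_spec (P : RProg) {w : List Ternary} {B S K T : ℕ}
    {f : List Bool → List Ternary} (hB : 1 ≤ B)
    (h : ∀ l : List Bool, l.length = K → ∃ st', Exec w B P .init l st' ∧ st'.out = f l)
    (hS : (P.top + 2) * (Nat.log 2 B + 1) < S)
    (hT : Nat.card P.machine.Q * ((w.length + 1) * (S * (3 ^ S * (K + 1)))) ≤ T) :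
    P.machine.HaltsWithin w T ∧ P.machine.UsesSpaceAtMost w S ∧
    (∀ r, ∃ l : List Bool, l.length = K ∧ P.machine.outputAfter w T r = f l) ∧
    ∀ A, P.machine.outputProb w T A = (coinCount K fun l => A (f l) : ℝ) / 2 ^ K := by
  have hM : ∀ q, P.flip q = false → ∀ i x b, P.machine.δ q i x b = P.machine.δ q i x false :=
    fun q hq i x b => tmStep_eq_of_flip _ _ _ q hq i x b
  have hG : Guided P.machine P.flip S w T K P.machine.init f := by
    intro l hl
    obtain ⟨st', h1, h2⟩ := h l hl
    obtain ⟨c', h3, h4, h5⟩ := h1.gRun hB hS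
    obtain ⟨t, h6⟩ := h3.timed
    have := h6.time_le h4
    rw [hl] at this
    exact ⟨t, c', this.trans hT, h6, h4, h5.trans h2⟩
  refine ⟨fun coins hc => (hG.output hM coins hc).1, fun coins => hG.space hM coins,
    fun r => (hG.output hM (List.ofFn r) (by simp)).2, fun A => ?_⟩
  have hcount := hG.count hM A
  have h1 : P.machine.outputProb w T A =
      (coinCount T fun l => A (P.machine.runFrom w P.machine.init l).output : ℝ) / 2 ^ T := rfl
  rw [h1, div_eq_div_iff (by positivity) (by positivity)]
  exact_mod_cast hcount

/-! ### Functions computed by register programs -/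

/-- A type whose elements are described by finitely many natural numbers, the variables. -/
class RCtx (Γ : Type) where
  /-- The number of variables. -/
  num : ℕ
  /-- The value of a variable. -/
  get : ℕ → Γ → ℕ

instance : RCtx ℕ := ⟨1, fun _ x => x⟩

instance {Γ : Type} [RCtx Γ] : RCtx (Γ × ℕ) :=
  ⟨RCtx.num Γ + 1, fun i p => if i < RCtx.num Γ then RCtx.get i p.1 else p.2⟩

lemma RState.set_regs (st : RState) (r v q : ℕ) :
    (st.set r v).regs q = if q = r then v else st.regs q := by
  simp [RState.set, update_apply]

lemma RState.set_add (st : RState) (r v k : ℕ) :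
    (st.set r v).set r ((st.set r v).regs r + k) = st.set r (v + k) := by
  simp [RState.set]

lemma RState.ext_regs {st st' : RState} (h : ∀ r, st.regs r = st'.regs r) (hp : st.pos = st'.pos)
    (ho : st.out = st'.out) : st = st' := RState.ext (funext h) hp ho

open RState (set_regs ext_regs)

lemma RState.set_eq_self {st : RState} {r v : ℕ} (h : st.regs r = v) : st.set r v = st := by
  rw [← h]; exact congrArg (RState.mk · _ _) (update_eq_self _ _)

lemma Exec.seq' {w : List Ternary} {B : ℕ} {P Q : RProg} {st st' st'' : RState}
    (h : Exec w B P st [] st') (h' : Exec w B Q st' [] st'') : Exec w B (.seq P Q) st [] st'' :=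
  Exec.seq h h'

lemma Exec.inc {w : List Ternary} {B r v : ℕ} {st : RState} (hv : st.regs r = v) (h : v + 1 ≤ B) :
    Exec w B (.act (.inc r)) st [] (st.set r (v + 1)) := by
  subst hv
  exact .act (.inc r st h)

lemma Exec.zero {w : List Ternary} {B r : ℕ} {st : RState} :
    Exec w B (.act (.zero r)) st [] (st.set r 0) := .act (.zero r st)

lemma Exec.skip {w : List Ternary} {B r : ℕ} {st : RState} (h : st.regs r = 0) :
    Exec w B (.act (.zero r)) st [] st := by
  have h5 := Exec.zero (w := w) (B := B) (r := r) (st := st)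
  rwa [RState.set_eq_self h] at h5

/-- A loop in which register `c` counts up to the value of register `a < c`. -/
lemma Exec.loop {w : List Ternary} {B a c N : ℕ} {P : RProg} (hac : a < c) (s : ℕ → RState)
    (ha : ∀ j ≤ N, (s j).regs a = N) (hc : ∀ j ≤ N, (s j).regs c = j)
    (hP : ∀ j < N, Exec w B P (s j) [] (s (j + 1))) :
    Exec w B (.untl (.le a c) P) (s 0) [] (s N) := by
  have key : ∀ m ≤ N, Exec w B (.untl (.le a c) P) (s (N - m)) [] (s N) := by
    intro m hm
    induction m with
    | zero =>
      have h := RTest.Val.le (w := w) a c (s N) hac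
      rw [ha N le_rfl, hc N le_rfl, decide_eq_true le_rfl] at h
      exact .untlT h
    | succ m ih =>
      have h := RTest.Val.le (w := w) a c (s (N - (m + 1))) hac
      rw [ha _ (by omega), hc _ (by omega), decide_eq_false (by omega)] at h
      have h1 := hP (N - (m + 1)) (by omega)
      rw [show N - (m + 1) + 1 = N - m by omega] at h1
      exact Exec.untlF h h1 (ih (by omega))
  simpa using key N le_rfl

/-- `f` is computed by register programs in which all values are bounded by the `e`-th power of a
bound on the variables: for all registers `ρ i` that hold the variables, the program adds `f` to
the register `tgt` and uses the registers from `d` on, which are zero, as scratch space. -/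
def RCompE {Γ : Type} [RCtx Γ] (e : ℕ) (f : Γ → ℕ) : Prop :=
  (∀ γ b, 2 ≤ b → (∀ i < RCtx.num Γ, RCtx.get i γ ≤ b) → f γ ≤ b ^ e) ∧
  ∀ (ρ : ℕ → ℕ) (d tgt : ℕ), tgt < d → (∀ i < RCtx.num Γ, ρ i < d ∧ ρ i ≠ tgt) →
    ∃ P : RProg, ∀ (w : List Ternary) (st : RState) (γ : Γ) (b B : ℕ), 2 ≤ b →
      (∀ i < RCtx.num Γ, st.regs (ρ i) = RCtx.get i γ) → (∀ i < RCtx.num Γ, RCtx.get i γ ≤ b) →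
      b ^ e ≤ B → (∀ r, d ≤ r → st.regs r = 0) → st.regs tgt + f γ ≤ B →
      Exec w B P st [] (st.set tgt (st.regs tgt + f γ))

/-- `f` is computed by register programs with polynomially bounded values. -/
def RComp {Γ : Type} [RCtx Γ] (f : Γ → ℕ) : Prop := ∃ e, RCompE e f

section Closure

variable {Γ : Type} [RCtx Γ]

lemma RCompE.mono {e e' : ℕ} {f : Γ → ℕ} (h : RCompE e f) (he : e ≤ e') : RCompE e' f := by
  have hp : ∀ b : ℕ, 2 ≤ b → b ^ e ≤ b ^ e' := fun b hb => Nat.pow_le_pow_right (by omega) he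
  refine ⟨fun γ b hb hγ => (h.1 γ b hb hγ).trans (hp b hb), fun ρ d tgt ht hρ => ?_⟩
  obtain ⟨P, hP⟩ := h.2 ρ d tgt ht hρ
  exact ⟨P, fun w st γ b B hb h1 h2 h3 h4 h5 => hP w st γ b B hb h1 h2 ((hp b hb).trans h3) h4 h5⟩

lemma RCompE.get {i : ℕ} (hi : i < RCtx.num Γ) : RCompE 1 fun γ : Γ => RCtx.get i γ := by
  refine ⟨fun γ b hb hγ => by simpa using hγ i hi, fun ρ d tgt ht hρ => ?_⟩
  refine ⟨.seq (.untl (.le (ρ i) d) (.seq (.act (.inc tgt)) (.act (.inc d)))) (.act (.zero d)),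
    fun w st γ b B hb h1 h2 h3 h4 h5 => ?_⟩
  dsimp only at h5
  obtain ⟨hd, hne⟩ := hρ i hi
  have hv := h1 i hi
  set N := RCtx.get i γ
  have hNB : N ≤ B := (h2 i hi).trans (by simpa using h3)
  let s : ℕ → RState := fun j => (st.set tgt (st.regs tgt + j)).set d j
  have hloop : Exec w B (.untl (.le (ρ i) d) (.seq (.act (.inc tgt)) (.act (.inc d)))) (s 0) [] (s N) := by
    refine Exec.loop hd s ?_ ?_ ?_
    · intro j _
      simp only [s, set_regs, hd.ne, hne, if_false, hv]
    · intro j _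
      simp only [s, set_regs, if_true]
    · intro j hj
      have e1 : (s j).regs tgt = st.regs tgt + j := by
        simp only [s, set_regs, ht.ne, if_false, if_true]
      have e2 : ((s j).set tgt (st.regs tgt + j + 1)).regs d = j := by
        simp only [s, set_regs, ht.ne', if_false, if_true]
      have e3 : ((s j).set tgt (st.regs tgt + j + 1)).set d (j + 1) = s (j + 1) := by
        refine ext_regs (fun q => ?_) rfl rfl
        simp only [s, set_regs]
        split_ifs <;> rfl
      exact (Exec.inc e1 (by omega)).seq' (e3 ▸ Exec.inc e2 (by omega))
  have e0 : s 0 = st := by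
    refine ext_regs (fun q => ?_) rfl rfl
    simp only [s, set_regs]
    split_ifs with h6 h7
    · rw [h6, h4 d le_rfl]
    · rw [h7, Nat.add_zero]
    · rfl
  have e1 : (s N).set d 0 = st.set tgt (st.regs tgt + N) := by
    refine ext_regs (fun q => ?_) rfl rfl
    simp only [s, set_regs]
    split_ifs with h6 h7
    · omega
    · rw [h6, h4 d le_rfl]
    · rfl
    · rfl
  rw [e0] at hloop
  have := hloop.seq' (Exec.zero (r := d))
  rwa [e1] at this

lemma RComp.get {i : ℕ} (hi : i < RCtx.num Γ) : RComp fun γ : Γ => RCtx.get i γ := ⟨1, RCompE.get hi⟩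

lemma RComp.const (c : ℕ) : RComp fun _ : Γ => c := by
  induction c with
  | zero =>
    refine ⟨0, fun γ b hb hγ => by simp, fun ρ d tgt ht hρ => ⟨.act (.zero d),
      fun w st γ b B hb h1 h2 h3 h4 h5 => ?_⟩⟩
    rw [Nat.add_zero, RState.set_eq_self (r := tgt) rfl]
    exact Exec.skip (h4 d le_rfl)
  | succ c ih =>
    obtain ⟨e, h1, h2⟩ := ih
    refine ⟨e + 1, fun γ b hb hγ => ?_, fun ρ d tgt ht hρ => ?_⟩
    · have : c ≤ b ^ e := h1 γ b hb hγ
      have h3 : 1 ≤ b ^ e := Nat.one_le_pow _ _ (by omega)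
      calc c + 1 ≤ b ^ e + b ^ e := by omega
        _ ≤ b ^ e * b := by rw [← two_mul, mul_comm]; exact Nat.mul_le_mul_left _ hb
        _ = b ^ (e + 1) := (pow_succ _ _).symm
    · obtain ⟨P, hP⟩ := h2 ρ d tgt ht hρ
      refine ⟨.seq P (.act (.inc tgt)), fun w st γ b B hb h1 h2 h3 h4 h5 => ?_⟩
      dsimp only at h5
      have h6 : b ^ e ≤ B := (Nat.pow_le_pow_right (by omega) (by omega)).trans h3
      have h7 := hP w st γ b B hb h1 h2 h6 h4 (by dsimp only; omega)
      have h8 := Exec.inc (w := w) (B := B) (r := tgt) (st := st.set tgt (st.regs tgt + c)) rfl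
        (by simp [set_regs]; omega)
      rw [RState.set_add] at h8
      exact h7.seq' h8

lemma RComp.add {f g : Γ → ℕ} (hf : RComp f) (hg : RComp g) : RComp fun γ => f γ + g γ := by
  obtain ⟨e, hf1, hf2⟩ := hf
  obtain ⟨e', hg1, hg2⟩ := hg
  have hp : ∀ b : ℕ, 2 ≤ b → b ^ e ≤ b ^ (e + e' + 1) ∧ b ^ e' ≤ b ^ (e + e' + 1) ∧
      b ^ e + b ^ e' ≤ b ^ (e + e' + 1) := by
    intro b hb
    refine ⟨Nat.pow_le_pow_right (by omega) (by omega), Nat.pow_le_pow_right (by omega) (by omega), ?_⟩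
    have h1 : b ^ e ≤ b ^ (e + e') := Nat.pow_le_pow_right (by omega) (by omega)
    have h2 : b ^ e' ≤ b ^ (e + e') := Nat.pow_le_pow_right (by omega) (by omega)
    calc b ^ e + b ^ e' ≤ b ^ (e + e') * 2 := by omega
      _ ≤ b ^ (e + e') * b := Nat.mul_le_mul_left _ hb
      _ = b ^ (e + e' + 1) := (pow_succ _ _).symm
  refine ⟨e + e' + 1, fun γ b hb hγ => (Nat.add_le_add (hf1 γ b hb hγ) (hg1 γ b hb hγ)).trans
    (hp b hb).2.2, fun ρ d tgt ht hρ => ?_⟩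
  obtain ⟨P, hP⟩ := hf2 ρ d tgt ht hρ
  obtain ⟨Q, hQ⟩ := hg2 ρ d tgt ht hρ
  refine ⟨.seq P Q, fun w st γ b B hb h1 h2 h3 h4 h5 => ?_⟩
  dsimp only at h5
  have h6 := hP w st γ b B hb h1 h2 ((hp b hb).1.trans h3) h4 (by omega)
  have h7 := hQ w (st.set tgt (st.regs tgt + f γ)) γ b B hb
    (fun i hi => by rw [set_regs, if_neg (hρ i hi).2, h1 i hi]) h2 ((hp b hb).2.1.trans h3)
    (fun r hr => by rw [set_regs, if_neg (by omega), h4 r hr])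
    (by simp [set_regs]; omega)
  rw [RState.set_add, Nat.add_assoc] at h7
  exact h6.seq' h7

/-- The state with the values `f 0, …, f (m - 1)` in the registers `d, …, d + m - 1`. -/
def RState.store (st : RState) (d m : ℕ) (f : ℕ → ℕ) : RState :=
  { st with regs := fun r => if d ≤ r ∧ r < d + m then f (r - d) else st.regs r }

lemma RState.store_regs (st : RState) (d m : ℕ) (f : ℕ → ℕ) (r : ℕ) :
    (st.store d m f).regs r = if d ≤ r ∧ r < d + m then f (r - d) else st.regs r := rfl

open RState (store_regs)

lemma RState.store_zero (st : RState) (d : ℕ) (f : ℕ → ℕ) : st.store d 0 f = st := by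
  refine ext_regs (fun q => ?_) rfl rfl
  rw [store_regs, if_neg (by omega)]

lemma RState.store_succ (st : RState) (d m : ℕ) (f : ℕ → ℕ) :
    st.store d (m + 1) f = (st.store d m f).set (d + m) (f m) := by
  refine ext_regs (fun q => ?_) rfl rfl
  rw [set_regs, store_regs, store_regs]
  by_cases hq : q = d + m
  · subst hq; simp
  · rw [if_neg hq]
    by_cases hq2 : d ≤ q ∧ q < d + m
    · rw [if_pos hq2, if_pos (by omega)]
    · rw [if_neg hq2, if_neg (by omega)]

/-- The variables of a computed context can be stored in consecutive registers. -/
lemma RCompE.exists_store {Δ : Type} [RCtx Δ] {φ : Γ → Δ} {E : ℕ}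
    (hφ : ∀ i < RCtx.num Δ, RCompE E fun γ => RCtx.get i (φ γ)) (ρ : ℕ → ℕ) (d : ℕ)
    (hρ : ∀ i < RCtx.num Γ, ρ i < d) : ∀ m ≤ RCtx.num Δ, ∃ P : RProg,
      ∀ (w : List Ternary) (st : RState) (γ : Γ) (b B : ℕ),
      2 ≤ b → (∀ i < RCtx.num Γ, st.regs (ρ i) = RCtx.get i γ) →
      (∀ i < RCtx.num Γ, RCtx.get i γ ≤ b) → b ^ E ≤ B → (∀ r, d ≤ r → st.regs r = 0) →
      Exec w B P st [] (st.store d m fun i => RCtx.get i (φ γ)) := by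
  intro m hm
  induction m with
  | zero =>
    refine ⟨.act (.zero d), fun w st γ b B hb h1 h2 h3 h4 => ?_⟩
    rw [RState.store_zero]
    exact Exec.skip (h4 d le_rfl)
  | succ m ih =>
    obtain ⟨P, hP⟩ := ih (by omega)
    obtain ⟨Q, hQ⟩ := (hφ m (by omega)).2 ρ (d + m + 1) (d + m) (by omega)
      (fun i hi => ⟨by have := hρ i hi; omega, by have := hρ i hi; omega⟩)
    refine ⟨.seq P Q, fun w st γ b B hb h1 h2 h3 h4 => ?_⟩
    have h5 := hP w st γ b B hb h1 h2 h3 h4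
    rw [RState.store_succ]
    set s := st.store d m fun i => RCtx.get i (φ γ) with hs
    have h0 : s.regs (d + m) = 0 := by
      rw [hs, store_regs, if_neg (by omega), h4 _ (by omega)]
    have h6 := hQ w s γ b B hb
      (fun i hi => by
        rw [hs, store_regs, if_neg (by have := hρ i hi; omega), h1 i hi]) h2 h3
      (fun r hr => by rw [hs, store_regs, if_neg (by omega), h4 _ (by omega)])
      (by rw [h0, Nat.zero_add]; exact ((hφ m (by omega)).1 γ b hb h2).trans h3)
    rw [h0, Nat.zero_add] at h6
    exact h5.seq' h6

lemma RState.exists_clear (d m : ℕ) : ∃ P : RProg, ∀ (w : List Ternary) (st : RState)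
    (f : ℕ → ℕ) (B : ℕ), (∀ r, d ≤ r → st.regs r = 0) → Exec w B P (st.store d m f) [] st := by
  induction m with
  | zero =>
    refine ⟨.act (.zero d), fun w st f B h4 => ?_⟩
    rw [RState.store_zero]
    exact Exec.skip (h4 d le_rfl)
  | succ m ih =>
    obtain ⟨P, hP⟩ := ih
    refine ⟨.seq (.act (.zero (d + m))) P, fun w st f B h4 => ?_⟩
    have h5 := Exec.zero (w := w) (B := B) (r := d + m) (st := st.store d (m + 1) f)
    have : (st.store d (m + 1) f).set (d + m) 0 = st.store d m f := by
      refine ext_regs (fun q => ?_) rfl rfl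
      rw [set_regs, store_regs, store_regs]
      by_cases hq : q = d + m
      · rw [if_pos hq, if_neg (by omega), h4 _ (by omega)]
      · rw [if_neg hq]
        by_cases hq2 : d ≤ q ∧ q < d + m
        · rw [if_pos hq2, if_pos (by omega)]
        · rw [if_neg hq2, if_neg (by omega)]
    rw [this] at h5
    exact h5.seq' (hP w st f B h4)

lemma RComp.exists_common {Δ : Type} [RCtx Δ] {φ : Γ → Δ}
    (hφ : ∀ i < RCtx.num Δ, RComp fun γ => RCtx.get i (φ γ)) :
    ∃ E, ∀ i < RCtx.num Δ, RCompE E fun γ => RCtx.get i (φ γ) := by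
  choose e he using hφ
  refine ⟨∑ i : Fin (RCtx.num Δ), e i i.2, fun i h => (he i h).mono ?_⟩
  exact Finset.single_le_sum (f := fun i : Fin (RCtx.num Δ) => e i i.2) (fun _ _ => Nat.zero_le _)
    (Finset.mem_univ (⟨i, h⟩ : Fin (RCtx.num Δ)))

/-- Composition: the variables of the inner context are computed into scratch registers. -/
lemma RComp.comp {Δ : Type} [RCtx Δ] {f : Δ → ℕ} (hf : RComp f) {φ : Γ → Δ}
    (hφ : ∀ i < RCtx.num Δ, RComp fun γ => RCtx.get i (φ γ)) : RComp fun γ => f (φ γ) := by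
  obtain ⟨ef, hf1, hf2⟩ := hf
  obtain ⟨E, hφ⟩ := RComp.exists_common hφ
  have hp : ∀ b : ℕ, 2 ≤ b → b ^ E ≤ b ^ (E + 1 + (E + 1) * ef) ∧
      (b ^ (E + 1)) ^ ef ≤ b ^ (E + 1 + (E + 1) * ef) ∧ b ^ E ≤ b ^ (E + 1) ∧ 2 ≤ b ^ (E + 1) := by
    intro b hb
    refine ⟨Nat.pow_le_pow_right (by omega) (by rw [add_assoc]; omega), ?_,
      Nat.pow_le_pow_right (by omega) (by omega), hb.trans (Nat.le_self_pow (by omega) b)⟩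
    rw [← pow_mul]
    exact Nat.pow_le_pow_right (by omega) (by omega)
  have hφb : ∀ γ b, 2 ≤ b → (∀ i < RCtx.num Γ, RCtx.get i γ ≤ b) →
      ∀ i < RCtx.num Δ, RCtx.get i (φ γ) ≤ b ^ (E + 1) := fun γ b hb hγ i hi =>
    ((hφ i hi).1 γ b hb hγ).trans (hp b hb).2.2.1
  refine ⟨E + 1 + (E + 1) * ef, fun γ b hb hγ => ?_, fun ρ d tgt ht hρ => ?_⟩
  · exact (hf1 (φ γ) _ (hp b hb).2.2.2 (hφb γ b hb hγ)).trans (hp b hb).2.1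
  obtain ⟨P, hP⟩ := RCompE.exists_store hφ ρ d (fun i hi => (hρ i hi).1) (RCtx.num Δ) le_rfl
  obtain ⟨R, hR⟩ := RState.exists_clear d (RCtx.num Δ)
  obtain ⟨Q, hQ⟩ := hf2 (fun i => d + i) (d + RCtx.num Δ) tgt (by omega)
    (fun i hi => ⟨by omega, by omega⟩)
  refine ⟨.seq P (.seq Q R), fun w st γ b B hb h1 h2 h3 h4 h5 => ?_⟩
  dsimp only at h5
  have h6 := hP w st γ b B hb h1 h2 ((hp b hb).1.trans h3) h4
  set s := st.store d (RCtx.num Δ) fun i => RCtx.get i (φ γ) with hs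
  have ht' : s.regs tgt = st.regs tgt := by
    rw [hs, store_regs, if_neg (by omega)]
  have h7 := hQ w s (φ γ) (b ^ (E + 1)) B (hp b hb).2.2.2
    (fun i hi => by rw [hs, store_regs, if_pos (by omega), Nat.add_sub_cancel_left])
    (hφb γ b hb h2)
    ((hp b hb).2.1.trans h3) (fun r hr => by
      rw [hs, store_regs, if_neg (by omega), h4 _ (by omega)])
    (by rw [ht']; exact h5)
  have e1 : s.set tgt (s.regs tgt + f (φ γ))
      = (st.set tgt (st.regs tgt + f (φ γ))).store d (RCtx.num Δ) fun i => RCtx.get i (φ γ) := by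
    rw [ht', hs]
    refine ext_regs (fun q => ?_) rfl rfl
    rw [set_regs, store_regs, store_regs, set_regs]
    by_cases hq : q = tgt
    · rw [if_pos hq, if_pos hq, if_neg (by omega)]
    · rw [if_neg hq, if_neg hq]
  rw [e1] at h7
  exact h6.seq' (h7.seq' (hR w _ _ B fun r hr => by rw [set_regs, if_neg (by omega), h4 r hr]))

lemma RComp.sum {n : Γ → ℕ} {h : Γ × ℕ → ℕ} (hn : RComp n) (hh : RComp h) :
    RComp fun γ => ∑ j ∈ range (n γ), h (γ, j) := by
  obtain ⟨en, hn1, hn2⟩ := hn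
  obtain ⟨eh, hh1, hh2⟩ := hh
  have hget : ∀ (γ : Γ) (j b : ℕ), (∀ i < RCtx.num Γ, RCtx.get i γ ≤ b) → j ≤ b →
      ∀ i < RCtx.num (Γ × ℕ), RCtx.get i ((γ, j) : Γ × ℕ) ≤ b := by
    intro γ j b hγ hj i _
    change (if i < RCtx.num Γ then RCtx.get i γ else j) ≤ b
    split_ifs with hi
    · exact hγ i hi
    · exact hj
  have hp : ∀ b : ℕ, 2 ≤ b → b ^ en ≤ b ^ (en + (en + 1) * eh) ∧
      (b ^ (en + 1)) ^ eh ≤ b ^ (en + (en + 1) * eh) ∧ b ^ en ≤ b ^ (en + 1) ∧ b ≤ b ^ (en + 1) ∧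
      2 ≤ b ^ (en + 1) := by
    intro b hb
    have h1 : b ≤ b ^ (en + 1) := Nat.le_self_pow (by omega) b
    refine ⟨Nat.pow_le_pow_right (by omega) (by omega), ?_,
      Nat.pow_le_pow_right (by omega) (by omega), h1, hb.trans h1⟩
    rw [← pow_mul]
    exact Nat.pow_le_pow_right (by omega) (by omega)
  have hhb : ∀ γ b j, 2 ≤ b → (∀ i < RCtx.num Γ, RCtx.get i γ ≤ b) → j < n γ →
      ∀ i < RCtx.num (Γ × ℕ), RCtx.get i ((γ, j) : Γ × ℕ) ≤ b ^ (en + 1) := by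
    intro γ b j hb hγ hj
    have := hn1 γ b hb hγ
    exact hget γ j _ (fun i hi => (hγ i hi).trans (hp b hb).2.2.2.1)
      (by have := (hp b hb).2.2.1; omega)
  refine ⟨en + (en + 1) * eh, fun γ b hb hγ => ?_, fun ρ d tgt ht hρ => ?_⟩
  · calc ∑ j ∈ range (n γ), h (γ, j) ≤ ∑ _j ∈ range (n γ), (b ^ (en + 1)) ^ eh := by
          refine Finset.sum_le_sum fun j hj => hh1 (γ, j) _ (hp b hb).2.2.2.2 ?_
          exact hhb γ b j hb hγ (mem_range.1 hj)
      _ = n γ * (b ^ (en + 1)) ^ eh := by simp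
      _ ≤ b ^ en * (b ^ (en + 1)) ^ eh := Nat.mul_le_mul_right _ (hn1 γ b hb hγ)
      _ = b ^ (en + (en + 1) * eh) := by rw [← pow_mul, ← pow_add]
  obtain ⟨P, hP⟩ := hn2 ρ (d + 1) d (by omega)
    (fun i hi => ⟨by have := (hρ i hi).1; omega, by have := (hρ i hi).1; omega⟩)
  obtain ⟨Q, hQ⟩ := hh2 (fun i => if i < RCtx.num Γ then ρ i else d + 1) (d + 2) tgt (by omega)
    (fun i _ => by
      split_ifs with h
      · have := hρ i h
        omega
      · omega)
  refine ⟨.seq P (.seq (.untl (.le d (d + 1)) (.seq Q (.act (.inc (d + 1)))))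
    (.seq (.act (.zero d)) (.act (.zero (d + 1))))), fun w st γ b B hb h1 h2 h3 h4 h5 => ?_⟩
  dsimp only at h5
  have hnb := hn1 γ b hb h2
  have hnB : n γ ≤ B := hnb.trans ((hp b hb).1.trans h3)
  let s : ℕ → RState := fun j =>
    ((st.set tgt (st.regs tgt + ∑ i ∈ range j, h (γ, i))).set (d + 1) j).set d (n γ)
  have h6 := hP w st γ b B hb h1 h2 ((hp b hb).1.trans h3) (fun r hr => h4 r (by omega))
    (by rw [h4 d le_rfl]; omega)
  have e0 : st.set d (st.regs d + n γ) = s 0 := by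
    refine ext_regs (fun q => ?_) rfl rfl
    simp only [s, set_regs, h4 d le_rfl, Finset.range_zero, Finset.sum_empty]
    split_ifs with ha hb hc
    · omega
    · rw [hb, h4 _ (by omega)]
    · rw [hc]; omega
    · rfl
  rw [e0] at h6
  have hloop : Exec w B (.untl (.le d (d + 1)) (.seq Q (.act (.inc (d + 1))))) (s 0) [] (s (n γ)) := by
    refine Exec.loop (by omega) s ?_ ?_ ?_
    · intro j _
      simp only [s, set_regs, if_true]
    · intro j _
      simp only [s, set_regs, if_true]
      rw [if_neg (by omega)]
    · intro j hj
      have et : (s j).regs tgt = st.regs tgt + ∑ i ∈ range j, h (γ, i) := by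
        simp only [s, set_regs, if_true]
        rw [if_neg (by omega), if_neg (by omega)]
      have hle : ∑ i ∈ range j, h (γ, i) + h (γ, j) ≤ ∑ i ∈ range (n γ), h (γ, i) := by
        rw [← Finset.sum_range_succ]
        exact Finset.sum_le_sum_of_subset (Finset.range_mono hj)
      have h7 := hQ w (s j) (γ, j) (b ^ (en + 1)) B (hp b hb).2.2.2.2
        (fun i hi => by
          change (s j).regs (if i < RCtx.num Γ then ρ i else d + 1) = (if i < RCtx.num Γ then RCtx.get i γ else j)
          split_ifs with hi'
          · have := hρ i hi'
            simp only [s, set_regs]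
            rw [if_neg (by omega), if_neg (by omega), if_neg (by omega), h1 i hi']
          · simp only [s, set_regs, if_true]
            rw [if_neg (by omega)])
        (hhb γ b j hb h2 hj) ((hp b hb).2.1.trans h3)
        (fun r hr => by
          simp only [s, set_regs]
          rw [if_neg (by omega), if_neg (by omega), if_neg (by omega), h4 r (by omega)])
        (by rw [et]; omega)
      have ec : ((s j).set tgt ((s j).regs tgt + h (γ, j))).regs (d + 1) = j := by
        simp only [s, set_regs, if_true]
        rw [if_neg (by omega), if_neg (by omega)]
      have es : ((s j).set tgt ((s j).regs tgt + h (γ, j))).set (d + 1) (j + 1) = s (j + 1) := by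
        rw [et]
        refine ext_regs (fun q => ?_) rfl rfl
        simp only [s, set_regs, Finset.sum_range_succ]
        split_ifs <;> first | rfl | omega
      exact h7.seq' (es ▸ Exec.inc ec (by omega))
  have e1 : ((s (n γ)).set d 0).set (d + 1) 0
      = st.set tgt (st.regs tgt + ∑ j ∈ range (n γ), h (γ, j)) := by
    refine ext_regs (fun q => ?_) rfl rfl
    simp only [s, set_regs]
    split_ifs with ha hb hc
    · omega
    · rw [ha, h4 _ (by omega)]
    · omega
    · rw [hc, h4 _ (by omega)]
    · rfl
    · rfl
  have h9 := Exec.zero (w := w) (B := B) (r := d + 1) (st := (s (n γ)).set d 0)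
  rw [e1] at h9
  exact h6.seq' (hloop.seq' (Exec.zero.seq' h9))

lemma RComp.le_ind {f g : Γ → ℕ} (hf : RComp f) (hg : RComp g) :
    RComp fun γ => if f γ ≤ g γ then 1 else 0 := by
  obtain ⟨e, hf1, hf2⟩ := hf
  obtain ⟨e', hg1, hg2⟩ := hg
  have hp : ∀ b : ℕ, 2 ≤ b → b ^ e ≤ b ^ (e + e') ∧ b ^ e' ≤ b ^ (e + e') ∧ 1 ≤ b ^ (e + e') :=
    fun b hb => ⟨Nat.pow_le_pow_right (by omega) (by omega),
      Nat.pow_le_pow_right (by omega) (by omega), Nat.one_le_pow _ _ (by omega)⟩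
  refine ⟨e + e', fun γ b hb hγ => ?_, fun ρ d tgt ht hρ => ?_⟩
  · have := (hp b hb).2.2
    dsimp only
    split_ifs <;> omega
  obtain ⟨P, hP⟩ := hf2 ρ (d + 1) d (by omega)
    (fun i hi => ⟨by have := (hρ i hi).1; omega, by have := (hρ i hi).1; omega⟩)
  obtain ⟨Q, hQ⟩ := hg2 ρ (d + 2) (d + 1) (by omega)
    (fun i hi => ⟨by have := (hρ i hi).1; omega, by have := (hρ i hi).1; omega⟩)
  refine ⟨.seq P (.seq Q (.seq (.ite (.le d (d + 1)) (.act (.inc tgt)) (.act (.zero (d + 2))))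
    (.seq (.act (.zero d)) (.act (.zero (d + 1)))))), fun w st γ b B hb h1 h2 h3 h4 h5 => ?_⟩
  dsimp only at h5
  have hfb := (hf1 γ b hb h2).trans ((hp b hb).1.trans h3)
  have hgb := (hg1 γ b hb h2).trans ((hp b hb).2.1.trans h3)
  have h6 := hP w st γ b B hb h1 h2 ((hp b hb).1.trans h3) (fun r hr => h4 r (by omega))
    (by rw [h4 d le_rfl]; omega)
  rw [h4 d le_rfl, Nat.zero_add] at h6
  have e1 : (st.set d (f γ)).regs (d + 1) = 0 := by
    rw [set_regs, if_neg (by omega), h4 _ (by omega)]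
  have h7 := hQ w (st.set d (f γ)) γ b B hb
    (fun i hi => by rw [set_regs, if_neg (by have := (hρ i hi).1; omega), h1 i hi]) h2
    ((hp b hb).2.1.trans h3)
    (fun r hr => by rw [set_regs, if_neg (by omega), h4 r (by omega)])
    (by rw [e1]; omega)
  rw [e1, Nat.zero_add] at h7
  set s1 := (st.set d (f γ)).set (d + 1) (g γ)
  have hv := RTest.Val.le (w := w) d (d + 1) s1 (by omega)
  have ed : s1.regs d = f γ := by
    simp only [s1, set_regs, if_true]; rw [if_neg (by omega)]
  have ed' : s1.regs (d + 1) = g γ := by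
    simp only [s1, set_regs, if_true]
  have et : s1.regs tgt = st.regs tgt := by
    simp only [s1, set_regs]; rw [if_neg (by omega), if_neg (by omega)]
  rw [ed, ed'] at hv
  have hite : Exec w B (.ite (.le d (d + 1)) (.act (.inc tgt)) (.act (.zero (d + 2)))) s1 []
      (s1.set tgt (st.regs tgt + if f γ ≤ g γ then 1 else 0)) := by
    by_cases hfg : f γ ≤ g γ
    · rw [decide_eq_true hfg] at hv
      simp only [hfg, if_true] at h5 ⊢
      exact Exec.iteT hv (Exec.inc et h5)
    · rw [decide_eq_false hfg] at hv
      simp only [hfg, if_false, Nat.add_zero]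
      rw [RState.set_eq_self et]
      refine Exec.iteF hv (Exec.skip ?_)
      simp only [s1, set_regs]
      rw [if_neg (by omega), if_neg (by omega), h4 _ (by omega)]
  set v := st.regs tgt + if f γ ≤ g γ then 1 else 0
  have h9 := Exec.zero (w := w) (B := B) (r := d + 1) (st := (s1.set tgt v).set d 0)
  have e9 : ((s1.set tgt v).set d 0).set (d + 1) 0 = st.set tgt v := by
    refine ext_regs (fun q => ?_) rfl rfl
    simp only [s1, set_regs]
    split_ifs with ha hb hc
    · omega
    · rw [ha, h4 _ (by omega)]
    · omega
    · rw [hc, h4 _ (by omega)]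
    · rfl
    · rfl
  rw [e9] at h9
  exact h6.seq' (h7.seq' (hite.seq' (Exec.zero.seq' h9)))

end Closure

section Arithmetic

variable {Γ : Type} [RCtx Γ] {f g : Γ → ℕ} {p q : Γ → Prop}

lemma RComp.congr (hf : RComp f) (h : ∀ γ, f γ = g γ) : RComp g := by
  rwa [← (funext h : f = g)]

lemma RComp.fst (hf : RComp f) : RComp fun p : Γ × ℕ => f p.1 :=
  hf.comp (φ := fun p : Γ × ℕ => p.1) fun i hi =>
    (RComp.get (Γ := Γ × ℕ) (i := i) (Nat.lt_succ_of_lt hi)).congr fun _ => if_pos hi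

lemma RComp.snd : RComp fun p : Γ × ℕ => p.2 :=
  (RComp.get (Γ := Γ × ℕ) (i := RCtx.num Γ) (Nat.lt_succ_self _)).congr fun _ => if_neg (lt_irrefl _)

lemma RComp.id : RComp fun x : ℕ => x := RComp.get (Γ := ℕ) (i := 0) Nat.one_pos

lemma RComp.app {f : ℕ → ℕ} (hf : RComp f) (hg : RComp g) :
    RComp fun γ => f (g γ) := hf.comp (φ := g) fun _ _ => hg

lemma RComp.app₂ {f : ℕ × ℕ → ℕ} {g h : Γ → ℕ} (hf : RComp f) (hg : RComp g) (hh : RComp h) :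
    RComp fun γ => f (g γ, h γ) := by
  refine hf.comp (φ := fun γ => (g γ, h γ)) fun i hi => ?_
  by_cases h1 : i < 1
  · exact hg.congr fun γ => (if_pos h1 : _ = g γ).symm
  · exact hh.congr fun γ => (if_neg h1 : _ = h γ).symm

lemma RComp.mul (hf : RComp f) (hg : RComp g) : RComp fun γ => f γ * g γ :=
  (RComp.sum hf hg.fst).congr fun γ => by simp

open Classical in
/-- A predicate whose indicator function is computed by register programs. -/
def RPred (p : Γ → Prop) : Prop := RComp fun γ => if p γ then 1 else 0

lemma RPred.congr (hp : RPred p) (h : ∀ γ, p γ ↔ q γ) : RPred q := by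
  rwa [← (funext fun γ => propext (h γ) : p = q)]

lemma RPred.le (hf : RComp f) (hg : RComp g) : RPred fun γ => f γ ≤ g γ := by
  classical
  exact (hf.le_ind hg).congr fun γ => by congr

lemma RPred.app {p : ℕ → Prop} (hp : RPred p) (hg : RComp g) :
    RPred fun γ => p (g γ) := RComp.app hp hg

lemma RPred.app₂ {p : ℕ × ℕ → Prop} {g h : Γ → ℕ} (hp : RPred p) (hg : RComp g)
    (hh : RComp h) : RPred fun γ => p (g γ, h γ) := RComp.app₂ hp hg hh

lemma RPred.of_pos (hf : RComp f) : RPred fun γ => 1 ≤ f γ := (RComp.const 1).le_ind hf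
  |>.congr fun γ => by congr

lemma RPred.not (hp : RPred p) : RPred fun γ => ¬ p γ := by
  refine (RPred.le hp (RComp.const 0)).congr fun γ => ?_
  by_cases h : p γ <;> simp [h]

lemma RPred.lt (hf : RComp f) (hg : RComp g) : RPred fun γ => f γ < g γ :=
  (RPred.le hg hf).not.congr fun _ => not_le

lemma RPred.and (hp : RPred p) (hq : RPred q) : RPred fun γ => p γ ∧ q γ := by
  refine (RPred.of_pos (RComp.mul hp hq)).congr fun γ => ?_
  by_cases h : p γ <;> by_cases h' : q γ <;> simp [h, h']

lemma RPred.or (hp : RPred p) (hq : RPred q) : RPred fun γ => p γ ∨ q γ :=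
  (hp.not.and hq.not).not.congr fun γ => by tauto

lemma RPred.eq (hf : RComp f) (hg : RComp g) : RPred fun γ => f γ = g γ :=
  ((RPred.le hf hg).and (RPred.le hg hf)).congr fun _ => le_antisymm_iff.symm

lemma RPred.eq_const (hf : RComp f) (c : ℕ) : RPred fun γ => f γ = c :=
  hf |>.congr (fun _ => rfl) |> fun h => RPred.eq h (RComp.const c)

lemma RPred.exists_lt {n : Γ → ℕ} {p : Γ × ℕ → Prop} (hn : RComp n) (hp : RPred p) :
    RPred fun γ => ∃ j < n γ, p (γ, j) := by
  refine (RPred.of_pos (RComp.sum hn hp)).congr fun γ => ?_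
  rw [Nat.one_le_iff_ne_zero, Ne, Finset.sum_eq_zero_iff]
  simp only [mem_range, ite_eq_right_iff, one_ne_zero, imp_false, not_forall, not_not, exists_prop]

lemma RPred.forall_lt {n : Γ → ℕ} {p : Γ × ℕ → Prop} (hn : RComp n) (hp : RPred p) :
    RPred fun γ => ∀ j < n γ, p (γ, j) :=
  (RPred.exists_lt hn hp.not).not.congr fun γ => by push Not; rfl

lemma RComp.ite [∀ γ, Decidable (p γ)] (hp : RPred p)
    (hf : RComp f) (hg : RComp g) : RComp fun γ => if p γ then f γ else g γ := by
  refine ((RComp.mul hp hf).add (RComp.mul hp.not hg)).congr fun γ => ?_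
  by_cases h : p γ <;> simp [h]

open Classical in
lemma RComp.count {n : Γ → ℕ} {p : Γ × ℕ → Prop} (hn : RComp n) (hp : RPred p) :
    RComp fun γ => ((range (n γ)).filter fun j => p (γ, j)).card :=
  (RComp.sum hn hp).congr fun _ => (Finset.card_filter _ _).symm

lemma RComp.sub (hf : RComp f) (hg : RComp g) : RComp fun γ => f γ - g γ := by
  classical
  refine (RComp.count hf (RPred.le hg.fst RComp.snd)).congr fun γ => ?_
  have : (range (f γ)).filter (fun j => g γ ≤ j) = Finset.Ico (g γ) (f γ) := by
    ext j; simp [and_comm]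
  rw [← Nat.card_Ico, ← this]
  congr

lemma RComp.div (hf : RComp f) (hg : RComp g) : RComp fun γ => f γ / g γ := by
  have h : RPred fun p : Γ × ℕ => 1 ≤ g p.1 ∧ (p.2 + 1) * g p.1 ≤ f p.1 :=
    (RPred.of_pos hg.fst).and (RPred.le ((RComp.snd.add (RComp.const 1)).mul hg.fst) hf.fst)
  classical
  refine (RComp.count hf h).congr fun γ => ?_
  rcases Nat.eq_zero_or_pos (g γ) with h0 | h0
  · simp [h0]
  have : (range (f γ)).filter (fun j => 1 ≤ g γ ∧ (j + 1) * g γ ≤ f γ)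
      = range (f γ / g γ) := by
    ext j
    simp only [mem_filter, mem_range]
    rw [Nat.lt_iff_add_one_le (n := f γ / g γ), Nat.le_div_iff_mul_le h0]
    refine ⟨fun h => h.2.2, fun h => ⟨?_, h0, h⟩⟩
    calc j + 1 ≤ (j + 1) * g γ := Nat.le_mul_of_pos_right _ h0
      _ ≤ f γ := h
  rw [← Finset.card_range (f γ / g γ), ← this]
  congr

lemma RComp.mod (hf : RComp f) (hg : RComp g) : RComp fun γ => f γ % g γ :=
  (hf.sub (hg.mul (hf.div hg))).congr fun γ => by
    have := Nat.div_add_mod (f γ) (g γ)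
    omega

lemma RPred.dvd (hf : RComp f) (hg : RComp g) : RPred fun γ => f γ ∣ g γ :=
  (RPred.eq (hg.mod hf) (RComp.const 0)).congr fun _ => (Nat.dvd_iff_mod_eq_zero).symm

/-- Lookup in a constant table. -/
lemma RComp.table (l : List ℕ) (hf : RComp f) : RComp fun γ => l.getD (f γ) 0 := by
  suffices h : RComp fun x : ℕ => l.getD x 0 from h.app hf
  induction l with
  | nil => exact RComp.const 0
  | cons a l ih =>
    refine (RComp.ite (p := fun x : ℕ => x = 0) (RPred.eq RComp.id (RComp.const 0))
      (RComp.const a) (ih.app (RComp.id.sub (RComp.const 1)))).congr fun x => ?_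
    cases x <;> simp

lemma RPred.prime : RPred fun n : ℕ => n.Prime := by
  have h : RPred fun q : ℕ × ℕ => q.2 ∣ q.1 → q.2 = 1 := ((RPred.dvd RComp.snd (RComp.fst RComp.id)).not.or
      (RPred.eq RComp.snd (RComp.const 1))).congr fun q => by tauto
  exact ((RPred.le (RComp.const 2) RComp.id).and (RPred.forall_lt RComp.id h)).congr fun n =>
    Nat.prime_def_lt.symm

/-- The least prime greater than `n`. -/
def primeAbove (n : ℕ) : ℕ := Nat.find (Nat.exists_infinite_primes (n + 1))

lemma primeAbove_prime (n : ℕ) : (primeAbove n).Prime :=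
  (Nat.find_spec (Nat.exists_infinite_primes (n + 1))).2

lemma lt_primeAbove (n : ℕ) : n < primeAbove n := (Nat.find_spec (Nat.exists_infinite_primes (n + 1))).1

lemma primeAbove_le {n : ℕ} (hn : n ≠ 0) : primeAbove n ≤ 2 * n := by
  obtain ⟨p, hp, h1, h2⟩ := Nat.exists_prime_lt_and_le_two_mul n hn
  exact (Nat.find_min' _ ⟨h1, hp⟩).trans h2

lemma RComp.primeAbove : RComp primeAbove := by
  have h1 : RPred fun q : ℕ × ℕ => q.1 + 1 ≤ q.2 ∧ q.2.Prime :=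
    (RPred.le (RComp.id.fst.add (RComp.const 1)) RComp.snd).and (RPred.prime.app RComp.snd)
  have h2 : RPred fun q : ℕ × ℕ => (q.1 + 1 ≤ q.2 ∧ q.2.Prime) ∧ ∀ j < q.2, ¬ (q.1 + 1 ≤ j ∧ j.Prime) := by
    refine h1.and ?_
    have h3 : RPred fun r : (ℕ × ℕ) × ℕ => ¬ (r.1.1 + 1 ≤ r.2 ∧ r.2.Prime) :=
      ((RPred.le ((RComp.id.fst.fst).add (RComp.const 1)) RComp.snd).and
        (RPred.prime.app RComp.snd)).not
    exact RPred.forall_lt RComp.snd h3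
  refine (RComp.sum ((RComp.id.mul (RComp.const 2)).add (RComp.const 3))
    (RComp.mul RComp.snd h2)).congr fun n => ?_
  have hb : _root_.primeAbove n < n * 2 + 3 := by
    rcases Nat.eq_zero_or_pos n with h0 | h0
    · have : _root_.primeAbove n ≤ 2 := Nat.find_min' _ ⟨by omega, Nat.prime_two⟩
      omega
    · have := primeAbove_le (n := n) (by omega)
      omega
  rw [Finset.sum_eq_single_of_mem (_root_.primeAbove n) (mem_range.2 hb)]
  · dsimp only
    rw [if_pos, mul_one]
    exact ⟨⟨lt_primeAbove n, primeAbove_prime n⟩, fun j hj => Nat.find_min _ hj⟩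
  · intro q _ hq
    dsimp only
    rw [if_neg, mul_zero]
    rintro ⟨h3, h4⟩
    rcases lt_trichotomy q (_root_.primeAbove n) with h | h | h
    · exact Nat.find_min _ h h3
    · exact hq h
    · exact h4 _ h ⟨lt_primeAbove n, primeAbove_prime n⟩

lemma RPred.isPowTwo : RPred fun n : ℕ => ∃ e, n = 2 ^ e := by
  have h : RPred fun q : ℕ × ℕ => q.2 ∣ q.1 → q.2 = 1 ∨ 2 ∣ q.2 :=
    ((RPred.dvd RComp.snd (RComp.fst RComp.id)).not.or
      ((RPred.eq RComp.snd (RComp.const 1)).or (RPred.dvd (RComp.const 2) RComp.snd))).congr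
      fun q => by tauto
  refine ((RPred.of_pos RComp.id).and (RPred.forall_lt (RComp.id.add (RComp.const 1)) h)).congr
    fun n => ⟨fun ⟨h1, h2⟩ => ?_, ?_⟩
  · obtain ⟨e, q, hq, he⟩ := Nat.exists_eq_two_pow_mul_odd (n := n) (by omega)
    have hqn : q ∣ n := ⟨2 ^ e, by rw [he, mul_comm]⟩
    rcases h2 q (Nat.lt_succ_of_le (Nat.le_of_dvd h1 hqn)) hqn with h3 | h3
    · exact ⟨e, by rw [he, show q = 1 from h3, mul_one]⟩
    · exact absurd hq (Nat.not_odd_iff_even.2 (even_iff_two_dvd.2 h3))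
  · rintro ⟨e, rfl⟩
    refine ⟨Nat.one_le_two_pow, fun j _ hj => ?_⟩
    obtain ⟨i, _, hi⟩ := (Nat.dvd_prime_pow Nat.prime_two).1 hj
    cases i with
    | zero => exact .inl (by simpa using hi)
    | succ i => exact .inr ⟨2 ^ i, by rw [show (j : ℕ) = _ from hi, pow_succ, mul_comm]⟩

lemma RComp.log2 : RComp fun n : ℕ => Nat.log 2 n := by
  classical
  have h : RPred fun q : ℕ × ℕ => 2 ≤ q.2 ∧ ∃ e, q.2 = 2 ^ e :=
    (RPred.le (RComp.const 2) RComp.snd).and (RPred.isPowTwo.app RComp.snd)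
  refine (RComp.count (RComp.id.add (RComp.const 1)) h).congr fun n => ?_
  rcases Nat.eq_zero_or_pos n with h0 | h0
  · subst h0; simp
  have : (range (n + 1)).filter (fun q => 2 ≤ q ∧ ∃ e, q = 2 ^ e)
      = (Finset.Icc 1 (Nat.log 2 n)).image (2 ^ ·) := by
    ext q
    simp only [mem_filter, mem_range, Finset.mem_image, Finset.mem_Icc]
    constructor
    · rintro ⟨h1, h2, e, rfl⟩
      refine ⟨e, ⟨?_, Nat.le_log_of_pow_le (by omega) (by omega)⟩, rfl⟩
      rcases Nat.eq_zero_or_pos e with h3 | h3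
      · subst h3; simp at h2
      · exact h3
    · rintro ⟨e, ⟨h1, h2⟩, rfl⟩
      refine ⟨?_, ?_, e, rfl⟩
      · exact Nat.lt_succ_of_le (Nat.pow_le_of_le_log (by omega) h2)
      · exact Nat.le_self_pow (by omega) 2
  trans ((Finset.Icc 1 (Nat.log 2 n)).image (2 ^ ·)).card
  · rw [← this]
    congr
  · rw [Finset.card_image_of_injective _ (Nat.pow_right_injective le_rfl), Nat.card_Icc]
    omega

lemma RPred.testBit : RPred fun p : ℕ × ℕ => p.1.testBit p.2 = true := by
  have h : RPred fun r : (ℕ × ℕ) × ℕ => ((∃ e, r.2 = 2 ^ e) ∧ Nat.log 2 r.2 = r.1.2) ∧ r.1.1 / r.2 % 2 = 1 :=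
    ((RPred.isPowTwo.app RComp.snd).and (RPred.eq (RComp.log2.app RComp.snd) RComp.snd.fst)).and
      (RPred.eq ((RComp.id.fst.fst.div RComp.snd).mod (RComp.const 2)) (RComp.const 1))
  refine (RPred.exists_lt (RComp.id.fst.add (RComp.const 1)) h).congr fun p => ?_
  obtain ⟨n, j⟩ := p
  dsimp only
  rw [Nat.testBit_eq_decide_div_mod_eq, decide_eq_true_iff]
  constructor
  · rintro ⟨q, _, ⟨⟨e, rfl⟩, h1⟩, h2⟩
    rw [Nat.log_pow (by omega)] at h1
    rwa [h1] at h2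
  · intro h1
    refine ⟨2 ^ j, ?_, ⟨⟨j, rfl⟩, Nat.log_pow (by omega) j⟩, h1⟩
    by_contra h2
    rw [Nat.div_eq_of_lt (by omega)] at h1
    omega

end Arithmetic

open RState (set_regs ext_regs store_regs)

/-! ### Stream algorithms -/

instance : RCtx Unit := ⟨0, fun _ _ => 0⟩

/-- The number with the binary digits `l`, most significant digit first. -/
def coinVal (l : List Bool) : ℕ := l.foldl (fun a b => 2 * a + if b = true then 1 else 0) 0

lemma coinVal_lt {l : List Bool} (h : l.length = 4) : coinVal l < 16 := by
  obtain ⟨a, b, c, d, rfl⟩ := List.length_eq_four.1 h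
  cases a <;> cases b <;> cases c <;> cases d <;> decide

/-- The word `a#b#c`. -/
def tripleWord (a b c : ℕ) : List Ternary :=
  binaryWord a ++ [Ternary.hash] ++ binaryWord b ++ [Ternary.hash] ++ binaryWord c

/-- An algorithm that reads its input symbol by symbol, with four coin flips per symbol: the update
of the variables by a symbol (`none` is the end of the input) and the value of the coin flips, and
the number of triples that are written after the update, with their components. -/
structure StreamAlg (Γ : Type) where
  init : Γ
  upd : Option Ternary → Γ × ℕ → Γ
  len : Γ → ℕ
  fstOut : Γ × ℕ → ℕ
  sndOut : Γ × ℕ → ℕ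
  trdOut : Γ × ℕ → ℕ

namespace StreamAlg

variable {Γ : Type} [RCtx Γ]

/-- The triples that are written in a state. -/
def emit (A : StreamAlg Γ) (γ : Γ) : List Ternary := (List.range (A.len γ)).flatMap fun t =>
    Ternary.hash :: tripleWord (A.fstOut (γ, t)) (A.sndOut (γ, t)) (A.trdOut (γ, t))

/-- The output for a list of events, from a state, with a list of coin flips. -/
def out (A : StreamAlg Γ) : List (Option Ternary) → Γ → List Bool → List Ternary
  | [], _, _ => []
  | o :: os, γ, l =>
    A.emit (A.upd o (γ, coinVal (l.take 4))) ++
      A.out os (A.upd o (γ, coinVal (l.take 4))) (l.drop 4)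

/-- All variables are bounded by `b` during the processing of a list of events. -/
def Bounded (A : StreamAlg Γ) (b : ℕ) : List (Option Ternary) → Γ → Prop
  | [], γ => ∀ i < RCtx.num Γ, RCtx.get i γ ≤ b
  | o :: os, γ => (∀ i < RCtx.num Γ, RCtx.get i γ ≤ b) ∧
    (∀ c < 16, ∀ i < RCtx.num Γ, RCtx.get i (A.upd o (γ, c)) ≤ b) ∧
    ∀ c < 16, A.Bounded b os (A.upd o (γ, c))

lemma Bounded.mono {A : StreamAlg Γ} {b b' : ℕ} {os : List (Option Ternary)} {γ : Γ}
    (h : A.Bounded b os γ) (hb : b ≤ b') : A.Bounded b' os γ := by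
  induction os generalizing γ with
  | nil => exact fun i hi => (h i hi).trans hb
  | cons o os ih =>
    exact ⟨fun i hi => (h.1 i hi).trans hb, fun c hc i hi => (h.2.1 c hc i hi).trans hb,
      fun c hc => ih (h.2.2 c hc)⟩

/-- All parts of the algorithm are computed by register programs. -/
structure Computable (A : StreamAlg Γ) : Prop where
  upd : ∀ o, ∀ i < RCtx.num Γ, RComp fun p => RCtx.get i (A.upd o p)
  len : RComp A.len
  fstOut : RComp A.fstOut
  sndOut : RComp A.sndOut
  trdOut : RComp A.trdOut

end StreamAlg

/-- The state of the register machine that holds the variables of `γ`. -/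
def RState.ofCtx {Γ : Type} [RCtx Γ] (γ : Γ) (p : ℕ) (u : List Ternary) : RState where
  regs r := if r < RCtx.num Γ then RCtx.get r γ else 0
  pos := p
  out := u

lemma RState.ofCtx_regs {Γ : Type} [RCtx Γ] (γ : Γ) (p : ℕ) (u : List Ternary) (r : ℕ) :
    (RState.ofCtx γ p u).regs r = if r < RCtx.num Γ then RCtx.get r γ else 0 := rfl

/-- Increments a register `k` times. -/
def RProg.incs (r : ℕ) : ℕ → RProg
  | 0 => .act (.inc r)
  | k + 1 => .seq (.incs r k) (.act (.inc r))

lemma Exec.incs {w : List Ternary} {B r k : ℕ} {st : RState} (h : st.regs r + k + 1 ≤ B) :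
    Exec w B (.incs r k) st [] (st.set r (st.regs r + k + 1)) := by
  induction k with
  | zero => exact Exec.inc rfl h
  | succ k ih =>
    have h1 := Exec.inc (w := w) (B := B) (r := r) (st := st.set r (st.regs r + k + 1)) rfl
      (by rw [set_regs, if_pos rfl]; omega)
    rw [RState.set_add] at h1
    exact (ih (by omega)).seq' h1

lemma Exec.flip {w : List Ternary} {B r z k : ℕ} {st : RState} (b : Bool) (hz : st.regs z = 0)
    (h : st.regs r + k + 1 ≤ B) :
    Exec w B (.ite .coin (.incs r k) (.act (.zero z))) st [b]
      (st.set r (st.regs r + if b = true then k + 1 else 0)) := by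
  cases b
  · rw [RState.set_eq_self (by simp)]
    exact Exec.iteF (l := [false]) (l' := []) (.coin st false) (Exec.skip hz)
  · exact Exec.iteT (l := [true]) (l' := []) (.coin st true) (Exec.incs h)

/-- A program that stores the value of four coin flips. -/
lemma RProg.exists_coins (r z : ℕ) (hrz : r ≠ z) : ∃ P : RProg, ∀ (w : List Ternary) (B : ℕ)
    (st : RState) (l : List Bool), 16 ≤ B → st.regs r = 0 → st.regs z = 0 → l.length = 4 →
    Exec w B P st l (st.set r (coinVal l)) := by
  let F : ℕ → RProg := fun k => .ite .coin (.incs r k) (.act (.zero z))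
  refine ⟨.seq (F 7) (.seq (F 3) (.seq (F 1) (F 0))), fun w B st l hB hr hz hl => ?_⟩
  obtain ⟨a, b, c, d, rfl⟩ := List.length_eq_four.1 hl
  have key : ∀ (v k : ℕ) (x : Bool), v + k + 1 ≤ 16 →
      Exec w B (F k) (st.set r v) [x] (st.set r (v + if x = true then k + 1 else 0)) := by
    intro v k x hv
    have h := Exec.flip (w := w) (B := B) (r := r) (z := z) (k := k) (st := st.set r v) x
      (by rw [set_regs, if_neg (Ne.symm hrz), hz])
      (by rw [set_regs, if_pos rfl]; omega)
    rwa [RState.set_add] at h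
  have h0 : st = st.set r 0 := (RState.set_eq_self hr).symm
  have h1 := key 0 7 a (by omega)
  have h2 := key _ 3 b (by cases a <;> simp : (0 + if a = true then 7 + 1 else 0) + 3 + 1 ≤ 16)
  have h3 := key _ 1 c (by cases a <;> cases b <;> simp :
    ((0 + if a = true then 7 + 1 else 0) + if b = true then 3 + 1 else 0) + 1 + 1 ≤ 16)
  have h4 := key _ 0 d (by cases a <;> cases b <;> cases c <;> simp :
    (((0 + if a = true then 7 + 1 else 0) + if b = true then 3 + 1 else 0) +
      if c = true then 1 + 1 else 0) + 0 + 1 ≤ 16)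
  rw [← h0] at h1
  have h5 := Exec.seq h1 (Exec.seq h2 (Exec.seq h3 h4))
  have hv : coinVal [a, b, c, d] = (((0 + if a = true then 7 + 1 else 0) +
      if b = true then 3 + 1 else 0) + if c = true then 1 + 1 else 0) +
      if d = true then 0 + 1 else 0 := by
    cases a <;> cases b <;> cases c <;> cases d <;> rfl
  rw [hv]
  exact h5

/-- A program that moves the contents of the registers from `d` on to the first registers. -/
lemma RProg.exists_move (d m₀ : ℕ) (hm₀ : m₀ ≤ d) : ∀ m ≤ m₀, ∃ P : RProg,
    ∀ (w : List Ternary) (B : ℕ) (st : RState) (f : ℕ → ℕ), (∀ r, d ≤ r → st.regs r = 0) → 2 ≤ B →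
    (∀ i < m₀, f i ≤ B) →
    Exec w B P (st.store d m₀ f) []
      { st with regs := fun r => if d ≤ r ∧ r < d + m₀ then (if r < d + m then 0 else f (r - d))
                  else if r < m then f r else st.regs r } := by
  intro m hm
  induction m with
  | zero =>
    refine ⟨.act (.zero (d + m₀)), fun w B st f h0 hB hf => ?_⟩
    have h : (st.store d m₀ f).regs (d + m₀) = 0 := by
      rw [store_regs, if_neg (by omega), h0 _ (by omega)]
    convert Exec.skip h using 1
    refine ext_regs (fun r => ?_) rfl rfl
    rw [store_regs]
    dsimp only
    split_ifs <;> first | rfl | omega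
  | succ m ih =>
    obtain ⟨P, hP⟩ := ih (by omega)
    obtain ⟨Q, hQ⟩ := (RCompE.get (Γ := ℕ) (i := 0) Nat.one_pos).2 (fun _ => d + m) (d + m₀) m
      (by omega) (fun _ _ => ⟨by omega, by omega⟩)
    refine ⟨.seq P (.seq (.act (.zero m)) (.seq Q (.act (.zero (d + m))))),
      fun w B st f h0 hB hf => (hP w B st f h0 hB hf).seq' (Exec.zero.seq' ?_)⟩
    set s : RState := { st with regs := fun r =>
      if d ≤ r ∧ r < d + m₀ then (if r < d + m then 0 else f (r - d))
                  else if r < m then f r else st.regs r } with hs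
    have e1 : (s.set m 0).regs m = 0 := by rw [set_regs, if_pos rfl]
    have h1 := hQ w (s.set m 0) (f m) B B hB
      (fun _ _ => by
        rw [set_regs, if_neg (by omega), hs]
        dsimp only
        rw [if_pos (by omega), if_neg (by omega), Nat.add_sub_cancel_left]; rfl)
      (fun _ _ => hf m (by omega)) (by rw [pow_one])
      (fun r hr => by
        rw [set_regs, if_neg (by omega), hs]
        dsimp only
        rw [if_neg (by omega), if_neg (by omega), h0 r (by omega)])
      (by rw [e1, Nat.zero_add]; exact hf m (by omega))
    rw [e1, Nat.zero_add] at h1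
    refine h1.seq' ?_
    convert Exec.zero using 1
    change _ = ((s.set m 0).set m (f m)).set (d + m) 0
    refine ext_regs (fun r => ?_) rfl rfl
    simp only [set_regs, hs]
    by_cases h2 : r = d + m
    · rw [if_pos h2, if_pos (by omega), if_pos (by omega)]
    by_cases h3 : r = m
    · rw [if_neg h2, if_pos h3, if_neg (by omega), if_pos (by omega), h3]
    · rw [if_neg h2, if_neg h3, if_neg h3]
      split_ifs <;> first | rfl | omega

section Stream

variable {Γ : Type} [RCtx Γ]

/-- The state of the register machine during output: in addition to the variables, two registers
hold the number of triples and the number of triples that have been written. -/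
def RState.ofCtxOut (γ : Γ) (L j p : ℕ) (u : List Ternary) : RState where
  regs r := if r < RCtx.num Γ then RCtx.get r γ else if r = RCtx.num Γ then L
    else if r = RCtx.num Γ + 1 then j else 0
  pos := p
  out := u

lemma RProg.exists_put {E : ℕ} {g : Γ × ℕ → ℕ} (hg : RCompE E g) : ∃ P : RProg,
    ∀ (w : List Ternary) (γ : Γ) (L j p : ℕ) (u : List Ternary) (b B : ℕ), 2 ≤ b →
    (∀ i < RCtx.num Γ, RCtx.get i γ ≤ b) → j ≤ b → b ^ E ≤ B →
    Exec w B P (.ofCtxOut γ L j p u) [] (.ofCtxOut γ L j p (u ++ binaryWord (g (γ, j)))) := by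
  set n := RCtx.num Γ with hn
  obtain ⟨P, hP⟩ := hg.2 (fun i => if i < n then i else n + 1) (n + 3) (n + 2) (by omega)
    (fun i _ => by split_ifs <;> omega)
  refine ⟨.seq P (.seq (.act (.emitBin (n + 2))) (.act (.zero (n + 2)))),
    fun w γ L j p u b B hb h1 h2 h3 => ?_⟩
  have hget : ∀ i < RCtx.num (Γ × ℕ), RCtx.get i (γ, j) ≤ b := by
    intro i _
    change (if i < n then RCtx.get i γ else j) ≤ b
    split_ifs with h
    · exact h1 i h
    · exact h2
  have e1 : (RState.ofCtxOut γ L j p u).regs (n + 2) = 0 := by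
    simp only [RState.ofCtxOut, ← hn]
    rw [if_neg (by omega), if_neg (by omega), if_neg (by omega)]
  have h5 := hP w (.ofCtxOut γ L j p u) (γ, j) b B hb
    (fun i _ => by
      change _ = if i < n then RCtx.get i γ else j
      simp only [RState.ofCtxOut, ← hn]
      by_cases h : i < n
      · rw [if_pos h, if_pos h, if_pos h]
      · rw [if_neg h, if_neg h, if_neg (by omega), if_neg (by omega), if_pos rfl]) hget h3
    (fun r hr => by
      simp only [RState.ofCtxOut, ← hn]
      rw [if_neg (by omega), if_neg (by omega), if_neg (by omega)])
    (by rw [e1, Nat.zero_add]; exact (hg.1 _ b hb hget).trans h3)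
  rw [e1, Nat.zero_add] at h5
  refine h5.seq' (Exec.seq' (.act (.emitBin _ _)) ?_)
  convert Exec.zero using 1
  ext r
  · have h6 : (RState.put ((RState.ofCtxOut γ L j p u).set (n + 2) (g (γ, j)))
        (binaryWord (((RState.ofCtxOut γ L j p u).set (n + 2) (g (γ, j))).regs (n + 2)))).regs
        = ((RState.ofCtxOut γ L j p u).set (n + 2) (g (γ, j))).regs := rfl
    rw [set_regs, h6, set_regs]
    by_cases h : r = n + 2
    · rw [if_pos h, h]
      simp only [RState.ofCtxOut, ← hn]
      rw [if_neg (by omega), if_neg (by omega), if_neg (by omega)]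
    · rw [if_neg h, if_neg h]; rfl
  · rfl
  · simp [RState.put, RState.set, RState.ofCtxOut]

/-- A program that writes the triples of a state. -/
lemma RProg.exists_emit {A : StreamAlg Γ} (hA : A.Computable) : ∃ (E : ℕ) (P : RProg),
    ∀ (w : List Ternary) (γ : Γ) (p : ℕ) (u : List Ternary) (b B : ℕ), 2 ≤ b →
    (∀ i < RCtx.num Γ, RCtx.get i γ ≤ b) → b ^ E ≤ B →
    Exec w B P (.ofCtx γ p u) [] (.ofCtx γ p (u ++ A.emit γ)) := by
  set n := RCtx.num Γ with hn
  obtain ⟨e0, h0⟩ := hA.len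
  obtain ⟨e1, h1⟩ := hA.fstOut
  obtain ⟨e2, h2⟩ := hA.sndOut
  obtain ⟨e3, h3⟩ := hA.trdOut
  obtain ⟨P0, hP0⟩ := h0.2 (fun i => i) (n + 1) n (by omega) (fun i hi => by omega)
  obtain ⟨P1, hP1⟩ := RProg.exists_put h1
  obtain ⟨P2, hP2⟩ := RProg.exists_put h2
  obtain ⟨P3, hP3⟩ := RProg.exists_put h3
  let body : RProg := .seq (.act (.emit .hash)) (.seq P1 (.seq (.act (.emit .hash)) (.seq P2
    (.seq (.act (.emit .hash)) (.seq P3 (.act (.inc (n + 1))))))))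
  refine ⟨e0 + (e0 + 1) * (e1 + e2 + e3), .seq P0 (.seq (.untl (.le n (n + 1)) body)
    (.seq (.act (.zero n)) (.act (.zero (n + 1))))), fun w γ p u b B hb hγ hB => ?_⟩
  have hb0 : b ^ e0 ≤ B := (Nat.pow_le_pow_right (by omega) (by omega)).trans hB
  have hlen : A.len γ ≤ b ^ e0 := h0.1 γ b hb hγ
  set b' := b ^ (e0 + 1) with hb'
  have hbb' : b ≤ b' := Nat.le_self_pow (by omega) b
  have hb0' : b ^ e0 ≤ b' := Nat.pow_le_pow_right (by omega) (by omega)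
  have hB' : ∀ e ≤ e1 + e2 + e3, b' ^ e ≤ B := fun e he => by
    refine le_trans ?_ hB
    rw [hb', ← pow_mul]
    exact Nat.pow_le_pow_right (by omega) ((Nat.mul_le_mul_left _ he).trans (by omega))
  let W : ℕ → List Ternary := fun t =>
    Ternary.hash :: tripleWord (A.fstOut (γ, t)) (A.sndOut (γ, t)) (A.trdOut (γ, t))
  let s : ℕ → RState := fun j => .ofCtxOut γ (A.len γ) j p (u ++ (List.range j).flatMap W)
  have hloop : Exec w B (.untl (.le n (n + 1)) body) (s 0) [] (s (A.len γ)) := by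
    refine Exec.loop (by omega) s ?_ ?_ ?_
    · intro j _
      simp only [s, RState.ofCtxOut, ← hn, if_true]
      rw [if_neg (by omega)]
    · intro j _
      simp only [s, RState.ofCtxOut, ← hn, if_true]
      rw [if_neg (by omega), if_neg (by omega)]
    · intro j hj
      have hjb : j ≤ b' := by omega
      have hγ' : ∀ i < RCtx.num Γ, RCtx.get i γ ≤ b' := fun i hi => (hγ i hi).trans hbb'
      have hemit : ∀ v, Exec w B (.act (.emit .hash)) (.ofCtxOut γ (A.len γ) j p v) []
          (.ofCtxOut γ (A.len γ) j p (v ++ [.hash])) := fun v => .act (.emit _ _)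
      refine (hemit _).seq' ((hP1 w γ _ j p _ b' B (hb.trans hbb') hγ' hjb (hB' _ (by omega))).seq'
        ((hemit _).seq' ((hP2 w γ _ j p _ b' B (hb.trans hbb') hγ' hjb (hB' _ (by omega))).seq'
        ((hemit _).seq' ((hP3 w γ _ j p _ b' B (hb.trans hbb') hγ' hjb (hB' _ (by omega))).seq' ?_)))))
      have hr : ∀ v, (RState.ofCtxOut γ (A.len γ) j p v).regs (n + 1) = j := by
        intro v
        simp only [RState.ofCtxOut, ← hn, if_true]
        rw [if_neg (by omega), if_neg (by omega)]
      convert Exec.inc (hr _) _ using 1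
      · ext r
        · rw [set_regs]
          simp only [s, RState.ofCtxOut, ← hn]
          split_ifs <;> first | rfl | omega
        · rfl
        · simp [s, RState.ofCtxOut, RState.set, List.range_succ, W, tripleWord]
      · omega
  have e0' : (RState.ofCtx γ p u).regs n = 0 := by
    rw [RState.ofCtx_regs, if_neg (by omega)]
  have h6 := hP0 w (.ofCtx γ p u) γ b B hb
    (fun i hi => by rw [RState.ofCtx_regs, if_pos hi]) hγ hb0
    (fun r hr => by rw [RState.ofCtx_regs, if_neg (by omega)])
    (by rw [e0', Nat.zero_add]; exact hlen.trans hb0)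
  have e1' : (RState.ofCtx γ p u).set n ((RState.ofCtx γ p u).regs n + A.len γ) = s 0 := by
    ext r
    · rw [e0', set_regs, RState.ofCtx_regs]
      simp only [s, RState.ofCtxOut, ← hn]
      split_ifs <;> first | rfl | omega
    · rfl
    · simp [s, RState.ofCtxOut, RState.ofCtx, RState.set]
  rw [e1'] at h6
  refine h6.seq' (hloop.seq' (Exec.zero.seq' ?_))
  convert Exec.zero using 1
  refine ext_regs (fun r => ?_) rfl rfl
  rw [set_regs, set_regs, RState.ofCtx_regs]
  simp only [s, RState.ofCtxOut, ← hn]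
  split_ifs <;> first | rfl | omega

/-- A program that processes an event. -/
lemma RProg.exists_event {A : StreamAlg Γ} (hA : A.Computable) (o : Option Ternary) :
    ∃ (E : ℕ) (P : RProg), ∀ (w : List Ternary) (γ : Γ) (p : ℕ) (u : List Ternary) (l : List Bool)
    (b B : ℕ), 16 ≤ b → (∀ i < RCtx.num Γ, RCtx.get i γ ≤ b) →
    (∀ i < RCtx.num Γ, RCtx.get i (A.upd o (γ, coinVal l)) ≤ b) → b ^ E ≤ B → l.length = 4 →
    Exec w B P (.ofCtx γ p u) l
      (.ofCtx (A.upd o (γ, coinVal l)) p (u ++ A.emit (A.upd o (γ, coinVal l)))) := by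
  set n := RCtx.num Γ with hn
  obtain ⟨P1, hP1⟩ := RProg.exists_coins n (n + 1) (by omega)
  obtain ⟨E2, hE2⟩ := RComp.exists_common (hA.upd o)
  obtain ⟨P2, hP2⟩ := RCompE.exists_store hE2 (fun i => i) (n + 1) (fun i hi => hi) n le_rfl
  obtain ⟨P3, hP3⟩ := RProg.exists_move (n + 1) n (by omega) n le_rfl
  obtain ⟨E4, P4, hP4⟩ := RProg.exists_emit hA
  refine ⟨E2 + E4 + 1, .seq P1 (.seq P2 (.seq P3 (.seq (.act (.zero n)) P4))),
    fun w γ p u l b B hb hγ hγ' hB hl => ?_⟩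
  have hpow : ∀ e ≤ E2 + E4 + 1, b ^ e ≤ B := fun e he =>
    (Nat.pow_le_pow_right (by omega) he).trans hB
  have hbB : b ≤ B := by simpa using hpow 1 (by omega)
  have h1 := hP1 w B (.ofCtx γ p u) l (hb.trans hbB) (by rw [RState.ofCtx_regs, if_neg (by omega)])
    (by rw [RState.ofCtx_regs, if_neg (by omega)]) hl
  set c := coinVal l with hc
  have hc16 : c < 16 := coinVal_lt hl
  have h2 := hP2 w ((RState.ofCtx γ p u).set n c) (γ, c) b B (by omega)
    (fun i hi => by
      change _ = if i < n then RCtx.get i γ else c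
      have : i < n + 1 := hi
      rw [set_regs, RState.ofCtx_regs]
      split_ifs <;> first | rfl | omega)
    (fun i _ => by
      change (if i < n then RCtx.get i γ else c) ≤ b
      split_ifs with h
      · exact hγ i h
      · omega)
    (hpow _ (by omega))
    (fun r hr => by rw [set_regs, if_neg (by omega), RState.ofCtx_regs, if_neg (by omega)])
  have h3 := hP3 w B ((RState.ofCtx γ p u).set n c) (fun i => RCtx.get i (A.upd o (γ, c)))
    (fun r hr => by rw [set_regs, if_neg (by omega), RState.ofCtx_regs, if_neg (by omega)])
    (by omega) (fun i hi => (hγ' i hi).trans hbB)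
  have h4 := hP4 w (A.upd o (γ, c)) p u b B (by omega) hγ' (hpow _ (by omega))
  refine (List.append_nil l) ▸ Exec.seq h1 (h2.seq' (h3.seq' (Exec.seq' Exec.zero ?_)))
  · convert h4 using 1
    refine ext_regs (fun r => ?_) rfl rfl
    rw [set_regs, RState.ofCtx_regs]
    dsimp only
    rw [set_regs, RState.ofCtx_regs]
    split_ifs <;> first | rfl | omega

/-- A program that processes the events of the input in order. -/
lemma RProg.exists_events {A : StreamAlg Γ} (hA : A.Computable) :
    ∃ (E : ℕ) (P : RProg), ∀ (w : List Ternary) (b B : ℕ), 16 ≤ b → b ^ E ≤ B →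
    ∀ (l : List Bool) (γ : Γ) (p : ℕ) (u : List Ternary), p ≤ w.length →
    l.length = 4 * (w.length - p + 1) →
    A.Bounded b ((w.drop p).map some ++ [none]) γ →
    ∃ st', Exec w B P (.ofCtx γ p u) l st' ∧ st'.out = u ++ A.out ((w.drop p).map some ++ [none]) γ l := by
  choose E P hP using RProg.exists_event hA
  let body : RProg := .seq (.ite (.sym (some .zero)) (P (some .zero)) (.ite (.sym (some .one))
    (P (some .one)) (P (some .hash)))) (.act .advance)
  refine ⟨E none + E (some .zero) + E (some .one) + E (some .hash),
    .seq (.untl (.sym none) body) (P none), fun w b B hb hB => ?_⟩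
  have hE : ∀ o, b ^ E o ≤ B := by
    intro o
    refine (Nat.pow_le_pow_right (by omega) ?_).trans hB
    rcases o with _ | (_ | _ | _) <;> omega
  have main : ∀ (k : ℕ) (l : List Bool) (γ : Γ) (p : ℕ) (u : List Ternary), p + k = w.length →
      l.length = 4 * (k + 1) → A.Bounded b ((w.drop p).map some ++ [none]) γ →
      ∃ l₁ l₂ st₁ st', l = l₁ ++ l₂ ∧ Exec w B (.untl (.sym none) body) (.ofCtx γ p u) l₁ st₁ ∧
        Exec w B (P none) st₁ l₂ st' ∧
        st'.out = u ++ A.out ((w.drop p).map some ++ [none]) γ l := by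
    intro k
    induction k with
    | zero =>
      intro l γ p u hp hl hbd
      have hd : w.drop p = [] := List.drop_eq_nil_of_le (by omega)
      rw [hd] at hbd ⊢
      obtain ⟨h1, h2, -⟩ := hbd
      refine ⟨[], l, _, _, rfl, .untlT (.symT none _ ?_), hP none w γ p u l b B hb h1 ?_ (hE _)
        (by omega), ?_⟩
      · exact List.getElem?_eq_none (by simp [RState.ofCtx]; omega)
      · exact h2 _ (coinVal_lt (by omega))
      · have ht : l.take 4 = l := List.take_of_length_le (by omega)
        simp [StreamAlg.out, RState.ofCtx, ht]
    | succ k ih =>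
      intro l γ p u hp hl hbd
      have hlt : p < w.length := by omega
      rw [List.drop_eq_getElem_cons hlt, List.map_cons, List.cons_append] at hbd ⊢
      obtain ⟨h1, h2, h3⟩ := hbd
      have hc : coinVal (l.take 4) < 16 := coinVal_lt (by simp; omega)
      obtain ⟨l₁, l₂, st₁, st', e1, e2, e3, e4⟩ := ih (l.drop 4)
        (A.upd (some w[p]) (γ, coinVal (l.take 4))) (p + 1)
        (u ++ A.emit (A.upd (some w[p]) (γ, coinVal (l.take 4)))) (by omega) (by simp; omega)
        (h3 _ hc)
      have h4 := hP (some w[p]) w γ p u (l.take 4) b B hb h1 (h2 _ hc) (hE _) (by simp; omega)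
      have hs : w[p]? = some w[p] := List.getElem?_eq_getElem hlt
      have hbody : Exec w B body (.ofCtx γ p u) (l.take 4)
          (.ofCtx (A.upd (some w[p]) (γ, coinVal (l.take 4))) (p + 1)
            (u ++ A.emit (A.upd (some w[p]) (γ, coinVal (l.take 4))))) := by
        suffices h : Exec w B body (.ofCtx γ p u) (l.take 4 ++ [])
            (.ofCtx (A.upd (some w[p]) (γ, coinVal (l.take 4))) (p + 1)
              (u ++ A.emit (A.upd (some w[p]) (γ, coinVal (l.take 4))))) by
          rwa [List.append_nil] at h
        refine Exec.seq ?_ (.act (.advance (RState.ofCtx (A.upd (some w[p]) (γ, coinVal (l.take 4)))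
          p (u ++ A.emit (A.upd (some w[p]) (γ, coinVal (l.take 4))))) hlt))
        generalize hv : w[p] = v at *
        rcases v with _ | _ | _
        · exact Exec.iteT (l := []) (.symT _ _ hs) h4
        · refine Exec.iteF (l := []) (.symF _ _ ?_) (Exec.iteT (l := []) (.symT _ _ hs) h4)
          simp [RState.ofCtx, hs]
        · refine Exec.iteF (l := []) (.symF _ _ ?_) (Exec.iteF (l := []) (.symF _ _ ?_) h4) <;>
          simp [RState.ofCtx, hs]
      refine ⟨l.take 4 ++ l₁, l₂, st₁, st', ?_, ?_, e3, ?_⟩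
      · rw [List.append_assoc, ← e1, List.take_append_drop]
      · refine Exec.untlF (l := []) (.symF _ _ ?_) hbody e2
        simp [RState.ofCtx, hs]
      · rw [e4, StreamAlg.out, List.append_assoc]
  intro l γ p u hp hl hbd
  obtain ⟨l₁, l₂, st₁, st', e1, e2, e3, e4⟩ := main (w.length - p) l γ p u (by omega) hl hbd
  exact ⟨st', e1 ▸ Exec.seq e2 e3, e4⟩

/-- A program that writes a constant word. -/
lemma RProg.exists_write (v : List Ternary) : ∃ P : RProg, ∀ (w : List Ternary) (B : ℕ)
    (st : RState), (∀ r, st.regs r = 0) → Exec w B P st [] (st.put v) := by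
  induction v with
  | nil =>
    refine ⟨.act (.zero 0), fun w B st h => ?_⟩
    have : st.put [] = st := by ext <;> simp [RState.put]
    rw [this]
    exact Exec.skip (h 0)
  | cons t v ih =>
    obtain ⟨P, hP⟩ := ih
    refine ⟨.seq (.act (.emit t)) P, fun w B st h => Exec.seq' (.act (.emit t st)) ?_⟩
    have := hP w B (st.put [t]) h
    simpa [RState.put] using this

/-- A program for a stream algorithm whose variables are polynomially bounded; the word `v` is
written first. -/
lemma RProg.exists_stream {A : StreamAlg Γ} (hA : A.Computable) (v : List Ternary) (a : ℕ)
    (hbd : ∀ w : List Ternary, A.Bounded ((w.length + 2) ^ a) (w.map some ++ [none]) A.init) :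
    ∃ (e : ℕ) (P : RProg), ∀ (w : List Ternary) (l : List Bool), l.length = 4 * (w.length + 1) →
      ∃ st', Exec w ((w.length + 2) ^ e) P .init l st' ∧
        st'.out = v ++ A.out (w.map some ++ [none]) A.init l := by
  obtain ⟨E, P, hP⟩ := RProg.exists_events hA
  obtain ⟨P0, hP0⟩ := RProg.exists_write v
  obtain ⟨E1, hE1⟩ := RComp.exists_common (Γ := Unit) (φ := fun _ => A.init)
    (fun i _ => RComp.const (RCtx.get i A.init))
  obtain ⟨P1, hP1⟩ := RCompE.exists_store hE1 (fun i => i) 0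
    (fun i hi => absurd hi (Nat.not_lt_zero i)) (RCtx.num Γ) le_rfl
  refine ⟨(a + 4) * E + E1, .seq P0 (.seq P1 P), fun w l hl => ?_⟩
  set b := (w.length + 2) ^ (a + 4) with hb
  set B := (w.length + 2) ^ ((a + 4) * E + E1) with hB
  have hmono : (w.length + 2) ^ a ≤ b := Nat.pow_le_pow_right (by omega) (by omega)
  have h16 : 16 ≤ b := calc
    16 = 2 ^ 4 := rfl
    _ ≤ (w.length + 2) ^ 4 := Nat.pow_le_pow_left (by omega) 4
    _ ≤ b := Nat.pow_le_pow_right (by omega) (by omega)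
  have hbB : b ^ E ≤ B := by
    rw [hb, hB, ← pow_mul]
    exact Nat.pow_le_pow_right (by omega) (by omega)
  obtain ⟨st', h1, h2⟩ := hP w b B h16 hbB l A.init 0 v (Nat.zero_le _) (by simpa using hl)
    ((hbd w).mono hmono)
  refine ⟨st', ?_, by simpa using h2⟩
  have h3 := hP0 w B .init (fun _ => rfl)
  have h4 := hP1 w (RState.put .init v) () 2 B le_rfl (fun i hi => absurd hi (Nat.not_lt_zero i))
    (fun i hi => absurd hi (Nat.not_lt_zero i))
    (calc 2 ^ E1 ≤ (w.length + 2) ^ E1 := Nat.pow_le_pow_left (by omega) _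
      _ ≤ B := Nat.pow_le_pow_right (by omega) (by omega)) (fun r _ => rfl)
  have e : (RState.put .init v).store 0 (RCtx.num Γ) (fun i => RCtx.get i A.init)
      = .ofCtx A.init 0 v := by
    ext r
    · rw [store_regs, RState.ofCtx_regs]
      simp [RState.put, RState.init]
    · rfl
    · simp [RState.store, RState.put, RState.ofCtx, RState.init]
  rw [e] at h4
  exact Exec.seq (l := []) h3 (Exec.seq (l := []) h4 h1)

end Stream

/-! ### Machines of stream algorithms -/

lemma nat_log_mul_le_logSpace (c n : ℕ) :
    c * Nat.log 2 (max n 2) ≤ logSpace (c : ℝ) n := by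
  have h : (Nat.log 2 (max n 2) : ℝ) ≤ Real.logb 2 (max (n : ℝ) 2) := by
    rw [Real.le_logb_iff_rpow_le one_lt_two (by positivity), Real.rpow_natCast]
    exact_mod_cast Nat.pow_log_le_self 2 (x := max n 2) (by omega)
  have h1 : ((c * Nat.log 2 (max n 2) : ℕ) : ℝ) ≤ (logSpace (c : ℝ) n : ℝ) := by
    rw [logSpace, Nat.cast_mul]
    exact (mul_le_mul_of_nonneg_left h (Nat.cast_nonneg _)).trans (Nat.le_ceil _)
  exact_mod_cast h1

/-- A stream algorithm whose variables are polynomially bounded is executed by a machine in logarithmic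
space and polynomial time. -/
lemma StreamAlg.exists_machine {Γ : Type} [RCtx Γ] {A : StreamAlg Γ} (hA : A.Computable)
    (v : List Ternary) (a : ℕ)
    (hbd : ∀ w : List Ternary, A.Bounded ((w.length + 2) ^ a) (w.map some ++ [none]) A.init) :
    ∃ (M : OPTM) (c₀ : ℕ), ∀ c, c₀ ≤ c → ∀ (w : List Ternary) (m : ℕ), m = logSpace (c : ℝ) w.length →
      M.HaltsWithin w (2 ^ m) ∧ M.UsesSpaceAtMost w m ∧
      (∀ r, ∃ l : List Bool, l.length = 4 * (w.length + 1) ∧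
        M.outputAfter w (2 ^ m) r = v ++ A.out (w.map some ++ [none]) A.init l) ∧
      ∀ Q : List Ternary → Prop, M.outputProb w (2 ^ m) Q =
        (coinCount (4 * (w.length + 1)) fun l => Q (v ++ A.out (w.map some ++ [none]) A.init l) : ℝ) /
          2 ^ (4 * (w.length + 1)) := by
  obtain ⟨e, P, hP⟩ := RProg.exists_stream hA v a hbd
  set q := Nat.card P.machine.Q
  set s := (P.top + 2) * (3 * e + 1) + 1 with hs
  refine ⟨P.machine, q + 7 + 3 * s, fun c hc w m hm => ?_⟩
  set n := w.length with hn
  set L := Nat.log 2 (max n 2) with hL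
  have hL1 : 1 ≤ L := Nat.le_log_of_pow_le (by omega) (by omega)
  have hcL : c * L ≤ m := hm ▸ nat_log_mul_le_logSpace c n
  have hn2 : n + 2 ≤ 2 ^ (L + 2) := by
    have h1 : max n 2 < 2 ^ (L + 1) := Nat.lt_pow_succ_log_self (by omega) _
    rw [pow_succ]
    omega
  have hlogB : Nat.log 2 ((n + 2) ^ e) ≤ 3 * e * L := calc
    Nat.log 2 ((n + 2) ^ e) ≤ Nat.log 2 (2 ^ ((L + 2) * e)) := by
      refine Nat.log_mono_right ?_
      rw [pow_mul]
      exact Nat.pow_le_pow_left hn2 e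
    _ = (L + 2) * e := Nat.log_pow (by omega) _
    _ ≤ (3 * L) * e := Nat.mul_le_mul_right _ (by omega)
    _ = 3 * e * L := by ring
  have hS : (P.top + 2) * (Nat.log 2 ((n + 2) ^ e) + 1) < s * L := by
    have h1 : (P.top + 2) * (Nat.log 2 ((n + 2) ^ e) + 1) ≤ (P.top + 2) * ((3 * e + 1) * L) := by
      refine Nat.mul_le_mul_left _ ?_
      rw [Nat.add_mul, Nat.one_mul]
      omega
    have h2 : s * L = (P.top + 2) * ((3 * e + 1) * L) + L := by rw [hs]; ring
    omega
  have hexp : q + ((L + 1) + (s * L + (2 * (s * L) + (L + 4)))) ≤ m := by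
    refine le_trans ?_ hcL
    have h1 : (q + 7 + 3 * s) * L ≤ c * L := Nat.mul_le_mul_right _ hc
    have h2 : (q + 7 + 3 * s) * L = q * L + 7 * L + 3 * (s * L) := by ring
    have h3 : q ≤ q * L := Nat.le_mul_of_pos_right _ hL1
    omega
  have hT : q * ((n + 1) * (s * L * (3 ^ (s * L) * (4 * (n + 1) + 1)))) ≤ 2 ^ m := by
    refine le_trans ?_ (Nat.pow_le_pow_right (by omega) hexp)
    rw [pow_add, pow_add (2 : ℕ) (L + 1), pow_add (2 : ℕ) (s * L), pow_add (2 : ℕ) (2 * (s * L))]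
    have h1 : max n 2 < 2 ^ (L + 1) := Nat.lt_pow_succ_log_self (by omega) _
    have h2 : 2 ^ (L + 4) = 2 ^ (L + 2) * 4 := pow_add 2 (L + 2) 2
    have h3 : 3 ^ (s * L) ≤ 2 ^ (2 * (s * L)) := calc
      3 ^ (s * L) ≤ (2 ^ 2) ^ (s * L) := Nat.pow_le_pow_left (by norm_num) _
      _ = 2 ^ (2 * (s * L)) := (pow_mul 2 2 _).symm
    exact Nat.mul_le_mul Nat.lt_two_pow_self.le (Nat.mul_le_mul (by omega)
      (Nat.mul_le_mul Nat.lt_two_pow_self.le (Nat.mul_le_mul h3 (by omega))))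
  obtain ⟨h1, h2, h3, h4⟩ := P.machine_spec (w := w) (B := (n + 2) ^ e) (S := s * L)
    (K := 4 * (n + 1)) (T := 2 ^ m)
    (f := fun l => v ++ A.out (w.map some ++ [none]) A.init l) (Nat.one_le_pow _ _ (by omega))
    (hP w) hS hT
  exact ⟨h1, fun coins => (h2 coins).trans_le (by omega), h3, h4⟩

/-! ### Circuits of elementary gates -/

section Gates

/-- The labels of the basis states of `m` qubits. -/
abbrev Bits (m : ℕ) := Fin m → Fin 2

variable {m : ℕ}

/-- The effect of a list of gates on a state. -/
noncomputable def runGates (gs : List (GateInstr m)) (ψ : QState m) : QState m :=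
  gs.foldl (fun ψ g => g.apply ψ) ψ

@[simp] lemma runGates_nil (ψ : QState m) : runGates [] ψ = ψ := rfl

lemma runGates_cons (g : GateInstr m) (gs : List (GateInstr m)) (ψ : QState m) :
    runGates (g :: gs) ψ = runGates gs (g.apply ψ) := rfl

lemma runGates_append (gs hs : List (GateInstr m)) (ψ : QState m) :
    runGates (gs ++ hs) ψ = runGates hs (runGates gs ψ) := List.foldl_append

/-- The eighth root of unity of the gate `T`. -/
noncomputable def omega8 : ℂ := Complex.exp (Complex.I * (Real.pi / 4))

lemma omega8_pow_four : omega8 ^ 4 = -1 := by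
  rw [omega8, ← Complex.exp_nat_mul, ← Complex.exp_pi_mul_I]
  congr 1
  push_cast
  ring

lemma omega8_pow_eight : omega8 ^ 8 = 1 := by
  rw [show 8 = 4 * 2 from rfl, pow_mul, omega8_pow_four]; norm_num

lemma norm_omega8 : ‖omega8‖ = 1 := by
  rw [omega8, mul_comm, show ((Real.pi : ℂ) / 4) = ((Real.pi / 4 : ℝ) : ℂ) by push_cast; rfl]
  exact Complex.norm_exp_ofReal_mul_I _

lemma apply_idle (a : Fin m) (c : Fin 3) (ψ : QState m) : GateInstr.apply ⟨a, a, c⟩ ψ = ψ := by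
  simp [GateInstr.apply]

lemma apply_H {a d : Fin m} (h : a ≠ d) (ψ : QState m) (x : Bits m) :
    GateInstr.apply ⟨a, d, 0⟩ ψ x = ((1 / Real.sqrt 2 : ℝ) : ℂ) *
      (ψ (update x a 0) + (if x a = 0 then 1 else -1) * ψ (update x a 1)) := by
  simp only [GateInstr.apply, h, if_false, if_true, applyOneQubit, hadamardMatrix, Fin.sum_univ_two,
    Matrix.smul_apply, smul_eq_mul]
  generalize x a = v
  fin_cases v <;> simp <;> ring

lemma apply_T {a d : Fin m} (h : a ≠ d) (ψ : QState m) (x : Bits m) :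
    GateInstr.apply ⟨a, d, 1⟩ ψ x = omega8 ^ (x a : ℕ) * ψ x := by
  simp only [GateInstr.apply, h, if_false]
  rw [if_neg (by decide)]
  simp only [if_true, applyOneQubit, piEighthMatrix, Fin.sum_univ_two]
  rcases (by omega : x a = 0 ∨ x a = 1) with h0 | h0
  · have : update x a 0 = x := by rw [← h0, update_eq_self]
    simp [h0, this]
  · have : update x a 1 = x := by rw [← h0, update_eq_self]
    simp [h0, this, omega8]

lemma apply_CN {a b : Fin m} (h : a ≠ b) (ψ : QState m) (x : Bits m) :
    GateInstr.apply ⟨a, b, 2⟩ ψ x = ψ (update x b (x b + x a)) := by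
  simp only [GateInstr.apply, h, if_false]
  rw [if_neg (by decide), if_neg (by decide)]
  rfl

/-- The gates `T^j` on the parity of the qubits `a` and `b`. -/
def parityT (a b d : Fin m) (j : ℕ) : List (GateInstr m) :=
  ⟨a, b, 2⟩ :: (List.replicate j ⟨b, d, 1⟩ ++ [⟨a, b, 2⟩])

lemma runGates_replicate_T {b d : Fin m} (h : b ≠ d) (j : ℕ) (ψ : QState m) (x : Bits m) :
    runGates (List.replicate j ⟨b, d, 1⟩) ψ x = omega8 ^ (j * (x b : ℕ)) * ψ x := by
  induction j generalizing ψ with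
  | zero => simp
  | succ j ih => rw [List.replicate_succ, runGates_cons, ih, apply_T h, ← mul_assoc]; ring

lemma fin_two_add_add (u v : Fin 2) : u + v + v = u := by
  revert u v; decide

lemma runGates_parityT {a b d : Fin m} (hab : a ≠ b) (h : b ≠ d) (j : ℕ) (ψ : QState m)
    (x : Bits m) :
    runGates (parityT a b d j) ψ x = omega8 ^ (j * ((x b + x a : Fin 2) : ℕ)) * ψ x := by
  rw [parityT, runGates_cons, runGates_append, runGates_cons, runGates_nil, apply_CN hab,
    runGates_replicate_T h, apply_CN hab]
  simp only [update_self, update_of_ne hab, fin_two_add_add, update_idem,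
    update_eq_self]

/-- A circuit for the doubly controlled phase flip. -/
def ccz (a b c d : Fin m) : List (GateInstr m) :=
  [⟨a, d, 1⟩, ⟨b, d, 1⟩, ⟨c, d, 1⟩] ++ (parityT a b d 7 ++ (parityT b c d 7 ++ (parityT a c d 7 ++
    [⟨a, c, 2⟩, ⟨b, c, 2⟩, ⟨c, d, 1⟩, ⟨b, c, 2⟩, ⟨a, c, 2⟩])))

lemma runGates_ccz {a b c d : Fin m} (hab : a ≠ b) (hac : a ≠ c) (hbc : b ≠ c) (ha : a ≠ d)
    (hb : b ≠ d) (hc : c ≠ d) (ψ : QState m) (x : Bits m) :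
    runGates (ccz a b c d) ψ x = (if x a = 1 ∧ x b = 1 ∧ x c = 1 then -1 else 1) * ψ x := by
  have h1 : ∀ (ψ : QState m) x, runGates [⟨a, c, 2⟩, ⟨b, c, 2⟩, ⟨c, d, 1⟩, ⟨b, c, 2⟩, ⟨a, c, 2⟩] ψ x
      = omega8 ^ ((x c + x a + x b : Fin 2) : ℕ) * ψ x := by
    intro ψ x
    simp only [runGates_cons, runGates_nil]
    rw [apply_CN hac, apply_CN hbc, apply_T hc, apply_CN hbc, apply_CN hac]
    simp only [update_self, update_of_ne hac, update_of_ne hbc,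
      fin_two_add_add, update_idem, update_eq_self]
  have h2 : ∀ (ψ : QState m) x, runGates [⟨a, d, 1⟩, ⟨b, d, 1⟩, ⟨c, d, 1⟩] ψ x
      = omega8 ^ (x a : ℕ) * omega8 ^ (x b : ℕ) * omega8 ^ (x c : ℕ) * ψ x := by
    intro ψ x
    simp only [runGates_cons, runGates_nil]
    rw [apply_T hc, apply_T hb, apply_T ha]
    ring
  rw [ccz, runGates_append, runGates_append, runGates_append, runGates_append, h1,
    runGates_parityT hac hc, runGates_parityT hbc hc, runGates_parityT hab hb, h2]
  have key : ∀ u v t : Fin 2, ((t + u + v : Fin 2) : ℕ) + (7 * ((t + u : Fin 2) : ℕ) +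
      (7 * ((t + v : Fin 2) : ℕ) + (7 * ((v + u : Fin 2) : ℕ) + ((u : ℕ) + (v : ℕ) + (t : ℕ))))) =
      8 * (if u = 0 ∧ v = 0 ∧ t = 0 then 0 else if u = 1 ∧ v = 1 ∧ t = 1 then 0 else 2) +
        (if u = 1 ∧ v = 1 ∧ t = 1 then 4 else 0) := by decide
  simp only [← mul_assoc, ← pow_add]
  congr 1
  simp only [add_assoc] at key ⊢
  rw [key, pow_add, pow_mul, omega8_pow_eight, one_pow, one_mul]
  split_ifs
  · exact omega8_pow_four
  · exact pow_zero _

/-- A circuit for the Toffoli gate with controls `a`, `b` and target `c`. -/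
def ccx (a b c d : Fin m) : List (GateInstr m) := ⟨c, d, 0⟩ :: (ccz a b c d ++ [⟨c, d, 0⟩])

lemma hadamard_factor_sq : ((1 / Real.sqrt 2 : ℝ) : ℂ) * ((1 / Real.sqrt 2 : ℝ) : ℂ) = 1 / 2 := by
  rw [← Complex.ofReal_mul, div_mul_div_comm, Real.mul_self_sqrt (by norm_num)]
  norm_num

lemma runGates_ccx {a b c d : Fin m} (hab : a ≠ b) (hac : a ≠ c) (hbc : b ≠ c) (ha : a ≠ d)
    (hb : b ≠ d) (hc : c ≠ d) (ψ : QState m) (x : Bits m) :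
    runGates (ccx a b c d) ψ x = ψ (update x c (x c + x a * x b)) := by
  rw [ccx, runGates_cons, runGates_append, runGates_cons, runGates_nil, apply_H hc,
    runGates_ccz hab hac hbc ha hb hc, runGates_ccz hab hac hbc ha hb hc, apply_H hc, apply_H hc]
  simp only [update_self, update_of_ne hac, update_of_ne hbc, update_idem]
  have h2 := hadamard_factor_sq
  generalize ((1 / Real.sqrt 2 : ℝ) : ℂ) = s at *
  rcases (by omega : x a = 0 ∨ x a = 1) with h0 | h0 <;>
  rcases (by omega : x b = 0 ∨ x b = 1) with h1 | h1 <;>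
  rcases (by omega : x c = 0 ∨ x c = 1) with h3 | h3 <;>
  simp [h0, h1, h3]
  all_goals first
    | linear_combination (2 * ψ (update x c 0)) * h2
    | linear_combination (2 * ψ (update x c 1)) * h2

/-- The Toffoli gate in which the control `a` is shifted by the qubit `o`. -/
def shiftedCcx (o a b c d : Fin m) : List (GateInstr m) := ⟨o, a, 2⟩ :: (ccx a b c d ++ [⟨o, a, 2⟩])

lemma runGates_shiftedCcx {o a b c d : Fin m} (hoa : o ≠ a) (hoc : o ≠ c) (hab : a ≠ b)
    (hac : a ≠ c) (hbc : b ≠ c) (ha : a ≠ d) (hb : b ≠ d) (hc : c ≠ d) (ψ : QState m)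
    (x : Bits m) :
    runGates (shiftedCcx o a b c d) ψ x
      = ψ (update x c (x c + (x a + x o) * x b)) := by
  rw [shiftedCcx, runGates_cons, runGates_append, runGates_cons, runGates_nil, apply_CN hoa,
    runGates_ccx hab hac hbc ha hb hc, apply_CN hoa]
  congr 1
  ext i
  by_cases h1 : i = c
  · subst h1
    simp [hac.symm, hac, hab.symm]
  by_cases h2 : i = a
  · subst h2
    simp [h1, hoa, hoc, fin_two_add_add]
  · simp [h1, h2]

lemma sum_flip (a : Fin m) (F : Bits m → ℝ) :
    ∑ x, F (update x a (x a + 1)) = ∑ x, F x := by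
  have h : Function.Involutive fun x : Bits m => update x a (x a + 1) := by
    intro x
    simp only [update_self, update_idem, fin_two_add_add, update_eq_self]
  exact Equiv.sum_comp h.toPerm F

lemma sum_normSq_apply (g : GateInstr m) (ψ : QState m) :
    ∑ x, ‖g.apply ψ x‖ ^ 2 = ∑ x, ‖ψ x‖ ^ 2 := by
  obtain ⟨a, b, c⟩ := g
  by_cases hab : a = b
  · subst hab; rw [apply_idle]
  rcases (by omega : c = 0 ∨ c = 1 ∨ c = 2) with rfl | rfl | rfl
  · have key : ∀ x : Bits m, ‖GateInstr.apply ⟨a, b, 0⟩ ψ x‖ ^ 2 +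
        ‖GateInstr.apply ⟨a, b, 0⟩ ψ (update x a (x a + 1))‖ ^ 2
        = ‖ψ x‖ ^ 2 + ‖ψ (update x a (x a + 1))‖ ^ 2 := by
      intro x
      have hs : ‖((1 / Real.sqrt 2 : ℝ) : ℂ)‖ ^ 2 = 1 / 2 := by
        rw [Complex.norm_real, Real.norm_eq_abs, sq_abs, div_pow, one_pow, Real.sq_sqrt (by norm_num)]
      have hp : ∀ u v : ℂ, ‖u + v‖ ^ 2 + ‖u - v‖ ^ 2 = 2 * (‖u‖ ^ 2 + ‖v‖ ^ 2) := by
        intro u v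
        have := parallelogram_law_with_norm ℝ u v
        exact this
      rw [apply_H hab, apply_H hab, norm_mul, norm_mul, mul_pow, mul_pow, hs, ← mul_add]
      simp only [update_self, update_idem]
      rcases (by omega : x a = 0 ∨ x a = 1) with h0 | h0
      · have h1 : update x a 0 = x := by rw [← h0, update_eq_self]
        have := hp (ψ x) (ψ (update x a 1))
        simp only [h0, h1, zero_add, if_true, one_mul, one_ne_zero, if_false, neg_mul, ← sub_eq_add_neg]
        rw [this]; ring
      · have h1 : update x a 1 = x := by rw [← h0, update_eq_self]
        have := hp (ψ (update x a 0)) (ψ x)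
        have h2 : (1 : Fin 2) + 1 = 0 := rfl
        simp only [h0, h1, h2, if_true, one_mul, one_ne_zero, if_false, neg_mul, ← sub_eq_add_neg]
        rw [add_comm, this]; ring
    have h1 := sum_congr rfl fun x (_ : x ∈ Finset.univ) => key x
    rw [Finset.sum_add_distrib, Finset.sum_add_distrib,
      sum_flip a (fun x => ‖GateInstr.apply ⟨a, b, 0⟩ ψ x‖ ^ 2), sum_flip a (fun x => ‖ψ x‖ ^ 2)] at h1
    linarith
  · refine sum_congr rfl fun x _ => ?_
    rw [apply_T hab, norm_mul, norm_pow, norm_omega8, one_pow, one_mul]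
  · have h : Function.Involutive fun x : Bits m => update x b (x b + x a) := by
      intro x
      simp only [update_self, update_of_ne hab, update_idem,
        fin_two_add_add, update_eq_self]
    rw [← Equiv.sum_comp h.toPerm fun x => ‖ψ x‖ ^ 2]
    exact sum_congr rfl fun x _ => by rw [apply_CN hab]; rfl

lemma sum_normSq_runGates (gs : List (GateInstr m)) (ψ : QState m) :
    ∑ x, ‖runGates gs ψ x‖ ^ 2 = ∑ x, ‖ψ x‖ ^ 2 := by
  induction gs generalizing ψ with
  | nil => rfl
  | cons g gs ih => rw [runGates_cons, ih, sum_normSq_apply]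

lemma sum_normSq_circuitState (gs : List (GateInstr m)) : ∑ x, ‖circuitState gs x‖ ^ 2 = 1 := by
  rw [show circuitState gs = runGates gs (QState.zero m) from rfl, sum_normSq_runGates,
    Finset.sum_eq_single_of_mem (fun _ => 0) (Finset.mem_univ _)]
  · simp [QState.zero]
  · intro x _ hx
    simp [QState.zero, hx]

lemma measureFirstProb_add (hm : 0 < m) (gs : List (GateInstr m)) :
    measureFirstProb 0 (circuitState gs) + measureFirstProb 1 (circuitState gs) = 1 := by
  rw [← sum_normSq_circuitState gs, measureFirstProb, measureFirstProb, ← Finset.sum_union]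
  · congr 1
    ext x
    simp only [Finset.mem_union, mem_filter, Finset.mem_univ, true_and, iff_true]
    rcases (by omega : x ⟨0, hm⟩ = 0 ∨ x ⟨0, hm⟩ = 1) with h | h
    · exact .inl ⟨⟨0, hm⟩, rfl, h⟩
    · exact .inr ⟨⟨0, hm⟩, rfl, h⟩
  · rw [Finset.disjoint_filter]
    rintro x _ ⟨i, hi, h⟩ ⟨j, hj, h'⟩
    rw [Fin.ext (hi.trans hj.symm), h'] at h
    exact absurd h (by decide)

/-- Gates that do not act on the qubit `z` leave it in the state `0`. -/
lemma runGates_idle_qubit {gs : List (GateInstr m)} {z : Fin m} (hgs : ∀ g ∈ gs, g.a ≠ z ∧ g.b ≠ z)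
    {ψ : QState m} (hψ : ∀ x, x z ≠ 0 → ψ x = 0) (x : Bits m) (hx : x z ≠ 0) :
    runGates gs ψ x = 0 := by
  induction gs generalizing ψ with
  | nil => exact hψ x hx
  | cons g gs ih =>
    rw [runGates_cons]
    refine ih (fun g hg => hgs g (.tail _ hg)) fun y hy => ?_
    obtain ⟨h1, h2⟩ := hgs g (.head _)
    obtain ⟨a, b, c⟩ := g
    have hu : ∀ v, ψ (update y a v) = 0 := fun v =>
      hψ _ (by rwa [update_of_ne (Ne.symm h1)])
    by_cases hab : a = b
    · subst hab; rw [apply_idle]; exact hψ y hy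
    rcases (by omega : c = 0 ∨ c = 1 ∨ c = 2) with rfl | rfl | rfl
    · rw [apply_H hab, hu, hu]; simp
    · rw [apply_T hab, hψ y hy, mul_zero]
    · rw [apply_CN hab]
      exact hψ _ (by rwa [update_of_ne (Ne.symm h2)])

end Gates

/-! ### Macros: padded circuits with numeric addresses -/

/-- The circuit of `ccz`, as triples of two operands and a gate. The operands `0`, `1`, `2` are the
arguments, `3` is a qubit in the state `1`, and `4` is a qubit on which no gate acts. -/
def cczRoles : List (ℕ × ℕ × ℕ) :=
  let par (a b : ℕ) : List (ℕ × ℕ × ℕ) := (a, b, 2) :: (List.replicate 7 (b, 4, 1) ++ [(a, b, 2)])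
  [(0, 4, 1), (1, 4, 1), (2, 4, 1)] ++ (par 0 1 ++ (par 1 2 ++ (par 0 2 ++
    [(0, 2, 2), (1, 2, 2), (2, 4, 1), (1, 2, 2), (0, 2, 2)])))

/-- The circuits of the macros, padded to length `39`: `1` is the Toffoli gate, `2` the Toffoli gate
whose first control is negated, `3` the Hadamard gate, `4` the doubly controlled phase flip, and
everything else is idle. -/
def macroRoles (κ : ℕ) : List (ℕ × ℕ × ℕ) :=
  if κ = 1 then (2, 4, 0) :: (cczRoles ++ (2, 4, 0) :: List.replicate 2 (4, 4, 0))
  else if κ = 2 then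
    (3, 0, 2) :: ((2, 4, 0) :: (cczRoles ++ [(2, 4, 0)]) ++ [(3, 0, 2)])
  else if κ = 3 then (0, 4, 0) :: List.replicate 38 (4, 4, 0)
  else if κ = 4 then cczRoles ++ List.replicate 4 (4, 4, 0)
  else List.replicate 39 (4, 4, 0)

lemma length_macroRoles (κ : ℕ) : (macroRoles κ).length = 39 := by
  unfold macroRoles
  split_ifs <;> rfl

/-- The address of an operand: the qubit `2` is kept in the state `1`, and no gate acts on the
qubit `1`. -/
def roleAddr (a b c r : ℕ) : ℕ :=
  if r = 0 then a else if r = 1 then b else if r = 2 then c else if r = 3 then 2 else 1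

section Macro

variable {m : ℕ} [NeZero m]

/-- The gate with numeric operands. -/
def gateAt (m : ℕ) [NeZero m] (a b c : ℕ) : GateInstr m := ⟨Fin.ofNat m a, Fin.ofNat m b, Fin.ofNat 3 c⟩

/-- The circuit of a macro with numeric arguments. -/
def macroGates (m : ℕ) [NeZero m] (κ a b c : ℕ) : List (GateInstr m) :=
  (macroRoles κ).map fun t => gateAt m (roleAddr a b c t.1) (roleAddr a b c t.2.1) t.2.2

/-- The value of the qubit with address `a` in a basis state. -/
def bitAt (x : Bits m) (a : ℕ) : Fin 2 := x (Fin.ofNat m a)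

/-- The basis state in which the qubit with address `a` is set to `v`. -/
def setBit (x : Bits m) (a : ℕ) (v : Fin 2) : Bits m := update x (Fin.ofNat m a) v

lemma ofNat_ne {a b : ℕ} (ha : a < m) (hb : b < m) (h : a ≠ b) : Fin.ofNat m a ≠ Fin.ofNat m b := by
  intro h1
  have h2 := congrArg Fin.val h1
  simp only [Fin.ofNat, Nat.mod_eq_of_lt ha, Nat.mod_eq_of_lt hb] at h2
  exact h h2

lemma bitAt_setBit_self (x : Bits m) (a : ℕ) (v : Fin 2) : bitAt (setBit x a v) a = v :=
  update_self _ _ _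

lemma bitAt_setBit_ne (x : Bits m) {a b : ℕ} (v : Fin 2) (hb : b < m) (ha : a < m)
    (h : b ≠ a) : bitAt (setBit x a v) b = bitAt x b := update_of_ne (ofNat_ne hb ha h) _ _

lemma setBit_setBit (x : Bits m) (a : ℕ) (v v' : Fin 2) :
    setBit (setBit x a v) a v' = setBit x a v' := update_idem _ _ _

lemma setBit_bitAt (x : Bits m) (a : ℕ) : setBit x a (bitAt x a) = x := update_eq_self _ _

lemma setBit_comm (x : Bits m) {a b : ℕ} (v v' : Fin 2) (ha : a < m) (hb : b < m)
    (h : a ≠ b) : setBit (setBit x a v) b v' = setBit (setBit x b v') a v :=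
  Function.update_comm (ofNat_ne ha hb h) _ _ _

lemma ext_bitAt {x y : Bits m} (h : ∀ a < m, bitAt x a = bitAt y a) : x = y := by
  ext i
  have := h i i.2
  simp only [bitAt, Fin.ofNat, Nat.mod_eq_of_lt i.2] at this
  exact congrArg Fin.val this

lemma runGates_idle (a b c : ℕ) (n : ℕ) (ψ : QState m) :
    runGates ((List.replicate n ((4 : ℕ), (4 : ℕ), (0 : ℕ))).map fun t => gateAt m
      (roleAddr a b c t.1) (roleAddr a b c t.2.1) t.2.2) ψ = ψ := by
  induction n with
  | zero => rfl
  | succ n ih =>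
    rw [List.replicate_succ, List.map_cons, runGates_cons]
    rw [show (gateAt m (roleAddr a b c (4, 4, 0).1) (roleAddr a b c (4, 4, 0).2.1) (4, 4, 0).2.2).apply ψ
      = ψ from apply_idle _ _ _, ih]

lemma runGates_macro_idle {κ : ℕ} (h : κ = 0) (a b c : ℕ) (ψ : QState m) :
    runGates (macroGates m κ a b c) ψ = ψ := by
  subst h; exact runGates_idle a b c 39 ψ

lemma runGates_macro_ccx {a b c : ℕ} (ha : a < m) (hb : b < m) (hc : c < m) (hab : a ≠ b)
    (hac : a ≠ c) (hbc : b ≠ c) (ha1 : a ≠ 1) (hb1 : b ≠ 1) (hc1 : c ≠ 1) (hm : 1 < m)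
    (ψ : QState m) (x : Bits m) :
    runGates (macroGates m 1 a b c) ψ x = ψ (setBit x c (bitAt x c + bitAt x a * bitAt x b)) := by
  have h : macroGates m 1 a b c = ccx (Fin.ofNat m a) (Fin.ofNat m b) (Fin.ofNat m c) (Fin.ofNat m 1)
      ++ (List.replicate 2 ((4 : ℕ), (4 : ℕ), (0 : ℕ))).map fun t => gateAt m
      (roleAddr a b c t.1) (roleAddr a b c t.2.1) t.2.2 := rfl
  rw [h, runGates_append, runGates_idle]
  exact runGates_ccx (ofNat_ne ha hb hab) (ofNat_ne ha hc hac) (ofNat_ne hb hc hbc)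
    (ofNat_ne ha hm ha1) (ofNat_ne hb hm hb1) (ofNat_ne hc hm hc1) ψ x

lemma runGates_macro_shifted {a b c : ℕ} (ha : a < m) (hb : b < m) (hc : c < m) (hab : a ≠ b)
    (hac : a ≠ c) (hbc : b ≠ c) (ha1 : a ≠ 1) (hb1 : b ≠ 1) (hc1 : c ≠ 1) (hm : 2 < m)
    (ha2 : 2 ≠ a) (hc2 : 2 ≠ c) (ψ : QState m) (x : Bits m) :
    runGates (macroGates m 2 a b c) ψ x
      = ψ (setBit x c (bitAt x c + (bitAt x a + bitAt x 2) * bitAt x b)) := by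
  have h : macroGates m 2 a b c = shiftedCcx (Fin.ofNat m 2) (Fin.ofNat m a) (Fin.ofNat m b)
    (Fin.ofNat m c) (Fin.ofNat m 1) := rfl
  have hm1 : 1 < m := by omega
  rw [h]
  exact runGates_shiftedCcx (ofNat_ne hm ha ha2) (ofNat_ne hm hc hc2)
    (ofNat_ne ha hb hab) (ofNat_ne ha hc hac) (ofNat_ne hb hc hbc)
    (ofNat_ne ha hm1 ha1) (ofNat_ne hb hm1 hb1) (ofNat_ne hc hm1 hc1) ψ x

lemma runGates_macro_H {a b c : ℕ} (ha : a < m) (ha1 : a ≠ 1) (hm : 1 < m) (ψ : QState m)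
    (x : Bits m) :
    runGates (macroGates m 3 a b c) ψ x = ((1 / Real.sqrt 2 : ℝ) : ℂ) *
      (ψ (setBit x a 0) + (if bitAt x a = 0 then 1 else -1) * ψ (setBit x a 1)) := by
  have h : macroGates m 3 a b c = ⟨Fin.ofNat m a, Fin.ofNat m 1, 0⟩ ::
      (List.replicate 38 ((4 : ℕ), (4 : ℕ), (0 : ℕ))).map fun t => gateAt m
      (roleAddr a b c t.1) (roleAddr a b c t.2.1) t.2.2 := rfl
  rw [h, runGates_cons, runGates_idle]
  exact apply_H (ofNat_ne ha hm ha1) ψ x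

lemma runGates_macro_ccz {a b c : ℕ} (ha : a < m) (hb : b < m) (hc : c < m) (hab : a ≠ b)
    (hac : a ≠ c) (hbc : b ≠ c) (ha1 : a ≠ 1) (hb1 : b ≠ 1) (hc1 : c ≠ 1) (hm : 1 < m)
    (ψ : QState m) (x : Bits m) :
    runGates (macroGates m 4 a b c) ψ x =
      (if bitAt x a = 1 ∧ bitAt x b = 1 ∧ bitAt x c = 1 then -1 else 1) * ψ x := by
  have h : macroGates m 4 a b c = ccz (Fin.ofNat m a) (Fin.ofNat m b) (Fin.ofNat m c) (Fin.ofNat m 1)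
      ++ (List.replicate 4 ((4 : ℕ), (4 : ℕ), (0 : ℕ))).map fun t => gateAt m
      (roleAddr a b c t.1) (roleAddr a b c t.2.1) t.2.2 := rfl
  rw [h, runGates_append, runGates_idle]
  exact runGates_ccz (ofNat_ne ha hb hab) (ofNat_ne ha hc hac) (ofNat_ne hb hc hbc)
    (ofNat_ne ha hm ha1) (ofNat_ne hb hm hb1) (ofNat_ne hc hm hc1) ψ x

end Macro

/-! ### Equality tests on a register of qubits -/

section EqTest

variable {m : ℕ} [NeZero m]

/-- The operands of an equality test on the qubits `q 0, …, q (n - 1)` with the scratch qubits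
`36 * j + 2`, and with target operands `u` and `v`. -/
structure EqTestAddr (m n : ℕ) (q : ℕ → ℕ) (u v : ℕ) : Prop where
  pos : 0 < n
  size : 36 * n + 3 < m
  q_lt : ∀ j < n, q j < m
  q_one : ∀ j < n, q j ≠ 1
  q_chain : ∀ j < n, ∀ i, q j ≠ 36 * i + 2
  q_v : ∀ j < n, q j ≠ v
  u_lt : u < m
  u_one : u ≠ 1
  u_chain : ∀ i, u ≠ 36 * (i + 1) + 2
  v_lt : v < m
  v_one : v ≠ 1
  v_chain : ∀ i, v ≠ 36 * i + 2
  u_v : u ≠ v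

/-- Level `j` of the test: the scratch qubit `j + 1` is set if the scratch qubit `j` is set and the
qubit `q j` has the value of bit `j` of `p`. -/
def eqStep (m : ℕ) [NeZero m] (q : ℕ → ℕ) (p j : ℕ) : List (GateInstr m) :=
  macroGates m (if p.testBit j = true then 1 else 2) (q j) (36 * j + 2) (36 * (j + 1) + 2)

/-- The levels `i, …, i + d - 1` of the test, a circuit `mid`, and the levels in reverse order. -/
def eqNest (m : ℕ) [NeZero m] (q : ℕ → ℕ) (p : ℕ) (mid : List (GateInstr m)) (i d : ℕ) :
    List (GateInstr m) :=
  (List.range' i d).flatMap (eqStep m q p) ++ (mid ++ (List.range' i d).reverse.flatMap (eqStep m q p))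

lemma eqNest_zero (q : ℕ → ℕ) (p : ℕ) (mid : List (GateInstr m)) (i : ℕ) :
    eqNest m q p mid i 0 = mid := by
  simp [eqNest]

lemma eqNest_succ (q : ℕ → ℕ) (p : ℕ) (mid : List (GateInstr m)) (i d : ℕ) :
    eqNest m q p mid i (d + 1) = eqStep m q p i ++ (eqNest m q p mid (i + 1) d ++ eqStep m q p i) := by
  simp [eqNest, List.range'_succ]

/-- All scratch qubits are `0`, except for the first one, which is `1`, and qubit `3` is `1`. -/
def IsClean (n : ℕ) (x : Bits m) : Prop :=
  bitAt x 2 = 1 ∧ bitAt x 3 = 1 ∧ ∀ j < n, bitAt x (36 * (j + 1) + 2) = 0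

/-- The qubits `q j` with `i ≤ j < n` hold the bits of `p`. -/
def BitsMatch (q : ℕ → ℕ) (p n i : ℕ) (x : Bits m) : Prop :=
  ∀ j, i ≤ j → j < n → (bitAt x (q j) = 1 ↔ p.testBit j = true)

noncomputable instance (q : ℕ → ℕ) (p n i : ℕ) (x : Bits m) : Decidable (BitsMatch q p n i x) :=
  Classical.propDecidable _

/-- The permutation of the basis states that is realized by `eqStep`. -/
def eqPerm (q : ℕ → ℕ) (p j : ℕ) (x : Bits m) : Bits m :=
  setBit x (36 * (j + 1) + 2) (bitAt x (36 * (j + 1) + 2) +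
    (bitAt x (q j) + if p.testBit j = true then 0 else bitAt x 2) * bitAt x (36 * j + 2))

variable {n : ℕ} {q : ℕ → ℕ} {u v : ℕ}

lemma EqTestAddr.runGates_eqStep (h : EqTestAddr m n q u v) {p j : ℕ} (hj : j < n) (ψ : QState m)
    (x : Bits m) : runGates (eqStep m q p j) ψ x = ψ (eqPerm q p j x) := by
  have h1 := h.size
  have h2 := h.q_chain j hj
  rw [eqStep, eqPerm]
  split_ifs with hp
  · rw [runGates_macro_ccx (h.q_lt j hj) (by omega) (by omega) (h2 _) (h2 _) (by omega)
      (h.q_one j hj) (by omega) (by omega) (by omega), add_zero]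
  · rw [runGates_macro_shifted (h.q_lt j hj) (by omega) (by omega) (h2 _) (h2 _) (by omega)
      (h.q_one j hj) (by omega) (by omega) (by omega) (by have := h2 0; omega) (by omega)]

lemma EqTestAddr.eqPerm_eqPerm (h : EqTestAddr m n q u v) {p j : ℕ} (hj : j < n)
    (x : Bits m) : eqPerm q p j (eqPerm q p j x) = x := by
  have h1 := h.size
  have h2 := h.q_chain j hj
  have h3 := h.q_lt j hj
  have e1 : ∀ w, bitAt (setBit x (36 * (j + 1) + 2) w) (q j) = bitAt x (q j) := fun w =>
    bitAt_setBit_ne _ _ h3 (by omega) (h2 _)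
  have e2 : ∀ w, bitAt (setBit x (36 * (j + 1) + 2) w) 2 = bitAt x 2 := fun w =>
    bitAt_setBit_ne _ _ (by omega) (by omega) (by omega)
  have e3 : ∀ w, bitAt (setBit x (36 * (j + 1) + 2) w) (36 * j + 2) = bitAt x (36 * j + 2) := fun w =>
    bitAt_setBit_ne _ _ (by omega) (by omega) (by omega)
  simp only [eqPerm, e1, e2, e3, bitAt_setBit_self, setBit_setBit, fin_two_add_add, setBit_bitAt]

open Classical in
lemma bitsMatch_succ {p i : ℕ} (hi : i < n)
    {x : Bits m} (hx : bitAt x 2 = 1) :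
    (if BitsMatch q p n i x then (1 : Fin 2) else 0) =
      (bitAt x (q i) + if p.testBit i = true then 0 else bitAt x 2) *
        if BitsMatch q p n (i + 1) x then 1 else 0 := by
  have h1 : BitsMatch q p n i x ↔ (bitAt x (q i) = 1 ↔ p.testBit i = true) ∧ BitsMatch q p n (i + 1) x := by
    constructor
    · exact fun h2 => ⟨h2 i le_rfl hi, fun j hj hjn => h2 j (by omega) hjn⟩
    · rintro ⟨h2, h3⟩ j hj hjn
      rcases Nat.eq_or_lt_of_le hj with rfl | hj'
      · exact h2
      · exact h3 j hj' hjn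
  rw [hx]
  simp only [h1]
  rcases (by omega : bitAt x (q i) = 0 ∨ bitAt x (q i) = 1) with h0 | h0 <;>
  cases p.testBit i <;> by_cases h4 : BitsMatch q p n (i + 1) x <;> simp [h0, h4]

/-- The permutation of the basis states that is realized by a nested test with the permutation `μ`
in the middle. -/
def eqNestPerm (q : ℕ → ℕ) (p : ℕ) (μ : Bits m → Bits m) :
    ℕ → ℕ → Bits m → Bits m
  | _, 0, x => μ x
  | i, d + 1, x => eqPerm q p i (eqNestPerm q p μ (i + 1) d (eqPerm q p i x))

lemma EqTestAddr.runGates_eqNest (h : EqTestAddr m n q u v) {p : ℕ} {mid : List (GateInstr m)}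
    {μ : Bits m → Bits m} (hμ : ∀ ψ x, runGates mid ψ x = ψ (μ x)) {i d : ℕ}
    (hd : i + d ≤ n) (ψ : QState m) (x : Bits m) :
    runGates (eqNest m q p mid i d) ψ x = ψ (eqNestPerm q p μ i d x) := by
  induction d generalizing i ψ x with
  | zero => rw [eqNest_zero, hμ]; rfl
  | succ d ih =>
    rw [eqNest_succ, runGates_append, runGates_append, h.runGates_eqStep (by omega),
      ih (by omega), h.runGates_eqStep (by omega)]
    rfl

lemma EqTestAddr.eqNestPerm_invol (h : EqTestAddr m n q u v) {p : ℕ}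
    {μ : Bits m → Bits m} (hμ : ∀ x, μ (μ x) = x) {i d : ℕ} (hd : i + d ≤ n)
    (x : Bits m) : eqNestPerm q p μ i d (eqNestPerm q p μ i d x) = x := by
  induction d generalizing i x with
  | zero => exact hμ x
  | succ d ih =>
    simp only [eqNestPerm]
    rw [h.eqPerm_eqPerm (by omega), ih (by omega), h.eqPerm_eqPerm (by omega)]

open Classical in
/-- The middle of a test may use the last scratch qubit, which holds the result. -/
lemma EqTestAddr.eqNestPerm_clean (h : EqTestAddr m n q u v) {p i d : ℕ} (hd : i + d = n)
    {x : Bits m} (hx : bitAt x 2 = 1)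
    (hc : ∀ j, i ≤ j → j < n → bitAt x (36 * (j + 1) + 2) = 0) :
    eqNestPerm q p (fun y => setBit y v (bitAt y v + bitAt y (36 * n + 2) * bitAt y u)) i d x
      = setBit x v (bitAt x v + (if BitsMatch q p n i x then 1 else 0) * bitAt x (36 * i + 2) *
        bitAt x u) := by
  have hs := h.size
  induction d generalizing i x with
  | zero =>
    obtain rfl : i = n := by omega
    have : BitsMatch q p i i x := fun j hj hjn => absurd hjn (by omega)
    rw [if_pos this, one_mul]; rfl
  | succ d ih =>
    set t := (bitAt x (q i) + if p.testBit i = true then 0 else bitAt x 2) * bitAt x (36 * i + 2)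
      with ht
    have e0 : eqPerm q p i x = setBit x (36 * (i + 1) + 2) t := by
      rw [eqPerm, hc i le_rfl (by omega), zero_add]
    have hb : ∀ a, a < m → a ≠ 36 * (i + 1) + 2 → ∀ w,
        bitAt (setBit x (36 * (i + 1) + 2) w) a = bitAt x a := fun a ha hne w =>
      bitAt_setBit_ne _ _ ha (by omega) hne
    have hm : BitsMatch q p n (i + 1) (setBit x (36 * (i + 1) + 2) t) ↔ BitsMatch q p n (i + 1) x := by
      refine forall_congr' fun j => forall_congr' fun _ => forall_congr' fun hj => ?_
      rw [hb _ (h.q_lt j hj) (h.q_chain j hj _)]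
    rw [eqNestPerm, e0, ih (by omega) (by rw [hb _ (by omega) (by omega), hx])
      (fun j hj hjn => by rw [hb _ (by omega) (by omega), hc j (by omega) hjn])]
    simp only [hm]
    rw [hb v h.v_lt (h.v_chain _), hb u h.u_lt (h.u_chain _), bitAt_setBit_self,
      bitsMatch_succ (i := i) (by omega) hx]
    set s := if BitsMatch q p n (i + 1) x then (1 : Fin 2) else 0
    set r := bitAt x v + s * t * bitAt x u with hr
    rw [setBit_comm _ _ _ (by omega) h.v_lt (h.v_chain _).symm]
    have hv : ∀ a, a < m → a ≠ v → bitAt (setBit x v r) a = bitAt x a := fun a ha hne =>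
      bitAt_setBit_ne _ _ ha h.v_lt hne
    have hb' : ∀ a, a < m → a ≠ 36 * (i + 1) + 2 → a ≠ v →
        bitAt (setBit (setBit x v r) (36 * (i + 1) + 2) t) a = bitAt x a := fun a ha hne hne' => by
      rw [bitAt_setBit_ne _ _ ha (by omega) hne, hv a ha hne']
    rw [eqPerm, bitAt_setBit_self, hb' _ (h.q_lt i (by omega)) (h.q_chain i (by omega) _)
      (h.q_v i (by omega)), hb' 2 (by omega) (by omega) (by have := h.v_chain 0; omega),
      hb' (36 * i + 2) (by omega) (by omega) (h.v_chain i).symm, ← ht, setBit_setBit]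
    have e1 : t + t = bitAt (setBit x v r) (36 * (i + 1) + 2) := by
      rw [hv _ (by omega) (h.v_chain _).symm, hc i le_rfl (by omega)]
      have : ∀ w : Fin 2, w + w = 0 := by decide
      exact this t
    rw [e1, setBit_bitAt, hr, ht]
    have key : ∀ a b c d : Fin 2, a * (b * c) * d = b * a * c * d := by decide
    rw [key]

end EqTest

section EqTestEffect

variable {m : ℕ} [NeZero m] {n : ℕ} {q : ℕ → ℕ} {u v : ℕ}

/-- The amplitudes of a state are concentrated on the clean basis states. -/
def CleanSupp (n : ℕ) (ψ : QState m) : Prop := ∀ x, ¬ IsClean n x → ψ x = 0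

lemma EqTestAddr.isClean_setBit (h : EqTestAddr m n q u v) (hv : v ≠ 3) {x : Bits m}
    {w : Fin 2} : IsClean n (setBit x v w) ↔ IsClean n x := by
  have hs := h.size
  have h2 := h.v_chain 0
  rw [IsClean, IsClean, bitAt_setBit_ne _ _ (by omega) h.v_lt (by omega),
    bitAt_setBit_ne _ _ (by omega) h.v_lt (by omega)]
  refine and_congr_right fun _ => and_congr_right fun _ => forall₂_congr fun j hj => ?_
  rw [bitAt_setBit_ne _ _ (by omega) h.v_lt (h.v_chain _).symm]

/-- The test adds `u` to `v` on the basis states in which the register holds `p`. -/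
lemma EqTestAddr.runGates_eqTest (h : EqTestAddr m n q u v) (hv : v ≠ 3) {p : ℕ} {ψ : QState m}
    (hψ : CleanSupp n ψ) (x : Bits m) :
    runGates (eqNest m q p (macroGates m 1 (36 * n + 2) u v) 0 n) ψ x
      = ψ (setBit x v (bitAt x v + (if BitsMatch q p n 0 x then 1 else 0) * bitAt x u)) := by
  have hs := h.size
  have hn := h.pos
  have hu : 36 * n + 2 ≠ u := by
    have := h.u_chain (n - 1)
    rw [show n - 1 + 1 = n by omega] at this
    exact this.symm
  set μ : Bits m → Bits m := fun y =>
    setBit y v (bitAt y v + bitAt y (36 * n + 2) * bitAt y u) with hμ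
  have hmid : ∀ ψ x, runGates (macroGates m 1 (36 * n + 2) u v) ψ x = ψ (μ x) :=
    runGates_macro_ccx (by omega) h.u_lt h.v_lt hu (h.v_chain n).symm h.u_v (by omega) h.u_one h.v_one
      (by omega)
  have hinv : ∀ x, μ (μ x) = x := by
    intro x
    simp only [hμ]
    rw [bitAt_setBit_self, bitAt_setBit_ne _ _ (by omega) h.v_lt (h.v_chain n).symm,
      bitAt_setBit_ne _ _ h.u_lt h.v_lt h.u_v, setBit_setBit, fin_two_add_add, setBit_bitAt]
  have hcl : ∀ y, IsClean n y → eqNestPerm q p μ 0 n y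
      = setBit y v (bitAt y v + (if BitsMatch q p n 0 y then 1 else 0) * bitAt y u) := by
    intro y hy
    rw [h.eqNestPerm_clean (by omega) hy.1 fun j _ hj => hy.2.2 j hj,
      show 36 * 0 + 2 = 2 from rfl, hy.1, mul_one]
  rw [h.runGates_eqNest hmid (by omega)]
  by_cases hx : IsClean n x
  · rw [hcl x hx]
  · rw [hψ _ fun h1 => hx ((h.isClean_setBit hv).1 h1), hψ]
    intro h1
    have h2 := hcl _ h1
    rw [h.eqNestPerm_invol hinv (by omega)] at h2
    rw [h2, h.isClean_setBit hv] at hx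
    exact hx h1

lemma EqTestAddr.cleanSupp_eqTest (h : EqTestAddr m n q u v) (hv : v ≠ 3) {p : ℕ} {ψ : QState m}
    (hψ : CleanSupp n ψ) :
    CleanSupp n (runGates (eqNest m q p (macroGates m 1 (36 * n + 2) u v) 0 n) ψ) := by
  intro x hx
  rw [h.runGates_eqTest hv hψ]
  exact hψ _ fun h1 => hx ((h.isClean_setBit hv).1 h1)

open Classical in
lemma EqTestAddr.runGates_eqNest_phase (h : EqTestAddr m n q u 3) {p i d : ℕ} (hd : i + d = n)
    {ψ : QState m} {x : Bits m} (hx : bitAt x 2 = 1)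
    (hc : ∀ j, i ≤ j → j < n → bitAt x (36 * (j + 1) + 2) = 0) :
    runGates (eqNest m q p (macroGates m 4 (36 * n + 2) u 3) i d) ψ x
      = (if bitAt x (36 * i + 2) * (if BitsMatch q p n i x then 1 else 0) = 1 ∧ bitAt x u = 1 ∧
          bitAt x 3 = 1 then -1 else 1) * ψ x := by
  have hs := h.size
  have hn := h.pos
  have hu : 36 * n + 2 ≠ u := by
    have := h.u_chain (n - 1)
    rw [show n - 1 + 1 = n by omega] at this
    exact this.symm
  induction d generalizing i ψ x with
  | zero =>
    obtain rfl : i = n := by omega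
    have : BitsMatch q p i i x := fun j hj hjn => absurd hjn (by omega)
    rw [eqNest_zero, if_pos this, mul_one]
    exact runGates_macro_ccz (by omega) h.u_lt h.v_lt hu (by omega) h.u_v (by omega) h.u_one (by omega)
      (by omega) ψ x
  | succ d ih =>
    rw [eqNest_succ, runGates_append, runGates_append, h.runGates_eqStep (by omega)]
    set t := (bitAt x (q i) + if p.testBit i = true then 0 else bitAt x 2) * bitAt x (36 * i + 2)
      with ht
    have e0 : eqPerm q p i x = setBit x (36 * (i + 1) + 2) t := by
      rw [eqPerm, hc i le_rfl (by omega), zero_add]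
    have hb : ∀ a, a < m → a ≠ 36 * (i + 1) + 2 → ∀ w,
        bitAt (setBit x (36 * (i + 1) + 2) w) a = bitAt x a := fun a ha hne w =>
      bitAt_setBit_ne _ _ ha (by omega) hne
    have hm : BitsMatch q p n (i + 1) (setBit x (36 * (i + 1) + 2) t) ↔ BitsMatch q p n (i + 1) x := by
      refine forall_congr' fun j => forall_congr' fun _ => forall_congr' fun hj => ?_
      rw [hb _ (h.q_lt j hj) (h.q_chain j hj _)]
    rw [ih (by omega) (by rw [e0, hb _ (by omega) (by omega), hx])
      (fun j hj hjn => by rw [e0, hb _ (by omega) (by omega), hc j (by omega) hjn]),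
      h.runGates_eqStep (by omega), h.eqPerm_eqPerm (by omega), e0]
    simp only [hm]
    rw [bitAt_setBit_self, hb u h.u_lt (h.u_chain _), hb 3 (by omega) (by omega),
      bitsMatch_succ (i := i) (by omega) hx, ht]
    have key : ∀ a b c : Fin 2, a * b * c = b * (a * c) := by decide
    rw [key]

/-- The test with a phase flip in the middle negates the amplitudes of the basis states in which
the register holds `p` and `u` is set. -/
lemma EqTestAddr.runGates_eqPhase (h : EqTestAddr m n q u 3) {p : ℕ} {ψ : QState m}
    (hψ : CleanSupp n ψ) (x : Bits m) :
    runGates (eqNest m q p (macroGates m 4 (36 * n + 2) u 3) 0 n) ψ x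
      = (if BitsMatch q p n 0 x ∧ bitAt x u = 1 then -1 else 1) * ψ x := by
  have hs := h.size
  have hn := h.pos
  by_cases hx : IsClean n x
  · rw [h.runGates_eqNest_phase (by omega) hx.1 fun j _ hj => hx.2.2 j hj,
      show 36 * 0 + 2 = 2 from rfl, hx.1, hx.2.1]
    congr 1
    by_cases h1 : BitsMatch q p n 0 x <;> simp [h1]
  · rw [hψ x hx, mul_zero]
    have hu : 36 * n + 2 ≠ u := by
      have := h.u_chain (n - 1)
      rw [show n - 1 + 1 = n by omega] at this
      exact this.symm
    have key : ∀ d i, i + d ≤ n → ∀ (ψ : QState m) x, ψ x = 0 →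
        runGates (eqNest m q p (macroGates m 4 (36 * n + 2) u 3) i d) ψ x = 0 := by
      intro d
      induction d with
      | zero =>
        intro i _ ψ x hx
        rw [eqNest_zero, runGates_macro_ccz (by omega) h.u_lt h.v_lt hu (by omega) h.u_v (by omega)
          h.u_one (by omega) (by omega), hx, mul_zero]
      | succ d ih =>
        intro i hi ψ x hx
        rw [eqNest_succ, runGates_append, runGates_append, h.runGates_eqStep (by omega)]
        refine ih (i + 1) (by omega) _ _ ?_
        rw [h.runGates_eqStep (by omega), h.eqPerm_eqPerm (by omega), hx]
    exact key n 0 (by omega) ψ x (hψ x hx)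

end EqTestEffect

/-! ### Hadamard gates on a register, and the diffusion operator -/

section Diffusion

variable {m : ℕ} [NeZero m]

lemma apply_sub_smul (g : GateInstr m) (t : ℂ) (ψ χ : QState m) :
    g.apply (fun x => ψ x - t * χ x) = fun x => g.apply ψ x - t * g.apply χ x := by
  obtain ⟨a, b, c⟩ := g
  ext x
  by_cases hab : a = b
  · subst hab; simp only [apply_idle]
  rcases (by omega : c = 0 ∨ c = 1 ∨ c = 2) with rfl | rfl | rfl
  · simp only [apply_H hab]; ring
  · simp only [apply_T hab]; ring
  · simp only [apply_CN hab]

lemma runGates_sub_smul (gs : List (GateInstr m)) (t : ℂ) (ψ χ : QState m) :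
    runGates gs (fun x => ψ x - t * χ x) = fun x => runGates gs ψ x - t * runGates gs χ x := by
  induction gs generalizing ψ χ with
  | nil => rfl
  | cons g gs ih => simp only [runGates_cons]; rw [apply_sub_smul, ih]

/-- Hadamard gates on the first qubits of a register, in increasing order, or idle gates. -/
def hLayer (m : ℕ) [NeZero m] (κ : ℕ) (q : ℕ → ℕ) (j : ℕ) : List (GateInstr m) :=
  (List.range j).flatMap fun i => macroGates m κ (q i) 1 1

/-- Hadamard gates on the first qubits of a register, in decreasing order, or idle gates. -/
def hLayerRev (m : ℕ) [NeZero m] (κ : ℕ) (q : ℕ → ℕ) (j : ℕ) : List (GateInstr m) :=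
  (List.range j).reverse.flatMap fun i => macroGates m κ (q i) 1 1

/-- The basis state in which the first qubits of a register are set to the binary digits of `z`. -/
def setReg (q : ℕ → ℕ) (z : ℕ) : ℕ → Bits m → Bits m
  | 0, x => x
  | j + 1, x => setBit (setReg q z j x) (q j) (if z.testBit j = true then 1 else 0)

variable {n : ℕ} {q : ℕ → ℕ}

lemma hLayer_succ (κ : ℕ) (j : ℕ) :
    hLayer m κ q (j + 1) = hLayer m κ q j ++ macroGates m κ (q j) 1 1 := by
  simp [hLayer, List.range_succ]

lemma hLayerRev_succ (κ : ℕ) (j : ℕ) :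
    hLayerRev m κ q (j + 1) = macroGates m κ (q j) 1 1 ++ hLayerRev m κ q j := by
  simp [hLayerRev, List.range_succ]

lemma runGates_hLayer_idle (j : ℕ) (ψ : QState m) : runGates (hLayer m 0 q j) ψ = ψ := by
  induction j with
  | zero => rfl
  | succ j ih => rw [hLayer_succ, runGates_append, ih, runGates_macro_idle rfl]

lemma runGates_hLayerRev_idle (j : ℕ) (ψ : QState m) : runGates (hLayerRev m 0 q j) ψ = ψ := by
  induction j with
  | zero => rfl
  | succ j ih => rw [hLayerRev_succ, runGates_append, runGates_macro_idle rfl, ih]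

/-- The addresses of a register: distinct qubits that may carry Hadamard gates. -/
structure RegAddr (m n : ℕ) (q : ℕ → ℕ) : Prop where
  one_lt : 1 < m
  lt : ∀ j < n, q j < m
  ne_one : ∀ j < n, q j ≠ 1
  inj : ∀ i < n, ∀ j < n, q i = q j → i = j

lemma RegAddr.mono (h : RegAddr m n q) {j : ℕ} (hj : j ≤ n) : RegAddr m j q where
  one_lt := h.one_lt
  lt i hi := h.lt i (by omega)
  ne_one i hi := h.ne_one i (by omega)
  inj i hi i' hi' := h.inj i (by omega) i' (by omega)

lemma bitAt_setReg_of_ne {a : ℕ} (ha : a < m) {j : ℕ} (hq : ∀ i < j, q i < m ∧ a ≠ q i) (z : ℕ)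
    (x : Bits m) : bitAt (setReg q z j x) a = bitAt x a := by
  induction j with
  | zero => rfl
  | succ j ih =>
    rw [setReg, bitAt_setBit_ne _ _ ha (hq j (by omega)).1 (hq j (by omega)).2,
      ih fun i hi => hq i (by omega)]

lemma RegAddr.bitAt_setReg (h : RegAddr m n q) (z : ℕ) (x : Bits m) {i : ℕ} (hi : i < n) :
    bitAt (setReg q z n x) (q i) = if z.testBit i = true then 1 else 0 := by
  induction n with
  | zero => omega
  | succ n ih =>
    rw [setReg]
    rcases Nat.lt_succ_iff_lt_or_eq.1 hi with h1 | rfl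
    · rw [bitAt_setBit_ne _ _ (h.lt i (by omega)) (h.lt n (by omega)), ih (h.mono (by omega)) h1]
      intro h2
      have := h.inj i (by omega) n (by omega) h2
      omega
    · rw [bitAt_setBit_self]

lemma setReg_setBit {j a : ℕ} (ha : a < m) (hq : ∀ i < j, q i < m ∧ a ≠ q i) (z : ℕ) (b : Fin 2)
    (x : Bits m) : setReg q z j (setBit x a b) = setBit (setReg q z j x) a b := by
  induction j with
  | zero => rfl
  | succ j ih =>
    rw [setReg, ih fun i hi => hq i (by omega), setReg,
      setBit_comm _ _ _ ha (hq j (by omega)).1 (hq j (by omega)).2]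

lemma RegAddr.setReg_setReg (h : RegAddr m n q) (z z' : ℕ) (x : Bits m) :
    setReg q z n (setReg q z' n x) = setReg q z n x := by
  induction n with
  | zero => rfl
  | succ n ih =>
    have h1 : ∀ i < n, q i < m ∧ q n ≠ q i := fun i hi => ⟨h.lt i (by omega), fun h2 => by
      have := h.inj n (by omega) i (by omega) h2
      omega⟩
    rw [setReg, setReg, setReg_setBit (h.lt n (by omega)) h1, setBit_setBit, ih (h.mono (by omega)), setReg]

lemma RegAddr.runGates_hLayerRev_hLayer (h : RegAddr m n q) (ψ : QState m) :
    runGates (hLayerRev m 3 q n) (runGates (hLayer m 3 q n) ψ) = ψ := by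
  induction n with
  | zero => rfl
  | succ n ih =>
    rw [hLayer_succ, hLayerRev_succ, runGates_append, runGates_append]
    have h1 : ∀ ψ : QState m, runGates (macroGates m 3 (q n) 1 1)
        (runGates (macroGates m 3 (q n) 1 1) ψ) = ψ := by
      intro ψ
      ext x
      have h2 := hadamard_factor_sq
      have hH := fun (ψ : QState m) x => runGates_macro_H (b := 1) (c := 1) (h.lt n (by omega))
        (h.ne_one n (by omega)) h.one_lt ψ x
      simp only [hH, bitAt_setBit_self, setBit_setBit]
      generalize ((1 / Real.sqrt 2 : ℝ) : ℂ) = s at *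
      rcases (by omega : bitAt x (q n) = 0 ∨ bitAt x (q n) = 1) with h0 | h0
      · have e : setBit x (q n) 0 = x := by rw [← h0, setBit_bitAt]
        simp only [h0, e, if_true, one_ne_zero, if_false]
        linear_combination (2 * ψ x) * h2
      · have e : setBit x (q n) 1 = x := by rw [← h0, setBit_bitAt]
        simp only [h0, e, if_true, one_ne_zero, if_false]
        linear_combination (2 * ψ x) * h2
    rw [h1, ih (h.mono (by omega))]

/-- The amplitudes of a layer of Hadamard gates on the zero state of the register. -/
lemma RegAddr.runGates_hLayer_zero (h : RegAddr m n q) (ψ : QState m) {x : Bits m}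
    (hx : ∀ j < n, bitAt x (q j) = 0) :
    runGates (hLayer m 3 q n) ψ x =
      ((1 / Real.sqrt 2 : ℝ) : ℂ) ^ n * ∑ z ∈ range (2 ^ n), ψ (setReg q z n x) := by
  induction n generalizing x with
  | zero => simp [hLayer, setReg]
  | succ n ih =>
    have h1 : ∀ i < n, q i < m ∧ q n ≠ q i := fun i hi => ⟨h.lt i (by omega), fun h2 => by
      have := h.inj n (by omega) i (by omega) h2
      omega⟩
    have hb : ∀ b, ∀ j < n, bitAt (setBit x (q n) b) (q j) = 0 := fun b j hj => by
      rw [bitAt_setBit_ne _ _ (h1 j hj).1 (h.lt n (by omega)) (h1 j hj).2.symm, hx j (by omega)]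
    rw [hLayer_succ, runGates_append, runGates_macro_H (h.lt n (by omega)) (h.ne_one n (by omega))
      h.one_lt, hx n (by omega), if_pos rfl, one_mul, ih (h.mono (by omega)) (hb 0),
      ih (h.mono (by omega)) (hb 1), pow_succ (2 : ℕ), mul_two, Finset.sum_range_add, pow_succ]
    have e1 : ∀ z ∈ range (2 ^ n), ψ (setReg q z n (setBit x (q n) 0)) = ψ (setReg q z (n + 1) x) := by
      intro z hz
      rw [setReg, setReg_setBit (h.lt n (by omega)) h1,
        Nat.testBit_lt_two_pow (mem_range.1 hz), if_neg (by simp)]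
    have e3 : ∀ z, ∀ j ≤ n, ∀ y : Bits m, setReg q (2 ^ n + z) j y = setReg q z j y := by
      intro z j hj y
      induction j with
      | zero => rfl
      | succ j ih' => rw [setReg, setReg, ih' (by omega), Nat.testBit_two_pow_add_gt (by omega)]
    have e2 : ∀ z ∈ range (2 ^ n),
        ψ (setReg q z n (setBit x (q n) 1)) = ψ (setReg q (2 ^ n + z) (n + 1) x) := by
      intro z hz
      rw [setReg, e3 z n le_rfl, setReg_setBit (h.lt n (by omega)) h1,
        Nat.testBit_two_pow_add_eq, Nat.testBit_lt_two_pow (mem_range.1 hz), if_pos (by simp)]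
    rw [sum_congr rfl e1, sum_congr rfl e2]
    ring

/-- A layer of Hadamard gates on a state in which the register is zero. -/
lemma RegAddr.runGates_hLayerRev_of_zero (h : RegAddr m n q) {ψ : QState m}
    (hψ : ∀ x, (∃ j < n, bitAt x (q j) ≠ 0) → ψ x = 0) (x : Bits m) :
    runGates (hLayerRev m 3 q n) ψ x = ((1 / Real.sqrt 2 : ℝ) : ℂ) ^ n * ψ (setReg q 0 n x) := by
  induction n generalizing ψ x with
  | zero => simp [hLayerRev, setReg]
  | succ n ih =>
    have h1 : ∀ i < n, q i < m ∧ q i ≠ q n := fun i hi => ⟨h.lt i (by omega), fun h2 => by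
      have := h.inj i (by omega) n (by omega) h2
      omega⟩
    have hH := fun x => runGates_macro_H (b := 1) (c := 1) (h.lt n (by omega))
        (h.ne_one n (by omega)) h.one_lt ψ x
    rw [hLayerRev_succ, runGates_append, ih (h.mono (by omega)), hH, setReg, Nat.zero_testBit,
      if_neg Bool.false_ne_true, hψ (setBit _ _ 1) ⟨n, by omega, by rw [bitAt_setBit_self]; exact one_ne_zero⟩, mul_zero,
      add_zero, pow_succ]
    · ring
    · rintro y ⟨j, hj, hy⟩
      have h2 : ∀ b, ψ (setBit y (q n) b) = 0 := fun b => hψ _ ⟨j, by omega, by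
        rwa [bitAt_setBit_ne _ _ (h1 j hj).1 (h.lt n (by omega)) (h1 j hj).2]⟩
      rw [hH, h2, h2]; ring

lemma RegAddr.runGates_hLayer_of_zero (h : RegAddr m n q) {ψ : QState m}
    (hψ : ∀ x, (∃ j < n, bitAt x (q j) ≠ 0) → ψ x = 0) (x : Bits m) :
    runGates (hLayer m 3 q n) ψ x = ((1 / Real.sqrt 2 : ℝ) : ℂ) ^ n * ψ (setReg q 0 n x) := by
  induction n generalizing ψ x with
  | zero => simp [hLayer, setReg]
  | succ n ih =>
    have h1 : ∀ i < n, q i < m ∧ q n ≠ q i := fun i hi => ⟨h.lt i (by omega), fun h2 => by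
      have := h.inj n (by omega) i (by omega) h2
      omega⟩
    have h3 : ∀ x, runGates (hLayer m 3 q n) ψ x =
        ((1 / Real.sqrt 2 : ℝ) : ℂ) ^ n * ψ (setReg q 0 n x) := fun x =>
      ih (h.mono (by omega)) (fun x ⟨j, hj, hx⟩ => hψ x ⟨j, by omega, hx⟩) x
    rw [hLayer_succ, runGates_append, runGates_macro_H (h.lt n (by omega)) (h.ne_one n (by omega))
      h.one_lt, h3, h3, setReg_setBit (h.lt n (by omega)) h1, setReg_setBit (h.lt n (by omega)) h1,
      hψ (setBit _ _ 1) ⟨n, by omega, by rw [bitAt_setBit_self]; exact one_ne_zero⟩, setReg, Nat.zero_testBit,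
      if_neg Bool.false_ne_true, mul_zero, mul_zero, add_zero, pow_succ]
    ring

lemma cleanSupp_hLayer {q : ℕ → ℕ} (h : RegAddr m n q) {N : ℕ} (hN : 36 * N + 3 < m)
    (hq : ∀ j < n, q j ≠ 3 ∧ ∀ i, q j ≠ 36 * i + 2) {ψ : QState m} (hψ : CleanSupp N ψ) :
    CleanSupp N (runGates (hLayer m 3 q n) ψ) := by
  induction n with
  | zero => exact hψ
  | succ n ih =>
    intro x hx
    rw [hLayer_succ, runGates_append, runGates_macro_H (h.lt n (by omega)) (h.ne_one n (by omega))
      h.one_lt]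
    have h0 := ih (h.mono (by omega)) fun j hj => hq j (by omega)
    have h2 := hq n (by omega)
    have h3 := h.lt n (by omega)
    have h1 : ∀ b, ¬ IsClean N (setBit x (q n) b) := by
      intro b hb
      refine hx ⟨?_, ?_, fun j hj => ?_⟩
      · rw [← hb.1, bitAt_setBit_ne _ _ (by omega) h3 (h2.2 0).symm]
      · rw [← hb.2.1, bitAt_setBit_ne _ _ (by omega) h3 h2.1.symm]
      · rw [← hb.2.2 j hj, bitAt_setBit_ne _ _ (by omega) h3 (h2.2 _).symm]
    rw [h0 _ (h1 0), h0 _ (h1 1)]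
    ring

open Classical in
/-- Hadamard gates, a phase flip of the zero state of the register, and Hadamard gates again: twice
the mean over the register is subtracted. -/
lemma runGates_diffusion {u : ℕ} (hq : RegAddr m n q) (h : EqTestAddr m n q u 3) {ψ : QState m}
    (hψ : CleanSupp n ψ) (hu : u = 2) (x : Bits m) :
    runGates (hLayer m 3 q n ++ (eqNest m q 0 (macroGates m 4 (36 * n + 2) u 3) 0 n ++
      hLayerRev m 3 q n)) ψ x
      = ψ x - 2 * ((1 / 2 : ℂ) ^ n * if IsClean n x then
          ∑ z ∈ range (2 ^ n), ψ (setReg q z n x) else 0) := by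
  classical
  subst hu
  have hs := h.size
  set χ := runGates (hLayer m 3 q n) ψ with hχ
  have hχc : CleanSupp n χ := cleanSupp_hLayer hq hs
    (fun j hj => ⟨h.q_v j hj, h.q_chain j hj⟩) hψ
  rw [runGates_append, runGates_append, ← hχ]
  have hP : runGates (eqNest m q 0 (macroGates m 4 (36 * n + 2) 2 3) 0 n) χ
      = fun x => χ x - 2 * (if BitsMatch q 0 n 0 x ∧ IsClean n x then χ x else 0) := by
    ext y
    rw [h.runGates_eqPhase hχc]
    by_cases hy : IsClean n y
    · have := hy.1
      by_cases h1 : BitsMatch q 0 n 0 y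
      · simp only [h1, hy, this, and_self, if_true]; ring
      · simp [h1]
    · simp [hχc y hy]
  have hclr : ∀ j < n, bitAt (setReg q 0 n x) (q j) = 0 := fun j hj => by
    rw [hq.bitAt_setReg _ _ hj, Nat.zero_testBit, if_neg (by simp)]
  have hbm : BitsMatch q 0 n 0 (setReg q 0 n x) := fun j _ hj => by
    rw [hclr j hj, Nat.zero_testBit]; simp
  have hcl : IsClean n (setReg q 0 n x) ↔ IsClean n x := by
    have e : ∀ a, a < m → (∀ i < n, a ≠ q i) → bitAt (setReg q 0 n x) a = bitAt x a :=
      fun a ha hne => bitAt_setReg_of_ne ha (fun i hi => ⟨hq.lt i hi, hne i hi⟩) _ _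
    rw [IsClean, IsClean, e 2 (by omega) (fun i hi => (h.q_chain i hi 0).symm),
      e 3 (by omega) (fun i hi => (h.q_v i hi).symm)]
    refine and_congr_right fun _ => and_congr_right fun _ => forall₂_congr fun j hj => ?_
    rw [e _ (by omega) (fun i hi => (h.q_chain i hi _).symm)]
  rw [hP, runGates_sub_smul, hq.runGates_hLayerRev_hLayer]
  dsimp only
  rw [hq.runGates_hLayerRev_of_zero]
  · simp only [hbm, hcl, true_and]
    have hsq : ((1 / Real.sqrt 2 : ℝ) : ℂ) ^ n * ((1 / Real.sqrt 2 : ℝ) : ℂ) ^ n = (1 / 2 : ℂ) ^ n := by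
      rw [← mul_pow, hadamard_factor_sq]
    split_ifs with h1
    · rw [hχ, hq.runGates_hLayer_zero ψ hclr]
      simp only [hq.setReg_setReg]
      rw [← hsq]
      ring
    · ring
  · rintro y ⟨j, hj, hy⟩
    rw [if_neg]
    rintro ⟨h1, -⟩
    have := h1 j (by omega) hj
    rw [Nat.zero_testBit] at this
    have h3 : bitAt y (q j) = 1 := by omega
    simp [h3] at this

end Diffusion

/-! ### The circuits of the search -/

section Search

variable {m : ℕ} [NeZero m] {n : ℕ}

/-- A test on a register, possibly between layers of Hadamard gates. -/
def testGates (m n : ℕ) [NeZero m] (κ₁ : ℕ) (q : ℕ → ℕ) (p κ u v κ₂ : ℕ) : List (GateInstr m) :=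
  hLayer m κ₁ q n ++ (eqNest m q p (macroGates m κ (36 * n + 2) u v) 0 n ++ hLayerRev m κ₂ q n)

/-- The index register of copy `c`. -/
def idxAddr (c j : ℕ) : ℕ := 36 * j + 20 + c

/-- The flags of copy `c`. -/
def flagAddr (c j : ℕ) : ℕ := 36 * j + 28 + c

/-- The qubits that accumulate the conjunction of the verdicts of the copies; the last one is
qubit `0`. -/
def verdictAddr (c : ℕ) : ℕ := if c = 0 then 2 else if c = 8 then 0 else 12 + c

/-- A circuit for each copy. -/
def forCopies (C : ℕ) (G : ℕ → List (GateInstr m)) : List (GateInstr m) := (List.range C).flatMap G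

lemma forCopies_succ (C : ℕ) (G : ℕ → List (GateInstr m)) :
    forCopies (C + 1) G = forCopies C G ++ G C := by
  simp [forCopies, List.range_succ]

lemma runGates_testGates_idle (q : ℕ → ℕ) (p κ u v : ℕ) (ψ : QState m) :
    runGates (testGates m n 0 q p κ u v 0) ψ
      = runGates (eqNest m q p (macroGates m κ (36 * n + 2) u v) 0 n) ψ := by
  rw [testGates, runGates_append, runGates_append, runGates_hLayer_idle, runGates_hLayerRev_idle]

/-- The content of the index register of copy `c`. -/
def idxVal (n c : ℕ) (x : Bits m) : ℕ := Nat.ofBits fun j : Fin n => decide (bitAt x (idxAddr c j) = 1)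

lemma idxVal_lt (c : ℕ) (x : Bits m) : idxVal n c x < 2 ^ n := Nat.ofBits_lt_two_pow _

lemma testBit_idxVal (c : ℕ) (x : Bits m) {j : ℕ} (hj : j < n) :
    (idxVal n c x).testBit j = decide (bitAt x (idxAddr c j) = 1) :=
  Nat.testBit_ofBits_lt _ j hj

lemma bitsMatch_idxAddr {c p : ℕ} (hp : p < 2 ^ n) (x : Bits m) :
    BitsMatch (idxAddr c) p n 0 x ↔ idxVal n c x = p := by
  constructor
  · intro h
    refine Nat.eq_of_testBit_eq fun j => ?_
    by_cases hj : j < n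
    · rw [testBit_idxVal c x hj, Bool.eq_iff_iff, decide_eq_true_iff]
      exact h j (Nat.zero_le j) hj
    · have hn : 2 ^ n ≤ 2 ^ j := Nat.pow_le_pow_right (by omega) (by omega)
      rw [Nat.testBit_lt_two_pow ((idxVal_lt c x).trans_le hn), Nat.testBit_lt_two_pow (hp.trans_le hn)]
  · rintro rfl j _ hj
    rw [testBit_idxVal c x hj, decide_eq_true_iff]

lemma idxVal_congr {c : ℕ} {x y : Bits m}
    (h : ∀ j < n, bitAt x (idxAddr c j) = bitAt y (idxAddr c j)) : idxVal n c x = idxVal n c y := by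
  rw [idxVal, idxVal]
  congr 1
  ext j
  rw [h j j.2]

/-- The basis state in which `X i` is added to the qubit `base + c` of each copy `c < C` with index
`i`, if the qubit `ua c` is set. -/
def shiftReg (base : ℕ) (ua : ℕ → ℕ) (n C : ℕ) (X : ℕ → Fin 2) (x : Bits m) : Bits m :=
  fun i => x i + if base ≤ (i : ℕ) ∧ (i : ℕ) < base + C then
    bitAt x (ua (i - base)) * X (idxVal n (i - base) x) else 0

lemma bitAt_shiftReg {base : ℕ} {ua : ℕ → ℕ} {C : ℕ} {X : ℕ → Fin 2} {x : Bits m} {a : ℕ}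
    (ha : a < m) : bitAt (shiftReg base ua n C X x) a = bitAt x a +
      if base ≤ a ∧ a < base + C then bitAt x (ua (a - base)) * X (idxVal n (a - base) x) else 0 := by
  simp only [bitAt, shiftReg, Fin.ofNat, Nat.mod_eq_of_lt ha]

/-- Shifts that do not interfere with their own controls. -/
structure ShiftAddr (m n base : ℕ) (ua : ℕ → ℕ) : Prop where
  size : 36 * (n + 1) ≤ m
  idx : ∀ j < n, ∀ c < 8, idxAddr c j < base ∨ base + 8 ≤ idxAddr c j
  ua_lt : ∀ c < 8, ua c < m
  ua_base : ∀ c < 8, ua c < base ∨ base + 8 ≤ ua c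

lemma idxAddr_lt {c j : ℕ} (hm : 36 * (n + 1) ≤ m) (hc : c < 8) (hj : j < n) :
    idxAddr c j < m := by
  unfold idxAddr; omega

lemma ShiftAddr.idxVal_shiftReg {base : ℕ} {ua : ℕ → ℕ} (h : ShiftAddr m n base ua) {C : ℕ}
    (hC : C ≤ 8) {X : ℕ → Fin 2} {x : Bits m} {c : ℕ} (hc : c < 8) :
    idxVal n c (shiftReg base ua n C X x) = idxVal n c x := by
  refine idxVal_congr fun j hj => ?_
  have := h.idx j hj c hc
  rw [bitAt_shiftReg (idxAddr_lt h.size hc hj), if_neg (by omega), add_zero]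

lemma ShiftAddr.bitAt_shiftReg_ua {base : ℕ} {ua : ℕ → ℕ} (h : ShiftAddr m n base ua) {C : ℕ}
    (hC : C ≤ 8) {X : ℕ → Fin 2} {x : Bits m} {c : ℕ} (hc : c < 8) :
    bitAt (shiftReg base ua n C X x) (ua c) = bitAt x (ua c) := by
  have := h.ua_base c hc
  rw [bitAt_shiftReg (h.ua_lt c hc), if_neg (by omega), add_zero]

lemma ShiftAddr.shiftReg_shiftReg {base : ℕ} {ua : ℕ → ℕ} (h : ShiftAddr m n base ua)
    (X Y : ℕ → Fin 2) (x : Bits m) :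
    shiftReg base ua n 8 X (shiftReg base ua n 8 Y x) = shiftReg base ua n 8 (fun v => Y v + X v) x := by
  refine ext_bitAt fun a ha => ?_
  rw [bitAt_shiftReg ha, bitAt_shiftReg ha, bitAt_shiftReg ha]
  split_ifs with h1
  · rw [h.bitAt_shiftReg_ua le_rfl (by omega), h.idxVal_shiftReg le_rfl (by omega)]
    have key : ∀ a b c d : Fin 2, a + b * c + b * d = a + b * (c + d) := by decide
    exact key _ _ _ _
  · rw [add_zero, add_zero]

lemma shiftReg_zero (base : ℕ) (ua : ℕ → ℕ) (C : ℕ) (x : Bits m) :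
    shiftReg base ua n C (fun _ => 0) x = x := by
  ext i
  simp [shiftReg]

/-- Tests of all index registers against `p`, with distinct targets. -/
lemma runGates_tests {base : ℕ} {ua : ℕ → ℕ} (h : ShiftAddr m n base ua) (hb : base + 8 ≤ m)
    (hb3 : base ≠ 3) (h3 : base < 3 → base + 8 ≤ 3)
    (ha : ∀ c < 8, EqTestAddr m n (idxAddr c) (ua c) (base + c)) {p : ℕ} (hp : p < 2 ^ n)
    {ψ : QState m} (hψ : CleanSupp n ψ) {C : ℕ} (hC : C ≤ 8) :
    CleanSupp n (runGates (forCopies C fun c => testGates m n 0 (idxAddr c) p 1 (ua c) (base + c) 0) ψ) ∧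
    ∀ x, runGates (forCopies C fun c => testGates m n 0 (idxAddr c) p 1 (ua c) (base + c) 0) ψ x
      = ψ (shiftReg base ua n C (fun v => if v = p then 1 else 0) x) := by
  induction C with
  | zero =>
    refine ⟨hψ, fun x => congrArg ψ ?_⟩
    ext i
    simp only [shiftReg]
    rw [if_neg (by omega), add_zero]
  | succ C ih =>
    obtain ⟨h1, h2⟩ := ih (by omega)
    have hne : base + C ≠ 3 := by omega
    rw [forCopies_succ, runGates_append, runGates_testGates_idle]
    refine ⟨(ha C (by omega)).cleanSupp_eqTest hne h1, fun x => ?_⟩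
    rw [(ha C (by omega)).runGates_eqTest hne h1, h2]
    congr 1
    set y := setBit x (base + C) (bitAt x (base + C) +
      (if BitsMatch (idxAddr C) p n 0 x then 1 else 0) * bitAt x (ua C)) with hy
    have hya : ∀ a < m, a ≠ base + C → bitAt y a = bitAt x a := fun a ha' hne' =>
      bitAt_setBit_ne _ _ ha' (by omega) hne'
    have hyi : ∀ c < 8, idxVal n c y = idxVal n c x := fun c hc => idxVal_congr fun j hj =>
      hya _ (idxAddr_lt h.size hc hj) (by have := h.idx j hj c hc; omega)
    refine ext_bitAt fun a ha' => ?_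
    rw [bitAt_shiftReg ha', bitAt_shiftReg ha']
    by_cases e : a = base + C
    · subst e
      rw [if_neg (by omega), if_pos (by omega), add_zero, hy, bitAt_setBit_self, Nat.add_sub_cancel_left,
        mul_comm]
      simp only [bitsMatch_idxAddr hp]
    · rw [hya a ha' e]
      by_cases e2 : base ≤ a ∧ a < base + C
      · rw [if_pos e2, if_pos (show base ≤ a ∧ a < base + (C + 1) by omega), hyi _ (by omega),
          hya _ (h.ua_lt _ (by omega)) (by have := h.ua_base (a - base) (by omega); omega)]
      · rw [if_neg e2, if_neg (by omega)]

/-- The circuits for the bits of a word that are `1`, where `i` is the position of the first bit. -/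
def wordGates (G : ℕ → List (GateInstr m)) : ℕ → List Bool → List (GateInstr m)
  | _, [] => []
  | i, β :: bs => (if β = true then G i else []) ++ wordGates G (i + 1) bs

/-- The bits of a word as a function of the position. -/
def bitsFn : ℕ → List Bool → ℕ → Fin 2
  | _, [], _ => 0
  | i, β :: bs, v => (if β = true ∧ v = i then 1 else 0) + bitsFn (i + 1) bs v

lemma bitsFn_eq (i : ℕ) (bs : List Bool) (v : ℕ) :
    bitsFn i bs v = if i ≤ v ∧ bs[v - i]? = some true then 1 else 0 := by
  induction bs generalizing i with
  | nil => simp [bitsFn]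
  | cons β bs ih =>
    rw [bitsFn, ih]
    rcases lt_trichotomy v i with h | h | h
    · rw [if_neg (by omega), if_neg (by omega), if_neg (by omega)]; rfl
    · subst h
      rw [if_neg (show ¬ (v + 1 ≤ v ∧ _) by omega)]
      simp
    · rw [if_neg (by omega), zero_add, show v - i = (v - (i + 1)) + 1 by omega, List.getElem?_cons_succ]
      simp only [show i + 1 ≤ v from h, show i ≤ v from h.le]

lemma runGates_word_tests {base : ℕ} {ua : ℕ → ℕ} (h : ShiftAddr m n base ua) (hb : base + 8 ≤ m)
    (hb3 : base ≠ 3) (h3 : base < 3 → base + 8 ≤ 3)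
    (ha : ∀ c < 8, EqTestAddr m n (idxAddr c) (ua c) (base + c)) {i : ℕ} {bs : List Bool}
    (hi : i + bs.length ≤ 2 ^ n) {ψ : QState m} (hψ : CleanSupp n ψ) :
    CleanSupp n (runGates (wordGates (fun p => forCopies 8 fun c =>
      testGates m n 0 (idxAddr c) p 1 (ua c) (base + c) 0) i bs) ψ) ∧
    ∀ x, runGates (wordGates (fun p => forCopies 8 fun c =>
      testGates m n 0 (idxAddr c) p 1 (ua c) (base + c) 0) i bs) ψ x
      = ψ (shiftReg base ua n 8 (bitsFn i bs) x) := by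
  induction bs generalizing i ψ with
  | nil => exact ⟨hψ, fun x => congrArg ψ (shiftReg_zero base ua 8 x).symm⟩
  | cons β bs ih =>
    rw [List.length_cons] at hi
    rw [wordGates, runGates_append]
    cases β
    · obtain ⟨h1, h2⟩ := ih (i := i + 1) (by omega) hψ
      refine ⟨h1, fun x => ?_⟩
      rw [if_neg Bool.false_ne_true, runGates_nil, h2]
      congr 1
      simp [bitsFn]
    · rw [if_pos rfl]
      obtain ⟨h1, h2⟩ := runGates_tests h hb hb3 h3 ha (p := i) (by omega) hψ le_rfl
      obtain ⟨h1', h2'⟩ := ih (i := i + 1) (by omega) h1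
      refine ⟨h1', fun x => ?_⟩
      rw [h2', h2, h.shiftReg_shiftReg]
      congr 2
      ext v
      simp [bitsFn, add_comm]

/-- The sign of a bit. -/
def bitSign (b : Fin 2) : ℝ := if b = 1 then -1 else 1

lemma bitSign_add (a b : Fin 2) : bitSign (a + b) = bitSign a * bitSign b := by
  unfold bitSign
  rcases (by omega : a = 0 ∨ a = 1) with rfl | rfl <;>
  rcases (by omega : b = 0 ∨ b = 1) with rfl | rfl <;> norm_num

lemma runGates_phases (ha : ∀ c < 8, EqTestAddr m n (idxAddr c) (4 + c) 3) {p : ℕ}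
    (hp : p < 2 ^ n) {ψ : QState m} (hψ : CleanSupp n ψ) {C : ℕ} (hC : C ≤ 8) (x : Bits m) :
    runGates (forCopies C fun c => testGates m n 0 (idxAddr c) p 4 (4 + c) 3 0) ψ x
      = ((∏ c ∈ range C, bitSign (bitAt x (4 + c) * if idxVal n c x = p then 1 else 0) : ℝ) : ℂ)
        * ψ x := by
  induction C generalizing x with
  | zero => simp [forCopies]
  | succ C ih =>
    have hcl : CleanSupp n (runGates (forCopies C fun c => testGates m n 0 (idxAddr c) p 4 (4 + c) 3 0) ψ) :=
      fun y hy => by rw [ih (by omega), hψ y hy, mul_zero]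
    rw [forCopies_succ, runGates_append, runGates_testGates_idle,
      (ha C (by omega)).runGates_eqPhase hcl, ih (by omega), ← mul_assoc, Finset.prod_range_succ]
    congr 1
    rw [mul_comm, Complex.ofReal_mul]
    congr 1
    simp only [bitsMatch_idxAddr hp, bitSign]
    by_cases h1 : idxVal n C x = p <;> by_cases h2 : bitAt x (4 + C) = 1 <;> simp [h1, h2]

lemma runGates_word_phases (ha : ∀ c < 8, EqTestAddr m n (idxAddr c) (4 + c) 3) {i : ℕ}
    {bs : List Bool} (hi : i + bs.length ≤ 2 ^ n) {ψ : QState m} (hψ : CleanSupp n ψ)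
    (x : Bits m) :
    runGates (wordGates (fun p => forCopies 8 fun c =>
      testGates m n 0 (idxAddr c) p 4 (4 + c) 3 0) i bs) ψ x
      = ((∏ c ∈ range 8, bitSign (bitAt x (4 + c) * bitsFn i bs (idxVal n c x)) : ℝ) : ℂ)
        * ψ x := by
  induction bs generalizing i ψ with
  | nil => simp [wordGates, bitsFn, bitSign]
  | cons β bs ih =>
    rw [List.length_cons] at hi
    rw [wordGates, runGates_append]
    cases β
    · rw [if_neg Bool.false_ne_true, runGates_nil, ih (by omega) hψ]
      simp [bitsFn]
    · have h1 := fun x => runGates_phases ha (p := i) (by omega) hψ le_rfl x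
      rw [if_pos rfl, ih (by omega) fun y hy => by rw [h1, hψ y hy, mul_zero], h1, ← mul_assoc,
        ← Complex.ofReal_mul, ← Finset.prod_mul_distrib]
      congr 2
      refine prod_congr rfl fun c _ => ?_
      rw [bitsFn, ← bitSign_add]
      congr 1
      have key : ∀ a b d : Fin 2, a * b + a * d = a * (d + b) := by decide
      rw [key]
      simp only [true_and]

end Search

/-! ### The amplitudes during the search -/

section Amplitudes

variable {m : ℕ} [NeZero m] {n : ℕ}

/-- The qubits of the index registers and of the flags. -/
def IsRegAddr (n a : ℕ) : Prop := 20 ≤ a % 36 ∧ a / 36 < n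

/-- The basis states that occur at the beginning of block `b`: apart from the index registers, only
the flags of blocks `2 ^ l < b` may be set. -/
def IsStd (n b : ℕ) (x : Bits m) : Prop :=
  (∀ a < m, ¬ IsRegAddr n a → bitAt x a = if a = 2 ∨ a = 3 then 1 else 0) ∧
    ∀ l < n, b ≤ 2 ^ l → ∀ c < 8, bitAt x (flagAddr c l) = 0

/-- The basis state with indices `z c` in which no flag is set. -/
def stdState (n : ℕ) (z : ℕ → ℕ) : Bits m := fun i =>
  if (i : ℕ) = 2 ∨ (i : ℕ) = 3 then 1
  else if 20 ≤ (i : ℕ) % 36 ∧ (i : ℕ) % 36 < 28 ∧ (i : ℕ) / 36 < n ∧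
    (z ((i : ℕ) % 36 - 20)).testBit ((i : ℕ) / 36) = true then 1 else 0

lemma bitAt_stdState {z : ℕ → ℕ} {a : ℕ} (ha : a < m) :
    bitAt (stdState (m := m) n z) a = if a = 2 ∨ a = 3 then 1
      else if 20 ≤ a % 36 ∧ a % 36 < 28 ∧ a / 36 < n ∧ (z (a % 36 - 20)).testBit (a / 36) = true
      then 1 else 0 := by
  simp only [bitAt, stdState, Fin.ofNat, Nat.mod_eq_of_lt ha]

lemma bitAt_stdState_idx {z : ℕ → ℕ} (hm : 36 * (n + 1) ≤ m) {c j : ℕ} (hc : c < 8) (hj : j < n) :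
    bitAt (stdState (m := m) n z) (idxAddr c j) = if (z c).testBit j = true then 1 else 0 := by
  have h1 : idxAddr c j % 36 = 20 + c := by unfold idxAddr; omega
  have h2 : idxAddr c j / 36 = j := by unfold idxAddr; omega
  have h3 : ¬ (idxAddr c j = 2 ∨ idxAddr c j = 3) := by unfold idxAddr; omega
  rw [bitAt_stdState (idxAddr_lt hm hc hj), if_neg h3, h1, h2, Nat.add_sub_cancel_left]
  refine if_congr ⟨fun h => h.2.2.2, fun h => ⟨by omega, by omega, hj, h⟩⟩ rfl rfl

lemma bitAt_stdState_of_not {z : ℕ → ℕ} {a : ℕ} (ha : a < m)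
    (h : ¬ (20 ≤ a % 36 ∧ a % 36 < 28 ∧ a / 36 < n)) :
    bitAt (stdState (m := m) n z) a = if a = 2 ∨ a = 3 then 1 else 0 := by
  rw [bitAt_stdState ha]
  refine if_congr Iff.rfl rfl (if_neg fun h1 => h ⟨h1.1, h1.2.1, h1.2.2.1⟩)

lemma idxVal_stdState {z : ℕ → ℕ} (hm : 36 * (n + 1) ≤ m) {c : ℕ} (hc : c < 8) (hz : z c < 2 ^ n) :
    idxVal n c (stdState (m := m) n z) = z c := by
  rw [← bitsMatch_idxAddr hz]
  intro j _ hj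
  rw [bitAt_stdState_idx hm hc hj]
  simp

lemma isStd_stdState (z : ℕ → ℕ) (hm : 36 * (n + 1) ≤ m) (b : ℕ) :
    IsStd n b (stdState (m := m) n z) := by
  refine ⟨fun a ha h => bitAt_stdState_of_not ha fun h1 => h ⟨h1.1, h1.2.2⟩, fun l hl _ c hc => ?_⟩
  have h1 : flagAddr c l % 36 = 28 + c := by unfold flagAddr; omega
  rw [bitAt_stdState_of_not (by unfold flagAddr; omega) (by omega), if_neg]
  unfold flagAddr; omega

/-- A basis state without flags is determined by its indices. -/
lemma IsStd.eq_stdState {b : ℕ} {x : Bits m} (h : IsStd n b x) (hm : 36 * (n + 1) ≤ m)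
    (hf : ∀ l < n, ∀ c < 8, bitAt x (flagAddr c l) = 0) :
    x = stdState n fun c => idxVal n c x := by
  refine ext_bitAt fun a ha => ?_
  by_cases h1 : 20 ≤ a % 36 ∧ a % 36 < 28 ∧ a / 36 < n
  · have e : a = idxAddr (a % 36 - 20) (a / 36) := by unfold idxAddr; omega
    rw [e, bitAt_stdState_idx hm (by omega) h1.2.2, testBit_idxVal _ _ h1.2.2, ← e]
    by_cases h2 : bitAt x a = 1
    · simp [h2]
    · simp only [h2, decide_false, Bool.false_eq_true, if_false]; omega
  · rw [bitAt_stdState_of_not ha h1]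
    by_cases h2 : 20 ≤ a % 36 ∧ a / 36 < n
    · have e : a = flagAddr (a % 36 - 28) (a / 36) := by unfold flagAddr; omega
      rw [if_neg (by omega), e, hf _ h2.2 _ (by omega)]
    · exact h.1 a ha h2

lemma IsStd.isClean {b : ℕ} {x : Bits m} (h : IsStd n b x) (hm : 36 * (n + 1) ≤ m) :
    IsClean n x := by
  have h1 : ∀ a < m, a % 36 < 20 → bitAt x a = if a = 2 ∨ a = 3 then 1 else 0 := fun a ha h1 =>
    h.1 a ha fun h2 => by have := h2.1; omega
  refine ⟨?_, ?_, fun j hj => ?_⟩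
  · rw [h1 2 (by omega) (by omega)]; simp
  · rw [h1 3 (by omega) (by omega)]; simp
  · rw [h1 _ (by omega) (by omega), if_neg (by omega)]

lemma setReg_stdState (z : ℕ → ℕ) (hm : 36 * (n + 1) ≤ m) {c : ℕ} (hc : c < 8) (v : ℕ) :
    setReg (idxAddr c) v n (stdState (m := m) n z) = stdState n (update z c v) := by
  have hr : RegAddr m n (idxAddr c) := ⟨by omega, fun j hj => idxAddr_lt hm hc hj,
    fun j _ => by unfold idxAddr; omega, fun i _ j _ h => by unfold idxAddr at h; omega⟩
  refine ext_bitAt fun a ha => ?_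
  by_cases h1 : ∃ j < n, a = idxAddr c j
  · obtain ⟨j, hj, rfl⟩ := h1
    rw [hr.bitAt_setReg _ _ hj, bitAt_stdState_idx hm hc hj, update_self]
  · have h2 : ∀ i < n, idxAddr c i < m ∧ a ≠ idxAddr c i := fun i hi =>
      ⟨hr.lt i hi, fun e => h1 ⟨i, hi, e⟩⟩
    rw [bitAt_setReg_of_ne ha h2, bitAt_stdState ha, bitAt_stdState ha]
    refine if_congr Iff.rfl rfl (if_congr ?_ rfl rfl)
    refine and_congr_right fun h3 => and_congr_right fun h4 => and_congr_right fun h5 => ?_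
    rw [update_of_ne]
    intro h6
    refine (h2 _ h5).2 ?_
    unfold idxAddr; omega

/-- The state at the beginning of block `b`, where `f c` are the amplitudes of copy `c` as long as
no flag is set. -/
structure BlockState (n b : ℕ) (f : ℕ → ℕ → ℝ) (ψ : QState m) : Prop where
  supp : ∀ x, ¬ IsStd n b x → ψ x = 0
  amp : ∀ z : ℕ → ℕ, (∀ c < 8, z c < 2 ^ n) →
    ψ (stdState n z) = ((∏ c ∈ range 8, f c (z c) : ℝ) : ℂ)

lemma BlockState.cleanSupp {b : ℕ} {f : ℕ → ℕ → ℝ} {ψ : QState m} (h : BlockState n b f ψ)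
    (hm : 36 * (n + 1) ≤ m) : CleanSupp n ψ :=
  fun x hx => h.supp x fun h1 => hx (h1.isClean hm)

lemma BlockState.congr {b : ℕ} {f g : ℕ → ℕ → ℝ} {ψ : QState m} (h : BlockState n b f ψ)
    (hfg : ∀ c < 8, ∀ v < 2 ^ n, f c v = g c v) : BlockState n b g ψ := by
  refine ⟨h.supp, fun z hz => ?_⟩
  rw [h.amp z hz]
  congr 1
  exact prod_congr rfl fun c hc => hfg c (mem_range.1 hc) _ (hz c (mem_range.1 hc))

lemma regAddr_idx (hm : 36 * (n + 1) ≤ m) {c : ℕ} (hc : c < 8) : RegAddr m n (idxAddr c) :=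
  ⟨by omega, fun j hj => idxAddr_lt hm hc hj, fun j _ => by unfold idxAddr; omega,
    fun i _ j _ h => by unfold idxAddr at h; omega⟩

/-- Side conditions of equality tests on an index register. -/
lemma eqTestAddr_idx (hn : 0 < n) (hm : 36 * (n + 1) ≤ m) {c u v : ℕ} (hc : c < 8)
    (hu : u = 2 ∨ u = 4 + c)
    (hv : v = 3 ∨ v = 4 + c ∨ ∃ l < n, v = flagAddr c l) (huv : u ≠ v) :
    EqTestAddr m n (idxAddr c) u v := by
  have hv' : v < m ∧ v ≠ 1 ∧ (∀ i, v ≠ 36 * i + 2) ∧ ∀ j, idxAddr c j ≠ v := by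
    unfold idxAddr
    rcases hv with rfl | rfl | ⟨l, hl, rfl⟩
    · exact ⟨by omega, by omega, by omega, by omega⟩
    · exact ⟨by omega, by omega, by omega, by omega⟩
    · unfold flagAddr
      exact ⟨by omega, by omega, by omega, by omega⟩
  clear hv
  exact ⟨hn, by omega, fun j hj => idxAddr_lt hm hc hj, fun j _ => by unfold idxAddr; omega,
    fun j _ i => by unfold idxAddr; omega, fun j _ => hv'.2.2.2 j, by omega, by omega,
    fun i => by omega, hv'.1, hv'.2.1, hv'.2.2.1, huv⟩

/-- The initial circuit: a uniform superposition in each index register. The phase flips have no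
effect because their controls are `0`. -/
def initGates (m n : ℕ) [NeZero m] : List (GateInstr m) :=
  forCopies 8 fun c => testGates m n 3 (idxAddr c) 0 4 (4 + c) 3 0

/-- The diffusion operator on each index register. -/
def diffGates (m n : ℕ) [NeZero m] : List (GateInstr m) :=
  forCopies 8 fun c => testGates m n 3 (idxAddr c) 0 4 2 3 3

lemma BlockState.init_step (hn : 0 < n) (hm : 36 * (n + 1) ≤ m) {f : ℕ → ℕ → ℝ} {ψ : QState m}
    (h : BlockState n 1 f ψ) {c : ℕ} (hc : c < 8) (hf : f c = fun v => if v = 0 then 1 else 0) :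
    BlockState n 1 (update f c fun _ => (1 / Real.sqrt 2) ^ n)
      (runGates (testGates m n 3 (idxAddr c) 0 4 (4 + c) 3 0) ψ) := by
  have hr := regAddr_idx hm hc
  have he := eqTestAddr_idx hn hm hc (u := 4 + c) (v := 3) (.inr rfl) (.inl rfl) (by omega)
  have hz : ∀ x : Bits m, (∃ j < n, bitAt x (idxAddr c j) ≠ 0) → ψ x = 0 := by
    rintro x ⟨j, hj, hx⟩
    by_cases h1 : IsStd n 1 x
    · have e := h1.eq_stdState hm fun l hl c hc => h1.2 l hl Nat.one_le_two_pow c hc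
      rw [e, h.amp _ fun c _ => idxVal_lt c x, Finset.prod_eq_zero (mem_range.2 hc)]
      · simp
      · rw [hf]
        dsimp only
        rw [if_neg]
        intro h0
        have h2 := testBit_idxVal c x hj
        rw [h0, Nat.zero_testBit] at h2
        have h3 : bitAt x (idxAddr c j) = 1 := by omega
        simp [h3] at h2
    · exact h.supp x h1
  have hrun := hr.runGates_hLayer_of_zero hz
  have hstd : ∀ {x : Bits m} v, IsStd n 1 (setReg (idxAddr c) v n x) → IsStd n 1 x := by
    intro x v hx
    have e : ∀ a < m, (¬ IsRegAddr n a ∨ 28 ≤ a % 36) →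
        bitAt (setReg (idxAddr c) v n x) a = bitAt x a := by
      refine fun a ha h1 => bitAt_setReg_of_ne ha (fun i hi => ⟨hr.lt i hi, ?_⟩) _ _
      rintro rfl
      unfold idxAddr IsRegAddr at h1
      omega
    refine ⟨fun a ha h1 => (e a ha (.inl h1)).symm.trans (hx.1 a ha h1), fun l hl hb c' hc' => ?_⟩
    rw [← hx.2 l hl hb c' hc', e _ (by unfold flagAddr; omega) (.inr (by unfold flagAddr; omega))]
  have hψ' : ∀ x, runGates (testGates m n 3 (idxAddr c) 0 4 (4 + c) 3 0) ψ x
      = ((1 / Real.sqrt 2 : ℝ) : ℂ) ^ n * ψ (setReg (idxAddr c) 0 n x) := by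
    intro x
    have hcl := cleanSupp_hLayer hr (N := n) he.size
      (fun j hj => ⟨he.q_v j hj, he.q_chain j hj⟩) (h.cleanSupp hm)
    rw [testGates, runGates_append, runGates_append, runGates_hLayerRev_idle, he.runGates_eqPhase hcl, hrun]
    by_cases h1 : IsStd n 1 x
    · rw [if_neg, one_mul]
      rintro ⟨-, h2⟩
      rw [h1.1 _ (by omega) (by unfold IsRegAddr; omega), if_neg (by omega)] at h2
      exact absurd h2 (by decide)
    · rw [h.supp _ fun h2 => h1 (hstd _ h2)]
      ring
  refine ⟨fun x hx => ?_, fun z hz' => ?_⟩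
  · rw [hψ', h.supp _ fun h2 => hx (hstd _ h2), mul_zero]
  · rw [hψ', setReg_stdState z hm hc, h.amp]
    · rw [← Finset.mul_prod_erase _ _ (mem_range.2 hc),
        ← Finset.mul_prod_erase _ _ (mem_range.2 hc), update_self, update_self,
        hf]
      push_cast
      rw [one_mul]
      congr 1
      refine prod_congr rfl fun c' hc' => ?_
      rw [update_of_ne (Finset.ne_of_mem_erase hc'), update_of_ne (Finset.ne_of_mem_erase hc')]
    · intro c' hc'
      by_cases e : c' = c
      · subst e; rw [update_self]; exact Nat.two_pow_pos n
      · rw [update_of_ne e]; exact hz' c' hc'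

lemma BlockState.init (hn : 0 < n) (hm : 36 * (n + 1) ≤ m) {ψ : QState m}
    (h : BlockState n 1 (fun _ v => if v = 0 then 1 else 0) ψ) :
    BlockState n 1 (fun _ _ => (1 / Real.sqrt 2) ^ n) (runGates (initGates m n) ψ) := by
  have key : ∀ C ≤ 8, BlockState n 1
      (fun c v => if c < C then (1 / Real.sqrt 2) ^ n else if v = 0 then 1 else 0)
      (runGates (forCopies C fun c => testGates m n 3 (idxAddr c) 0 4 (4 + c) 3 0) ψ) := by
    intro C hC
    induction C with
    | zero => simpa [forCopies] using h
    | succ C ih =>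
      rw [forCopies_succ, runGates_append]
      refine ((ih (by omega)).init_step hn hm (c := C) (by omega) (by simp)).congr fun c hc v hv => ?_
      by_cases e : c = C
      · subst e; simp
      · rw [update_of_ne e]
        simp only [show (c < C + 1) ↔ c < C by omega]
  exact (key 8 le_rfl).congr fun c hc v hv => if_pos hc

/-- The diffusion operator on functions of an index. -/
noncomputable def diffuse (n : ℕ) (f : ℕ → ℝ) (v : ℕ) : ℝ :=
  f v - 2 * ((1 / 2) ^ n * ∑ w ∈ range (2 ^ n), f w)

lemma BlockState.diff_step (hn : 0 < n) (hm : 36 * (n + 1) ≤ m) {b : ℕ} {f : ℕ → ℕ → ℝ}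
    {ψ : QState m} (h : BlockState n b f ψ) {c : ℕ} (hc : c < 8) :
    BlockState n b (update f c (diffuse n (f c)))
      (runGates (testGates m n 3 (idxAddr c) 0 4 2 3 3) ψ) := by
  classical
  have hr := regAddr_idx hm hc
  have he := eqTestAddr_idx hn hm hc (u := 2) (v := 3) (.inl rfl) (.inl rfl) (by omega)
  have hrun := runGates_diffusion hr he (h.cleanSupp hm) rfl
  refine ⟨fun x hx => ?_, fun z hz' => ?_⟩
  · have hstd : ∀ v, ¬ IsStd n b (setReg (idxAddr c) v n x) := by
      intro v hx'
      have e : ∀ a < m, (¬ IsRegAddr n a ∨ 28 ≤ a % 36) →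
          bitAt (setReg (idxAddr c) v n x) a = bitAt x a := by
        refine fun a ha h1 => bitAt_setReg_of_ne ha (fun i hi => ⟨hr.lt i hi, ?_⟩) _ _
        rintro rfl
        unfold idxAddr IsRegAddr at h1
        omega
      refine hx ⟨fun a ha h1 => (e a ha (.inl h1)).symm.trans (hx'.1 a ha h1), fun l hl hb c' hc' => ?_⟩
      rw [← hx'.2 l hl hb c' hc', e _ (by unfold flagAddr; omega) (.inr (by unfold flagAddr; omega))]
    rw [testGates, hrun, h.supp x hx, Finset.sum_eq_zero fun z _ => h.supp _ (hstd z)]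
    simp
  · rw [testGates, hrun, if_pos ((isStd_stdState z hm b).isClean hm), h.amp z hz']
    have hupd : ∀ (g : ℕ → ℕ → ℝ) (v : ℕ), (∏ c' ∈ range 8, g c' (update z c v c'))
        = g c v * ∏ c' ∈ (range 8).erase c, g c' (z c') := by
      intro g v
      rw [← Finset.mul_prod_erase _ _ (mem_range.2 hc), update_self]
      congr 1
      exact prod_congr rfl fun c' hc' => by
        rw [update_of_ne (Finset.ne_of_mem_erase hc')]
    have h1 : ∀ v ∈ range (2 ^ n), ψ (setReg (idxAddr c) v n (stdState n z))
        = ((f c v * ∏ c' ∈ (range 8).erase c, f c' (z c') : ℝ) : ℂ) := by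
      intro v hv
      rw [setReg_stdState z hm hc, h.amp, hupd]
      intro c' hc'
      by_cases e : c' = c
      · subst e; rw [update_self]; exact mem_range.1 hv
      · rw [update_of_ne e]; exact hz' c' hc'
    rw [sum_congr rfl h1, ← Complex.ofReal_sum, ← Finset.sum_mul,
      ← Finset.mul_prod_erase _ _ (mem_range.2 hc),
      ← Finset.mul_prod_erase _ _ (mem_range.2 hc), update_self]
    have h2 : ∏ c' ∈ (range 8).erase c, update f c (diffuse n (f c)) c' (z c')
        = ∏ c' ∈ (range 8).erase c, f c' (z c') :=
      prod_congr rfl fun c' hc' => by rw [update_of_ne (Finset.ne_of_mem_erase hc')]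
    rw [h2, diffuse]
    push_cast
    ring

lemma BlockState.diff (hn : 0 < n) (hm : 36 * (n + 1) ≤ m) {b : ℕ} {f : ℕ → ℝ} {ψ : QState m}
    (h : BlockState n b (fun _ => f) ψ) :
    BlockState n b (fun _ => diffuse n f) (runGates (diffGates m n) ψ) := by
  have key : ∀ C ≤ 8, BlockState n b (fun c => if c < C then diffuse n f else f)
      (runGates (forCopies C fun c => testGates m n 3 (idxAddr c) 0 4 2 3 3) ψ) := by
    intro C hC
    induction C with
    | zero => simpa [forCopies] using h
    | succ C ih =>
      rw [forCopies_succ, runGates_append]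
      refine ((ih (by omega)).diff_step hn hm (c := C) (by omega)).congr fun c hc v hv => ?_
      by_cases e : c = C
      · subst e; simp
      · rw [update_of_ne e]
        simp only [show (c < C + 1) ↔ c < C by omega]
  exact (key 8 le_rfl).congr fun c hc v hv => by rw [if_pos hc]

end Amplitudes

section Blocks

variable {m : ℕ} [NeZero m] {n : ℕ}

/-- Addition of the bits of the first word to the qubits `4 + c`, at the positions given by the index
registers. -/
def xGates (m n : ℕ) [NeZero m] (bs : List Bool) : List (GateInstr m) :=
  wordGates (fun p => forCopies 8 fun c => testGates m n 0 (idxAddr c) p 1 2 (4 + c) 0) 0 bs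

open Classical in
/-- In block `b`, the phase flips controlled by the bits of the second word, or, if `b` is a power
of `2`, the addition of the conjunction of both bits to a flag. -/
noncomputable def yGates (m n : ℕ) [NeZero m] (b : ℕ) (bs : List Bool) : List (GateInstr m) :=
  wordGates (fun p => forCopies 8 fun c => testGates m n 0 (idxAddr c) p
    (if ∃ e, b = 2 ^ e then 1 else 4) (4 + c)
    (if ∃ e, b = 2 ^ e then flagAddr c (Nat.log 2 b) else 3) 0) 0 bs

/-- The circuit of block `b` before the diffusion. -/
noncomputable def oracleGates (m n : ℕ) [NeZero m] (b : ℕ) (xs ys : List Bool) : List (GateInstr m) :=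
  xGates m n xs ++ (yGates m n b ys ++ xGates m n xs)

/-- Whether both words have the bit `1` at a position. -/
def common (xs ys : List Bool) (v : ℕ) : Fin 2 := bitsFn 0 xs v * bitsFn 0 ys v

open Classical in
/-- The effect of block `b` on amplitudes before the diffusion: the common positions are removed if
`b` is a power of `2`, and otherwise their sign is changed. -/
noncomputable def oracle (b : ℕ) (F : ℕ → Fin 2) (f : ℕ → ℝ) (v : ℕ) : ℝ :=
  if F v = 1 then if ∃ e, b = 2 ^ e then 0 else - f v else f v

lemma shiftAddr_idx (hm : 36 * (n + 1) ≤ m) : ShiftAddr m n 4 fun _ => 2 where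
  size := hm
  idx j _ c hc := by unfold idxAddr; omega
  ua_lt c _ := by omega
  ua_base c _ := by omega

lemma shiftAddr_flag (hm : 36 * (n + 1) ≤ m) {l : ℕ} :
    ShiftAddr m n (36 * l + 28) fun c => 4 + c where
  size := hm
  idx j _ c hc := by unfold idxAddr; omega
  ua_lt c _ := by omega
  ua_base c _ := by omega

lemma runGates_xGates (hn : 0 < n) (hm : 36 * (n + 1) ≤ m) {bs : List Bool}
    (hi : bs.length ≤ 2 ^ n) {ψ : QState m} (hψ : CleanSupp n ψ) :
    CleanSupp n (runGates (xGates m n bs) ψ) ∧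
    ∀ x, runGates (xGates m n bs) ψ x = ψ (shiftReg 4 (fun _ => 2) n 8 (bitsFn 0 bs) x) :=
  runGates_word_tests (shiftAddr_idx hm) (by omega) (by omega) (by omega)
    (fun _ hc => eqTestAddr_idx hn hm hc (.inl rfl) (.inr (.inl rfl)) (by omega)) (by omega) hψ

lemma BlockState.oracle_phase (hn : 0 < n) (hm : 36 * (n + 1) ≤ m) {b : ℕ}
    (hb : ¬ ∃ e, b = 2 ^ e) {xs ys : List Bool} (hx : xs.length ≤ 2 ^ n) (hy : ys.length ≤ 2 ^ n)
    {f : ℕ → ℝ} {ψ : QState m} (h : BlockState n b (fun _ => f) ψ) :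
    BlockState n b (fun _ => oracle b (common xs ys) f) (runGates (oracleGates m n b xs ys) ψ) := by
  obtain ⟨h1, e1⟩ := runGates_xGates hn hm hx (h.cleanSupp hm)
  have e2 := fun x => runGates_word_phases (fun c hc => eqTestAddr_idx hn hm hc (u := 4 + c) (v := 3)
    (.inr rfl) (.inl rfl) (by omega)) (i := 0) (bs := ys) (by omega) h1 x
  have h2 : CleanSupp n (runGates (yGates m n b ys) (runGates (xGates m n xs) ψ)) := by
    intro x hx
    rw [yGates]
    simp only [if_neg hb]
    rw [e2, h1 x hx, mul_zero]
  obtain ⟨-, e3⟩ := runGates_xGates hn hm hx h2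
  have hA := shiftAddr_idx (m := m) hm
  have e : ∀ x, runGates (oracleGates m n b xs ys) ψ x
      = ((∏ c ∈ range 8, bitSign ((bitAt x (4 + c) + bitAt x 2 * bitsFn 0 xs (idxVal n c x))
        * bitsFn 0 ys (idxVal n c x)) : ℝ) : ℂ) * ψ x := by
    intro x
    rw [oracleGates, runGates_append, runGates_append, e3, yGates]
    simp only [if_neg hb]
    rw [e2, e1, hA.shiftReg_shiftReg]
    congr 1
    · congr 1
      refine prod_congr rfl fun c hc => ?_
      have hc := mem_range.1 hc
      rw [hA.idxVal_shiftReg le_rfl hc, bitAt_shiftReg (by omega), if_pos (by omega), Nat.add_sub_cancel_left]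
    · have key : ∀ a : Fin 2, a + a = 0 := by decide
      simp only [key]
      rw [shiftReg_zero]
  refine ⟨fun x hx => by rw [e, h.supp x hx, mul_zero], fun z hz => ?_⟩
  rw [e, h.amp z hz, ← Complex.ofReal_mul, ← Finset.prod_mul_distrib]
  congr 1
  refine prod_congr rfl fun c hc => ?_
  have hc := mem_range.1 hc
  rw [bitAt_stdState_of_not (by omega) (by omega), bitAt_stdState_of_not (by omega) (by omega),
    if_neg (by omega), if_pos (by omega), idxVal_stdState hm hc (hz c hc), zero_add, one_mul, oracle,
    if_neg hb]
  unfold bitSign common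
  split_ifs <;> ring

lemma BlockState.oracle_check (hn : 0 < n) (hm : 36 * (n + 1) ≤ m) {l : ℕ} (hl : l < n)
    {xs ys : List Bool} (hx : xs.length ≤ 2 ^ n) (hy : ys.length ≤ 2 ^ n)
    {f : ℕ → ℝ} {ψ : QState m} (h : BlockState n (2 ^ l) (fun _ => f) ψ) :
    BlockState n (2 ^ l + 1) (fun _ => oracle (2 ^ l) (common xs ys) f)
      (runGates (oracleGates m n (2 ^ l) xs ys) ψ) := by
  have hb : ∃ e, 2 ^ l = 2 ^ e := ⟨l, rfl⟩
  have hlog : Nat.log 2 (2 ^ l) = l := Nat.log_pow (by omega) l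
  obtain ⟨h1, e1⟩ := runGates_xGates hn hm hx (h.cleanSupp hm)
  have hA := shiftAddr_idx (m := m) hm
  have hF := shiftAddr_flag (m := m) hm (l := l)
  have e2 := runGates_word_tests hF (by omega) (by omega) (by omega)
    (fun c hc => eqTestAddr_idx hn hm hc (u := 4 + c) (v := 36 * l + 28 + c)
    (.inr rfl) (.inr (.inr ⟨l, hl, rfl⟩)) (by omega)) (i := 0) (bs := ys) (by omega) h1
  have hyg : yGates m n (2 ^ l) ys = wordGates (fun p => forCopies 8 fun c =>
      testGates m n 0 (idxAddr c) p 1 (4 + c) (36 * l + 28 + c) 0) 0 ys := by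
    rw [yGates]
    simp only [if_pos hb, hlog, flagAddr]
  rw [← hyg] at e2
  obtain ⟨-, e3⟩ := runGates_xGates hn hm hx e2.1
  set A := shiftReg (m := m) 4 (fun _ => 2) n 8 (bitsFn 0 xs) with hAdef
  set B := shiftReg (m := m) (36 * l + 28) (fun c => 4 + c) n 8 (bitsFn 0 ys) with hBdef
  have e : ∀ x, runGates (oracleGates m n (2 ^ l) xs ys) ψ x = ψ (A (B (A x))) := by
    intro x
    rw [oracleGates, runGates_append, runGates_append, e3, e2.2, e1]
  have hAidx : ∀ x : Bits m, ∀ c < 8, idxVal n c (A x) = idxVal n c x := fun x c hc =>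
    hA.idxVal_shiftReg le_rfl hc
  have hBidx : ∀ x : Bits m, ∀ c < 8, idxVal n c (B x) = idxVal n c x := fun x c hc =>
    hF.idxVal_shiftReg le_rfl hc
  have hbit : ∀ x : Bits m, ∀ a < m, bitAt (A (B (A x))) a = bitAt x a +
      if 36 * l + 28 ≤ a ∧ a < 36 * l + 28 + 8 then
        (bitAt x (4 + (a - (36 * l + 28))) + bitAt x 2 * bitsFn 0 xs (idxVal n (a - (36 * l + 28)) x))
          * bitsFn 0 ys (idxVal n (a - (36 * l + 28)) x) else 0 := by
    intro x a ha
    have hB2 : bitAt (B (A x)) 2 = bitAt x 2 := by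
      rw [hBdef, bitAt_shiftReg (by omega), if_neg (by omega), add_zero, hAdef,
        bitAt_shiftReg (by omega), if_neg (by omega), add_zero]
    rw [hAdef, bitAt_shiftReg ha, ← hAdef]
    by_cases h4 : 4 ≤ a ∧ a < 4 + 8
    · rw [if_pos h4, if_neg (by omega), add_zero, hB2, hBidx _ _ (by omega), hAidx _ _ (by omega),
        hBdef, bitAt_shiftReg ha, if_neg (by omega), add_zero, hAdef, bitAt_shiftReg ha, if_pos h4,
        fin_two_add_add]
    · rw [if_neg h4, add_zero, hBdef, bitAt_shiftReg ha, hAdef, bitAt_shiftReg ha, if_neg h4, add_zero,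
        ← hAdef]
      congr 1
      refine ite_congr rfl (fun h5 => ?_) fun _ => rfl
      rw [hAidx _ _ (by omega), hAdef, bitAt_shiftReg (by omega), if_pos (by omega), Nat.add_sub_cancel_left]
  have hbit' : ∀ x : Bits m, ∀ a < m, ¬ (36 * l + 28 ≤ a ∧ a < 36 * l + 28 + 8) →
      bitAt (A (B (A x))) a = bitAt x a := fun x a ha h5 => by rw [hbit x a ha, if_neg h5, add_zero]
  refine ⟨fun x hx => ?_, fun z hz => ?_⟩
  · rw [e]
    refine h.supp _ fun hs => hx ⟨fun a ha h5 => ?_, fun l' hl' hb' c hc => ?_⟩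
    · rw [← hs.1 a ha h5, hbit' x a ha fun h6 => h5 (by unfold IsRegAddr; omega)]
    · have hll : l < l' := (Nat.pow_lt_pow_iff_right (show 1 < 2 by omega)).1 (by omega)
      rw [← hs.2 l' hl' (by omega) c hc, hbit' x _ (by unfold flagAddr; omega) (by unfold flagAddr; omega)]
  · rw [e]
    have hfl : ∀ c < 8, bitAt (A (B (A (stdState n z)))) (flagAddr c l) = common xs ys (z c) := by
      intro c hc
      have ha : flagAddr c l < m := by unfold flagAddr; omega
      have ha' : flagAddr c l - (36 * l + 28) = c := by unfold flagAddr; omega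
      rw [hbit _ _ ha, if_pos (by unfold flagAddr; omega), ha', (isStd_stdState z hm 0).2 l hl (Nat.zero_le _) c hc,
        bitAt_stdState_of_not (by omega) (by omega), bitAt_stdState_of_not (by omega) (by omega),
        if_neg (by omega), if_pos (by omega), idxVal_stdState hm hc (hz c hc)]
      simp [common]
    by_cases hc0 : ∃ c < 8, common xs ys (z c) = 1
    · obtain ⟨c, hc, h1⟩ := hc0
      rw [h.supp _ fun hs => ?_, Finset.prod_eq_zero (mem_range.2 hc)]
      · simp
      · rw [oracle, if_pos h1, if_pos hb]
      · have := hs.2 l hl le_rfl c hc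
        rw [hfl c hc, h1] at this
        exact absurd this (by decide)
    · have hc1 : ∀ c < 8, common xs ys (z c) ≠ 1 := fun c hc h1 => hc0 ⟨c, hc, h1⟩
      have hst : A (B (A (stdState n z))) = stdState n z := by
        refine ext_bitAt fun a ha => ?_
        by_cases h5 : 36 * l + 28 ≤ a ∧ a < 36 * l + 28 + 8
        · have ea : a = flagAddr (a - (36 * l + 28)) l := by unfold flagAddr; omega
          have h6 := hc1 (a - (36 * l + 28)) (by omega)
          rw [ea, hfl _ (by omega), (isStd_stdState z hm 0).2 l hl (Nat.zero_le _) _ (by omega)]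
          omega
        · exact hbit' _ a ha h5
      rw [hst, h.amp z hz]
      congr 1
      refine prod_congr rfl fun c hc => ?_
      rw [oracle, if_neg (hc1 c (mem_range.1 hc))]

/-- The effect of a block. -/
lemma BlockState.oracle (hn : 0 < n) (hm : 36 * (n + 1) ≤ m) {b : ℕ} (hb : b < 2 ^ n)
    {xs ys : List Bool} (hx : xs.length ≤ 2 ^ n) (hy : ys.length ≤ 2 ^ n)
    {f : ℕ → ℝ} {ψ : QState m} (h : BlockState n b (fun _ => f) ψ) :
    BlockState n (b + 1) (fun _ => _root_.oracle b (common xs ys) f)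
      (runGates (oracleGates m n b xs ys) ψ) := by
  by_cases h1 : ∃ e, b = 2 ^ e
  · obtain ⟨l, rfl⟩ := h1
    exact h.oracle_check hn hm ((Nat.pow_lt_pow_iff_right (by omega)).1 hb) hx hy
  · have h2 := h.oracle_phase hn hm h1 hx hy
    refine ⟨fun x hx => h2.supp x fun hs => hx ⟨hs.1, fun l hl hbl => hs.2 l hl (by omega)⟩, h2.amp⟩

/-- The amplitudes of each copy after the blocks `1, …, B`, if no flag is set. -/
noncomputable def amplitude (n : ℕ) (F : ℕ → Fin 2) : ℕ → ℕ → ℝ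
  | 0 => fun _ => (1 / Real.sqrt 2) ^ n
  | B + 1 => diffuse n (_root_.oracle (B + 1) F (amplitude n F B))

/-- The circuit of the blocks `1, …, B`. -/
noncomputable def blocksGates (m n : ℕ) [NeZero m] (xs ys : List Bool) : ℕ → List (GateInstr m)
  | 0 => []
  | B + 1 => blocksGates m n xs ys B ++ (oracleGates m n (B + 1) xs ys ++ diffGates m n)

lemma BlockState.blocks (hn : 0 < n) (hm : 36 * (n + 1) ≤ m) {B : ℕ} (hB : B < 2 ^ n)
    {xs ys : List Bool} (hx : xs.length ≤ 2 ^ n) (hy : ys.length ≤ 2 ^ n) {ψ : QState m}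
    (h : BlockState n 1 (fun _ => amplitude n (common xs ys) 0) ψ) :
    BlockState n (B + 1) (fun _ => amplitude n (common xs ys) B)
      (runGates (blocksGates m n xs ys B) ψ) := by
  induction B with
  | zero => exact h
  | succ B ih =>
    rw [blocksGates, runGates_append, runGates_append]
    exact ((ih (by omega)).oracle hn hm hB hx hy).diff hn hm

/-- The conjunction of the verdicts of the copies: a copy is counted if none of its flags is set. -/
def verdictGates (m n : ℕ) [NeZero m] (C : ℕ) : List (GateInstr m) :=
  forCopies C fun c => testGates m n 0 (flagAddr c) 0 1 (verdictAddr c) (verdictAddr (c + 1)) 0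

lemma verdictGates_succ (C : ℕ) : verdictGates m n (C + 1) = verdictGates m n C ++
    testGates m n 0 (flagAddr C) 0 1 (verdictAddr C) (verdictAddr (C + 1)) 0 := forCopies_succ _ _

/-- The effect of the test of one copy. -/
noncomputable def verdictStep (n c : ℕ) (x : Bits m) : Bits m :=
  setBit x (verdictAddr (c + 1)) (bitAt x (verdictAddr (c + 1)) +
    (if BitsMatch (flagAddr c) 0 n 0 x then 1 else 0) * bitAt x (verdictAddr c))

lemma eqTestAddr_flag (hn : 0 < n) (hm : 36 * (n + 1) ≤ m) {c : ℕ} (hc : c < 8) :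
    EqTestAddr m n (flagAddr c) (verdictAddr c) (verdictAddr (c + 1)) := by
  have h1 : verdictAddr c < 20 ∧ verdictAddr c ≠ 1 ∧ verdictAddr (c + 1) ≠ 1 ∧
      verdictAddr (c + 1) ≠ 2 ∧ verdictAddr (c + 1) < 20 ∧ verdictAddr c ≠ verdictAddr (c + 1) := by
    interval_cases c <;> decide
  obtain ⟨h1, h2, h3, h4, h5, h6⟩ := h1
  exact ⟨hn, by omega, fun j hj => by unfold flagAddr; omega, fun j _ => by unfold flagAddr; omega,
    fun j _ i => by unfold flagAddr; omega, fun j _ => by unfold flagAddr; omega, by omega, h2,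
    fun i => by omega, by omega, h3, fun i => by omega, h6⟩

lemma runGates_verdict (hn : 0 < n) (hm : 36 * (n + 1) ≤ m) {ψ : QState m} (hψ : CleanSupp n ψ)
    {C : ℕ} (hC : C ≤ 8) : CleanSupp n (runGates (verdictGates m n C) ψ) ∧
    ∀ W : Bits m → ℝ, ∑ x, W x * ‖runGates (verdictGates m n C) ψ x‖ ^ 2
      = ∑ x, W ((List.range C).foldl (fun x c => verdictStep n c x) x) * ‖ψ x‖ ^ 2 := by
  induction C with
  | zero => exact ⟨hψ, fun W => by simp [verdictGates, forCopies]⟩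
  | succ C ih =>
    obtain ⟨h1, h2⟩ := ih (by omega)
    have he := eqTestAddr_flag (m := m) hn hm (c := C) (by omega)
    have hv : verdictAddr (C + 1) ≠ 3 := by
      have : C < 8 := by omega
      interval_cases C <;> decide
    have h3 : runGates (verdictGates m n (C + 1)) ψ = fun x =>
        runGates (verdictGates m n C) ψ (verdictStep n C x) := by
      ext x
      rw [verdictGates_succ, runGates_append, runGates_testGates_idle, he.runGates_eqTest hv h1]
      rfl
    have hinv : Function.Involutive (verdictStep (m := m) n C) := by
      intro x
      have hb : BitsMatch (flagAddr C) 0 n 0 (verdictStep n C x) ↔ BitsMatch (flagAddr C) 0 n 0 x := by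
        refine forall_congr' fun j => forall_congr' fun _ => forall_congr' fun hj => ?_
        rw [verdictStep, bitAt_setBit_ne _ _ (he.q_lt j hj) he.v_lt (he.q_v j hj)]
      conv_lhs => rw [verdictStep]
      simp only [hb]
      have hu : bitAt (verdictStep n C x) (verdictAddr C) = bitAt x (verdictAddr C) :=
        bitAt_setBit_ne _ _ he.u_lt he.v_lt he.u_v
      rw [hu]
      simp only [verdictStep]
      rw [bitAt_setBit_self, setBit_setBit, fin_two_add_add, setBit_bitAt]
    refine ⟨?_, fun W => ?_⟩
    · have := he.cleanSupp_eqTest hv h1 (p := 0)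
      rwa [verdictGates_succ, runGates_append, runGates_testGates_idle]
    · rw [h3]
      have h4 := Equiv.sum_comp (hinv.toPerm _)
        fun x => W (verdictStep n C x) * ‖runGates (verdictGates m n C) ψ x‖ ^ 2
      simp only [Function.Involutive.coe_toPerm, hinv _] at h4
      rw [h4, h2 fun x => W (verdictStep n C x)]
      simp [List.range_succ]

lemma bitAt_foldl_verdictStep (hn : 0 < n) (hm : 36 * (n + 1) ≤ m) {b : ℕ} {x : Bits m}
    (hx : IsStd n b x) {C : ℕ} (hC : C ≤ 8) :
    (∀ a < m, 20 ≤ a → bitAt ((List.range C).foldl (fun x c => verdictStep n c x) x) a = bitAt x a) ∧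
    ∀ c ≤ 8, bitAt ((List.range C).foldl (fun x c => verdictStep n c x) x) (verdictAddr c)
      = if c ≤ C ∧ ∀ c' < c, ∀ l < n, bitAt x (flagAddr c' l) = 0 then 1 else 0 := by
  induction C with
  | zero =>
    refine ⟨fun a _ _ => rfl, fun c hc => ?_⟩
    have h1 : verdictAddr c < 20 ∧ verdictAddr c ≠ 3 ∧ (verdictAddr c = 2 ↔ c = 0) := by
      interval_cases c <;> decide
    rw [List.range_zero, List.foldl_nil, hx.1 _ (by omega) (by unfold IsRegAddr; omega)]
    refine if_congr ⟨fun h => ?_, fun h => ?_⟩ rfl rfl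
    · have hc0 : c = 0 := by omega
      subst hc0
      exact ⟨le_rfl, fun _ h => absurd h (by omega)⟩
    · exact .inl (h1.2.2.2 (by omega))
  | succ C ih =>
    obtain ⟨h1, h2⟩ := ih (by omega)
    rw [List.range_succ, List.foldl_append, List.foldl_cons, List.foldl_nil]
    set y := (List.range C).foldl (fun x c => verdictStep n c x) x
    have he := eqTestAddr_flag (m := m) hn hm (c := C) (by omega)
    have hv : verdictAddr (C + 1) < 20 ∧ ∀ c ≤ 8, c ≠ C + 1 → verdictAddr c ≠ verdictAddr (C + 1) := by
      have : C < 8 := by omega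
      interval_cases C <;> decide
    refine ⟨fun a ha ha' => ?_, fun c hc => ?_⟩
    · rw [verdictStep, bitAt_setBit_ne _ _ ha he.v_lt (by omega), h1 a ha ha']
    · by_cases e : c = C + 1
      · subst e
        have hb : BitsMatch (flagAddr C) 0 n 0 y ↔ ∀ l < n, bitAt x (flagAddr C l) = 0 := by
          refine forall_congr' fun j => ⟨fun h hj => ?_, fun h _ hj => ?_⟩
          · have h3 := h (Nat.zero_le _) hj
            rw [h1 _ (he.q_lt j hj) (by unfold flagAddr; omega)] at h3
            simp only [Nat.zero_testBit, Bool.false_eq_true, iff_false] at h3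
            omega
          · rw [h1 _ (he.q_lt j hj) (by unfold flagAddr; omega), h hj]
            simp
        rw [verdictStep, bitAt_setBit_self, h2 (C + 1) hc, h2 C (by omega), if_neg (by omega), zero_add]
        simp only [hb]
        have h4 : (∀ c' < C + 1, ∀ l < n, bitAt x (flagAddr c' l) = 0) ↔
            (∀ l < n, bitAt x (flagAddr C l) = 0) ∧ ∀ c' < C, ∀ l < n, bitAt x (flagAddr c' l) = 0 :=
          ⟨fun h => ⟨h C (by omega), fun c' h' => h c' (by omega)⟩, fun h c' h' => by
            rcases Nat.lt_succ_iff_lt_or_eq.1 h' with h5 | rfl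
            exacts [h.2 c' h5, h.1]⟩
        simp only [h4, le_refl, true_and]
        by_cases h5 : ∀ l < n, bitAt x (flagAddr C l) = 0
        · by_cases h6 : ∀ c' < C, ∀ l < n, bitAt x (flagAddr c' l) = 0
          · rw [if_pos h5, if_pos h6, if_pos ⟨h5, h6⟩, one_mul]
          · rw [if_neg h6, mul_zero]
            exact (if_neg fun h7 => h6 h7.2).symm
        · rw [if_neg h5, zero_mul]
          exact (if_neg fun h7 => h5 h7.1).symm
      · have hvl : verdictAddr c < m := by
          have : verdictAddr c < 20 := by interval_cases c <;> decide
          omega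
        rw [verdictStep, bitAt_setBit_ne _ _ hvl he.v_lt (hv.2 c hc e), h2 c hc]
        exact if_congr (by rw [show (c ≤ C + 1 ↔ c ≤ C) by omega]) rfl rfl

lemma stdState_congr {z z' : ℕ → ℕ} (h : ∀ c < 8, z c = z' c) :
    stdState (m := m) n z = stdState n z' := by
  funext i
  rw [stdState, stdState]
  exact if_congr Iff.rfl rfl (if_congr (and_congr_right fun h6 => and_congr_right fun h7 => by
    rw [h _ (by omega)]) rfl rfl)

/-- The probability that no copy has found a common position. -/
lemma BlockState.measure_verdict (hn : 0 < n) (hm : 36 * (n + 1) ≤ m) {b : ℕ} {f : ℕ → ℝ}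
    {ψ : QState m} (h : BlockState n b (fun _ => f) ψ) :
    measureFirstProb 1 (runGates (verdictGates m n 8) ψ)
      = (∑ v ∈ range (2 ^ n), f v ^ 2) ^ 8 := by
  classical
  have h1 : measureFirstProb 1 (runGates (verdictGates m n 8) ψ)
      = ∑ x, (if bitAt x 0 = 1 then (1 : ℝ) else 0) * ‖runGates (verdictGates m n 8) ψ x‖ ^ 2 := by
    rw [measureFirstProb, Finset.sum_filter]
    refine sum_congr rfl fun x _ => ?_
    rw [ite_mul, one_mul, zero_mul]
    refine if_congr ⟨?_, fun h0 => ⟨Fin.ofNat m 0, by simp [Fin.ofNat], h0⟩⟩ rfl rfl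
    rintro ⟨i, hi, hx⟩
    rwa [bitAt, show Fin.ofNat m 0 = i from Fin.ext (by simp [Fin.ofNat, hi])]
  rw [h1, (runGates_verdict hn hm (h.cleanSupp hm) le_rfl).2 fun x => if bitAt x 0 = 1 then (1 : ℝ) else 0]
  have h2 : ∀ x : Bits m,
      (if bitAt ((List.range 8).foldl (fun x c => verdictStep n c x) x) 0 = 1 then (1 : ℝ) else 0)
        * ‖ψ x‖ ^ 2 = if x = stdState n (fun c => idxVal n c x) then ‖ψ x‖ ^ 2 else 0 := by
    intro x
    by_cases hx : IsStd n b x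
    · have h3 := (bitAt_foldl_verdictStep hn hm hx (C := 8) le_rfl).2 8 le_rfl
      rw [show verdictAddr 8 = 0 from rfl] at h3
      rw [h3, ite_mul, one_mul, zero_mul]
      by_cases h4 : ∀ c' < 8, ∀ l < n, bitAt x (flagAddr c' l) = 0
      · rw [if_pos (by rw [if_pos ⟨le_rfl, h4⟩]), if_pos]
        exact hx.eq_stdState hm fun l hl c hc => h4 c hc l hl
      · rw [if_neg (by rw [if_neg fun h5 => h4 h5.2]; decide), if_neg]
        intro h5
        rw [h5] at h4
        exact h4 fun c hc l hl => (isStd_stdState _ hm 0).2 l hl (Nat.zero_le _) c hc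
    · rw [h.supp x hx]
      simp
  rw [sum_congr rfl fun x _ => h2 x, ← Finset.sum_filter]
  set ext : (Fin 8 → ℕ) → ℕ → ℕ := fun z c => if hc : c < 8 then z ⟨c, hc⟩ else 0 with hext
  have h5 : ∑ x ∈ Finset.univ.filter (fun x : Bits m => x = stdState n fun c => idxVal n c x),
      ‖ψ x‖ ^ 2 = ∑ z ∈ Fintype.piFinset (fun _ : Fin 8 => range (2 ^ n)), ∏ c, f (z c) ^ 2 := by
    refine Finset.sum_bij' (fun x _ c => idxVal n c x) (fun z _ => stdState n (ext z)) ?_ ?_ ?_ ?_ ?_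
    · intro x _
      simpa using fun c => idxVal_lt _ x
    · intro z hz
      simp only [Fintype.mem_piFinset, mem_range] at hz
      rw [mem_filter]
      refine ⟨Finset.mem_univ _, ?_⟩
      have := (isStd_stdState (m := m) (ext z) hm 0).eq_stdState hm fun l hl c hc =>
        (isStd_stdState (ext z) hm 0).2 l hl (Nat.zero_le _) c hc
      exact this
    · intro x hx
      rw [mem_filter] at hx
      conv_rhs => rw [hx.2]
      exact stdState_congr fun c hc => by rw [hext]; exact dif_pos hc
    · intro z hz
      simp only [Fintype.mem_piFinset, mem_range] at hz
      ext c
      rw [idxVal_stdState hm c.2 (by simp [hext, hz c])]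
      simp [hext]
    · intro x hx
      rw [mem_filter] at hx
      conv_lhs => rw [hx.2, h.amp _ fun c _ => idxVal_lt c x, Complex.norm_real, Real.norm_eq_abs, sq_abs,
        ← Finset.prod_pow, Finset.prod_range]
  rw [h5, ← Finset.prod_univ_sum (fun _ : Fin 8 => range (2 ^ n)) fun _ v => f v ^ 2]
  simp

end Blocks

/-! ### Rotations and the success probability -/

section Rotation

variable {n : ℕ} {F : ℕ → Fin 2} {θ : ℝ}

/-- The number of common positions. -/
def commonCount (n : ℕ) (F : ℕ → Fin 2) : ℕ := ((range (2 ^ n)).filter fun v => F v = 1).card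

/-- The amplitudes `f` are constant on the common positions and on the other ones, and `p`, `q` are the
coordinates of `f` with respect to the normalized indicator functions of these two sets, where `sin θ ^ 2`
is the density of the common positions. -/
def HasCoords (n : ℕ) (F : ℕ → Fin 2) (θ : ℝ) (f : ℕ → ℝ) (p q : ℝ) : Prop :=
  ∃ α β : ℝ, (∀ v, f v = if F v = 1 then β else α) ∧ p = Real.cos θ * Real.sqrt 2 ^ n * α ∧
    q = Real.sin θ * Real.sqrt 2 ^ n * β

lemma sum_two_valued (n : ℕ) (F : ℕ → Fin 2) (α β : ℝ) :
    ∑ v ∈ range (2 ^ n), (if F v = 1 then β else α)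
      = commonCount n F * β + (2 ^ n - commonCount n F) * α := by
  have h := Finset.card_filter_add_card_filter_not (s := range (2 ^ n)) fun v => F v = 1
  rw [Finset.card_range] at h
  have h' : ((2 : ℝ) ^ n) = commonCount n F + (Finset.filter (fun v => ¬ F v = 1) (range (2 ^ n))).card := by
    rw [commonCount]
    exact_mod_cast h.symm
  rw [Finset.sum_ite, Finset.sum_const, Finset.sum_const, nsmul_eq_mul, nsmul_eq_mul, h', commonCount]
  ring

lemma sqrt_two_pow_sq (n : ℕ) : (Real.sqrt 2 ^ n) ^ 2 = 2 ^ n := by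
  rw [← pow_mul, mul_comm, pow_mul, Real.sq_sqrt (by norm_num)]

lemma hasCoords_zero : HasCoords n F θ (amplitude n F 0) (Real.cos θ) (Real.sin θ) := by
  have h : Real.sqrt 2 ^ n * (1 / Real.sqrt 2) ^ n = 1 := by
    rw [← mul_pow, mul_one_div, div_self (by positivity), one_pow]
  refine ⟨(1 / Real.sqrt 2) ^ n, (1 / Real.sqrt 2) ^ n, fun v => by simp [amplitude], ?_, ?_⟩ <;>
  rw [mul_assoc, h, mul_one]

lemma HasCoords.diffuse (hθ : Real.sin θ ^ 2 * 2 ^ n = commonCount n F) {f : ℕ → ℝ} {p q : ℝ}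
    (h : HasCoords n F θ f p q) : HasCoords n F θ (diffuse n f)
      (-Real.cos (2 * θ) * p - Real.sin (2 * θ) * q) (Real.cos (2 * θ) * q - Real.sin (2 * θ) * p) := by
  obtain ⟨α, β, hf, rfl, rfl⟩ := h
  have hs : (1 / 2 : ℝ) ^ n * ∑ w ∈ range (2 ^ n), f w
      = Real.sin θ ^ 2 * β + Real.cos θ ^ 2 * α := by
    have h2 : (1 / 2 : ℝ) ^ n * 2 ^ n = 1 := by rw [← mul_pow]; norm_num
    rw [sum_congr rfl fun v _ => hf v, sum_two_valued, ← hθ, Real.cos_sq']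
    linear_combination (Real.sin θ ^ 2 * β + (1 - Real.sin θ ^ 2) * α) * h2
  refine ⟨α - 2 * (Real.sin θ ^ 2 * β + Real.cos θ ^ 2 * α),
    β - 2 * (Real.sin θ ^ 2 * β + Real.cos θ ^ 2 * α), fun v => ?_, ?_, ?_⟩
  · rw [_root_.diffuse, hs, hf]
    split_ifs <;> rfl
  · rw [Real.cos_two_mul, Real.sin_two_mul]
    ring
  · rw [Real.cos_two_mul, Real.sin_two_mul]
    linear_combination (2 * Real.sin θ * Real.sqrt 2 ^ n * β) * Real.sin_sq_add_cos_sq θ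

lemma HasCoords.oracle_phase {b : ℕ} (hb : ¬ ∃ e, b = 2 ^ e) {f : ℕ → ℝ} {p q : ℝ}
    (h : HasCoords n F θ f p q) : HasCoords n F θ (oracle b F f) p (-q) := by
  obtain ⟨α, β, hf, rfl, rfl⟩ := h
  refine ⟨α, -β, fun v => ?_, rfl, by ring⟩
  rw [oracle, hf, if_neg hb]
  split_ifs <;> rfl

lemma HasCoords.oracle_check (l : ℕ) {f : ℕ → ℝ} {p q : ℝ}
    (h : HasCoords n F θ f p q) : HasCoords n F θ (oracle (2 ^ l) F f) p 0 := by
  obtain ⟨α, β, hf, rfl, rfl⟩ := h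
  refine ⟨α, 0, fun v => ?_, rfl, by ring⟩
  rw [oracle, hf, if_pos (show ∃ e, 2 ^ l = 2 ^ e from ⟨l, rfl⟩)]
  split_ifs <;> rfl

lemma HasCoords.sum_sq (hθ : Real.sin θ ^ 2 * 2 ^ n = commonCount n F) {f : ℕ → ℝ} {p q : ℝ}
    (h : HasCoords n F θ f p q) : ∑ v ∈ range (2 ^ n), f v ^ 2 = p ^ 2 + q ^ 2 := by
  obtain ⟨α, β, hf, rfl, rfl⟩ := h
  have h1 : ∀ v ∈ range (2 ^ n), f v ^ 2 = if F v = 1 then β ^ 2 else α ^ 2 := fun v _ => by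
    rw [hf]; split_ifs <;> rfl
  rw [sum_congr rfl h1, sum_two_valued, ← hθ, mul_pow, mul_pow, mul_pow, mul_pow, sqrt_two_pow_sq,
    Real.cos_sq']
  ring

/-- Between two checks, the state rotates by `2 θ` in each block; the check in block `2 ^ l` measures the
angle `2 ^ l θ`. -/
lemma hasCoords_amplitude (hθ : Real.sin θ ^ 2 * 2 ^ n = commonCount n F) (l j : ℕ) (hj : j < 2 ^ l) :
    ∃ r : ℝ, r ^ 2 = ∏ i ∈ range (l + 1), Real.cos (2 ^ i * θ) ^ 2 ∧
      HasCoords n F θ (amplitude n F (2 ^ l + j)) (r * Real.cos (2 * θ * (j + 1)))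
        (r * Real.sin (2 * θ * (j + 1))) := by
  have check : ∀ {l B : ℕ} {r : ℝ}, B + 1 = 2 ^ l →
      HasCoords n F θ (amplitude n F B) (r * Real.cos (2 ^ l * θ)) (r * Real.sin (2 ^ l * θ)) →
      HasCoords n F θ (amplitude n F (2 ^ l)) ((-(r * Real.cos (2 ^ l * θ))) * Real.cos (2 * θ))
        ((-(r * Real.cos (2 ^ l * θ))) * Real.sin (2 * θ)) := by
    intro l B r hB h
    have h1 := (h.oracle_check l).diffuse hθ
    rw [← hB, amplitude, hB]
    convert h1 using 1 <;> ring
  induction l generalizing j with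
  | zero =>
    have hj0 : j = 0 := by omega
    subst hj0
    refine ⟨-(1 * Real.cos (2 ^ 0 * θ)), by simp, ?_⟩
    have h1 := check (l := 0) (B := 0) (r := 1) rfl (by simpa using hasCoords_zero (n := n) (F := F) (θ := θ))
    simpa using h1
  | succ l ih =>
    induction j with
    | zero =>
      obtain ⟨r, hr, h⟩ := ih (2 ^ l - 1) (by have := Nat.two_pow_pos l; omega)
      refine ⟨-(r * Real.cos (2 ^ (l + 1) * θ)), ?_, ?_⟩
      · rw [Finset.prod_range_succ, ← hr]
        ring
      · have hl := Nat.two_pow_pos l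
        have e : 2 * θ * (((2 ^ l - 1 : ℕ) : ℝ) + 1) = 2 ^ (l + 1) * θ := by
          have : ((2 ^ l - 1 : ℕ) : ℝ) + 1 = 2 ^ l := by
            have : 2 ^ l - 1 + 1 = 2 ^ l := by omega
            exact_mod_cast this
          rw [this]; ring
        rw [e] at h
        have h1 := check (l := l + 1) (by rw [pow_succ]; omega) h
        simpa using h1
    | succ j ihj =>
      obtain ⟨r, hr, h⟩ := ihj (by omega)
      refine ⟨-r, by rw [neg_sq, hr], ?_⟩
      have hb : ¬ ∃ e, 2 ^ (l + 1) + j + 1 = 2 ^ e := by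
        rintro ⟨e, he⟩
        have h1 : l + 1 < e := (Nat.pow_lt_pow_iff_right (show 1 < 2 by omega)).1 (by omega)
        have h2 : e < l + 1 + 1 := (Nat.pow_lt_pow_iff_right (show 1 < 2 by omega)).1
          (by rw [pow_succ 2 (l + 1)]; omega)
        omega
      have h1 := (h.oracle_phase hb).diffuse hθ
      rw [← add_assoc, amplitude]
      have e : 2 * θ * (((j + 1 : ℕ) : ℝ) + 1) = 2 * θ * (j + 1) + 2 * θ := by push_cast; ring
      rw [e, Real.cos_add, Real.sin_add]
      convert h1 using 1 <;> ring

lemma sum_sq_amplitude (hθ : Real.sin θ ^ 2 * 2 ^ n = commonCount n F) {k : ℕ} (hk : 1 ≤ k) :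
    ∑ v ∈ range (2 ^ n), amplitude n F (2 ^ k - 1) v ^ 2
      = ∏ i ∈ range k, Real.cos (2 ^ i * θ) ^ 2 := by
  obtain ⟨l, rfl⟩ : ∃ l, k = l + 1 := ⟨k - 1, by omega⟩
  have hl := Nat.two_pow_pos l
  obtain ⟨r, hr, h⟩ := hasCoords_amplitude hθ l (2 ^ l - 1) (by omega)
  rw [show 2 ^ (l + 1) - 1 = 2 ^ l + (2 ^ l - 1) by rw [pow_succ]; omega, h.sum_sq hθ, mul_pow, mul_pow,
    ← mul_add, Real.cos_sq_add_sin_sq, mul_one, hr]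

lemma cos_half_sq_le : Real.cos (1 / 2) ^ 2 ≤ 7 / 9 := by
  have h1 := Real.cos_sq (1 / 2)
  have h2 := Real.cos_one_le
  norm_num at h1 h2 ⊢
  linarith

/-- If there is a common position, then some check finds it with constant probability. -/
lemma exists_cos_sq_le (hθ1 : θ ≤ Real.pi / 2) {k : ℕ} (hk : 1 ≤ k)
    (h : 1 ≤ 2 ^ k * θ) : ∃ i < k, Real.cos (2 ^ i * θ) ^ 2 ≤ 7 / 9 := by
  classical
  have hex : ∃ i, 1 / 2 ≤ (2 : ℝ) ^ i * θ := ⟨k, by linarith⟩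
  have hi := Nat.find_spec hex
  have hle : Nat.find hex ≤ k - 1 := Nat.find_min' hex (by
    have : (2 : ℝ) ^ k = 2 * 2 ^ (k - 1) := by rw [← pow_succ']; congr 1; omega
    rw [this] at h
    linarith)
  have hub : (2 : ℝ) ^ Nat.find hex * θ ≤ Real.pi / 2 := by
    rcases Nat.eq_zero_or_pos (Nat.find hex) with h0 | h0
    · rw [h0]; simpa using hθ1
    · have h1 := Nat.find_min hex (show Nat.find hex - 1 < Nat.find hex by omega)
      have : (2 : ℝ) ^ Nat.find hex = 2 * 2 ^ (Nat.find hex - 1) := by rw [← pow_succ']; congr 1; omega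
      have h2 := Real.pi_gt_three
      rw [this]
      linarith
  refine ⟨Nat.find hex, by omega, le_trans ?_ cos_half_sq_le⟩
  refine pow_le_pow_left₀ (Real.cos_nonneg_of_mem_Icc ⟨by linarith, hub⟩) ?_ 2
  exact Real.cos_le_cos_of_nonneg_of_le_pi (by norm_num) (by have := Real.pi_pos; linarith) hi

/-- After `2 ^ k - 1` blocks, nothing has been lost if there is no common position, and a constant
fraction of the weight has been lost otherwise. -/
lemma sum_sq_amplitude_cases {k : ℕ} (hk : 1 ≤ k) (F : ℕ → Fin 2) :
    ((∀ v < 2 ^ (2 * k), F v ≠ 1) →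
      ∑ v ∈ range (2 ^ (2 * k)), amplitude (2 * k) F (2 ^ k - 1) v ^ 2 = 1) ∧
    ((∃ v < 2 ^ (2 * k), F v = 1) →
      ∑ v ∈ range (2 ^ (2 * k)), amplitude (2 * k) F (2 ^ k - 1) v ^ 2 ≤ 7 / 9) := by
  constructor
  · intro h
    have hc : commonCount (2 * k) F = 0 := by
      rw [commonCount, Finset.card_eq_zero, Finset.filter_eq_empty_iff]
      exact fun v hv => h v (mem_range.1 hv)
    rw [sum_sq_amplitude (θ := 0) (by simp [hc]) hk]
    simp
  · rintro ⟨v, hv, hF⟩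
    set t := commonCount (2 * k) F with ht
    have ht1 : 1 ≤ t := Finset.card_pos.2 ⟨v, mem_filter.2 ⟨mem_range.2 hv, hF⟩⟩
    have htN : t ≤ 2 ^ (2 * k) := (Finset.card_filter_le _ _).trans (Finset.card_range _).le
    have hN : (0 : ℝ) < 2 ^ (2 * k) := by positivity
    have htN' : (t : ℝ) ≤ 2 ^ (2 * k) := by exact_mod_cast htN
    have ht1' : (1 : ℝ) ≤ t := by exact_mod_cast ht1
    set s := Real.sqrt (t / 2 ^ (2 * k)) with hs
    have hs2 : s ^ 2 = t / 2 ^ (2 * k) := Real.sq_sqrt (by positivity)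
    have hs1 : s ≤ 1 := by
      refine Real.sqrt_le_iff.2 ⟨zero_le_one, ?_⟩
      rw [one_pow, div_le_one hN]
      exact htN'
    have hs0 : 0 ≤ s := Real.sqrt_nonneg _
    have hsin : Real.sin (Real.arcsin s) = s := Real.sin_arcsin (by linarith) hs1
    have h0 : 0 ≤ Real.arcsin s := Real.arcsin_nonneg.2 hs0
    have hk1 : 1 ≤ 2 ^ k * s := by
      have h1 : (1 : ℝ) ≤ (2 ^ k * s) ^ 2 := by
        rw [mul_pow, hs2, ← pow_mul, mul_comm k 2, mul_div_cancel₀ _ hN.ne']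
        exact ht1'
      have h2 : (0 : ℝ) ≤ 2 ^ k * s := by positivity
      nlinarith
    have hle : s ≤ Real.arcsin s := by
      conv_lhs => rw [← hsin]
      exact Real.sin_le h0
    obtain ⟨i, hi, hci⟩ := exists_cos_sq_le (Real.arcsin_le_pi_div_two s) hk
      (hk1.trans (mul_le_mul_of_nonneg_left hle (by positivity)))
    rw [sum_sq_amplitude (θ := Real.arcsin s) (by rw [hsin, hs2, div_mul_cancel₀ _ hN.ne']) hk,
      ← Finset.mul_prod_erase _ _ (mem_range.2 hi)]
    refine (mul_le_of_le_one_right (by positivity) (Finset.prod_le_one (fun _ _ => by positivity)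
      fun j _ => ?_)).trans hci
    exact Real.cos_sq_le_one _

end Rotation

/-! ### The streaming algorithm -/

/-- The variables of the streaming algorithm. -/
structure Reg where
  /-- `0` while the prefix `1^k#` is read, `1` while the words are read, `2` when all is over. -/
  mode : ℕ
  /-- The number of leading ones. -/
  k : ℕ
  /-- The number of bits of the current word that have been read. -/
  i : ℕ
  /-- The number of complete words. -/
  j : ℕ
  /-- The length of the complete words. -/
  N : ℕ
  /-- The number of events. -/
  e : ℕ
  /-- A power of `16` that bounds the seed. -/
  P : ℕ
  /-- The seed of the fingerprints. -/
  R : ℕ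
  /-- The level of the fingerprint. -/
  T : ℕ
  /-- The fingerprint of the part of the word at the current level. -/
  v : ℕ
  /-- The fingerprint of the part of the word at lower levels. -/
  S : ℕ
  /-- The fingerprint of the first word. -/
  HX : ℕ
  /-- The fingerprint of the second word. -/
  HY : ℕ
  /-- The kind of circuit to be written: `0` nothing, `1` for a bit of the first word of a block, `2` for
  a bit of the second word, `3` initialization, `4` diffusion, `5` conjunction of the verdicts. -/
  op : ℕ
  /-- The position of the last bit. -/
  pos : ℕ

instance : RCtx Reg where
  num := 15
  get i γ := [γ.mode, γ.k, γ.i, γ.j, γ.N, γ.e, γ.P, γ.R, γ.T, γ.v, γ.S, γ.HX, γ.HY, γ.op, γ.pos].getD i 0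

lemma Reg.forall_get {p : ℕ → (Reg → ℕ) → Prop} (h0 : p 0 Reg.mode) (h1 : p 1 Reg.k) (h2 : p 2 Reg.i)
    (h3 : p 3 Reg.j) (h4 : p 4 Reg.N) (h5 : p 5 Reg.e) (h6 : p 6 Reg.P) (h7 : p 7 Reg.R) (h8 : p 8 Reg.T)
    (h9 : p 9 Reg.v) (h10 : p 10 Reg.S) (h11 : p 11 Reg.HX) (h12 : p 12 Reg.HY) (h13 : p 13 Reg.op)
    (h14 : p 14 Reg.pos) : ∀ i < RCtx.num Reg, p i (RCtx.get i) := by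
  intro i hi
  change i < 15 at hi
  interval_cases i <;> assumption

/-- The modulus of the fingerprints of level `T`. -/
def hashMod (T : ℕ) : ℕ := primeAbove (16 * T ^ 2)

/-- The fingerprint of the current word. -/
def Reg.digest (γ : Reg) : ℕ := γ.S * hashMod γ.T + γ.v

/-- Counts an event and appends a random digit to the seed if it is too short for the fingerprints
that may be needed next. -/
def Reg.absorb (p : Reg × ℕ) : Reg := { p.1 with
    e := p.1.e + 1
    P := if p.1.P < 16 * (p.1.e + 1) ^ 4 then p.1.P * 16 else p.1.P
    R := if p.1.P < 16 * (p.1.e + 1) ^ 4 then p.1.R + p.1.P * p.2 else p.1.R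
    op := 0 }

/-- Reads a bit of a word. The level is squared after `T` bits. -/
def Reg.push (β : ℕ) (γ : Reg) : Reg := { γ with
    i := γ.i + 1
    T := if γ.i = γ.T then γ.T ^ 2 else γ.T
    v := if γ.i = γ.T then β else (γ.v * (γ.R % (16 * γ.T ^ 2)) + β) % hashMod γ.T
    S := if γ.i = γ.T then γ.digest else γ.S
    op := if 3 ≤ γ.j ∧ β = 1 then (if γ.j % 3 = 1 then 2 else 1) else 0
    pos := γ.i }

/-- Stops. -/
def Reg.quit (γ : Reg) : Reg := { γ with mode := 2 }

/-- Whether the word that has just been read has the right length and agrees with the first or the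
second word, according to the fingerprints. -/
def Reg.WordOk (γ : Reg) : Prop :=
  (γ.j = 0 → (∃ q, γ.i = 2 ^ q) ∧ Nat.log 2 γ.i = 2 * γ.k) ∧ (γ.j ≠ 0 → γ.i = γ.N) ∧
    (γ.j ≠ 0 → γ.j % 3 ≠ 1 → γ.digest = γ.HX) ∧ (γ.j ≠ 1 → γ.j % 3 = 1 → γ.digest = γ.HY)

/-- Completes a word. -/
def Reg.close (γ : Reg) : Reg := { γ with
    i := 0
    j := γ.j + 1
    N := γ.i
    T := 4
    v := 0
    S := 0
    HX := if γ.j = 0 then γ.digest else γ.HX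
    HY := if γ.j = 1 then γ.digest else γ.HY
    op := if γ.j = 2 then 3 else if 3 ≤ γ.j ∧ γ.j % 3 = 2 then 4 else 0 }

/-- Whether the input is accepted at its end: all blocks are complete, and their number is `2 ^ k`. -/
def Reg.Final (γ : Reg) : Prop := γ.mode = 1 ∧ γ.i = 0 ∧ 1 ≤ γ.j ∧ γ.j % 3 = 0 ∧ (γ.j / 3) ^ 2 = γ.N

open Classical in
/-- The update by a symbol that is not the end of the input. -/
noncomputable def Reg.read (o : Ternary) (γ : Reg) : Reg :=
  match o with
  | .zero => if γ.mode = 0 then γ.quit else if γ.mode = 1 then γ.push 0 else γ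
  | .one => if γ.mode = 0 then { γ with k := γ.k + 1 } else if γ.mode = 1 then γ.push 1 else γ
  | .hash => if γ.mode = 0 then (if 1 ≤ γ.k then { γ with mode := 1 } else γ.quit)
      else if γ.mode = 1 then (if γ.WordOk then γ.close else γ.quit) else γ

open Classical in
/-- The update by an event. -/
noncomputable def Reg.upd (o : Option Ternary) (p : Reg × ℕ) : Reg :=
  match o with
  | none => if (Reg.absorb p).Final then { Reg.absorb p with mode := 2, op := 5 } else (Reg.absorb p).quit
  | some o => (Reg.absorb p).read o

section Emission

open Classical in
/-- The macro number `u` of the test of copy `c`: its kind. -/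
noncomputable def Reg.kind (γ : Reg) (u : ℕ) : ℕ :=
  if u < 2 * γ.k then (if γ.op = 3 ∨ γ.op = 4 then 3 else 0)
  else if 3 * (2 * γ.k) < u then (if γ.op = 4 then 3 else 0)
  else if u = 2 * (2 * γ.k) then
    (if γ.op = 1 ∨ γ.op = 5 ∨ (γ.op = 2 ∧ ∃ e, γ.j / 3 = 2 ^ e) then 1 else 4)
  else if u < 2 * (2 * γ.k) then
    (if (γ.op = 1 ∨ γ.op = 2) ∧ γ.pos.testBit (u - 2 * γ.k) = true then 1 else 2)
  else (if (γ.op = 1 ∨ γ.op = 2) ∧ γ.pos.testBit (3 * (2 * γ.k) - u) = true then 1 else 2)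

/-- The qubit that macro number `u` refers to, as a position in the register. -/
def Reg.level (γ : Reg) (u : ℕ) : ℕ :=
  if u < 2 * γ.k then u else if u < 2 * (2 * γ.k) then u - 2 * γ.k
  else if 3 * (2 * γ.k) < u then 4 * (2 * γ.k) - u else 3 * (2 * γ.k) - u

/-- The first operand of macro number `u` of the test of copy `c`. -/
def Reg.arg₁ (γ : Reg) (c u : ℕ) : ℕ :=
  if u = 2 * (2 * γ.k) then 36 * (2 * γ.k) + 2
  else if γ.op = 5 then flagAddr c (γ.level u) else idxAddr c (γ.level u)

/-- The first controlling operand of the test of copy `c`. -/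
def Reg.argU (γ : Reg) (c : ℕ) : ℕ :=
  if γ.op = 1 ∨ γ.op = 4 then 2 else if γ.op = 5 then verdictAddr c else 4 + c

open Classical in
/-- The target of the test of copy `c`. -/
noncomputable def Reg.argV (γ : Reg) (c : ℕ) : ℕ :=
  if γ.op = 1 then 4 + c else if γ.op = 5 then verdictAddr (c + 1)
  else if γ.op = 2 ∧ ∃ e, γ.j / 3 = 2 ^ e then flagAddr c (Nat.log 2 (γ.j / 3)) else 3

/-- The second operand of macro number `u` of the test of copy `c`. -/
def Reg.arg₂ (γ : Reg) (c u : ℕ) : ℕ :=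
  if u < 2 * γ.k ∨ 3 * (2 * γ.k) < u then 1
  else if u = 2 * (2 * γ.k) then γ.argU c else 36 * γ.level u + 2

/-- The third operand of macro number `u` of the test of copy `c`. -/
noncomputable def Reg.arg₃ (γ : Reg) (c u : ℕ) : ℕ :=
  if u < 2 * γ.k ∨ 3 * (2 * γ.k) < u then 1
  else if u = 2 * (2 * γ.k) then γ.argV c else 36 * (γ.level u + 1) + 2

/-- The number of gates of a test of one copy. -/
def Reg.testLen (γ : Reg) : ℕ := 39 * (4 * (2 * γ.k) + 1)

/-- Entry `s` of the table of a macro. -/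
def roleEntry (f : ℕ × ℕ × ℕ → ℕ) (κ s : ℕ) : ℕ := ((macroRoles κ).map f).getD s 0

/-- An operand of gate number `t`. -/
noncomputable def Reg.operand (f : ℕ × ℕ × ℕ → ℕ) (p : Reg × ℕ) : ℕ :=
  roleAddr (p.1.arg₁ (p.2 / p.1.testLen) (p.2 % p.1.testLen / 39))
    (p.1.arg₂ (p.2 / p.1.testLen) (p.2 % p.1.testLen / 39))
    (p.1.arg₃ (p.2 / p.1.testLen) (p.2 % p.1.testLen / 39))
    (roleEntry f (p.1.kind (p.2 % p.1.testLen / 39)) (p.2 % 39))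

end Emission

/-- The streaming algorithm for the language. -/
noncomputable def disjAlg : StreamAlg Reg where
  init := ⟨0, 0, 0, 0, 0, 0, 1, 0, 4, 0, 0, 0, 0, 0, 0⟩
  upd := Reg.upd
  len γ := if γ.op = 0 then 0 else 8 * γ.testLen
  fstOut := Reg.operand Prod.fst
  sndOut := Reg.operand fun t => t.2.1
  trdOut p := roleEntry (fun t => t.2.2) (p.1.kind (p.2 % p.1.testLen / 39)) (p.2 % 39)

section Computability

variable {Γ : Type} [RCtx Γ] {φ : Γ → Reg}

/-- All variables are computed by register programs. -/
def RegComp (φ : Γ → Reg) : Prop := ∀ i < RCtx.num Reg, RComp fun γ => RCtx.get i (φ γ)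

lemma RegComp.mk {mode k i j N e P R T v S HX HY op pos : Γ → ℕ} (h0 : RComp mode) (h1 : RComp k)
    (h2 : RComp i) (h3 : RComp j) (h4 : RComp N) (h5 : RComp e) (h6 : RComp P) (h7 : RComp R)
    (h8 : RComp T) (h9 : RComp v) (h10 : RComp S) (h11 : RComp HX) (h12 : RComp HY) (h13 : RComp op)
    (h14 : RComp pos) : RegComp fun γ => ⟨mode γ, k γ, i γ, j γ, N γ, e γ, P γ, R γ, T γ, v γ, S γ, HX γ,
      HY γ, op γ, pos γ⟩ :=
  Reg.forall_get (p := fun _ f => RComp fun γ => f ⟨mode γ, k γ, i γ, j γ, N γ, e γ, P γ, R γ, T γ, v γ,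
    S γ, HX γ, HY γ, op γ, pos γ⟩) h0 h1 h2 h3 h4 h5 h6 h7 h8 h9 h10 h11 h12 h13 h14

lemma RegComp.ite {p : Γ → Prop} [∀ γ, Decidable (p γ)] {ψ : Γ → Reg} (hp : RPred p) (h : RegComp φ)
    (h' : RegComp ψ) : RegComp fun γ => if p γ then φ γ else ψ γ := fun i hi =>
  (RComp.ite hp (h i hi) (h' i hi)).congr fun γ => by dsimp only; split_ifs <;> rfl

lemma RegComp.mode (h : RegComp φ) : RComp fun γ => (φ γ).mode := h 0 (by decide)
lemma RegComp.k (h : RegComp φ) : RComp fun γ => (φ γ).k := h 1 (by decide)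
lemma RegComp.i (h : RegComp φ) : RComp fun γ => (φ γ).i := h 2 (by decide)
lemma RegComp.j (h : RegComp φ) : RComp fun γ => (φ γ).j := h 3 (by decide)
lemma RegComp.N (h : RegComp φ) : RComp fun γ => (φ γ).N := h 4 (by decide)
lemma RegComp.e (h : RegComp φ) : RComp fun γ => (φ γ).e := h 5 (by decide)
lemma RegComp.P (h : RegComp φ) : RComp fun γ => (φ γ).P := h 6 (by decide)
lemma RegComp.R (h : RegComp φ) : RComp fun γ => (φ γ).R := h 7 (by decide)
lemma RegComp.T (h : RegComp φ) : RComp fun γ => (φ γ).T := h 8 (by decide)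
lemma RegComp.v (h : RegComp φ) : RComp fun γ => (φ γ).v := h 9 (by decide)
lemma RegComp.S (h : RegComp φ) : RComp fun γ => (φ γ).S := h 10 (by decide)
lemma RegComp.HX (h : RegComp φ) : RComp fun γ => (φ γ).HX := h 11 (by decide)
lemma RegComp.HY (h : RegComp φ) : RComp fun γ => (φ γ).HY := h 12 (by decide)
lemma RegComp.op (h : RegComp φ) : RComp fun γ => (φ γ).op := h 13 (by decide)
lemma RegComp.pos (h : RegComp φ) : RComp fun γ => (φ γ).pos := h 14 (by decide)

lemma RegComp.id : RegComp fun γ : Reg => γ := fun _ hi => RComp.get hi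

lemma RegComp.reg : RegComp fun p : Reg × ℕ => p.1 := fun _ hi => (RegComp.id _ hi).fst

lemma RComp.sq {f : Γ → ℕ} (hf : RComp f) : RComp fun γ => f γ ^ 2 :=
  (hf.mul hf).congr fun _ => (pow_two _).symm

lemma RegComp.hashMod {f : Γ → ℕ} (hf : RComp f) : RComp fun γ => hashMod (f γ) :=
  RComp.primeAbove.app ((RComp.const 16).mul hf.sq)

lemma RegComp.digest (h : RegComp φ) : RComp fun γ => (φ γ).digest := (h.S.mul (RegComp.hashMod h.T)).add h.v

lemma RegComp.absorb : RegComp Reg.absorb := by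
  have h := RegComp.reg
  have h1 : RComp fun p : Reg × ℕ => 16 * (p.1.e + 1) ^ 4 :=
    ((RComp.const 16).mul (h.e.add (RComp.const 1)).sq.sq).congr fun p => by ring
  have h2 := RPred.lt h.P h1
  exact .mk h.mode h.k h.i h.j h.N (h.e.add (.const 1)) (.ite h2 (h.P.mul (.const 16)) h.P)
    (.ite h2 (h.R.add (h.P.mul .snd)) h.R) h.T h.v h.S h.HX h.HY (.const 0) h.pos

lemma RegComp.push (h : RegComp φ) (β : ℕ) : RegComp fun γ => (φ γ).push β := by
  have h1 := RPred.eq h.i h.T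
  have h2 := (RPred.le (.const 3) h.j).and (RPred.eq (.const β) (.const 1))
  exact .mk h.mode h.k (h.i.add (.const 1)) h.j h.N h.e h.P h.R (.ite h1 h.T.sq h.T)
    (.ite h1 (.const β) (((h.v.mul (h.R.mod ((RComp.const 16).mul h.T.sq))).add (.const β)).mod
      (RegComp.hashMod h.T)))
    (.ite h1 h.digest h.S) h.HX h.HY
    (.ite h2 (.ite (.eq (h.j.mod (.const 3)) (.const 1)) (.const 2) (.const 1)) (.const 0)) h.i

lemma RegComp.quit (h : RegComp φ) : RegComp fun γ => (φ γ).quit :=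
  .mk (.const 2) h.k h.i h.j h.N h.e h.P h.R h.T h.v h.S h.HX h.HY h.op h.pos

lemma RegComp.wordOk (h : RegComp φ) : RPred fun γ => (φ γ).WordOk := by
  have h0 := RPred.eq_const h.j 0
  have h1 := RPred.eq_const h.j 1
  have h2 := RPred.eq_const (h.j.mod (.const 3)) 1
  refine ((h0.not.or ((RPred.isPowTwo.app h.i).and (.eq (RComp.log2.app h.i) ((RComp.const 2).mul h.k)))).and
    ((h0.or (.eq h.i h.N)).and ((h0.or (h2.or (.eq h.digest h.HX))).and
    (h1.or (h2.not.or (.eq h.digest h.HY)))))).congr fun γ => ?_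
  unfold Reg.WordOk
  tauto

lemma RegComp.close (h : RegComp φ) : RegComp fun γ => (φ γ).close :=
  .mk h.mode h.k (.const 0) (h.j.add (.const 1)) h.i h.e h.P h.R (.const 4) (.const 0) (.const 0)
    (.ite (.eq_const h.j 0) h.digest h.HX) (.ite (.eq_const h.j 1) h.digest h.HY)
    (.ite (.eq_const h.j 2) (.const 3) (.ite ((RPred.le (.const 3) h.j).and
      (.eq_const (h.j.mod (.const 3)) 2)) (.const 4) (.const 0))) h.pos

lemma RegComp.final (h : RegComp φ) : RPred fun γ => (φ γ).Final :=
  (RPred.eq_const h.mode 1).and ((RPred.eq_const h.i 0).and ((RPred.le (.const 1) h.j).and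
    ((RPred.eq_const (h.j.mod (.const 3)) 0).and (.eq (h.j.div (.const 3)).sq h.N))))

lemma RegComp.read (h : RegComp φ) (o : Ternary) : RegComp fun γ => (φ γ).read o := by
  classical
  have h0 := RPred.eq_const h.mode 0
  have h1 := RPred.eq_const h.mode 1
  cases o
  · exact .ite h0 h.quit (.ite h1 (h.push 0) h)
  · exact .ite h0 (.mk h.mode (h.k.add (.const 1)) h.i h.j h.N h.e h.P h.R h.T h.v h.S h.HX h.HY h.op h.pos)
      (.ite h1 (h.push 1) h)
  · exact .ite h0 (.ite (.le (.const 1) h.k)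
      (.mk (.const 1) h.k h.i h.j h.N h.e h.P h.R h.T h.v h.S h.HX h.HY h.op h.pos) h.quit)
      (.ite h1 (.ite h.wordOk h.close h.quit) h)

lemma RegComp.upd (o : Option Ternary) : RegComp (Reg.upd o) := by
  classical
  have h := RegComp.absorb
  cases o
  · exact .ite h.final (.mk (.const 2) h.k h.i h.j h.N h.e h.P h.R h.T h.v h.S h.HX h.HY (.const 5) h.pos)
      h.quit
  · exact h.read _

lemma RComp.roleEntry (f : ℕ × ℕ × ℕ → ℕ) {κ s : Γ → ℕ} (hκ : RComp κ) (hs : RComp s) :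
    RComp fun γ => roleEntry f (κ γ) (s γ) := by
  have h : ∀ l, RComp fun γ => ((macroRoles l).map f).getD (s γ) 0 := fun l => RComp.table _ hs
  refine (RComp.ite (RPred.eq_const hκ 1) (h 1) (.ite (RPred.eq_const hκ 2) (h 2)
    (.ite (RPred.eq_const hκ 3) (h 3) (.ite (RPred.eq_const hκ 4) (h 4) (h 0))))).congr fun γ => ?_
  split_ifs with h1 h2 h3 h4
  · rw [h1]; rfl
  · rw [h2]; rfl
  · rw [h3]; rfl
  · rw [h4]; rfl
  · simp only [_root_.roleEntry, macroRoles, if_neg h1, if_neg h2, if_neg h3, if_neg h4]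
    rfl

lemma RPred.testBit_app {f g : Γ → ℕ} (hf : RComp f) (hg : RComp g) :
    RPred fun γ => (f γ).testBit (g γ) = true := RPred.testBit.app₂ hf hg

variable {c u : Γ → ℕ}

lemma RegComp.verdict (hc : RComp c) : RComp fun γ => verdictAddr (c γ) :=
  .ite (.eq_const hc 0) (.const 2) (.ite (.eq_const hc 8) (.const 0) ((RComp.const 12).add hc))

lemma RegComp.level (h : RegComp φ) (hu : RComp u) : RComp fun γ => (φ γ).level (u γ) := by
  have hn := (RComp.const 2).mul h.k
  exact .ite (.lt hu hn) hu (.ite (.lt hu ((RComp.const 2).mul hn)) (hu.sub hn)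
    (.ite (.lt ((RComp.const 3).mul hn) hu) (((RComp.const 4).mul hn).sub hu) (((RComp.const 3).mul hn).sub hu)))

lemma RegComp.kind (h : RegComp φ) (hu : RComp u) : RComp fun γ => (φ γ).kind (u γ) := by
  classical
  have hn := (RComp.const 2).mul h.k
  have ho := fun c => RPred.eq_const h.op c
  have hb := (ho 1).or (ho 2)
  exact .ite (.lt hu hn) (.ite ((ho 3).or (ho 4)) (.const 3) (.const 0))
    (.ite (.lt ((RComp.const 3).mul hn) hu) (.ite (ho 4) (.const 3) (.const 0))
    (.ite (.eq hu ((RComp.const 2).mul hn))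
      (.ite ((ho 1).or ((ho 5).or ((ho 2).and (RPred.isPowTwo.app (h.j.div (.const 3)))))) (.const 1) (.const 4))
    (.ite (.lt hu ((RComp.const 2).mul hn))
      (.ite (hb.and (.testBit_app h.pos (hu.sub hn))) (.const 1) (.const 2))
      (.ite (hb.and (.testBit_app h.pos (((RComp.const 3).mul hn).sub hu))) (.const 1) (.const 2)))))

lemma RegComp.arg₁ (h : RegComp φ) (hc : RComp c) (hu : RComp u) :
    RComp fun γ => (φ γ).arg₁ (c γ) (u γ) := by
  have hn := (RComp.const 2).mul h.k
  have hl := (RComp.const 36).mul (h.level hu)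
  exact .ite (.eq hu ((RComp.const 2).mul hn)) (((RComp.const 36).mul hn).add (.const 2))
    (.ite (.eq_const h.op 5) ((hl.add (.const 28)).add hc) ((hl.add (.const 20)).add hc))

lemma RegComp.arg₂ (h : RegComp φ) (hc : RComp c) (hu : RComp u) :
    RComp fun γ => (φ γ).arg₂ (c γ) (u γ) := by
  have hn := (RComp.const 2).mul h.k
  have ho := fun c => RPred.eq_const h.op c
  exact .ite ((RPred.lt hu hn).or (.lt ((RComp.const 3).mul hn) hu)) (.const 1)
    (.ite (.eq hu ((RComp.const 2).mul hn)) (.ite ((ho 1).or (ho 4)) (.const 2)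
      (.ite (ho 5) (RegComp.verdict hc) ((RComp.const 4).add hc)))
      (((RComp.const 36).mul (h.level hu)).add (.const 2)))

lemma RegComp.arg₃ (h : RegComp φ) (hc : RComp c) (hu : RComp u) :
    RComp fun γ => (φ γ).arg₃ (c γ) (u γ) := by
  classical
  have hn := (RComp.const 2).mul h.k
  have ho := fun c => RPred.eq_const h.op c
  have hb := h.j.div (.const 3)
  exact .ite ((RPred.lt hu hn).or (.lt ((RComp.const 3).mul hn) hu)) (.const 1)
    (.ite (.eq hu ((RComp.const 2).mul hn)) (.ite (ho 1) ((RComp.const 4).add hc)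
      (.ite (ho 5) (RegComp.verdict (hc.add (.const 1)))
      (.ite ((ho 2).and (RPred.isPowTwo.app hb))
        ((((RComp.const 36).mul (RComp.log2.app hb)).add (.const 28)).add hc) (.const 3))))
      (((RComp.const 36).mul ((h.level hu).add (.const 1))).add (.const 2)))

lemma disjAlg_computable : disjAlg.Computable := by
  have h := RegComp.reg
  have hL : RComp fun p : Reg × ℕ => p.1.testLen :=
    (RComp.const 39).mul (((RComp.const 4).mul ((RComp.const 2).mul h.k)).add (.const 1))
  have hc := RComp.snd.div hL
  have hu := (RComp.snd.mod hL).div (.const 39)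
  have hs := RComp.snd (Γ := Reg) |>.mod (.const 39)
  have hop : ∀ f, RComp (Reg.operand f) := fun f => by
    have hr := RComp.roleEntry f (h.kind hu) hs
    exact .ite (.eq_const hr 0) (h.arg₁ hc hu) (.ite (.eq_const hr 1) (h.arg₂ hc hu)
      (.ite (.eq_const hr 2) (h.arg₃ hc hu) (.ite (.eq_const hr 3) (.const 2) (.const 1))))
  refine ⟨fun o => RegComp.upd o, ?_, hop _, hop _, RComp.roleEntry _ (h.kind hu) hs⟩
  have h' := RegComp.id
  exact .ite (.eq_const h'.op 0) (.const 0) ((RComp.const 8).mul ((RComp.const 39).mul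
    (((RComp.const 4).mul ((RComp.const 2).mul h'.k)).add (.const 1))))

end Computability

/-! ### Invariants of the streaming algorithm -/

lemma hashMod_le {T : ℕ} (hT : 1 ≤ T) : hashMod T ≤ 32 * T ^ 2 := by
  have := primeAbove_le (n := 16 * T ^ 2) (by positivity)
  unfold hashMod
  omega

lemma lt_hashMod (T : ℕ) : 16 * T ^ 2 < hashMod T := lt_primeAbove _

/-- The invariants between two events (`d = 0`), and after an event has been counted (`d = 1`). -/
structure Reg.Inv (d : ℕ) (γ : Reg) : Prop where
  mode_le : γ.mode ≤ 2
  k_le : γ.k + d ≤ γ.e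
  i_le : γ.i + d ≤ γ.e
  j_le : γ.j + d ≤ γ.e
  N_le : γ.N ≤ γ.e
  pos_le : γ.pos ≤ γ.e
  op_le : γ.op ≤ 5
  P_pow : ∃ a, γ.P = 16 ^ a
  le_P : 16 * γ.e ^ 4 ≤ γ.P
  P_lt : γ.P < 256 * (γ.e + 1) ^ 4
  R_lt : γ.R < γ.P
  T_pow : ∃ t, γ.T = 4 ^ 2 ^ t
  T_le : γ.T = 4 ∨ γ.T ≤ γ.i ^ 2
  v_lt : γ.v < hashMod γ.T
  S_lt : γ.S < γ.T ^ 5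
  HX_le : γ.HX ≤ 32 * (γ.e + 2) ^ 14
  HY_le : γ.HY ≤ 32 * (γ.e + 2) ^ 14
  k_pos : γ.mode = 1 → 1 ≤ γ.k ∧ 2 + d ≤ γ.e
  j_zero : γ.mode = 0 → γ.j = 0
  N_eq : γ.mode = 1 → 1 ≤ γ.j → γ.N = 2 ^ (2 * γ.k)
  op_pos : γ.op ≠ 0 → 1 ≤ γ.k ∧ 2 ^ (2 * γ.k) ≤ γ.e

namespace Reg

variable {γ : Reg} {d c : ℕ}

lemma Inv.absorb (h : γ.Inv 0) (hc : c < 16) : (Reg.absorb (γ, c)).Inv 1 := by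
  obtain ⟨a, ha⟩ := h.P_pow
  have hP1 : 1 ≤ γ.P := ha ▸ Nat.one_le_pow _ _ (by omega)
  have hmono : (γ.e + 2) ^ 14 ≤ (γ.e + 1 + 2) ^ 14 := Nat.pow_le_pow_left (by omega) _
  have hmono4 : (γ.e + 1) ^ 4 ≤ (γ.e + 1 + 1) ^ 4 := Nat.pow_le_pow_left (by omega) _
  have h1 := h.k_le; have h2 := h.i_le; have h3 := h.j_le; have h4 := h.N_le; have h5 := h.pos_le
  have hR := h.R_lt; have hP := h.P_lt; have hle := h.le_P
  have hHX := h.HX_le; have hHY := h.HY_le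
  refine { h with
    k_le := ?_, i_le := ?_, j_le := ?_, N_le := ?_, pos_le := ?_, op_le := ?_, P_pow := ?_, le_P := ?_,
    P_lt := ?_, R_lt := ?_, HX_le := ?_, HY_le := ?_, k_pos := ?_, op_pos := ?_ } <;> simp only [Reg.absorb]
  · omega
  · omega
  · omega
  · omega
  · omega
  · omega
  · split_ifs
    · exact ⟨a + 1, by rw [ha, pow_succ]⟩
    · exact ⟨a, ha⟩
  · split_ifs with h6
    · rcases Nat.eq_zero_or_pos γ.e with h0 | h0
      · rw [h0]; omega
      · have : (γ.e + 1) ^ 4 ≤ (2 * γ.e) ^ 4 := Nat.pow_le_pow_left (by omega) _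
        rw [mul_pow] at this
        omega
    · omega
  · split_ifs with h6 <;> omega
  · split_ifs with h6
    · have : γ.P * c ≤ γ.P * 15 := Nat.mul_le_mul_left _ (by omega)
      omega
    · exact hR
  · omega
  · omega
  · exact fun hm => ⟨(h.k_pos hm).1, by have := (h.k_pos hm).2; omega⟩
  · exact fun h0 => absurd rfl h0

lemma Inv.four_le (h : γ.Inv d) : 4 ≤ γ.T := by
  obtain ⟨t, ht⟩ := h.T_pow
  rw [ht]
  exact Nat.le_self_pow (by positivity) 4

lemma Inv.T_le' (h : γ.Inv d) : γ.T ≤ (γ.e + 2) ^ 2 := by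
  have h1 := h.i_le
  rcases h.T_le with h2 | h2
  · rw [h2]; exact Nat.pow_le_pow_left (show 2 ≤ γ.e + 2 by omega) 2
  · exact h2.trans (Nat.pow_le_pow_left (by omega) 2)

lemma Inv.digest_lt (h : γ.Inv d) : γ.digest < γ.T ^ 5 * (32 * γ.T ^ 2) := by
  have h1 := h.four_le
  have h2 := h.v_lt
  calc γ.digest < (γ.S + 1) * hashMod γ.T := by unfold digest; rw [add_mul, one_mul]; omega
    _ ≤ _ := Nat.mul_le_mul h.S_lt (hashMod_le (by omega))

lemma Inv.digest_le (h : γ.Inv d) : γ.digest ≤ 32 * (γ.e + 2) ^ 14 := by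
  refine h.digest_lt.le.trans ?_
  calc γ.T ^ 5 * (32 * γ.T ^ 2) = 32 * γ.T ^ 7 := by ring
    _ ≤ 32 * ((γ.e + 2) ^ 2) ^ 7 := Nat.mul_le_mul_left _ (Nat.pow_le_pow_left h.T_le' 7)
    _ = _ := by ring

/-- The seed is long enough for the current level. -/
lemma Inv.dvd_P (h : γ.Inv d) (he : 3 ≤ γ.e) : 16 * γ.T ^ 2 ∣ γ.P := by
  obtain ⟨a, ha⟩ := h.P_pow
  obtain ⟨t, ht⟩ := h.T_pow
  have e : 16 * γ.T ^ 2 = 16 ^ (2 ^ t + 1) := by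
    rw [ht, ← pow_mul, mul_comm (2 ^ t), pow_mul, show (4 : ℕ) ^ 2 = 16 by norm_num, pow_succ']
  have hle : 16 * γ.T ^ 2 ≤ γ.P := by
    refine le_trans ?_ h.le_P
    rcases h.T_le with h1 | h1
    · rw [h1]
      have := Nat.pow_le_pow_left he 4
      omega
    · have h2 : γ.T ^ 2 ≤ (γ.i ^ 2) ^ 2 := Nat.pow_le_pow_left h1 2
      rw [← pow_mul, show 2 * 2 = 4 from rfl] at h2
      have h3 := h.i_le
      have h4 : γ.i ^ 4 ≤ γ.e ^ 4 := Nat.pow_le_pow_left (by omega) 4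
      omega
  rw [e, ha] at hle ⊢
  exact pow_dvd_pow _ ((Nat.pow_le_pow_iff_right (by omega)).1 hle)

lemma Inv.mono (h : γ.Inv 1) : γ.Inv 0 := { h with
    k_le := by have := h.k_le; omega
    i_le := by have := h.i_le; omega
    j_le := by have := h.j_le; omega
    k_pos := fun hm => ⟨(h.k_pos hm).1, by have := (h.k_pos hm).2; omega⟩ }

lemma Inv.quit (h : γ.Inv 0) : γ.quit.Inv 0 := { h with
    mode_le := le_rfl
    j_zero := fun hm => absurd hm (show ¬ 2 = 0 by decide)
    k_pos := fun hm => absurd hm (show ¬ 2 = 1 by decide)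
    N_eq := fun hm => absurd hm (show ¬ 2 = 1 by decide) }

lemma Inv.push (h : γ.Inv 1) (hm : γ.mode = 1) {β : ℕ} (hβ : β ≤ 1) : (γ.push β).Inv 0 := by
  have h4 := h.four_le
  have hp : 16 * 4 ^ 2 ≤ 16 * γ.T ^ 2 := Nat.mul_le_mul_left _ (Nat.pow_le_pow_left h4 2)
  have h1 := h.i_le
  have hpos : ∀ T, 1 < hashMod T ∨ T = 0 := fun T => by
    rcases Nat.eq_zero_or_pos T with h0 | h0
    · exact .inr h0
    · have := lt_hashMod T
      have : 1 ≤ T ^ 2 := Nat.one_le_pow _ _ h0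
      omega
  refine { h.mono with
    i_le := ?_, pos_le := ?_, op_le := ?_, T_pow := ?_, T_le := ?_, v_lt := ?_, S_lt := ?_, j_zero := fun h0 => absurd (hm.symm.trans h0) one_ne_zero, op_pos := ?_ } <;>
    simp only [Reg.push]
  · omega
  · omega
  · split_ifs <;> omega
  · split_ifs
    · obtain ⟨t, ht⟩ := h.T_pow
      exact ⟨t + 1, by rw [ht, ← pow_mul, pow_succ]⟩
    · exact h.T_pow
  · split_ifs with h5
    · right; rw [h5]; exact Nat.pow_le_pow_left (by omega) 2
    · exact h.T_le.imp_right fun h6 => h6.trans (Nat.pow_le_pow_left (by omega) 2)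
  · split_ifs with h5
    · rcases hpos (γ.T ^ 2) with h6 | h6
      · omega
      · have : 0 < γ.T ^ 2 := by positivity
        omega
    · exact Nat.mod_lt _ (by have := lt_hashMod γ.T; omega)
  · split_ifs with h5
    · refine h.digest_lt.trans_le ?_
      have h6 : 4 ^ 3 ≤ γ.T ^ 3 := Nat.pow_le_pow_left h4 3
      calc γ.T ^ 5 * (32 * γ.T ^ 2) = γ.T ^ 7 * 32 := by ring
        _ ≤ γ.T ^ 7 * γ.T ^ 3 := Nat.mul_le_mul_left _ (by omega)
        _ = (γ.T ^ 2) ^ 5 := by ring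
    · exact h.S_lt
  · intro h5
    have h6 : 3 ≤ γ.j := by
      by_contra h7
      exact h5 (if_neg fun h8 => h7 h8.1)
    exact ⟨(h.k_pos hm).1, (h.N_eq hm (by omega)) ▸ h.N_le⟩

lemma WordOk.i_eq (h : γ.WordOk) (hi : γ.Inv d) (hm : γ.mode = 1) : γ.i = 2 ^ (2 * γ.k) := by
  by_cases h0 : γ.j = 0
  · obtain ⟨⟨q, hq⟩, h2⟩ := h.1 h0
    rw [hq, Nat.log_pow (by omega)] at h2
    rw [hq, h2]
  · rw [h.2.1 h0, hi.N_eq hm (by omega)]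

lemma Inv.close (h : γ.Inv 1) (hm : γ.mode = 1) (hw : γ.WordOk) : γ.close.Inv 0 := by
  have h1 := h.i_le
  have h2 := h.j_le
  have h3 := hw.i_eq h hm
  have h5 := lt_hashMod 4
  refine { h.mono with
    i_le := ?_, j_le := ?_, N_le := ?_, op_le := ?_, T_pow := ⟨0, rfl⟩, T_le := .inl rfl, v_lt := ?_,
    S_lt := ?_, HX_le := ?_, HY_le := ?_, N_eq := fun _ _ => h3,
    j_zero := fun h0 => absurd (hm.symm.trans h0) one_ne_zero, op_pos := ?_ } <;>
    simp only [Reg.close]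
  · omega
  · omega
  · omega
  · split_ifs <;> omega
  · omega
  · norm_num
  · split_ifs
    · exact h.digest_le
    · exact h.HX_le
  · split_ifs
    · exact h.digest_le
    · exact h.HY_le
  · exact fun _ => ⟨(h.k_pos hm).1, by omega⟩

lemma Inv.read (h : γ.Inv 1) (hop : γ.op = 0) (o : Ternary) : (γ.read o).Inv 0 := by
  have h0 := h.mono
  cases o
  · simp only [Reg.read]
    split_ifs with h1 h2
    exacts [h0.quit, h.push h2 (by omega), h0]
  · simp only [Reg.read]
    split_ifs with h1 h2
    · have h3 := h.k_le
      refine { h0 with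
        k_le := ?_, k_pos := fun h4 => ?_, N_eq := fun h4 => ?_, op_pos := fun h4 => ?_ }
      · simp only; omega
      · simp only at h4; omega
      · simp only at h4; omega
      · exact absurd hop h4
    · exact h.push h2 (by omega)
    · exact h0
  · simp only [Reg.read]
    split_ifs with h1 h2 h3 h4
    · have h3 := h.k_le
      refine { h0 with
        mode_le := ?_, k_pos := fun _ => ⟨h2, ?_⟩, j_zero := fun h4 => absurd h4 one_ne_zero,
        N_eq := fun _ h4 => ?_ }
      · simp only; omega
      · simp only; omega
      · have := h.j_zero h1
        simp only at h4
        omega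
    · exact h0.quit
    · exact h.close h3 h4
    · exact h0.quit
    · exact h0

lemma Inv.upd (h : γ.Inv 0) (hc : c < 16) (o : Option Ternary) : (Reg.upd o (γ, c)).Inv 0 := by
  have h1 := h.absorb hc
  cases o with
  | some o => exact h1.read rfl o
  | none =>
    simp only [Reg.upd]
    split_ifs with h2
    · obtain ⟨hm, hi, hj, h3, h4⟩ := h2
      refine { h1.mono.quit with op_le := le_rfl, op_pos := fun _ => ⟨(h1.k_pos hm).1, ?_⟩ }
      exact (h1.N_eq hm hj) ▸ h1.N_le
    · exact h1.mono.quit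

lemma upd_e (o : Option Ternary) : (Reg.upd o (γ, c)).e = γ.e + 1 := by
  cases o with
  | none => simp only [Reg.upd]; split_ifs <;> rfl
  | some o => cases o <;> simp only [Reg.upd, Reg.read] <;> split_ifs <;> rfl

lemma Inv.get_le (h : γ.Inv 0) {n : ℕ} (he : γ.e ≤ n + 1) :
    ∀ i < RCtx.num Reg, RCtx.get i γ ≤ (n + 2) ^ 40 := by
  have key : ∀ x a, x ≤ 2 ^ a * (γ.e + 2) ^ (20 - a) → a ≤ 20 → x ≤ (n + 2) ^ 40 := by
    intro x a hx ha
    calc x ≤ 2 ^ a * (γ.e + 2) ^ (20 - a) := hx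
      _ ≤ (γ.e + 2) ^ a * (γ.e + 2) ^ (20 - a) := Nat.mul_le_mul_right _ (Nat.pow_le_pow_left (by omega) a)
      _ = (γ.e + 2) ^ 20 := by rw [← pow_add]; congr 1; omega
      _ ≤ ((n + 2) ^ 2) ^ 20 := Nat.pow_le_pow_left (by nlinarith) 20
      _ = _ := by rw [← pow_mul]
  have hle : ∀ a, 1 ≤ a → γ.e + 2 ≤ (γ.e + 2) ^ a := fun a ha => Nat.le_self_pow (by omega) _
  have hsmall : ∀ x, x ≤ γ.e + 5 → x ≤ (n + 2) ^ 40 := fun x hx => key x 3 (by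
    have := hle (20 - 3) (by omega)
    omega) (by omega)
  have h1 := h.k_le; have h2 := h.i_le; have h3 := h.j_le
  have hpw : ∀ a b, a ≤ b → (γ.e + 2) ^ a ≤ (γ.e + 2) ^ b := fun a b hab =>
    Nat.pow_le_pow_right (by omega) hab
  have hP : γ.P ≤ (n + 2) ^ 40 := key _ 8 (by
    have h4 : (γ.e + 1) ^ 4 ≤ (γ.e + 2) ^ 4 := Nat.pow_le_pow_left (by omega) 4
    have := hpw 4 (20 - 8) (by omega)
    have := h.P_lt
    omega) (by omega)
  have hT : γ.T ≤ (γ.e + 2) ^ 2 := h.T_le'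
  have hT1 := h.four_le
  have hv : γ.v ≤ 32 * (γ.e + 2) ^ 4 := by
    have h5 := h.v_lt.le.trans (hashMod_le (by omega))
    have h6 : γ.T ^ 2 ≤ ((γ.e + 2) ^ 2) ^ 2 := Nat.pow_le_pow_left hT 2
    rw [← pow_mul, show 2 * 2 = 4 from rfl] at h6
    omega
  have hS : γ.S ≤ (γ.e + 2) ^ 10 := by
    have h6 : γ.T ^ 5 ≤ ((γ.e + 2) ^ 2) ^ 5 := Nat.pow_le_pow_left hT 5
    rw [← pow_mul] at h6
    exact h.S_lt.le.trans h6
  have hH : ∀ x, x ≤ 32 * (γ.e + 2) ^ 14 → x ≤ (n + 2) ^ 40 := fun x hx => key x 5 (by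
    have := hpw 14 (20 - 5) (by omega)
    omega) (by omega)
  refine Reg.forall_get (p := fun _ f => f γ ≤ (n + 2) ^ 40)
    (hsmall _ (h.mode_le.trans (by omega))) (hsmall _ (by omega)) (hsmall _ (by omega))
    (hsmall _ (by omega)) (hsmall _ (h.N_le.trans (by omega))) (hsmall _ (by omega)) hP
    (h.R_lt.le.trans hP) (key _ 0 ?_ (by omega)) (hH _ (hv.trans ?_)) (key _ 0 ?_ (by omega)) (hH _ h.HX_le)
    (hH _ h.HY_le) (hsmall _ (h.op_le.trans (by omega))) (hsmall _ (h.pos_le.trans (by omega)))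
  · have := hpw 2 20 (by omega); simpa using hT.trans this
  · have := hpw 4 14 (by omega); omega
  · have := hpw 10 20 (by omega); simpa using hS.trans this

lemma inv_init : disjAlg.init.Inv 0 := by
  have := lt_hashMod 4
  constructor <;> simp only [disjAlg] <;> try first | omega | norm_num
  · exact ⟨0, rfl⟩
  · exact ⟨0, rfl⟩

lemma Inv.bounded {n : ℕ} {os : List (Option Ternary)} (h : γ.Inv 0) (he : γ.e + os.length ≤ n + 1) :
    disjAlg.Bounded ((n + 2) ^ 40) os γ := by
  induction os generalizing γ with
  | nil => exact h.get_le he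
  | cons o os ih =>
    rw [List.length_cons] at he
    have h1 : ∀ c < 16, (Reg.upd o (γ, c)).Inv 0 ∧ (Reg.upd o (γ, c)).e = γ.e + 1 := fun c hc =>
      ⟨h.upd hc o, upd_e o⟩
    exact ⟨h.get_le (by omega), fun c hc => (h1 c hc).1.get_le (by rw [(h1 c hc).2]; omega),
      fun c hc => ih (h1 c hc).1 (by
        change (Reg.upd o (γ, c)).e + os.length ≤ n + 1
        rw [(h1 c hc).2]; omega)⟩

lemma bounded_disjAlg (w : List Ternary) :
    disjAlg.Bounded ((w.length + 2) ^ 40) (w.map some ++ [none]) disjAlg.init :=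
  inv_init.bounded (by simp [disjAlg])

end Reg

/-! ### The circuit that is written -/

section Gates

variable {m : ℕ} [NeZero m]

/-- The gates that are written in a state. -/
noncomputable def Reg.gates (m : ℕ) [NeZero m] (γ : Reg) : List (GateInstr m) :=
  (List.range (disjAlg.len γ)).map fun t =>
    gateAt m (disjAlg.fstOut (γ, t)) (disjAlg.sndOut (γ, t)) (disjAlg.trdOut (γ, t))

lemma range_mul_map {α : Type*} (a b : ℕ) (f : ℕ → α) :
    (List.range (a * b)).map f = (List.range a).flatMap fun i => (List.range b).map fun r => f (i * b + r) := by
  induction a with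
  | zero => simp
  | succ a ih =>
    rw [add_mul, one_mul, List.range_add, List.map_append, ih, List.range_succ, List.flatMap_append]
    simp

lemma reverse_flatMap_range {α : Type*} (n : ℕ) (f : ℕ → List α) :
    (List.range n).reverse.flatMap f = (List.range n).flatMap fun i => f (n - 1 - i) := by
  rw [List.range_eq_range', List.reverse_range', List.flatMap_map, List.range_eq_range']
  simp

lemma range_map_macro (κ a b c : ℕ) :
    ((List.range 39).map fun s => gateAt m (roleAddr a b c (roleEntry Prod.fst κ s))
      (roleAddr a b c (roleEntry (fun t => t.2.1) κ s)) (roleEntry (fun t => t.2.2) κ s))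
      = macroGates m κ a b c := by
  have hl := length_macroRoles κ
  refine List.ext_getElem (by simp [macroGates, hl]) fun i h1 h2 => ?_
  have hi : i < (macroRoles κ).length := by simpa [macroGates] using h2
  simp [macroGates, roleEntry, List.getD_eq_getElem?_getD, hi]

/-- The macros of a test in the order in which they are written. -/
lemma flatMap_macro_eq_testGates {n κ₁ p κ u v κ₂ : ℕ} {q K A B C : ℕ → ℕ}
    (h₁ : ∀ i < n, K i = κ₁ ∧ A i = q i ∧ B i = 1 ∧ C i = 1)
    (h₂ : ∀ i < n, K (n + i) = (if p.testBit i = true then 1 else 2) ∧ A (n + i) = q i ∧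
      B (n + i) = 36 * i + 2 ∧ C (n + i) = 36 * (i + 1) + 2)
    (h₃ : K (2 * n) = κ ∧ A (2 * n) = 36 * n + 2 ∧ B (2 * n) = u ∧ C (2 * n) = v)
    (h₄ : ∀ i < n, K (3 * n - i) = (if p.testBit i = true then 1 else 2) ∧ A (3 * n - i) = q i ∧
      B (3 * n - i) = 36 * i + 2 ∧ C (3 * n - i) = 36 * (i + 1) + 2)
    (h₅ : ∀ i < n, K (4 * n - i) = κ₂ ∧ A (4 * n - i) = q i ∧ B (4 * n - i) = 1 ∧ C (4 * n - i) = 1) :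
    ((List.range (4 * n + 1)).flatMap fun i => macroGates m (K i) (A i) (B i) (C i))
      = testGates m n κ₁ q p κ u v κ₂ := by
  have e : 4 * n + 1 = n + (n + (1 + (n + n))) := by omega
  have hc : ∀ {f g : ℕ → List (GateInstr m)}, (∀ i < n, f i = g i) →
      (List.range n).flatMap f = (List.range n).flatMap g := fun h =>
    List.flatMap_congr fun i hi => h i (List.mem_range.1 hi)
  rw [e, testGates, hLayer, hLayerRev, eqNest, ← List.range_eq_range', reverse_flatMap_range,
    reverse_flatMap_range]
  simp only [List.range_add, List.flatMap_append, List.flatMap_map, List.range_one, List.map_cons,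
    List.map_nil, List.flatMap_cons, List.flatMap_nil, List.append_nil, List.append_assoc, List.map_append,
    List.map_map, Function.comp_def]
  congr 1
  · exact hc fun i hi => by rw [(h₁ i hi).1, (h₁ i hi).2.1, (h₁ i hi).2.2.1, (h₁ i hi).2.2.2]
  congr 1
  · exact hc fun i hi => by rw [eqStep, (h₂ i hi).1, (h₂ i hi).2.1, (h₂ i hi).2.2.1, (h₂ i hi).2.2.2]
  congr 1
  · rw [show n + (n + 0) = 2 * n by omega, h₃.1, h₃.2.1, h₃.2.2.1, h₃.2.2.2]
  congr 1
  · refine hc fun i hi => ?_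
    obtain ⟨k1, k2, k3, k4⟩ := h₄ (n - 1 - i) (by omega)
    rw [show n + (n + (1 + i)) = 3 * n - (n - 1 - i) by omega, eqStep, k1, k2, k3, k4]
  · refine hc fun i hi => ?_
    obtain ⟨k1, k2, k3, k4⟩ := h₅ (n - 1 - i) (by omega)
    rw [show n + (n + (1 + (n + i))) = 4 * n - (n - 1 - i) by omega, k1, k2, k3, k4]

open Classical in
/-- The gates written in a state are a test of each copy. -/
lemma Reg.gates_eq {γ : Reg} (h : γ.op ≠ 0) : γ.gates m = forCopies 8 fun c =>
    testGates m (2 * γ.k) (if γ.op = 3 ∨ γ.op = 4 then 3 else 0)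
      (if γ.op = 5 then flagAddr c else idxAddr c) (if γ.op = 1 ∨ γ.op = 2 then γ.pos else 0)
      (if γ.op = 1 ∨ γ.op = 5 ∨ (γ.op = 2 ∧ ∃ e, γ.j / 3 = 2 ^ e) then 1 else 4)
      (γ.argU c) (γ.argV c) (if γ.op = 4 then 3 else 0) := by
  have hbit : ∀ i, ((γ.op = 1 ∨ γ.op = 2) ∧ γ.pos.testBit i = true) ↔
      (if γ.op = 1 ∨ γ.op = 2 then γ.pos else 0).testBit i = true := fun i => by
    split_ifs with h1 <;> simp [h1]
  rw [Reg.gates, show disjAlg.len γ = 8 * γ.testLen from if_neg h, range_mul_map, forCopies]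
  congr 1
  ext1 c
  rw [Reg.testLen, mul_comm 39, range_mul_map]
  rw [← flatMap_macro_eq_testGates (K := γ.kind) (A := γ.arg₁ c) (B := γ.arg₂ c) (C := γ.arg₃ c)]
  · refine List.flatMap_congr fun u hu => ?_
    rw [← range_map_macro]
    refine List.map_congr_left fun s hs => ?_
    have hu := List.mem_range.1 hu
    have hs := List.mem_range.1 hs
    have h0 : u * 39 + s < γ.testLen := by unfold Reg.testLen; omega
    have e0 : (4 * (2 * γ.k) + 1) * 39 = γ.testLen := mul_comm _ _
    have e1 : (c * γ.testLen + (u * 39 + s)) / γ.testLen = c := by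
      rw [mul_comm, Nat.mul_add_div (by omega), Nat.div_eq_of_lt h0, add_zero]
    have e2 : (c * γ.testLen + (u * 39 + s)) % γ.testLen / 39 = u := by
      rw [mul_comm c, Nat.mul_add_mod, Nat.mod_eq_of_lt h0]
      omega
    have e3 : (c * γ.testLen + (u * 39 + s)) % 39 = s := by
      rw [show c * γ.testLen + (u * 39 + s) = 39 * (c * (4 * (2 * γ.k) + 1) + u) + s by
        unfold Reg.testLen; ring, Nat.mul_add_mod, Nat.mod_eq_of_lt hs]
    rw [e0]
    simp only [disjAlg, Reg.operand, e1, e2, e3]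
  all_goals simp only [Reg.kind, Reg.arg₁, Reg.arg₂, Reg.arg₃, Reg.level, hbit]
  · intro i hi
    simp only [show i < 2 * γ.k from hi, show ¬ i = 2 * (2 * γ.k) by omega, if_true, if_false, true_or]
    split_ifs <;> simp
  · intro i hi
    simp only [show ¬ 2 * γ.k + i < 2 * γ.k by omega, show ¬ 3 * (2 * γ.k) < 2 * γ.k + i by omega,
      show ¬ 2 * γ.k + i = 2 * (2 * γ.k) by omega, show 2 * γ.k + i < 2 * (2 * γ.k) by omega, if_true,
      if_false, or_false, Nat.add_sub_cancel_left]
    split_ifs <;> simp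
  · simp only [show ¬ 2 * (2 * γ.k) < 2 * γ.k by omega, show ¬ 3 * (2 * γ.k) < 2 * (2 * γ.k) by omega,
      if_true, if_false, or_false, and_self]
  · intro i hi
    simp only [show ¬ 3 * (2 * γ.k) - i < 2 * γ.k by omega, show ¬ 3 * (2 * γ.k) < 3 * (2 * γ.k) - i by omega,
      show ¬ 3 * (2 * γ.k) - i = 2 * (2 * γ.k) by omega, show ¬ 3 * (2 * γ.k) - i < 2 * (2 * γ.k) by omega,
      if_false, or_false, show 3 * (2 * γ.k) - (3 * (2 * γ.k) - i) = i by omega]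
    split_ifs <;> simp
  · intro i hi
    simp only [show ¬ 4 * (2 * γ.k) - i < 2 * γ.k by omega, show 3 * (2 * γ.k) < 4 * (2 * γ.k) - i by omega,
      show ¬ 4 * (2 * γ.k) - i = 2 * (2 * γ.k) by omega, show ¬ 4 * (2 * γ.k) - i < 2 * (2 * γ.k) by omega,
      if_true, if_false, or_true, show 4 * (2 * γ.k) - (4 * (2 * γ.k) - i) = i by omega]
    split_ifs <;> simp

lemma gateAt_word {a b c : ℕ} (ha : a < m) (hb : b < m) (hc : c < 3) :
    (gateAt m a b c).word = tripleWord a b c := by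
  simp [gateAt, GateInstr.word, tripleWord, Fin.ofNat, Nat.mod_eq_of_lt ha, Nat.mod_eq_of_lt hb,
    Nat.mod_eq_of_lt hc]

/-- All operands are below `m`. -/
def Reg.Fits (m : ℕ) (γ : Reg) : Prop :=
  γ.op ≠ 0 → 36 * (2 * γ.k + 1) ≤ m ∧ 36 * (Nat.log 2 (γ.j / 3) + 1) ≤ m

lemma Reg.Fits.operand {γ : Reg} (h : γ.Fits m) (f : ℕ × ℕ × ℕ → ℕ) {t : ℕ} (ht : t < disjAlg.len γ) :
    Reg.operand f (γ, t) < m ∧ (γ.op ≠ 5 → Reg.operand f (γ, t) ≠ 0) := by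
  have h0 : γ.op ≠ 0 := fun h0 => by
    rw [show disjAlg.len γ = 0 from if_pos h0] at ht
    omega
  obtain ⟨h1, h2⟩ := h h0
  rw [show disjAlg.len γ = 8 * γ.testLen from if_neg h0] at ht
  have hc : t / γ.testLen < 8 := Nat.div_lt_of_lt_mul (by rwa [mul_comm])
  have hL : 0 < γ.testLen := by unfold Reg.testLen; omega
  have hu : t % γ.testLen / 39 ≤ 4 * (2 * γ.k) := by
    have := Nat.mod_lt t hL
    unfold Reg.testLen at this ⊢
    omega
  simp only [Reg.operand]
  generalize t / γ.testLen = c at hc ⊢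
  generalize t % γ.testLen / 39 = u at hu ⊢
  have hl : u ≠ 2 * (2 * γ.k) → γ.level u < 2 * γ.k := fun hne => by
    unfold Reg.level; split_ifs <;> omega
  have hv : ∀ c ≤ 8, verdictAddr c < 20 := fun c hc => by unfold verdictAddr; split_ifs <;> omega
  have ha₁ : γ.arg₁ c u < m ∧ γ.arg₁ c u ≠ 0 := by
    unfold Reg.arg₁ flagAddr idxAddr
    split_ifs with h3
    · omega
    · have := hl h3; omega
    · have := hl h3; omega
  have ha₂ : γ.arg₂ c u < m ∧ (γ.op ≠ 5 → γ.arg₂ c u ≠ 0) := by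
    have := hv c hc.le
    unfold Reg.arg₂ Reg.argU
    split_ifs with h3 h4 h5 h6
    · omega
    · omega
    · exact ⟨by omega, fun h7 => absurd h6 h7⟩
    · omega
    · have := hl h4; omega
  have ha₃ : γ.arg₃ c u < m ∧ (γ.op ≠ 5 → γ.arg₃ c u ≠ 0) := by
    have := hv (c + 1) hc
    unfold Reg.arg₃ Reg.argV flagAddr
    split_ifs with h3 h4 h5 h6 h7
    · omega
    · omega
    · exact ⟨by omega, fun h7 => absurd h6 h7⟩
    · generalize Nat.log 2 (γ.j / 3) = l at h2 ⊢
      clear h7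
      omega
    · omega
    · have := hl h4; omega
  unfold roleAddr
  split_ifs
  exacts [⟨ha₁.1, fun _ => ha₁.2⟩, ha₂, ha₃, by omega, by omega]

lemma trdOut_lt (p : Reg × ℕ) : disjAlg.trdOut p < 3 := by
  have key : ∀ κ s, roleEntry (fun t => t.2.2) κ s < 3 := fun κ s => by
    have h : ∀ t ∈ macroRoles κ, t.2.2 < 3 := by
      unfold macroRoles
      split_ifs <;> decide
    rw [roleEntry, List.getD_eq_getElem?_getD, List.getElem?_map]
    rcases h1 : (macroRoles κ)[s]? with _ | t
    · exact Nat.succ_pos 2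
    · exact h t (List.mem_of_getElem? h1)
  exact key _ _

lemma Reg.Fits.emit_eq {γ : Reg} (h : γ.Fits m) :
    disjAlg.emit γ = (γ.gates m).flatMap fun g => Ternary.hash :: g.word := by
  rw [StreamAlg.emit, Reg.gates, List.flatMap_map]
  refine List.flatMap_congr fun t ht => ?_
  have ht := List.mem_range.1 ht
  exact congrArg _ (gateAt_word (h.operand _ ht).1 (h.operand _ ht).1 (trdOut_lt _)).symm

lemma Reg.Fits.gates_ne_zero {γ : Reg} (h : γ.Fits m) (h5 : γ.op ≠ 5) (g : GateInstr m)
    (hg : g ∈ γ.gates m) : g.a ≠ Fin.ofNat m 0 ∧ g.b ≠ Fin.ofNat m 0 := by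
  rw [Reg.gates, List.mem_map] at hg
  obtain ⟨t, ht, rfl⟩ := hg
  have ht := List.mem_range.1 ht
  have hm : 0 < m := Nat.pos_of_ne_zero (NeZero.ne m)
  exact ⟨ofNat_ne (h.operand _ ht).1 hm ((h.operand _ ht).2 h5),
    ofNat_ne (h.operand _ ht).1 hm ((h.operand _ ht).2 h5)⟩

end Gates

/-! ### Fingerprints of words -/

/-- The position in a word and the fingerprint of the part that has been read. -/
structure Fp where
  i : ℕ
  T : ℕ
  v : ℕ
  S : ℕ

/-- The fingerprint with the seed `ρ` after one more bit. -/
def Fp.push (ρ : ℕ) (s : Fp) (β : Bool) : Fp where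
  i := s.i + 1
  T := if s.i = s.T then s.T ^ 2 else s.T
  v := if s.i = s.T then β.toNat else (s.v * (ρ % (16 * s.T ^ 2)) + β.toNat) % hashMod s.T
  S := if s.i = s.T then s.S * hashMod s.T + s.v else s.S

/-- The fingerprint of a word. -/
def Fp.ofWord (ρ : ℕ) (u : List Bool) : Fp := u.foldl (Fp.push ρ) ⟨0, 4, 0, 0⟩

/-- The fingerprint as a number. -/
def Fp.digest (s : Fp) : ℕ := s.S * hashMod s.T + s.v

lemma Fp.ofWord_append (ρ : ℕ) (u : List Bool) (β : Bool) :
    Fp.ofWord ρ (u ++ [β]) = (Fp.ofWord ρ u).push ρ β := by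
  simp [Fp.ofWord]

/-- The value modulo a prime of the polynomial with the coefficients `u` at the point given by `ρ`. -/
def hornerMod (T ρ : ℕ) (u : List Bool) : ℕ :=
  u.foldl (fun v β => (v * (ρ % (16 * T ^ 2)) + β.toNat) % hashMod T) 0

lemma one_lt_hashMod {T : ℕ} (hT : 1 ≤ T) : 1 < hashMod T := by
  have := lt_hashMod T
  have : 1 ≤ T ^ 2 := Nat.one_le_pow _ _ hT
  omega

lemma hornerMod_append (T ρ : ℕ) (u : List Bool) (β : Bool) : hornerMod T ρ (u ++ [β])
    = (hornerMod T ρ u * (ρ % (16 * T ^ 2)) + β.toNat) % hashMod T := by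
  simp [hornerMod]

lemma hornerMod_lt {T : ℕ} (hT : 1 ≤ T) (ρ : ℕ) (u : List Bool) : hornerMod T ρ u < hashMod T := by
  have h := one_lt_hashMod hT
  induction u using List.reverseRecOn with
  | nil => exact Nat.zero_lt_of_lt h
  | append_singleton u β _ => rw [hornerMod_append]; exact Nat.mod_lt _ (by omega)

lemma mul_add_inj {p a a' v v' : ℕ} (hv : v < p) (hv' : v' < p) (h : a * p + v = a' * p + v') :
    a = a' ∧ v = v' := by
  have b1 := congrArg (· / p) h
  have b2 := congrArg (· % p) h
  simp only [mul_comm _ p, Nat.mul_add_mod, Nat.mod_eq_of_lt hv, Nat.mod_eq_of_lt hv',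
    Nat.mul_add_div (Nat.zero_lt_of_lt hv), Nat.div_eq_of_lt hv, Nat.div_eq_of_lt hv', add_zero] at b1 b2
  exact ⟨b1, b2⟩

/-- If the fingerprints of the words of a list of pairs of bits agree, then so do the values of two
distinct polynomials, independent of the seed. -/
def Separated (b : ℕ) (A : ℕ → Prop) : Prop :=
  ∃ t, ∃ s s' : List Bool, s ≠ s' ∧ s.length = s'.length ∧ s.length ≤ 4 ^ 2 ^ t ∧
    (4 ^ 2 ^ t = 4 ∨ 4 ^ 2 ^ t ≤ b ^ 2) ∧ ∀ ρ, A ρ → hornerMod (4 ^ 2 ^ t) ρ s = hornerMod (4 ^ 2 ^ t) ρ s'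

lemma Separated.mono {b b' : ℕ} (hb : b ≤ b') {A B : ℕ → Prop} (h : Separated b A) (hBA : ∀ ρ, B ρ → A ρ) :
    Separated b' B := by
  obtain ⟨t, s, s', h1, h2, h3, h4, h5⟩ := h
  exact ⟨t, s, s', h1, h2, h3, h4.imp_right fun h => h.trans (Nat.pow_le_pow_left hb 2),
    fun ρ h => h5 ρ (hBA ρ h)⟩

/-- The fingerprint of a word splits into the part of the word at the current level and the part at
lower levels. -/
lemma Fp.exists_split (l : List (Bool × Bool)) : ∃ t, ∃ r s : List (Bool × Bool), l = r ++ s ∧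
    l.length ≤ 4 ^ 2 ^ t ∧ (4 ^ 2 ^ t = 4 ∨ 4 ^ 2 ^ t ≤ l.length ^ 2) ∧
    (∀ ρ, (Fp.ofWord ρ (l.map Prod.fst)).i = l.length ∧ (Fp.ofWord ρ (l.map Prod.fst)).T = 4 ^ 2 ^ t ∧
      (Fp.ofWord ρ (l.map Prod.fst)).v = hornerMod (4 ^ 2 ^ t) ρ (s.map Prod.fst)) ∧
    (∀ ρ, (Fp.ofWord ρ (l.map Prod.snd)).i = l.length ∧ (Fp.ofWord ρ (l.map Prod.snd)).T = 4 ^ 2 ^ t ∧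
      (Fp.ofWord ρ (l.map Prod.snd)).v = hornerMod (4 ^ 2 ^ t) ρ (s.map Prod.snd)) ∧
    (r.map Prod.fst = r.map Prod.snd ∨ Separated l.length fun ρ =>
      (Fp.ofWord ρ (l.map Prod.fst)).S = (Fp.ofWord ρ (l.map Prod.snd)).S) := by
  induction l using List.reverseRecOn with
  | nil => exact ⟨0, [], [], rfl, by simp, by simp, fun _ => ⟨rfl, rfl, rfl⟩, fun _ => ⟨rfl, rfl, rfl⟩, .inl rfl⟩
  | append_singleton l β ih =>
    obtain ⟨t, r, s, h1, h2, h3, h4, h5, h6⟩ := ih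
    have hpos : 1 ≤ 4 ^ 2 ^ t := Nat.one_le_pow _ _ (by omega)
    have hsmall : ∀ (T ρ : ℕ) (β : Bool), 1 ≤ T → hornerMod T ρ [β] = β.toNat := fun T ρ β hT => by
      rw [hornerMod, List.foldl_cons, List.foldl_nil, zero_mul, zero_add]
      exact Nat.mod_eq_of_lt (by have := one_lt_hashMod hT; cases β <;> simp <;> omega)
    simp only [List.map_append, List.map_cons, List.map_nil, Fp.ofWord_append, List.length_append,
      List.length_singleton]
    by_cases hl : l.length = 4 ^ 2 ^ t
    · have e : (4 ^ 2 ^ t) ^ 2 = 4 ^ 2 ^ (t + 1) := by rw [← pow_mul, pow_succ 2 t]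
      have hge : 4 ≤ 4 ^ 2 ^ t := Nat.le_self_pow (by positivity) 4
      refine ⟨t + 1, l, [β], rfl, ?_, .inr ?_, fun ρ => ?_, fun ρ => ?_, ?_⟩
      · rw [← e, hl]; nlinarith
      · rw [← e, ← hl]; exact Nat.pow_le_pow_left (by omega) 2
      · obtain ⟨k1, k2, k3⟩ := h4 ρ
        refine ⟨by rw [Fp.push, k1], ?_, ?_⟩ <;> simp only [Fp.push, k1, k2, if_pos hl]
        · exact e
        · rw [List.map_cons, List.map_nil, hsmall _ _ _ (Nat.one_le_pow _ _ (by omega))]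
      · obtain ⟨k1, k2, k3⟩ := h5 ρ
        refine ⟨by rw [Fp.push, k1], ?_, ?_⟩ <;> simp only [Fp.push, k1, k2, if_pos hl]
        · exact e
        · rw [List.map_cons, List.map_nil, hsmall _ _ _ (Nat.one_le_pow _ _ (by omega))]
      · have key : ∀ ρ, ((Fp.ofWord ρ (l.map Prod.fst)).push ρ β.1).S = ((Fp.ofWord ρ (l.map Prod.snd)).push ρ β.2).S →
            (Fp.ofWord ρ (l.map Prod.fst)).S = (Fp.ofWord ρ (l.map Prod.snd)).S ∧
            hornerMod (4 ^ 2 ^ t) ρ (s.map Prod.fst) = hornerMod (4 ^ 2 ^ t) ρ (s.map Prod.snd) := by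
          intro ρ h
          obtain ⟨k1, k2, k3⟩ := h4 ρ
          obtain ⟨k1', k2', k3'⟩ := h5 ρ
          simp only [Fp.push, k1, k2, k3, k1', k2', k3', if_pos hl] at h
          have a1 := hornerMod_lt hpos ρ (s.map Prod.fst)
          have a2 := hornerMod_lt hpos ρ (s.map Prod.snd)
          exact mul_add_inj a1 a2 h
        rcases h6 with h6 | h6
        · by_cases hs : s.map Prod.fst = s.map Prod.snd
          · left; rw [h1, List.map_append, List.map_append, h6, hs]
          · right
            exact ⟨t, s.map Prod.fst, s.map Prod.snd, hs, by simp, by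
              rw [List.length_map, ← hl, h1, List.length_append]; omega,
              h3.imp_right fun h => h.trans (Nat.pow_le_pow_left (by omega) 2), fun ρ h => (key ρ h).2⟩
        · exact .inr (h6.mono (by omega) fun ρ h => (key ρ h).1)
    · refine ⟨t, r, s ++ [β], by rw [h1, List.append_assoc], by omega,
        h3.imp_right fun h => h.trans (Nat.pow_le_pow_left (by omega) 2), fun ρ => ?_, fun ρ => ?_, ?_⟩
      · obtain ⟨k1, k2, k3⟩ := h4 ρ
        refine ⟨by rw [Fp.push, k1], ?_, ?_⟩ <;> simp only [Fp.push, k1, k2, k3, if_neg hl]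
        rw [List.map_append, List.map_cons, List.map_nil, hornerMod_append]
      · obtain ⟨k1, k2, k3⟩ := h5 ρ
        refine ⟨by rw [Fp.push, k1], ?_, ?_⟩ <;> simp only [Fp.push, k1, k2, k3, if_neg hl]
        rw [List.map_append, List.map_cons, List.map_nil, hornerMod_append]
      · refine h6.imp_right fun h => h.mono (by omega) fun ρ h => ?_
        obtain ⟨k1, k2, k3⟩ := h4 ρ
        obtain ⟨k1', k2', k3'⟩ := h5 ρ
        simpa only [Fp.push, k1, k2, k1', k2', if_neg hl] using h

lemma separated_of_ne {u u' : List Bool} (hlen : u.length = u'.length) (hne : u ≠ u') :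
    Separated u.length fun ρ => (Fp.ofWord ρ u).digest = (Fp.ofWord ρ u').digest := by
  have hu : (u.zip u').map Prod.fst = u := List.map_fst_zip hlen.le
  have hu' : (u.zip u').map Prod.snd = u' := List.map_snd_zip hlen.ge
  have hl : (u.zip u').length = u.length := by rw [List.length_zip]; omega
  obtain ⟨t, r, s, h1, h2, h3, h4, h5, h6⟩ := Fp.exists_split (u.zip u')
  rw [hl] at h2 h3 h6
  rw [hu] at h4 h6
  rw [hu'] at h5 h6
  have hpos : 1 ≤ 4 ^ 2 ^ t := Nat.one_le_pow _ _ (by omega)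
  have key : ∀ ρ, (Fp.ofWord ρ u).digest = (Fp.ofWord ρ u').digest →
      (Fp.ofWord ρ u).S = (Fp.ofWord ρ u').S ∧
      hornerMod (4 ^ 2 ^ t) ρ (s.map Prod.fst) = hornerMod (4 ^ 2 ^ t) ρ (s.map Prod.snd) := by
    intro ρ h
    obtain ⟨k1, k2, k3⟩ := h4 ρ
    obtain ⟨k1', k2', k3'⟩ := h5 ρ
    simp only [Fp.digest, k2, k3, k2', k3'] at h
    have a1 := hornerMod_lt hpos ρ (s.map Prod.fst)
    have a2 := hornerMod_lt hpos ρ (s.map Prod.snd)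
    exact mul_add_inj a1 a2 h
  rcases h6 with h6 | h6
  · by_cases hs : s.map Prod.fst = s.map Prod.snd
    · refine absurd (hu.symm.trans (Eq.trans ?_ hu')) hne
      rw [h1, List.map_append, List.map_append, h6, hs]
    · have hsl : s.length ≤ 4 ^ 2 ^ t := by
        have := congrArg List.length h1
        rw [List.length_append, hl] at this
        omega
      exact ⟨t, s.map Prod.fst, s.map Prod.snd, hs, by simp, by rwa [List.length_map], h3,
        fun ρ h => (key ρ h).2⟩
  · exact h6.mono le_rfl fun ρ h => (key ρ h).1

/-- Distinct polynomials agree at few points. -/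
lemma card_hornerMod_eq_le {T : ℕ} {s s' : List Bool} (hlen : s.length = s'.length)
    (hs : s.length ≤ T) (hne : s ≠ s') :
    ((range (16 * T ^ 2)).filter fun r => hornerMod T r s = hornerMod T r s').card ≤ T := by
  open Polynomial in
  have hp : Fact (hashMod T).Prime := ⟨primeAbove_prime _⟩
  set p := hashMod T with hpdef
  have ex : ∀ l : List (Bool × Bool), ∃ D : (ZMod p)[X], (D = 0 → l.map Prod.fst = l.map Prod.snd) ∧
      (D ≠ 0 → D.natDegree < l.length) ∧ ∀ r < 16 * T ^ 2,
        D.eval (r : ZMod p) = (hornerMod T r (l.map Prod.fst) : ZMod p) - hornerMod T r (l.map Prod.snd) := by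
    intro l
    induction l using List.reverseRecOn with
    | nil => exact ⟨0, fun _ => rfl, fun h => absurd rfl h, fun r _ => by simp [hornerMod]⟩
    | append_singleton l β ih =>
      obtain ⟨D, h1, h2, h3⟩ := ih
      refine ⟨D * X + C ((β.1.toNat : ZMod p) - β.2.toNat), fun h => ?_, fun h => ?_, fun r hr => ?_⟩
      · have h4 := congrArg (fun q => q.coeff 0) h
        simp only [coeff_add, coeff_mul_X_zero, coeff_C_zero, zero_add, coeff_zero] at h4
        rw [h4, C_0, add_zero] at h
        have h5 : D = 0 := by simpa using h
        have h6 : β.1 = β.2 := by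
          rcases β with ⟨_ | _, _ | _⟩ <;> simp at h4 ⊢
        simp [h1 h5, h6]
      · have h4 : (D * X + C ((β.1.toNat : ZMod p) - β.2.toNat)).natDegree ≤ (D * X).natDegree :=
          (natDegree_add_le _ _).trans (max_le le_rfl (by rw [natDegree_C]; exact Nat.zero_le _))
        by_cases hD : D = 0
        · rw [hD, zero_mul, zero_add, natDegree_C]
          simp
        · rw [natDegree_mul_X hD] at h4
          have := h2 hD
          rw [List.length_append, List.length_singleton]
          omega
      · simp only [List.map_append, List.map_cons, List.map_nil, hornerMod_append, ← hpdef]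
        simp only [eval_add, eval_mul, eval_X, eval_C, h3 r hr, ZMod.natCast_mod, Nat.cast_add, Nat.cast_mul,
          Nat.mod_eq_of_lt hr]
        ring
  obtain ⟨D, h1, h2, h3⟩ := ex (s.zip s')
  rw [List.map_fst_zip hlen.le, List.map_snd_zip hlen.ge] at h1
  have hD : D ≠ 0 := fun h => hne (h1 h)
  refine le_trans (Finset.card_le_card_of_injOn (t := D.roots.toFinset) (fun r => (r : ZMod p)) ?_ ?_) ?_
  · intro r hr
    rw [Finset.mem_coe, mem_filter, mem_range] at hr
    rw [Finset.mem_coe, Multiset.mem_toFinset, Polynomial.mem_roots hD, Polynomial.IsRoot, h3 r hr.1,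
      List.map_fst_zip hlen.le, List.map_snd_zip hlen.ge, hr.2, sub_self]
  · intro r hr r' hr' h
    rw [Finset.mem_coe, mem_filter, mem_range] at hr hr'
    have h4 := lt_hashMod T
    rw [ZMod.natCast_eq_natCast_iff'] at h
    rwa [Nat.mod_eq_of_lt (by omega), Nat.mod_eq_of_lt (by omega)] at h
  · refine (Multiset.toFinset_card_le _).trans ((Polynomial.card_roots' D).trans ?_)
    have := h2 hD
    rw [List.length_zip] at this
    omega

/-! ### The seed -/

/-- The final seed, from the state of the seed after `e` events, with `E` events to come. -/
def seedFrom : ℕ → ℕ → ℕ → ℕ → List Bool → ℕ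
  | 0, _, _, R, _ => R
  | E + 1, e, P, R, l =>
    seedFrom E (e + 1) (if P < 16 * (e + 1) ^ 4 then P * 16 else P)
      (if P < 16 * (e + 1) ^ 4 then R + P * coinVal (l.take 4) else R) (l.drop 4)

lemma seedFrom_mod (E e P R : ℕ) (l : List Bool) : seedFrom E e P R l % P = R % P := by
  induction E generalizing e P R l with
  | zero => rfl
  | succ E ih =>
    rw [seedFrom]
    split_ifs
    · have h := ih (e + 1) (P * 16) (R + P * coinVal (l.take 4)) (l.drop 4)
      have h1 := congrArg (· % P) h
      simpa [Nat.mod_mul_right_mod] using h1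
    · exact ih _ _ _ _

lemma coinCount_four (E : ℕ) (Q : ℕ → List Bool → Prop) :
    coinCount (4 * (E + 1)) (fun l => Q (coinVal (l.take 4)) (l.drop 4))
      = ∑ c ∈ range 16, coinCount (4 * E) (Q c) := by
  rw [show 4 * (E + 1) = 4 * E + 1 + 1 + 1 + 1 by ring]
  simp only [coinCount_succ, Finset.sum_range_succ, Finset.sum_range_zero, List.take_succ_cons,
    List.drop_succ_cons, List.take_zero, List.drop_zero, coinVal, List.foldl_cons, List.foldl_nil, if_true,
    Bool.false_eq_true, if_false]
  norm_num
  ring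

/-- The seed is uniformly distributed modulo small powers of `16`. -/
lemma coinCount_seed (b : ℕ) (B : Finset ℕ) (hB : ∀ x ∈ B, x < 16 ^ b) (E e a R : ℕ)
    (hP : 16 * e ^ 4 ≤ 16 ^ a) (hb : 16 ^ b ≤ 16 * (e + E) ^ 4) (ha : a ≤ b) (hR : R < 16 ^ a) :
    coinCount (4 * E) (fun l => seedFrom E e (16 ^ a) R l % 16 ^ b ∈ B) * 16 ^ b
      = 16 ^ E * (16 ^ a * (B.filter fun x => x % 16 ^ a = R).card) := by
  classical
  have hconst : ∀ (E e a R : ℕ), b ≤ a →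
      coinCount (4 * E) (fun l => seedFrom E e (16 ^ a) R l % 16 ^ b ∈ B)
        = if R % 16 ^ b ∈ B then 16 ^ E else 0 := by
    intro E e a R h
    have h1 : ∀ l, seedFrom E e (16 ^ a) R l % 16 ^ b = R % 16 ^ b := fun l => by
      have h2 := congrArg (· % 16 ^ b) (seedFrom_mod E e (16 ^ a) R l)
      simpa [Nat.mod_mod_of_dvd _ (pow_dvd_pow 16 h)] using h2
    simp only [h1, coinCount_const]
    rw [show (16 : ℕ) = 2 ^ 4 by norm_num, ← pow_mul 2 4 E]
  have hbase : ∀ (E e R : ℕ), R < 16 ^ b → coinCount (4 * E) (fun l => seedFrom E e (16 ^ b) R l % 16 ^ b ∈ B)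
      * 16 ^ b = 16 ^ E * (16 ^ b * (B.filter fun x => x % 16 ^ b = R).card) := by
    intro E e R hR
    rw [hconst E e b R le_rfl, Nat.mod_eq_of_lt hR]
    have h1 : B.filter (fun x => x % 16 ^ b = R) = if R ∈ B then {R} else ∅ := by
      ext x
      rw [mem_filter]
      constructor
      · rintro ⟨h1, h2⟩
        rw [Nat.mod_eq_of_lt (hB x h1)] at h2
        subst h2
        simp [h1]
      · intro h
        split_ifs at h with h2
        · rw [Finset.mem_singleton] at h
          subst h
          exact ⟨h2, Nat.mod_eq_of_lt hR⟩
        · simp at h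
    rw [h1]
    split_ifs <;> simp
  induction E generalizing e a R with
  | zero =>
    have hab : b ≤ a := (Nat.pow_le_pow_iff_right (show 1 < 16 by omega)).1 (hb.trans hP)
    obtain rfl : a = b := by omega
    exact hbase 0 e R hR
  | succ E ih =>
    rcases Nat.lt_or_ge a b with hlt | hge
    · simp only [seedFrom]
      rw [coinCount_four E fun c l => seedFrom E (e + 1) (if 16 ^ a < 16 * (e + 1) ^ 4 then 16 ^ a * 16 else 16 ^ a)
        (if 16 ^ a < 16 * (e + 1) ^ 4 then R + 16 ^ a * c else R) l % 16 ^ b ∈ B, Finset.sum_mul]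
      have hb' : 16 ^ b ≤ 16 * (e + 1 + E) ^ 4 := by rw [add_right_comm]; exact hb
      split_ifs with h1
      · have hle : 16 * (e + 1) ^ 4 ≤ 16 ^ (a + 1) := by
          rw [pow_succ 16 a]
          rcases Nat.eq_zero_or_pos e with h0 | h0
          · have : 1 ≤ 16 ^ a := Nat.one_le_pow _ _ (by omega)
            rw [h0]; omega
          · have : (e + 1) ^ 4 ≤ (2 * e) ^ 4 := Nat.pow_le_pow_left (by omega) _
            rw [mul_pow] at this
            omega
        have h2 : ∀ c ∈ range 16, coinCount (4 * E) (fun l => seedFrom E (e + 1) (16 ^ a * 16)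
            (R + 16 ^ a * c) l % 16 ^ b ∈ B) * 16 ^ b
            = 16 ^ E * (16 ^ (a + 1) * (B.filter fun x => x % 16 ^ (a + 1) = R + 16 ^ a * c).card) := by
          intro c hc
          have hc := mem_range.1 hc
          have h3 := ih (e + 1) (a + 1) (R + 16 ^ a * c) hle hb' hlt (by
            rw [pow_succ]
            have : 16 ^ a * c ≤ 16 ^ a * 15 := Nat.mul_le_mul_left _ (by omega)
            omega)
          rwa [pow_succ 16 a] at h3 ⊢
        rw [sum_congr rfl h2, ← Finset.mul_sum, ← Finset.mul_sum]
        have h4 : ∑ c ∈ range 16, (B.filter fun x => x % 16 ^ (a + 1) = R + 16 ^ a * c).card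
            = (B.filter fun x => x % 16 ^ a = R).card := by
          rw [Finset.card_eq_sum_card_fiberwise (f := fun x => x / 16 ^ a % 16) (t := range 16)
            fun x _ => by
              rw [Finset.mem_coe, mem_range]
              exact Nat.mod_lt _ (by omega)]
          refine sum_congr rfl fun c hc => ?_
          have hc := mem_range.1 hc
          rw [Finset.filter_filter]
          congr 1
          refine Finset.filter_congr fun x _ => ?_
          rw [pow_succ, Nat.mod_mul]
          have hx := Nat.mod_lt x (show 16 ^ a > 0 by positivity)
          constructor
          · intro h
            have h5 := congrArg (· % 16 ^ a) h
            simp only [Nat.add_mul_mod_self_left, Nat.mod_mod, Nat.mod_eq_of_lt hR] at h5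
            refine ⟨h5, ?_⟩
            rw [h5] at h
            exact Nat.eq_of_mul_eq_mul_left (show 0 < 16 ^ a by positivity) (by omega)
          · rintro ⟨rfl, rfl⟩; rfl
        rw [h4, pow_succ, pow_succ]
        ring
      · rw [Finset.sum_const, Finset.card_range, smul_eq_mul, ih (e + 1) a R (by omega) hb' hlt.le hR, pow_succ]
        ring
    · obtain rfl : a = b := by omega
      exact hbase (E + 1) e R hR

lemma coinCount_mono {T : ℕ} {A B : List Bool → Prop} (h : ∀ l, l.length = T → A l → B l) :
    coinCount T A ≤ coinCount T B := by
  classical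
  refine Finset.card_le_card fun r hr => ?_
  rw [mem_filter] at hr ⊢
  exact ⟨hr.1, h _ (List.length_ofFn) hr.2⟩

lemma coinCount_add_not (T : ℕ) (A : List Bool → Prop) :
    coinCount T A + coinCount T (fun l => ¬ A l) = 2 ^ T := by
  classical
  unfold coinCount
  rw [Finset.card_filter_add_card_filter_not]
  simp

/-- Two distinct words of the same length rarely have the same fingerprint. -/
lemma coinCount_collision {u u' : List Bool} (hlen : u.length = u'.length) (hne : u ≠ u') {E : ℕ}
    (hE : 3 ≤ E) (hu : u.length ≤ E) :
    64 * coinCount (4 * E) (fun l => (Fp.ofWord (seedFrom E 0 1 0 l) u).digest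
      = (Fp.ofWord (seedFrom E 0 1 0 l) u').digest) ≤ 2 ^ (4 * E) := by
  classical
  obtain ⟨t, s, s', h1, h2, h3, h4, h5⟩ := separated_of_ne hlen hne
  set T := 4 ^ 2 ^ t with hT
  have hT4 : 4 ≤ T := Nat.le_self_pow (by positivity) 4
  have hM : 16 * T ^ 2 = 16 ^ (2 ^ t + 1) := by
    rw [hT, ← pow_mul, mul_comm (2 ^ t), pow_mul, show (4 : ℕ) ^ 2 = 16 by norm_num, pow_succ']
  set B := (range (16 * T ^ 2)).filter fun r => hornerMod T r s = hornerMod T r s' with hB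
  have hcard : B.card ≤ T := card_hornerMod_eq_le h2 h3 h1
  have hle : 16 ^ (2 ^ t + 1) ≤ 16 * (0 + E) ^ 4 := by
    rw [← hM, zero_add]
    refine Nat.mul_le_mul_left _ ?_
    rcases h4 with h4 | h4
    · rw [h4]
      exact le_trans (by norm_num) (Nat.pow_le_pow_left hE 4)
    · calc T ^ 2 ≤ (u.length ^ 2) ^ 2 := Nat.pow_le_pow_left h4 2
        _ = u.length ^ 4 := by rw [← pow_mul]
        _ ≤ E ^ 4 := Nat.pow_le_pow_left hu 4
  have hcount := coinCount_seed (2 ^ t + 1) B (fun x hx => by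
    rw [← hM]; exact mem_range.1 (mem_filter.1 hx).1) E 0 0 0 (by norm_num) hle (Nat.zero_le _)
    (by norm_num)
  have hmono := coinCount_mono (T := 4 * E) (A := fun l => (Fp.ofWord (seedFrom E 0 1 0 l) u).digest
      = (Fp.ofWord (seedFrom E 0 1 0 l) u').digest)
    (B := fun l => seedFrom E 0 (16 ^ 0) 0 l % 16 ^ (2 ^ t + 1) ∈ B) fun l _ h => by
      rw [hB, mem_filter, mem_range, ← hM]
      refine ⟨Nat.mod_lt _ (by positivity), ?_⟩
      have h6 := h5 _ h
      simpa [hornerMod] using h6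
  set K := coinCount (4 * E) fun l => seedFrom E 0 (16 ^ 0) 0 l % 16 ^ (2 ^ t + 1) ∈ B
  have h16 : (2 : ℕ) ^ (4 * E) = 16 ^ E := by rw [pow_mul]; norm_num
  rw [← hM] at hcount
  have h7 : K * (16 * T ^ 2) ≤ 16 ^ E * T := by
    rw [hcount, pow_zero, one_mul]
    exact Nat.mul_le_mul_left _ ((Finset.card_filter_le _ _).trans hcard)
  have h8 : K * (16 * T) ≤ 16 ^ E := by
    refine Nat.le_of_mul_le_mul_right ?_ (show 0 < T by omega)
    calc K * (16 * T) * T = K * (16 * T ^ 2) := by ring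
      _ ≤ _ := h7
  rw [h16]
  calc _ ≤ 64 * K := Nat.mul_le_mul_left _ hmono
    _ = K * (16 * 4) := by ring
    _ ≤ K * (16 * T) := Nat.mul_le_mul_left _ (by omega)
    _ ≤ _ := h8

/-! ### Runs of the streaming algorithm -/

section Runs

variable {m : ℕ} [NeZero m] {γ : Reg} {ρ : ℕ}

/-- The events of a run with the values of their coin flips. -/
def events : List (Option Ternary) → List Bool → List (Option Ternary × ℕ)
  | [], _ => []
  | o :: os, l => (o, coinVal (l.take 4)) :: events os (l.drop 4)

/-- The state after a list of events. -/
noncomputable def Reg.steps (γ : Reg) (evs : List (Option Ternary × ℕ)) : Reg :=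
  evs.foldl (fun γ p => Reg.upd p.1 (γ, p.2)) γ

/-- The gates that are written during a list of events. -/
noncomputable def Reg.trace (m : ℕ) [NeZero m] : List (Option Ternary × ℕ) → Reg → List (GateInstr m)
  | [], _ => []
  | p :: evs, γ => (Reg.upd p.1 (γ, p.2)).gates m ++ Reg.trace m evs (Reg.upd p.1 (γ, p.2))

lemma events_lt {os : List (Option Ternary)} {l : List Bool} (hl : l.length = 4 * os.length) :
    ∀ p ∈ events os l, p.2 < 16 := by
  induction os generalizing l with
  | nil => exact fun p hp => absurd hp List.not_mem_nil
  | cons o os ih =>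
    rw [List.length_cons] at hl
    rw [events, List.forall_mem_cons]
    exact ⟨coinVal_lt (by rw [List.length_take]; omega), ih (by rw [List.length_drop]; omega)⟩

lemma Reg.upd_seed (o : Option Ternary) (p : Reg × ℕ) :
    (Reg.upd o p).P = (Reg.absorb p).P ∧ (Reg.upd o p).R = (Reg.absorb p).R := by
  cases o with
  | none => simp only [Reg.upd]; split_ifs <;> exact ⟨rfl, rfl⟩
  | some o => cases o <;> simp only [Reg.upd, Reg.read] <;> split_ifs <;> exact ⟨rfl, rfl⟩

lemma Reg.steps_events_R (os : List (Option Ternary)) (l : List Bool) :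
    (γ.steps (events os l)).R = seedFrom os.length γ.e γ.P γ.R l := by
  induction os generalizing γ l with
  | nil => rfl
  | cons o os ih =>
    have h := Reg.upd_seed o (γ, coinVal (l.take 4))
    rw [events, Reg.steps, List.foldl_cons, ← Reg.steps, ih, Reg.upd_e, h.1, h.2]
    rfl

lemma Reg.steps_R_mod (evs : List (Option Ternary × ℕ)) : (γ.steps evs).R % γ.P = γ.R % γ.P := by
  induction evs generalizing γ with
  | nil => rfl
  | cons p evs ih =>
    have h := ih (γ := Reg.upd p.1 (γ, p.2))
    obtain ⟨h1, h2⟩ := Reg.upd_seed p.1 (γ, p.2)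
    rw [h1, h2] at h
    rw [Reg.steps, List.foldl_cons, ← Reg.steps]
    simp only [Reg.absorb] at h
    split_ifs at h
    · simpa [Nat.mod_mul_right_mod] using congrArg (· % γ.P) h
    · exact h

/-- A run with final seed `ρ`. -/
structure Live (ρ : ℕ) (γ : Reg) (evs : List (Option Ternary × ℕ)) : Prop where
  inv : γ.Inv 0
  lt : ∀ p ∈ evs, p.2 < 16
  seed : (γ.steps evs).R = ρ

lemma Live.cons {p : Option Ternary × ℕ} {evs : List (Option Ternary × ℕ)} (h : Live ρ γ (p :: evs)) :
    Live ρ (Reg.upd p.1 (γ, p.2)) evs :=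
  ⟨h.inv.upd (h.lt p (.head _)) _, fun q hq => h.lt q (.tail _ hq), h.seed⟩

/-- During a run, the current seed is a suffix of the final one. -/
lemma Live.mod_eq {evs : List (Option Ternary × ℕ)} (h : Live ρ γ evs) : ρ % γ.P = γ.R := by
  rw [← h.seed, Reg.steps_R_mod, Nat.mod_eq_of_lt h.inv.R_lt]

/-- A partial word has been read, after `j` complete words the first two of which are `X` and `Y`. -/
structure Reading (k ρ j : ℕ) (X Y u : List Bool) (γ : Reg) : Prop where
  mode : γ.mode = 1
  k_eq : γ.k = k
  j_eq : γ.j = j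
  fp : (⟨γ.i, γ.T, γ.v, γ.S⟩ : Fp) = Fp.ofWord ρ u
  N : 1 ≤ j → γ.N = 2 ^ (2 * k)
  HX : 1 ≤ j → γ.HX = (Fp.ofWord ρ X).digest
  HY : 2 ≤ j → γ.HY = (Fp.ofWord ρ Y).digest

/-- The prefix `1^k` has been read. -/
structure Prefix (k : ℕ) (γ : Reg) : Prop where
  mode : γ.mode = 0
  k_eq : γ.k = k
  j_eq : γ.j = 0
  fp : (⟨γ.i, γ.T, γ.v, γ.S⟩ : Fp) = ⟨0, 4, 0, 0⟩

variable {k j c : ℕ} {X Y u : List Bool}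

lemma Fp.ofWord_i (ρ : ℕ) (u : List Bool) : (Fp.ofWord ρ u).i = u.length := by
  induction u using List.reverseRecOn with
  | nil => rfl
  | append_singleton u β ih => rw [Fp.ofWord_append, Fp.push, ih, List.length_append, List.length_singleton]

lemma Reading.length (h : Reading k ρ j X Y u γ) : γ.i = u.length := by
  rw [← Fp.ofWord_i ρ, ← h.fp]

lemma Reading.digest (h : Reading k ρ j X Y u γ) : γ.digest = (Fp.ofWord ρ u).digest := by
  rw [← h.fp]; rfl

lemma Reading.push (h : Reading k ρ j X Y u γ) (hi : γ.Inv 0) (hc : c < 16)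
    (hρ : ρ % (Reg.absorb (γ, c)).P = (Reg.absorb (γ, c)).R) (β : Bool) :
    Reg.upd (some (.ofBool β)) (γ, c) = (Reg.absorb (γ, c)).push β.toNat ∧
      Reading k ρ j X Y (u ++ [β]) (Reg.upd (some (.ofBool β)) (γ, c)) := by
  have hm := h.mode
  have e : Reg.upd (some (.ofBool β)) (γ, c) = (Reg.absorb (γ, c)).push β.toNat := by
    cases β <;> simp [Reg.upd, Reg.read, Ternary.ofBool, show (Reg.absorb (γ, c)).mode = 1 from hm]
  refine ⟨e, ?_⟩
  rw [e]
  refine ⟨hm, h.k_eq, h.j_eq, ?_, h.N, h.HX, h.HY⟩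
  have hi' := hi.absorb hc
  have hR : (Reg.absorb (γ, c)).R % (16 * γ.T ^ 2) = ρ % (16 * γ.T ^ 2) := by
    rw [← hρ]
    exact Nat.mod_mod_of_dvd _ (hi'.dvd_P (hi'.k_pos hm).2)
  rw [Fp.ofWord_append, ← h.fp, Fp.push, ← hR]
  rfl

lemma Reg.wordOk_iff (h : Reading k ρ j X Y u γ) : γ.WordOk ↔ u.length = 2 ^ (2 * k) ∧
    (j ≠ 0 → j % 3 ≠ 1 → (Fp.ofWord ρ u).digest = (Fp.ofWord ρ X).digest) ∧
    (j ≠ 1 → j % 3 = 1 → (Fp.ofWord ρ u).digest = (Fp.ofWord ρ Y).digest) := by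
  rw [Reg.WordOk, h.digest, h.length, h.j_eq, h.k_eq]
  constructor
  · rintro ⟨h1, h2, h3, h4⟩
    refine ⟨?_, fun h5 h6 => (h3 h5 h6).trans (h.HX (by omega)), fun h5 h6 => (h4 h5 h6).trans (h.HY (by omega))⟩
    by_cases h0 : j = 0
    · obtain ⟨⟨q, hq⟩, h6⟩ := h1 h0
      rw [hq, Nat.log_pow (by omega)] at h6
      rw [hq, h6]
    · rw [h2 h0, h.N (by omega)]
  · rintro ⟨h1, h2, h3⟩
    refine ⟨fun _ => ⟨⟨_, h1⟩, by rw [h1, Nat.log_pow (by omega)]⟩, fun h5 => by rw [h1, h.N (by omega)],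
      fun h5 h6 => (h2 h5 h6).trans (h.HX (by omega)).symm, fun h5 h6 => (h3 h5 h6).trans (h.HY (by omega)).symm⟩

lemma Reading.absorb (h : Reading k ρ j X Y u γ) : Reading k ρ j X Y u (Reg.absorb (γ, c)) :=
  ⟨h.mode, h.k_eq, h.j_eq, h.fp, h.N, h.HX, h.HY⟩

lemma Reading.close (h : Reading k ρ j X Y u γ) (hok : γ.WordOk) :
    Reading k ρ (j + 1) (if j = 0 then u else X) (if j = 1 then u else Y) [] γ.close := by
  have h1 := h.digest
  refine ⟨h.mode, h.k_eq, congrArg (· + 1) h.j_eq, rfl, fun _ => h.length.trans ((Reg.wordOk_iff h).1 hok).1,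
    fun _ => ?_, fun _ => ?_⟩ <;> simp only [Reg.close, h.j_eq]
  · split_ifs
    · exact h1
    · exact h.HX (by omega)
  · split_ifs
    · exact h1
    · exact h.HY (by omega)

/-- The word `1^k#u₁#⋯u_r#`. -/
def encode (k : ℕ) (ws : List (List Bool)) : List Ternary :=
  List.replicate k Ternary.one ++ Ternary.hash :: ws.flatMap fun u => u.map Ternary.ofBool ++ [Ternary.hash]

/-- What a state says about the part of the input that has been read. -/
def Shape (ρ : ℕ) (w : List Ternary) (γ : Reg) : Prop :=
  γ.mode = 2 ∨ (∃ k, w = List.replicate k Ternary.one ∧ Prefix k γ) ∨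
    ∃ k ws u, 1 ≤ k ∧ w = encode k ws ++ u.map Ternary.ofBool ∧
      Reading k ρ ws.length (ws.getD 0 []) (ws.getD 1 []) u γ ∧
      ∀ q < ws.length, (ws.getD q []).length = 2 ^ (2 * k) ∧
        (Fp.ofWord ρ (ws.getD q [])).digest = (Fp.ofWord ρ (ws.getD (if q % 3 = 1 then 1 else 0) [])).digest

lemma Prefix.upd_hash (h : Prefix k γ) (hk : 1 ≤ k) :
    Reading k ρ 0 X Y [] (Reg.upd (some .hash) (γ, c)) ∧ (Reg.upd (some .hash) (γ, c)).op = 0 := by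
  have e : Reg.upd (some .hash) (γ, c) = { Reg.absorb (γ, c) with mode := 1 } := by
    simp [Reg.upd, Reg.read, Reg.absorb, h.mode, h.k_eq, hk]
  rw [e]
  exact ⟨⟨rfl, h.k_eq, h.j_eq, h.fp, fun h => absurd h (by omega), fun h => absurd h (by omega),
    fun h => absurd h (by omega)⟩, rfl⟩

lemma Prefix.upd_one (h : Prefix k γ) :
    Prefix (k + 1) (Reg.upd (some .one) (γ, c)) ∧ (Reg.upd (some .one) (γ, c)).op = 0 := by
  have e : Reg.upd (some .one) (γ, c) = { Reg.absorb (γ, c) with k := γ.k + 1 } := by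
    simp [Reg.upd, Reg.read, Reg.absorb, h.mode]
  rw [e]
  exact ⟨⟨h.mode, congrArg (· + 1) h.k_eq, h.j_eq, h.fp⟩, rfl⟩

lemma Reading.upd_hash (h : Reading k ρ j X Y u γ) : Reg.upd (some .hash) (γ, c)
    = open Classical in if (Reg.absorb (γ, c)).WordOk then (Reg.absorb (γ, c)).close else (Reg.absorb (γ, c)).quit := by
  simp [Reg.upd, Reg.read, show (Reg.absorb (γ, c)).mode = 1 from h.mode]

lemma encode_append (k : ℕ) (ws : List (List Bool)) (u : List Bool) :
    encode k (ws ++ [u]) = encode k ws ++ u.map Ternary.ofBool ++ [Ternary.hash] := by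
  simp [encode]

lemma Shape.upd {w : List Ternary} (h : Shape ρ w γ) (hi : γ.Inv 0) (hc : c < 16) (o : Ternary)
    (hρ : ρ % (Reg.absorb (γ, c)).P = (Reg.absorb (γ, c)).R) : Shape ρ (w ++ [o]) (Reg.upd (some o) (γ, c)) := by
  rcases h with h | ⟨k, rfl, h⟩ | ⟨k, ws, u, hk, rfl, h, hq⟩
  · left
    cases o <;> simp [Reg.upd, Reg.read, show (Reg.absorb (γ, c)).mode = 2 from h]
  · have hm : (Reg.absorb (γ, c)).mode = 0 := h.mode
    cases o
    · left; simp [Reg.upd, Reg.read, hm, Reg.quit]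
    · exact .inr (.inl ⟨k + 1, by rw [List.replicate_succ'], h.upd_one.1⟩)
    · by_cases hk : 1 ≤ k
      · exact .inr (.inr ⟨k, [], [], hk, by simp [encode], (h.upd_hash hk).1, fun q hq => absurd hq (by simp)⟩)
      · left; simp [Reg.upd, Reg.read, hm, Reg.quit, show (Reg.absorb (γ, c)).k = k from h.k_eq, hk]
  · by_cases ho : ∃ β, o = Ternary.ofBool β
    · obtain ⟨β, rfl⟩ := ho
      exact .inr (.inr ⟨k, ws, u ++ [β], hk, by simp, (h.push hi hc hρ β).2, hq⟩)
    · have ho : o = Ternary.hash := by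
        cases o
        exacts [absurd ⟨false, rfl⟩ ho, absurd ⟨true, rfl⟩ ho, rfl]
      subst ho
      rw [h.upd_hash]
      split_ifs with hok
      · have h1 := (h.absorb (c := c)).close hok
        obtain ⟨k1, k2, k3⟩ := (Reg.wordOk_iff (h.absorb (c := c))).1 hok
        have hlt : ∀ q < ws.length, (ws ++ [u]).getD q [] = ws.getD q [] := fun q hq =>
          List.getD_append _ _ _ _ hq
        have heq : ∀ q, q = ws.length → (ws ++ [u]).getD q [] = u := by
          rintro q rfl; simp
        refine .inr (.inr ⟨k, ws ++ [u], [], hk, by rw [encode_append]; simp, ?_, fun q hq' => ?_⟩)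
        · rw [List.length_append, List.length_singleton]
          have e0 : (ws ++ [u]).getD 0 [] = if ws.length = 0 then u else ws.getD 0 [] := by
            split_ifs with h0
            exacts [heq 0 h0.symm, hlt 0 (by omega)]
          have hE : 2 ≤ ws.length + 1 → (ws ++ [u]).getD 1 [] = if ws.length = 1 then u else ws.getD 1 [] := by
            intro h2
            split_ifs with h0
            exacts [heq 1 h0.symm, hlt 1 (by omega)]
          rw [e0]
          exact { h1 with HY := fun h2 => by rw [hE h2]; exact h1.HY h2 }
        · rw [List.length_append, List.length_singleton] at hq'
          rcases Nat.lt_succ_iff_lt_or_eq.1 hq' with h5 | h5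
          · rw [hlt q h5, hlt _ (by split_ifs <;> omega)]
            exact hq q h5
          · rw [heq q h5]
            refine ⟨k1, ?_⟩
            split_ifs with h6
            · by_cases h7 : q = 1
              · rw [heq 1 (by omega)]
              · rw [hlt 1 (by omega)]
                exact k3 (by omega) (by omega)
            · by_cases h7 : q = 0
              · rw [heq 0 (by omega)]
              · rw [hlt 0 (by omega)]
                exact k2 (by omega) (by omega)
      · exact .inl rfl

/-- The state before the last event. -/
lemma Live.exists_last {os w : List Ternary} {l : List Bool}
    (h : Live ρ γ (events (os.map some ++ [none]) l)) (hs : Shape ρ w γ) : ∃ γ' c,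
      Shape ρ (w ++ os) γ' ∧ γ.steps (events (os.map some ++ [none]) l) = Reg.upd none (γ', c) := by
  induction os generalizing γ w l with
  | nil => exact ⟨γ, _, by rwa [List.append_nil], rfl⟩
  | cons o os ih =>
    have h1 := h.cons
    have h2 := h1.mod_eq
    rw [(Reg.upd_seed _ _).1, (Reg.upd_seed _ _).2] at h2
    obtain ⟨γ', c, h3, h4⟩ := ih h1 (hs.upd h.inv (h.lt _ (.head _)) o h2)
    exact ⟨γ', c, by rwa [List.append_assoc] at h3, h4⟩

lemma map_ofBool_append_hash_inj {u u' : List Bool} {r r' : List Ternary}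
    (h : u.map Ternary.ofBool ++ Ternary.hash :: r = u'.map Ternary.ofBool ++ Ternary.hash :: r') :
    u = u' ∧ r = r' := by
  induction u generalizing u' with
  | nil =>
    cases u' with
    | nil => simpa using h
    | cons β u' => cases β <;> simp [Ternary.ofBool] at h
  | cons β u ih =>
    cases u' with
    | nil => cases β <;> simp [Ternary.ofBool] at h
    | cons β' u' =>
      rw [List.map_cons, List.map_cons, List.cons_append, List.cons_append, List.cons.injEq] at h
      obtain ⟨rfl, rfl⟩ := ih h.2
      refine ⟨?_, rfl⟩
      cases β <;> cases β' <;> simp [Ternary.ofBool] at h ⊢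

lemma encode_inj {k k' : ℕ} {ws ws' : List (List Bool)} (h : encode k ws = encode k' ws') :
    k = k' ∧ ws = ws' := by
  have e : ∀ k, List.replicate k Ternary.one = (List.replicate k true).map Ternary.ofBool := fun k => by
    simp [Ternary.ofBool]
  rw [encode, encode, e, e] at h
  obtain ⟨h1, h2⟩ := map_ofBool_append_hash_inj h
  refine ⟨by simpa using congrArg List.length h1, ?_⟩
  clear h h1
  induction ws generalizing ws' with
  | nil => cases ws' <;> simp at h2 ⊢
  | cons u ws ih =>
    cases ws' with
    | nil => simp at h2
    | cons u' ws' =>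
      simp only [List.flatMap_cons, List.append_assoc, List.singleton_append] at h2
      obtain ⟨rfl, h3⟩ := map_ofBool_append_hash_inj h2
      rw [ih h3]

end Runs

/-! ### The circuit for a well-formed input -/

section WellFormed

variable {m : ℕ} [NeZero m] {γ : Reg} {ρ k j : ℕ} {X Y u : List Bool}

/-- The events `os` write the gates `gs` and lead to a state with property `Q`. -/
def Leads (m : ℕ) [NeZero m] (ρ : ℕ) (os : List (Option Ternary)) (gs : List (GateInstr m)) (γ : Reg)
    (Q : Reg → Prop) : Prop :=
  ∀ rest l, Live ρ γ (events (os ++ rest) l) → ∃ γ' l', Live ρ γ' (events rest l') ∧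
    Reg.trace m (events (os ++ rest) l) γ = gs ++ Reg.trace m (events rest l') γ' ∧ Q γ'

lemma Leads.nil {Q : Reg → Prop} (h : Q γ) : Leads m ρ [] [] γ Q := fun _ l hl => ⟨γ, l, hl, rfl, h⟩

lemma Leads.append {os os' : List (Option Ternary)} {gs gs' : List (GateInstr m)} {Q Q' : Reg → Prop}
    (h : Leads m ρ os gs γ Q) (h' : ∀ γ', Q γ' → Leads m ρ os' gs' γ' Q') :
    Leads m ρ (os ++ os') (gs ++ gs') γ Q' := by
  intro rest l hl
  rw [List.append_assoc] at hl ⊢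
  obtain ⟨γ₁, l₁, h1, h2, h3⟩ := h _ l hl
  obtain ⟨γ₂, l₂, h4, h5, h6⟩ := h' γ₁ h3 _ l₁ h1
  exact ⟨γ₂, l₂, h4, by rw [h2, h5, List.append_assoc], h6⟩

lemma Leads.one {o : Option Ternary} {gs : List (GateInstr m)} {Q : Reg → Prop}
    (h : ∀ c < 16, γ.Inv 0 → ρ % (Reg.absorb (γ, c)).P = (Reg.absorb (γ, c)).R →
      (Reg.upd o (γ, c)).gates m = gs ∧ Q (Reg.upd o (γ, c))) : Leads m ρ [o] gs γ Q := by
  intro rest l hl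
  have h2 := hl.cons.mod_eq
  rw [(Reg.upd_seed _ _).1, (Reg.upd_seed _ _).2] at h2
  obtain ⟨h3, h4⟩ := h _ (hl.lt _ (.head _)) hl.inv h2
  refine ⟨_, l.drop 4, hl.cons, ?_, h4⟩
  rw [← h3]
  rfl

lemma Reg.gates_zero (h : γ.op = 0) : γ.gates m = [] := by
  rw [Reg.gates, show disjAlg.len γ = 0 from if_pos h]
  rfl

open Classical in
/-- The gates for a bit at position `p` of word `j`. -/
noncomputable def bitGates (m : ℕ) [NeZero m] (n j : ℕ) : ℕ → List (GateInstr m) := fun p =>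
  if j % 3 = 1 then forCopies 8 fun c => testGates m n 0 (idxAddr c) p (if ∃ e, j / 3 = 2 ^ e then 1 else 4)
    (4 + c) (if ∃ e, j / 3 = 2 ^ e then flagAddr c (Nat.log 2 (j / 3)) else 3) 0
  else forCopies 8 fun c => testGates m n 0 (idxAddr c) p 1 2 (4 + c) 0

lemma Leads.bits (us : List Bool) (h : Reading k ρ j X Y u γ) :
    Leads m ρ ((us.map Ternary.ofBool).map some)
      (if 3 ≤ j then wordGates (bitGates m (2 * k) j) u.length us else []) γ (Reading k ρ j X Y (u ++ us)) := by
  classical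
  induction us generalizing γ u with
  | nil =>
    rw [List.append_nil, wordGates, ite_self]
    exact .nil h
  | cons β us ih =>
    have h1 : Leads m ρ [some (Ternary.ofBool β)]
        (if 3 ≤ j then if β = true then bitGates m (2 * k) j u.length else [] else []) γ
        (Reading k ρ j X Y (u ++ [β])) := by
      refine .one fun c hc hi hρ => ?_
      obtain ⟨e, h2⟩ := h.push hi hc hρ β
      refine ⟨?_, h2⟩
      have hop : (Reg.upd (some (Ternary.ofBool β)) (γ, c)).op
          = if 3 ≤ j ∧ β.toNat = 1 then (if j % 3 = 1 then 2 else 1) else 0 := by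
        rw [e, ← h.j_eq]; rfl
      have hpos : (Reg.upd (some (Ternary.ofBool β)) (γ, c)).pos = u.length := by
        rw [e, ← h.length]; rfl
      by_cases hj : 3 ≤ j ∧ β.toNat = 1
      · have hβ : β = true := by cases β <;> simp at hj ⊢
        rw [if_pos hj] at hop
        rw [if_pos hj.1, if_pos hβ, bitGates]
        by_cases h3 : j % 3 = 1
        · rw [if_pos h3] at hop
          rw [if_pos h3, Reg.gates_eq (by omega), h2.k_eq, hpos]
          by_cases h4 : ∃ e, j / 3 = 2 ^ e <;> simp only [hop, Reg.argU, Reg.argV, h2.j_eq, h4] <;> rfl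
        · rw [if_neg h3] at hop
          rw [if_neg h3, Reg.gates_eq (by omega), h2.k_eq, hpos]
          simp [hop, Reg.argU, Reg.argV]
      · rw [if_neg hj] at hop
        rw [Reg.gates_zero hop]
        split_ifs with h3 h4
        · exact absurd ⟨h3, by rw [h4]; rfl⟩ hj
        all_goals rfl
    have h3 := h1.append fun γ' h' => ih h'
    rw [List.append_assoc, List.length_append, List.length_singleton] at h3
    convert h3 using 1
    · rfl
    · split_ifs <;> simp [wordGates, *]
    · rfl

/-- The gates that are written while word `j` is read. -/
noncomputable def readGates (m : ℕ) [NeZero m] (n j : ℕ) (u : List Bool) : List (GateInstr m) :=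
  (if 3 ≤ j then wordGates (bitGates m n j) 0 u else []) ++
    if j = 2 then initGates m n else if 3 ≤ j ∧ j % 3 = 2 then diffGates m n else []

lemma Leads.word (h : Reading k ρ j X Y [] γ) (hlen : u.length = 2 ^ (2 * k))
    (hu : u = if j % 3 = 1 then Y else X) : Leads m ρ ((u.map Ternary.ofBool ++ [Ternary.hash]).map some)
      (readGates m (2 * k) j u) γ (Reading k ρ (j + 1) X Y []) := by
  rw [List.map_append, readGates]
  refine (Leads.bits u h).append fun γ' h' => .one fun c _ _ _ => ?_
  rw [List.nil_append] at h'
  have hok : (Reg.absorb (γ', c)).WordOk := (Reg.wordOk_iff h'.absorb).2 ⟨hlen,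
    fun _ h1 => by rw [hu, if_neg h1], fun _ h1 => by rw [hu, if_pos h1]⟩
  rw [h'.upd_hash, if_pos hok]
  have h1 := h'.absorb.close hok
  have e1 : (if j = 0 then u else X) = X := by
    split_ifs with h0
    · rw [hu, if_neg (by omega)]
    · rfl
  have e2 : (if j = 1 then u else Y) = Y := by
    split_ifs with h0
    · rw [hu, if_pos (by omega)]
    · rfl
  rw [e1, e2] at h1
  refine ⟨?_, h1⟩
  have hop : (Reg.absorb (γ', c)).close.op = if j = 2 then 3 else if 3 ≤ j ∧ j % 3 = 2 then 4 else 0 := by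
    rw [← h'.j_eq]; rfl
  split_ifs at hop ⊢ with h2 h3
  · rw [Reg.gates_eq (by omega), h1.k_eq]
    simp [hop, Reg.argU, Reg.argV, initGates]
  · rw [Reg.gates_eq (by omega), h1.k_eq]
    simp [hop, Reg.argU, Reg.argV, diffGates]
  · exact Reg.gates_zero hop

/-- The words of `b` blocks. -/
def blockWords (x y : List Bool) (b : ℕ) : List (List Bool) := (List.replicate b [x, y, x]).flatten

lemma blockWords_succ (x y : List Bool) (b : ℕ) : blockWords x y (b + 1) = blockWords x y b ++ [x, y, x] := by
  simp [blockWords, List.replicate_succ']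

lemma readGates_block {b : ℕ} (hb : 1 ≤ b) (n : ℕ) (x y : List Bool) :
    readGates m n (3 * b) x ++ (readGates m n (3 * b + 1) y ++ readGates m n (3 * b + 2) x)
      = oracleGates m n b x y ++ diffGates m n := by
  have e : ∀ j, j % 3 ≠ 1 → ∀ u, wordGates (bitGates m n j) 0 u = xGates m n u := fun j hj u =>
    congrArg (wordGates · 0 u) (funext fun p => if_neg hj)
  have e1 : ∀ u, wordGates (bitGates m n (3 * b + 1)) 0 u = yGates m n b u := fun u =>
    congrArg (wordGates · 0 u) (funext fun p => by
      rw [bitGates, if_pos (by omega), show (3 * b + 1) / 3 = b by omega])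
  have h0 : 3 ≤ 3 * b ∧ 3 ≤ 3 * b + 1 ∧ 3 ≤ 3 * b + 2 ∧ 3 * b ≠ 2 ∧ 3 * b + 1 ≠ 2 ∧ 3 * b + 2 ≠ 2 ∧ 3 * b % 3 ≠ 2 ∧
      (3 * b + 1) % 3 ≠ 2 ∧ (3 * b + 2) % 3 = 2 := by omega
  simp only [readGates, h0, e (3 * b) (by omega), e (3 * b + 2) (by omega), e1, oracleGates, List.append_nil,
    List.append_assoc, if_true, if_false, and_true, and_false]

lemma Leads.block {b : ℕ} {x y : List Bool} (hx : x.length = 2 ^ (2 * k)) (hy : y.length = 2 ^ (2 * k))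
    (h : Reading k ρ (3 * b) x y [] γ) : Leads m ρ
      (([x, y, x].flatMap fun u => u.map Ternary.ofBool ++ [Ternary.hash]).map some)
      (readGates m (2 * k) (3 * b) x ++ (readGates m (2 * k) (3 * b + 1) y ++ readGates m (2 * k) (3 * b + 2) x)) γ
      (Reading k ρ (3 * (b + 1)) x y []) := by
  simp only [List.flatMap_cons, List.flatMap_nil, List.append_nil, List.map_append (l₁ := _ ++ [Ternary.hash])]
  refine (Leads.word h hx (by rw [if_neg (by omega)])).append fun γ' h' => ?_
  refine (Leads.word h' hy (by rw [if_pos (by omega)])).append fun γ'' h'' => ?_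
  exact Leads.word h'' hx (by rw [if_neg (by omega)])

lemma Leads.blocks {x y : List Bool} (hx : x.length = 2 ^ (2 * k)) (hy : y.length = 2 ^ (2 * k))
    (h : Reading k ρ 0 x y [] γ) (B : ℕ) : Leads m ρ
      (((blockWords x y (B + 1)).flatMap fun u => u.map Ternary.ofBool ++ [Ternary.hash]).map some)
      (initGates m (2 * k) ++ blocksGates m (2 * k) x y B) γ (Reading k ρ (3 * (B + 1)) x y []) := by
  induction B with
  | zero =>
    have h1 := Leads.block (m := m) (b := 0) hx hy h
    convert h1 using 1
    · simp [blockWords]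
    · simp [readGates, blocksGates]
  | succ B ih =>
    rw [blockWords_succ, List.flatMap_append, List.map_append, blocksGates, ← List.append_assoc]
    refine ih.append fun γ' h' => ?_
    rw [← readGates_block (by omega)]
    exact Leads.block hx hy h'

/-- The circuit for a well-formed input. -/
lemma Leads.encode {x y : List Bool} (hk : 1 ≤ k) (hx : x.length = 2 ^ (2 * k)) (hy : y.length = 2 ^ (2 * k)) :
    Leads m ρ ((encode k (blockWords x y (2 ^ k))).map some ++ [none])
      (initGates m (2 * k) ++ blocksGates m (2 * k) x y (2 ^ k - 1) ++ verdictGates m (2 * k) 8) disjAlg.init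
      fun γ => γ.op = 5 ∧ γ.k = k := by
  have h1 : ∀ k', Leads m ρ ((List.replicate k' Ternary.one).map some) [] disjAlg.init (Prefix k') := by
    intro k'
    induction k' with
    | zero => exact .nil ⟨rfl, rfl, rfl, rfl⟩
    | succ k' ih =>
      rw [List.replicate_succ', List.map_append]
      exact ih.append (gs' := []) fun γ' h' => .one fun c _ _ _ => ⟨Reg.gates_zero h'.upd_one.2, h'.upd_one.1⟩
  have e : 2 ^ k = 2 ^ k - 1 + 1 := by have := Nat.two_pow_pos k; omega
  have h2 : ∀ γ₁, Prefix k γ₁ → Leads m ρ [some Ternary.hash] [] γ₁ (Reading k ρ 0 x y []) := fun γ₁ h₁ =>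
    .one fun c _ _ _ => ⟨Reg.gates_zero (h₁.upd_hash (ρ := ρ) (X := x) (Y := y) hk).2, (h₁.upd_hash hk).1⟩
  rw [_root_.encode, List.map_append, List.map_cons, ← List.singleton_append (l := List.map some _)]
  refine Leads.append (Q := Reading k ρ (3 * 2 ^ k) x y []) ((h1 k).append (gs' := _ ++ _) fun γ₁ h₁ =>
    (h2 γ₁ h₁).append (gs' := _ ++ _) fun γ₂ h₂ => ?_) fun γ₃ h₃ => .one fun c _ _ _ => ?_
  · have h4 := Leads.blocks (m := m) hx hy h₂ (2 ^ k - 1)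
    rwa [← e] at h4
  · have h4 := h₃.absorb (c := c)
    have hpos := Nat.two_pow_pos k
    have hf : (Reg.absorb (γ₃, c)).Final := by
      refine ⟨h4.mode, h4.length, ?_, ?_, ?_⟩
      · rw [h4.j_eq]; omega
      · rw [h4.j_eq]; omega
      · rw [h4.j_eq, h4.N (by omega), Nat.mul_div_cancel_left _ (by omega), ← pow_mul, mul_comm]
    have e5 : Reg.upd none (γ₃, c) = { Reg.absorb (γ₃, c) with mode := 2, op := 5 } := if_pos hf
    rw [e5]
    refine ⟨?_, rfl, h4.k_eq⟩
    rw [Reg.gates_eq (by simp), show ({ Reg.absorb (γ₃, c) with mode := 2, op := 5 } : Reg).k = k from h4.k_eq]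
    simp [Reg.argU, Reg.argV, verdictGates]

end WellFormed

/-! ### The first gates -/

section Preamble

variable {m : ℕ} [NeZero m]

/-- The gates that set the qubits `2` and `3`: the product of `H`, `T ^ 4 = Z` and `H` is the negation. -/
def preamble (m : ℕ) [NeZero m] : List (GateInstr m) :=
  [2, 3].flatMap fun a => gateAt m a 1 0 :: (List.replicate 4 (gateAt m a 1 1) ++ [gateAt m a 1 0])

lemma runGates_not {a d : Fin m} (h : a ≠ d) (ψ : QState m) (x : Bits m) :
    runGates (⟨a, d, 0⟩ :: (List.replicate 4 ⟨a, d, 1⟩ ++ [⟨a, d, 0⟩])) ψ x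
      = ψ (update x a (x a + 1)) := by
  rw [runGates_cons, runGates_append, runGates_cons, runGates_nil, apply_H h]
  simp only [runGates_replicate_T h, apply_H h, update_self, update_idem, pow_mul, omega8_pow_four]
  have h1 := hadamard_factor_sq
  generalize ((1 / Real.sqrt 2 : ℝ) : ℂ) = f at h1
  rcases (by omega : x a = 0 ∨ x a = 1) with h0 | h0 <;> simp [h0, show (1 : Fin 2) + 1 = 0 from rfl]
  · linear_combination (2 * ψ (update x a 1)) * h1
  · linear_combination (2 * ψ (update x a 0)) * h1

/-- The state after the preamble is the standard state with all indices `0`. -/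
lemma runGates_preamble {n : ℕ} (hm : 36 * (n + 1) ≤ m) (x : Bits m) :
    runGates (preamble m) (QState.zero m) x = if x = stdState n (fun _ => 0) then 1 else 0 := by
  have h2 := ofNat_ne (m := m) (a := 2) (b := 1) (by omega) (by omega) (by omega)
  have h3 := ofNat_ne (m := m) (a := 3) (b := 1) (by omega) (by omega) (by omega)
  have h5 := ofNat_ne (m := m) (a := 3) (b := 2) (by omega) (by omega) (by omega)
  rw [show preamble m = (⟨Fin.ofNat m 2, Fin.ofNat m 1, 0⟩ :: (List.replicate 4 ⟨Fin.ofNat m 2, Fin.ofNat m 1, 1⟩ ++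
    [⟨Fin.ofNat m 2, Fin.ofNat m 1, 0⟩])) ++ (⟨Fin.ofNat m 3, Fin.ofNat m 1, 0⟩ ::
    (List.replicate 4 ⟨Fin.ofNat m 3, Fin.ofNat m 1, 1⟩ ++ [⟨Fin.ofNat m 3, Fin.ofNat m 1, 0⟩])) from rfl,
    runGates_append, runGates_not h3, runGates_not h2, QState.zero, Pi.single_apply]
  congr 1
  have hv : ∀ i : Fin m, ∀ c < m, i = Fin.ofNat m c ↔ (i : ℕ) = c := fun i c hc => by
    rw [Fin.ext_iff, show ((Fin.ofNat m c : Fin m) : ℕ) = c from Nat.mod_eq_of_lt hc]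
  rw [eq_iff_iff, funext_iff, funext_iff]
  refine forall_congr' fun i => ?_
  simp only [update_apply, stdState, hv i 2 (by omega), hv i 3 (by omega), Nat.zero_testBit, Bool.false_eq_true,
    and_false, if_false, if_neg h5.symm]
  have hx : ∀ v : Fin 2, v + 1 = 0 ↔ v = 1 := by decide
  by_cases e2 : (i : ℕ) = 2
  · rw [if_pos e2, if_pos (.inl e2), ← (hv i 2 (by omega)).2 e2, hx]
  · by_cases e3 : (i : ℕ) = 3
    · rw [if_neg e2, if_pos e3, if_pos (.inr e3), ← (hv i 3 (by omega)).2 e3, hx]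
    · rw [if_neg e2, if_neg e3, if_neg (by tauto)]

lemma blockState_preamble {n : ℕ} (hm : 36 * (n + 1) ≤ m) :
    BlockState n 1 (fun _ v => if v = 0 then 1 else 0) (runGates (preamble m) (QState.zero m)) := by
  refine ⟨fun x hx => ?_, fun z hz => ?_⟩
  · rw [runGates_preamble hm, if_neg]
    rintro rfl
    exact hx (isStd_stdState _ hm _)
  · rw [runGates_preamble hm, Finset.prod_ite_zero]
    by_cases h : ∀ c ∈ range 8, z c = 0
    · rw [if_pos h, if_pos (stdState_congr fun c hc => h c (mem_range.2 hc))]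
      simp
    · rw [if_neg h, if_neg, Complex.ofReal_zero]
      intro e
      refine h fun c hc => ?_
      have hc := mem_range.1 hc
      refine Nat.eq_of_testBit_eq fun j => ?_
      by_cases hj : j < n
      · have h1 := congrArg (bitAt · (idxAddr c j)) e
        simp only [bitAt_stdState_idx hm hc hj] at h1
        simpa using h1
      · rw [Nat.zero_testBit, Nat.testBit_eq_false_of_lt ((hz c hc).trans_le (Nat.pow_le_pow_right (by omega) (by omega)))]

end Preamble

/-! ### The output on all inputs -/

section Output

variable {m n : ℕ} [NeZero m] {γ : Reg} {ρ : ℕ}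

lemma Reg.Inv.fits (h : γ.Inv 0) (he : γ.e ≤ n + 1) (hm : 180 * Nat.log 2 (max n 2) ≤ m) : γ.Fits m := by
  intro h0
  have h1 : 1 ≤ Nat.log 2 (max n 2) := Nat.le_log_of_pow_le (by omega) (by omega)
  have h2 : n + 1 < 2 ^ (Nat.log 2 (max n 2) + 2) := by
    have := Nat.lt_pow_succ_log_self (b := 2) (by omega) (max n 2)
    rw [pow_succ] at this ⊢
    omega
  have h3 : 2 * γ.k < Nat.log 2 (max n 2) + 2 :=
    (Nat.pow_lt_pow_iff_right (a := 2) (by omega)).1 (((h.op_pos h0).2.trans he).trans_lt h2)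
  have h4 : Nat.log 2 (γ.j / 3) < Nat.log 2 (max n 2) + 2 := by
    refine Nat.log_lt_of_lt_pow' (by omega) (lt_of_le_of_lt ?_ h2)
    have := h.j_le
    omega
  generalize Nat.log 2 (γ.j / 3) = a at h4 ⊢
  omega

lemma Live.out_eq {os : List (Option Ternary)} {l : List Bool} (h : Live ρ γ (events os l))
    (he : γ.e + os.length ≤ n + 1) (hm : 180 * Nat.log 2 (max n 2) ≤ m) : disjAlg.out os γ l
      = (Reg.trace m (events os l) γ).flatMap fun g => Ternary.hash :: g.word := by
  induction os generalizing γ l with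
  | nil => rfl
  | cons o os ih =>
    rw [List.length_cons] at he
    have h1 := ih h.cons (by rw [Reg.upd_e]; omega)
    rw [StreamAlg.out, events, Reg.trace, List.flatMap_append, ← h1]
    exact congrArg (· ++ _) (h.cons.inv.fits (n := n) (by rw [Reg.upd_e]; omega) hm).emit_eq

lemma Reg.upd_some_op (o : Ternary) (p : Reg × ℕ) : (Reg.upd (some o) p).op ≤ 4 := by
  have h1 : ∀ γ β, (Reg.push β γ).op ≤ 4 := fun γ β => by unfold Reg.push; dsimp only; split_ifs <;> omega
  have h2 : ∀ γ : Reg, γ.close.op ≤ 4 := fun γ => by unfold Reg.close; dsimp only; split_ifs <;> omega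
  cases o <;> simp only [Reg.upd, Reg.read] <;> split_ifs <;> first | exact h1 _ _ | exact h2 _ | exact Nat.zero_le _

/-- No gate acts on the qubit `0` before the verdict. -/
lemma Live.trace_ne_zero {os : List Ternary} {l : List Bool} (h : Live ρ γ (events (os.map some ++ [none]) l))
    (he : γ.e + os.length ≤ n) (hm : 180 * Nat.log 2 (max n 2) ≤ m)
    (h5 : (γ.steps (events (os.map some ++ [none]) l)).op ≠ 5) :
    ∀ g ∈ Reg.trace m (events (os.map some ++ [none]) l) γ, g.a ≠ Fin.ofNat m 0 ∧ g.b ≠ Fin.ofNat m 0 := by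
  induction os generalizing γ l with
  | nil =>
    have h1 := (h.cons.inv.fits (n := n) (by rw [Reg.upd_e]; omega) hm).gates_ne_zero h5
    intro g hg
    exact h1 g (by simpa [events, Reg.trace] using hg)
  | cons o os ih =>
    rw [List.length_cons] at he
    intro g hg
    rcases List.mem_append.1 hg with h1 | h1
    · have := Reg.upd_some_op o (γ, coinVal (l.take 4))
      exact (h.cons.inv.fits (n := n) (by rw [Reg.upd_e]; omega) hm).gates_ne_zero (show _ ≠ 5 by dsimp only; omega) g h1
    · exact ih h.cons (by rw [Reg.upd_e]; omega) h5 g h1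

lemma circuitWord_cons (g : GateInstr m) (gs : List (GateInstr m)) :
    circuitWord (g :: gs) = g.word ++ gs.flatMap fun g => Ternary.hash :: g.word := by
  induction gs generalizing g with
  | nil => simp [circuitWord, List.intercalate]
  | cons g' gs ih =>
    rw [List.flatMap_cons, List.cons_append, ← ih g']
    simp [circuitWord, List.intercalate]

lemma circuitWord_append {gs : List (GateInstr m)} (h : gs ≠ []) (gs' : List (GateInstr m)) :
    circuitWord (gs ++ gs') = circuitWord gs ++ gs'.flatMap fun g => Ternary.hash :: g.word := by
  cases gs with
  | nil => exact absurd rfl h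
  | cons g gs => rw [List.cons_append, circuitWord_cons, circuitWord_cons, List.flatMap_append, List.append_assoc]

/-- The word of the preamble does not depend on the number of qubits. -/
lemma circuitWord_preamble (hm : 4 ≤ m) : circuitWord (preamble m) = circuitWord (preamble 4) := by
  have e : ∀ (m : ℕ) [NeZero m], 4 ≤ m → ∀ a < 4, ∀ c < 3, (gateAt m a 1 c).word = tripleWord a 1 c :=
    fun m _ hm a ha c hc => gateAt_word (by omega) (by omega) hc
  refine congrArg (List.intercalate _) ?_
  simp [preamble, e m hm, e 4 le_rfl]

/-- The circuit on input `w` with the coin flips `l`. -/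
noncomputable def circuit (m : ℕ) [NeZero m] (w : List Ternary) (l : List Bool) : List (GateInstr m) :=
  preamble m ++ Reg.trace m (events (w.map some ++ [none]) l) disjAlg.init

variable {w : List Ternary} {l : List Bool}

lemma live_init (hl : l.length = 4 * (w.length + 1)) :
    Live (seedFrom (w.length + 1) 0 1 0 l) disjAlg.init (events (w.map some ++ [none]) l) := by
  have h := Reg.steps_events_R (γ := disjAlg.init) (w.map some ++ [none]) l
  rw [List.length_append, List.length_map] at h
  exact ⟨Reg.inv_init, events_lt (by simpa using hl), h⟩

lemma circuitWord_circuit (hl : l.length = 4 * (w.length + 1)) (hm : 180 * Nat.log 2 (max w.length 2) ≤ m) :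
    circuitWord (preamble 4) ++ disjAlg.out (w.map some ++ [none]) disjAlg.init l = circuitWord (circuit m w l) := by
  have h1 : 1 ≤ Nat.log 2 (max w.length 2) := Nat.le_log_of_pow_le (by omega) (by omega)
  rw [circuit, circuitWord_append (gs := preamble m) (List.cons_ne_nil _ _), circuitWord_preamble (m := m) (by omega), (live_init hl).out_eq _ hm]
  simp [disjAlg]

/-- If the input is not accepted, then the outcome is `0`. -/
lemma measure_circuit_rejected (hl : l.length = 4 * (w.length + 1)) (hm : 180 * Nat.log 2 (max w.length 2) ≤ m)
    (h5 : (disjAlg.init.steps (events (w.map some ++ [none]) l)).op ≠ 5) :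
    measureFirstProb 0 (circuitState (circuit m w l)) = 1 := by
  have h1 : 1 ≤ Nat.log 2 (max w.length 2) := Nat.le_log_of_pow_le (by omega) (by omega)
  have hgs : ∀ g ∈ circuit m w l, g.a ≠ Fin.ofNat m 0 ∧ g.b ≠ Fin.ofNat m 0 := by
    intro g hg
    rcases List.mem_append.1 hg with h | h
    · have h01 := ofNat_ne (m := m) (a := 1) (b := 0) (by omega) (by omega) (by omega)
      have h02 := ofNat_ne (m := m) (a := 2) (b := 0) (by omega) (by omega) (by omega)
      have h03 := ofNat_ne (m := m) (a := 3) (b := 0) (by omega) (by omega) (by omega)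
      simp only [preamble, List.mem_flatMap, List.mem_cons, List.not_mem_nil, or_false, List.mem_append,
        List.mem_replicate] at h
      rcases h with ⟨a, rfl | rfl, rfl | ⟨-, rfl⟩ | rfl⟩
      exacts [⟨h02, h01⟩, ⟨h02, h01⟩, ⟨h02, h01⟩, ⟨h03, h01⟩, ⟨h03, h01⟩, ⟨h03, h01⟩]
    · exact (live_init hl).trace_ne_zero (n := w.length) (by simp [disjAlg]) hm h5 g h
  have h0 : measureFirstProb 1 (circuitState (circuit m w l)) = 0 := by
    refine Finset.sum_eq_zero fun x hx => ?_
    obtain ⟨i, hi, hx⟩ := (mem_filter.1 hx).2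
    have hi' : Fin.ofNat m 0 = i := Fin.ext (by rw [hi]; exact Nat.zero_mod m)
    rw [show circuitState (circuit m w l) x = 0 from runGates_idle_qubit hgs (fun x hx => ?_) x
      (by rw [hi', hx]; decide)]
    · simp
    · rw [QState.zero, Pi.single_eq_of_ne]
      rintro rfl
      exact hx rfl
  have := measureFirstProb_add (m := m) (by omega) (circuit m w l)
  linarith

/-- The outcome for a well-formed input. -/
lemma measure_circuit_encode {k : ℕ} (hk : 1 ≤ k) {X Y : List Bool} (hX : X.length = 2 ^ (2 * k))
    (hY : Y.length = 2 ^ (2 * k)) (hw : w = encode k (blockWords X Y (2 ^ k))) (hl : l.length = 4 * (w.length + 1))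
    (hm : 180 * Nat.log 2 (max w.length 2) ≤ m) : measureFirstProb 1 (circuitState (circuit m w l))
      = (∑ v ∈ range (2 ^ (2 * k)), amplitude (2 * k) (common X Y) (2 ^ k - 1) v ^ 2) ^ 8 := by
  have h := Leads.encode (m := m) (ρ := seedFrom (w.length + 1) 0 1 0 l) hk hX hY [] l
  rw [← hw, List.append_nil] at h
  obtain ⟨γ', l', -, h1, -⟩ := h (live_init hl)
  have hlen : 2 ^ (2 * k) ≤ w.length := by
    obtain ⟨b, hb⟩ : ∃ b, 2 ^ k = b + 1 := ⟨2 ^ k - 1, by have := Nat.two_pow_pos k; omega⟩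
    rw [hw, hb, blockWords_succ, encode]
    simp
    omega
  have hmk : 36 * (2 * k + 1) ≤ m := by
    have h3 : 2 * k ≤ Nat.log 2 (max w.length 2) := Nat.le_log_of_pow_le (by omega) (by omega)
    omega
  rw [circuit, h1, show circuitState _ = runGates _ (QState.zero m) from rfl, runGates_append, events, Reg.trace,
    List.append_nil, runGates_append, runGates_append]
  have h0 : 2 ^ k - 1 < 2 ^ (2 * k) := by
    have := Nat.pow_le_pow_right (show 0 < 2 by omega) (show k ≤ 2 * k by omega)
    have := Nat.two_pow_pos k
    omega
  exact (((blockState_preamble hmk).init (by omega) hmk).blocks (by omega) hmk h0 hX.le hY.le).measure_verdict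
    (by omega) hmk

end Output

/-! ### The verification of the input -/

section Verification

variable {w : List Ternary} {l : List Bool} {ρ : ℕ}

lemma eq_blockWords {X Y : List Bool} {b : ℕ} {ws : List (List Bool)} (hlen : ws.length = 3 * b)
    (h : ∀ q < ws.length, ws.getD q [] = if q % 3 = 1 then Y else X) : ws = blockWords X Y b := by
  induction b generalizing ws with
  | zero => exact List.eq_nil_of_length_eq_zero hlen
  | succ b ih =>
    match ws, hlen, h with
    | u₀ :: u₁ :: u₂ :: ws, hlen, h =>
      simp only [List.length_cons] at hlen h
      have e0 := h 0 (by omega)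
      have e1 := h 1 (by omega)
      have e2 := h 2 (by omega)
      simp only [List.getD_cons_zero, List.getD_cons_succ] at e0 e1 e2
      rw [blockWords, List.replicate_succ, List.flatten_cons, ← blockWords, ← ih (ws := ws) (by omega) fun q hq => ?_,
        e0, e1, e2]
      · rfl
      · have h3 := h (q + 3) (by omega)
        rwa [Nat.add_mod_right] at h3

/-- What the input looks like if it is accepted. -/
structure Accepted (ρ k : ℕ) (ws : List (List Bool)) : Prop where
  k_pos : 1 ≤ k
  length : ws.length = 3 * 2 ^ k
  digest : ∀ q < ws.length, (ws.getD q []).length = 2 ^ (2 * k) ∧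
    (Fp.ofWord ρ (ws.getD q [])).digest = (Fp.ofWord ρ (ws.getD (if q % 3 = 1 then 1 else 0) [])).digest

lemma Live.accepted (h : Live ρ disjAlg.init (events (w.map some ++ [none]) l))
    (h5 : (disjAlg.init.steps (events (w.map some ++ [none]) l)).op = 5) :
    ∃ k ws, w = encode k ws ∧ Accepted ρ k ws := by
  obtain ⟨γ, c, hs, e⟩ := h.exists_last (w := []) (.inr (.inl ⟨0, rfl, rfl, rfl, rfl, rfl⟩))
  rw [e] at h5
  have hf : (Reg.absorb (γ, c)).Final := by
    by_contra hf
    rw [Reg.upd, if_neg hf] at h5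
    exact absurd h5 (by simp [Reg.quit, Reg.absorb])
  obtain ⟨hm, hi, hj, hj3, hN⟩ := hf
  rw [List.nil_append] at hs
  rcases hs with hs | ⟨k, -, hs⟩ | ⟨k, ws, u, hk, hw, hr, hq⟩
  · exact absurd (hs.symm.trans hm) (by omega)
  · exact absurd (hs.mode.symm.trans hm) (by omega)
  · have hr := hr.absorb (c := c)
    have hu : u = [] := List.eq_nil_of_length_eq_zero (hr.length.symm.trans hi)
    rw [hr.j_eq] at hj hj3 hN
    rw [hr.N hj, mul_comm 2 k, pow_mul] at hN
    refine ⟨k, ws, by simpa [hu] using hw, hk, ?_, hq⟩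
    rw [← Nat.pow_left_injective (n := 2) (by omega) hN]
    omega

/-- An input that is not well-formed is rarely accepted. -/
lemma coinCount_accepted (hw : ∀ k X Y, 1 ≤ k → X.length = 2 ^ (2 * k) → Y.length = 2 ^ (2 * k) →
    w ≠ encode k (blockWords X Y (2 ^ k))) : 64 * coinCount (4 * (w.length + 1)) (fun l =>
      (disjAlg.init.steps (events (w.map some ++ [none]) l)).op = 5) ≤ 2 ^ (4 * (w.length + 1)) := by
  classical
  by_cases hex : ∃ l : List Bool, l.length = 4 * (w.length + 1) ∧
    (disjAlg.init.steps (events (w.map some ++ [none]) l)).op = 5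
  · obtain ⟨l₀, hl₀, h₀⟩ := hex
    obtain ⟨k, ws, e, ha⟩ := (live_init hl₀).accepted h₀
    have hpos := Nat.two_pow_pos k
    -- Some word differs from the word that it should repeat, as the input is not well-formed.
    obtain ⟨q, hq, hne⟩ : ∃ q < ws.length, ws.getD q [] ≠ ws.getD (if q % 3 = 1 then 1 else 0) [] := by
      by_contra hcon
      push Not at hcon
      refine hw k (ws.getD 0 []) (ws.getD 1 []) ha.k_pos (ha.digest _ (by rw [ha.length]; omega)).1
        (ha.digest _ (by rw [ha.length]; omega)).1 ?_
      rw [← eq_blockWords ha.length fun q hq => ?_]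
      · exact e
      · rw [hcon q hq]
        split_ifs <;> rfl
    have hq' : (if q % 3 = 1 then 1 else 0) < ws.length := by rw [ha.length]; split_ifs <;> omega
    have hle : (ws.getD q []).length ≤ w.length := by
      have hmem : ws.getD q [] ∈ ws := by
        rw [List.getD_eq_getElem _ _ hq]
        exact List.getElem_mem hq
      obtain ⟨s, t, hst⟩ := List.append_of_mem hmem
      rw [e, encode]
      conv_rhs => rw [hst]
      simp only [List.length_append, List.flatMap_append, List.flatMap_cons, List.length_cons, List.length_map]
      omega
    have h4 : 4 ≤ 2 ^ (2 * k) := by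
      rw [pow_mul]
      exact Nat.le_self_pow (by have := ha.k_pos; omega) 4
    have h1 := (ha.digest q hq).1
    refine le_trans (Nat.mul_le_mul_left _ (coinCount_mono fun l hl h => ?_))
      (coinCount_collision (h1.trans (ha.digest _ hq').1.symm) hne (E := w.length + 1) (by omega) (by omega))
    obtain ⟨k', ws', e', ha'⟩ := (live_init hl).accepted h
    obtain ⟨rfl, rfl⟩ := encode_inj (e.symm.trans e')
    exact (ha'.digest q hq).2
  · push Not at hex
    have h := coinCount_mono (T := 4 * (w.length + 1)) (B := fun _ => False) hex
    rw [coinCount_const, if_neg not_false, Nat.le_zero] at h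
    rw [h]
    exact Nat.zero_le _

end Verification

/-! ### The language -/

lemma disjWord_eq_encode (k : ℕ) (x y : Fin (2 ^ (2 * k)) → Bool) :
    disjWord k x y = encode k (blockWords (List.ofFn x) (List.ofFn y) (2 ^ k)) := by
  have e : ∀ x : Fin (2 ^ (2 * k)) → Bool, bitWord x = (List.ofFn x).map Ternary.ofBool := fun x => by
    rw [List.map_ofFn]; rfl
  rw [disjWord, encode, e, e, List.append_assoc, List.singleton_append]
  congr 2
  induction 2 ^ k with
  | zero => rfl
  | succ b ih =>
    rw [List.replicate_succ, List.flatten_cons, ih]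
    simp [blockWords, List.replicate_succ]

lemma common_eq_one_iff {n : ℕ} (x y : Fin n → Bool) {v : ℕ} (hv : v < n) :
    common (List.ofFn x) (List.ofFn y) v = 1 ↔ x ⟨v, hv⟩ = true ∧ y ⟨v, hv⟩ = true := by
  rw [common, bitsFn_eq, bitsFn_eq]
  cases h1 : x ⟨v, hv⟩ <;> cases h2 : y ⟨v, hv⟩ <;> simp [hv, h1, h2]

lemma disj_eq_true_iff {n : ℕ} (x y : Fin n → Bool) :
    disj x y = true ↔ ∀ v < n, common (List.ofFn x) (List.ofFn y) v ≠ 1 := by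
  rw [disj, decide_eq_true_iff]
  constructor
  · intro h v hv h1
    have h2 := (common_eq_one_iff x y hv).1 h1
    simpa [h2.1, h2.2] using h ⟨v, hv⟩
  · intro h i
    have h1 := h i i.2
    rw [ne_eq, common_eq_one_iff x y i.2] at h1
    cases hx : x i <;> cases hy : y i <;> simp_all

lemma le_coinCount_div {K : ℕ} {A : List Bool → Prop} {p : ℝ} (hp : p ≤ 63 / 64)
    (h : 64 * coinCount K (fun l => ¬ A l) ≤ 2 ^ K) : p ≤ (coinCount K A : ℝ) / 2 ^ K := by
  have h1 := coinCount_add_not K A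
  have h2 : 63 * 2 ^ K ≤ 64 * coinCount K A := by omega
  rw [le_div_iff₀ (by positivity)]
  have h3 : (63 : ℝ) * 2 ^ K ≤ 64 * coinCount K A := by exact_mod_cast h2
  have h4 : (0 : ℝ) < 2 ^ K := by positivity
  nlinarith

lemma coinCount_not_le_of_forall {K : ℕ} {A : List Bool → Prop} (h : ∀ l, l.length = K → A l) :
    64 * coinCount K (fun l => ¬ A l) ≤ 2 ^ K := by
  have h1 := coinCount_mono (T := K) (A := fun l => ¬ A l) (B := fun _ => False) fun l hl h2 => h2 (h l hl)
  rw [coinCount_const, if_neg not_false, Nat.le_zero] at h1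
  rw [h1]
  exact Nat.zero_le _

theorem mainTheorem2 : LDISJ ∈ OQBPL := by
  obtain ⟨M, c₀, hM⟩ := StreamAlg.exists_machine disjAlg_computable (circuitWord (preamble 4)) 40 Reg.bounded_disjAlg
  refine Set.mem_iUnion.2 ⟨⟨((max c₀ 180 : ℕ) : ℝ), by positivity⟩, M, fun w => ?_⟩
  set m := logSpace ((max c₀ 180 : ℕ) : ℝ) w.length with hmdef
  obtain ⟨h1, h2, h3, h4⟩ := hM (max c₀ 180) (le_max_left _ _) w m rfl
  have hm : 180 * Nat.log 2 (max w.length 2) ≤ m :=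
    (Nat.mul_le_mul_right _ (le_max_right c₀ 180)).trans (nat_log_mul_le_logSpace _ _)
  have hlog : 1 ≤ Nat.log 2 (max w.length 2) := Nat.le_log_of_pow_le (by omega) (by omega)
  have : NeZero m := ⟨by omega⟩
  have hne : ∀ l, circuit m w l ≠ [] := fun l => List.cons_ne_nil _ _
  have hs : Real.sqrt (2 / 3) ≤ 1 - (7 / 9) ^ 8 := Real.sqrt_le_iff.2 (by norm_num)
  have hs1 : Real.sqrt (2 / 3) ≤ 1 := hs.trans (by norm_num)
  have hs2 : Real.sqrt (2 / 3) ≤ 63 / 64 := hs.trans (by norm_num)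
  have hout : ∀ v l, l.length = 4 * (w.length + 1) →
      Real.sqrt (2 / 3) ≤ measureFirstProb v (circuitState (circuit m w l)) →
      CircuitOutcome m v (Real.sqrt (2 / 3))
        (circuitWord (preamble 4) ++ disjAlg.out (w.map some ++ [none]) disjAlg.init l) :=
    fun v l hl h => ⟨_, hne l, circuitWord_circuit hl hm, h⟩
  refine ⟨⟨h1, h2⟩, fun r => ?_, ?_, fun hw => ?_⟩
  · obtain ⟨l, hl, e⟩ := h3 r
    exact ⟨_, hne l, by rw [e, circuitWord_circuit hl hm]⟩
  · rintro ⟨k, hk, x, y, hxy, rfl⟩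
    rw [h4]
    refine le_coinCount_div hs2 (coinCount_not_le_of_forall fun l hl => hout 1 l hl ?_)
    rw [measure_circuit_encode hk List.length_ofFn List.length_ofFn (disjWord_eq_encode k x y) hl hm,
      (sum_sq_amplitude_cases hk _).1 ((disj_eq_true_iff x y).1 hxy), one_pow]
    exact hs1
  · rw [h4]
    refine le_coinCount_div hs2 ?_
    by_cases hex : ∃ k X Y, 1 ≤ k ∧ X.length = 2 ^ (2 * k) ∧ Y.length = 2 ^ (2 * k) ∧
      w = encode k (blockWords X Y (2 ^ k))
    · obtain ⟨k, X, Y, hk, hX, hY, e⟩ := hex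
      refine coinCount_not_le_of_forall fun l hl => hout 0 l hl ?_
      obtain ⟨x, rfl⟩ : ∃ x : Fin (2 ^ (2 * k)) → Bool, X = List.ofFn x :=
        ⟨fun i => X[i], List.ext_getElem (by simp [hX]) (by simp)⟩
      obtain ⟨y, rfl⟩ : ∃ y : Fin (2 ^ (2 * k)) → Bool, Y = List.ofFn y :=
        ⟨fun i => Y[i], List.ext_getElem (by simp [hY]) (by simp)⟩
      have hxy : ¬ ∀ v < 2 ^ (2 * k), common (List.ofFn x) (List.ofFn y) v ≠ 1 := fun h =>
        hw ⟨k, hk, x, y, (disj_eq_true_iff x y).2 h, by rw [e, disjWord_eq_encode]⟩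
      push Not at hxy
      have h5 := (sum_sq_amplitude_cases hk _).2 hxy
      have h6 := measureFirstProb_add (m := m) (by omega) (circuit m w l)
      rw [measure_circuit_encode hk hX hY e hl hm] at h6
      have h7 := pow_le_pow_left₀ (Finset.sum_nonneg fun _ _ => sq_nonneg _) h5 8
      linarith
    · refine le_trans (Nat.mul_le_mul_left _ (coinCount_mono fun l hl h => ?_))
        (coinCount_accepted (w := w) fun k X Y hk hX hY e => hex ⟨k, X, Y, hk, hX, hY, e⟩)
      by_contra h5
      exact h (hout 0 l hl (by rw [measure_circuit_rejected hl hm h5]; exact hs1))
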